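/- Let $(\Omega,\mathcal F,\mathbb P,\{\mathcal F_t\}_{t\ge 0})$ be a filtered probability space carrying a sequence $W=(W^k)_{k\ge 1}$ of mutually independent standard Brownian motions relative to $\{\mathcal F_t\}$. Let $A>0$, let $\sigma_k\in H^2(0,1)\cap H^1_0(0,1)$ satisfy $\int_0^1\sum_k|(\sigma_k)_{xx}|^2\,dx<\infty$, and write $\sigma W=\sum_k\sigma_kW^k$. Let $\mathcal X$ be the set of pairs $(\rho,u)\in H^1(0,1)\times H^1_0(0,1)$ with $\int_0^1\rho\,dx=1$ and $\rho>0$ on $[0,1]$, and for $(\rho,u)\in\mathcal X$ set $$\mathcal E(\rho,u)=\int_0^1\Big(\tfrac12\rho u^2+A^2\rho\log\rho\Big)dx+\tfrac12\int_0^1\Big(\frac{\rho_xu}{\rho}+\tfrac12\frac{\rho_x^2}{\rho^3}\Big)dx .$$ Given deterministic initial data $(\rho_0,u_0)\in\mathcal X$, let $(\rho,u)$ be a strong solution on $(0,1)$ of $$\rho_t+(\rho u)_x=0,\qquad d(\rho u)+(\rho u^2+A^2\rho)_x\,dt=u_{xx}\,dt+\sum_k\rho\,\sigma_k\,dW^k,$$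 with $u=0$ at $x=0,1$ and $(\rho,u)|_{t=0}=(\rho_0,u_0)$. This means that $(\rho,u)$ is adapted, that almost surely $(\rho(t),u(t))\in\mathcal X$ for all $t\ge0$, $\rho\in L^\infty(0,T;H^1)$ and $u\in L^\infty(0,T;H^1_0)\cap L^2(0,T;H^2)$ for all $T>0$, and that the equations hold integrated in time, against test functions $\varphi\in C_c^\infty(0,1)$, for all $t\ge0$ almost surely, the noise term being an It\^o integral. Then there are deterministic real-valued functions $C_1(T,w,A,E)$, $C_2(T,w,A,E)$, nondecreasing in $E$, and $C_3(T,w,A,E,R)$, nondecreasing in $E$ and in $R$, where $T\ge 0$ and $w$ ranges over functions $[0,T]\times[0,1]\to\mathbb R$, which do not depend on the probability space, the noise coefficients, the initial data or the solution, such that almost surely, for every $T\ge0$, with $w=\sigma W|_{[0,T]\times[0,1]}$ and $E_0=\mathcal E(\rho_0,u_0)$, $$\sup_{t\in[0,T]}\Big[\mathcal E(\rho(t),u(t))+\int_0^T\big(\|u_x\|_{L^2}^2+A^2\|(\log\rho)_x\|_{L^2}^2\big)ds\Big]\le C_1(T,w,A,E_0),$$ $$\sup_{t\in[0,T]}\Big[\|\rho(t)\|_{L^\infty}+\|\rho^{-1}(t)\|_{L^\infty}\Big]\le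 C_2(T,w,A,E_0),$$ $$\sup_{t\in[0,T]}\Big[\|u_x(t)\|_{L^2}^2+\int_0^T\!\!\int_0^1\frac{|u_{xx}|^2}{\rho}\,dx\,ds\Big]\le C_3\big(T,w,A,E_0,\|(u_0)_x\|_{L^2}\big),$$ all the time integrals being finite. -/

import Mathlib

open MeasureTheory ProbabilityTheory Filter Topology Set
open scoped NNReal ENNReal

namespace StochCNS

noncomputable section

/-! ### Sobolev functions on the unit interval

Elements of `H¹(0,1)` are represented by their absolutely continuous representatives, as functions
`ℝ → ℝ` of which only the values on `[0,1]` matter. -/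

/-- The spatial derivative on `[0,1]` (one-sided at the end points). -/
def dx (f : ℝ → ℝ) : ℝ → ℝ := derivWithin f (Icc 0 1)

/-- Lebesgue measure on the unit interval. -/
def unitMeasure : Measure ℝ := volume.restrict (Ioc 0 1)

/-- `f ∈ H¹(0,1)`: `f` is absolutely continuous on `[0,1]` with square integrable derivative. -/
def IsH1 (f : ℝ → ℝ) : Prop :=
  AbsolutelyContinuousOnInterval f 0 1 ∧ MemLp (dx f) 2 unitMeasure

/-- `f ∈ H¹₀(0,1)`. -/
def IsH10 (f : ℝ → ℝ) : Prop := IsH1 f ∧ f 0 = 0 ∧ f 1 = 0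

/-- `f ∈ H²(0,1)`: both `f` and `f_x` belong to `H¹(0,1)`. -/
def IsH2 (f : ℝ → ℝ) : Prop := IsH1 f ∧ IsH1 (dx f)

/-- The `L²(0,1)` norm. -/
def normL2 (f : ℝ → ℝ) : ℝ := √(∫ x in (0 : ℝ)..1, f x ^ 2)

/-- The phase space: `ρ ∈ H¹` strictly positive on `[0,1]` with unit mass, and `u ∈ H¹₀`. -/
structure InPhaseSpace (ρ u : ℝ → ℝ) : Prop where
  density : IsH1 ρ
  velocity : IsH10 u
  mass : ∫ x in (0 : ℝ)..1, ρ x = 1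
  pos : ∀ x ∈ Icc (0 : ℝ) 1, 0 < ρ x

/-- Test functions: smooth functions with compact support in `(0,1)`. -/
def IsTestFunction (φ : ℝ → ℝ) : Prop :=
  ContDiff ℝ (⊤ : ℕ∞) φ ∧ HasCompactSupport φ ∧ tsupport φ ⊆ Ioo 0 1

/-! ### Entropy and energy -/

/-- The entropy `∫ (½ ρ u² + A² ρ log ρ) dx`. -/
def entropy (A : ℝ) (ρ u : ℝ → ℝ) : ℝ :=
  ∫ x in (0 : ℝ)..1, (1 / 2 * ρ x * u x ^ 2 + A ^ 2 * ρ x * Real.log (ρ x))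

/-- The modified energy, i.e. the entropy plus `½ ∫ (ρ_x u / ρ + ½ ρ_x² / ρ³) dx`. -/
def energy (A : ℝ) (ρ u : ℝ → ℝ) : ℝ :=
  entropy A ρ u +
    1 / 2 * ∫ x in (0 : ℝ)..1, (dx ρ x * u x / ρ x + 1 / 2 * (dx ρ x ^ 2 / ρ x ^ 3))

/-- The dissipation density in time, `‖u_x‖² + A² ‖(log ρ)_x‖²`. -/
def dissipation (A : ℝ) (ρ u : ℝ → ℝ) : ℝ :=
  normL2 (dx u) ^ 2 + A ^ 2 * normL2 (dx fun x => Real.log (ρ x)) ^ 2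

/-! ### Noise -/

/-- `W = (W^k)` is a sequence of mutually independent standard Brownian motions relative to the
filtration `ℱ`. -/
structure IsWienerSequence {Ω : Type*} {mΩ : MeasurableSpace Ω} (P : Measure Ω)
    (ℱ : Filtration ℝ≥0 mΩ) (W : ℕ → ℝ≥0 → Ω → ℝ) : Prop where
  brownian : ∀ k, IsBrownianReal (W k) P
  adapted : ∀ k t, Measurable[ℱ t] (W k t)
  indep_past : ∀ k (s t : ℝ≥0), s ≤ t →
    Indep (MeasurableSpace.comap (fun ω => W k t ω - W k s ω) inferInstance) (ℱ s) P
  indep : iIndepFun (fun k ω (t : ℝ≥0) => W k t ω) P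

/-- The assumption on the noise coefficients: `σ_k ∈ H² ∩ H¹₀` and
`∫ ∑_k |(σ_k)_{xx}|² dx < ∞`. -/
structure IsNoiseCoefficient (σ : ℕ → ℝ → ℝ) : Prop where
  memH2 : ∀ k, IsH2 (σ k)
  memH10 : ∀ k, IsH10 (σ k)
  finite : ∫⁻ x, ∑' k, ENNReal.ofReal (dx (dx (σ k)) x ^ 2) ∂unitMeasure < ⊤

/-- The value of `σW = ∑_k σ_k W^k` at `(t,x)`, as the limit of the partial sums (the series need
not converge absolutely). -/
def noise {Ω : Type*} (σ : ℕ → ℝ → ℝ) (W : ℕ → ℝ≥0 → Ω → ℝ) (ω : Ω) (t : ℝ≥0) (x : ℝ) : ℝ :=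
  limUnder atTop fun n : ℕ => ∑ k ∈ Finset.range n, σ k x * W k t ω

/-- Paths of `σW` over the time interval `[0,T]`. -/
abbrev NoisePath (T : ℝ≥0) : Type := Icc (0 : ℝ≥0) T → Icc (0 : ℝ) 1 → ℝ

/-- The path of `σW` over `[0,T] × [0,1]`. -/
def noisePath {Ω : Type*} (σ : ℕ → ℝ → ℝ) (W : ℕ → ℝ≥0 → Ω → ℝ) (T : ℝ≥0) (ω : Ω) :
    NoisePath T :=
  fun t x => noise σ W ω t x

/-! ### Stochastic integrals -/

/-- `J` is the Itô integral process `∫₀ᵗ X dB` of a continuous adapted process `X`: it has almost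
surely continuous paths, and `J t` is the limit in probability of the left-endpoint Riemann sums
along the uniform partitions of `[0,t]`. -/
def IsItoIntegral {Ω : Type*} {mΩ : MeasurableSpace Ω} (P : Measure Ω)
    (X B J : ℝ≥0 → Ω → ℝ) : Prop :=
  (∀ᵐ ω ∂P, Continuous fun t => J t ω) ∧
  ∀ t : ℝ≥0, TendstoInMeasure P
    (fun (n : ℕ) ω => ∑ i ∈ Finset.range n,
      X (t * i / n) ω * (B (t * (i + 1) / n) ω - B (t * i / n) ω))
    atTop (J t)

/-- `I` is the process `∑_k ∫₀ᵗ X^k dW^k`: it has almost surely continuous paths, and the series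
of Itô integrals converges to it in probability at every time. -/
def IsItoSeries {Ω : Type*} {mΩ : MeasurableSpace Ω} (P : Measure Ω)
    (X W : ℕ → ℝ≥0 → Ω → ℝ) (I : ℝ≥0 → Ω → ℝ) : Prop :=
  (∀ᵐ ω ∂P, Continuous fun t => I t ω) ∧
  ∃ J : ℕ → ℝ≥0 → Ω → ℝ, (∀ k, IsItoIntegral P (X k) (W k) (J k)) ∧
    ∀ t : ℝ≥0, TendstoInMeasure P (fun (n : ℕ) ω => ∑ k ∈ Finset.range n, J k t ω) atTop (I t)

/-! ### Strong solutions -/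

/-- Lebesgue measure on `(0,T) × (0,1)`. -/
def spaceTime (T : ℝ) : Measure (ℝ × ℝ) := (volume.restrict (Ioc 0 T)).prod unitMeasure

/-- The regularity of a path `t ↦ (ρ(t), u(t))` of a strong solution: every `(ρ(t), u(t))` lies in
the phase space, `ρ ∈ L^∞_loc H¹` and `u ∈ L^∞_loc H¹₀ ∩ L²_loc H²`. -/
structure HasStrongRegularity (ρ u : ℝ → ℝ → ℝ) : Prop where
  phase : ∀ t, 0 ≤ t → InPhaseSpace (ρ t) (u t)
  bound : ∀ T : ℝ, ∃ M : ℝ, ∀ t ∈ Icc 0 T,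
    normL2 (ρ t) ≤ M ∧ normL2 (dx (ρ t)) ≤ M ∧ normL2 (u t) ≤ M ∧ normL2 (dx (u t)) ≤ M
  memH2 : ∀ᵐ t ∂(volume.restrict (Ioi (0 : ℝ))), IsH2 (u t)
  density : ∀ T : ℝ, MemLp (fun p : ℝ × ℝ => ρ p.1 p.2) 2 (spaceTime T)
  density_x : ∀ T : ℝ, MemLp (fun p : ℝ × ℝ => dx (ρ p.1) p.2) 2 (spaceTime T)
  velocity : ∀ T : ℝ, MemLp (fun p : ℝ × ℝ => u p.1 p.2) 2 (spaceTime T)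
  velocity_x : ∀ T : ℝ, MemLp (fun p : ℝ × ℝ => dx (u p.1) p.2) 2 (spaceTime T)
  velocity_xx : ∀ T : ℝ, MemLp (fun p : ℝ × ℝ => dx (dx (u p.1)) p.2) 2 (spaceTime T)

/-- `(ρ, u)` is a strong solution, with deterministic initial data `(ρ₀, u₀)`, of
`ρ_t + (ρ u)_x = 0` and `d(ρ u) + (ρ u² + A² ρ)_x dt = u_xx dt + ∑_k ρ σ_k dW^k` on `(0,1)` with
`u = 0` at the boundary. The equations hold integrated in time and against test functions in
space. -/
structure IsStrongSolution {Ω : Type*} {mΩ : MeasurableSpace Ω} (P : Measure Ω)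
    (ℱ : Filtration ℝ≥0 mΩ) (W : ℕ → ℝ≥0 → Ω → ℝ) (σ : ℕ → ℝ → ℝ) (A : ℝ)
    (ρ₀ u₀ : ℝ → ℝ) (ρ u : ℝ → Ω → ℝ → ℝ) : Prop where
  adapted : ∀ (t : ℝ≥0), ∀ x ∈ Icc (0 : ℝ) 1,
    Measurable[ℱ t] (fun ω => ρ t ω x) ∧ Measurable[ℱ t] (fun ω => u t ω x)
  regularity : ∀ᵐ ω ∂P, HasStrongRegularity (fun t => ρ t ω) (fun t => u t ω)
  initial : ∀ᵐ ω ∂P, ∀ x ∈ Icc (0 : ℝ) 1, ρ 0 ω x = ρ₀ x ∧ u 0 ω x = u₀ x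
  continuity : ∀ᵐ ω ∂P, ∀ φ, IsTestFunction φ → ∀ t : ℝ≥0,
    ∫ x in (0 : ℝ)..1, ρ t ω x * φ x =
      (∫ x in (0 : ℝ)..1, ρ₀ x * φ x) -
        ∫ s in (0 : ℝ)..t, ∫ x in (0 : ℝ)..1, dx (fun y => ρ s ω y * u s ω y) x * φ x
  momentum : ∀ φ, IsTestFunction φ → ∃ I : ℝ≥0 → Ω → ℝ,
    IsItoSeries P (fun k t ω => ∫ x in (0 : ℝ)..1, ρ t ω x * σ k x * φ x) W I ∧
    ∀ᵐ ω ∂P, ∀ t : ℝ≥0,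
      ∫ x in (0 : ℝ)..1, ρ t ω x * u t ω x * φ x =
        (∫ x in (0 : ℝ)..1, ρ₀ x * u₀ x * φ x) -
          (∫ s in (0 : ℝ)..t, ∫ x in (0 : ℝ)..1,
            dx (fun y => ρ s ω y * u s ω y ^ 2 + A ^ 2 * ρ s ω y) x * φ x) +
          (∫ s in (0 : ℝ)..t, ∫ x in (0 : ℝ)..1, dx (dx (u s ω)) x * φ x) +
          I t ω

end

end StochCNS

/-! The noise is removed by the substitution v = u − w with w = σW. By conservation of mass, ∫ρσ_kφ
dx is absolutely continuous in time, so its Itô integral against W^k is an ordinary integration by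
parts along paths, without correction term. After summation over k, almost every path of ρ(u − w)
solves an equation with an integrable rate (`ae_ito_eq_pairing`,
`IsStrongSolution.ae_isPathSolution`). The other probabilistic input is that w and w_x are almost
surely continuous and that w_xx is bounded in L², uniformly on [0,T], by some N (`ae_isNoisePath`);
it follows from Doob's inequality, used once in time and once in the length of the partial sums.
Everything else concerns a single path (`IsPathSolution`).

Energy bound. Write D = ∂_t + u∂_x. Then ρDv = u_xx − A²ρ_x − ρu w_x, and since D log ρ = −u_x also
ρD(ρ_x/ρ²) = −u_xx. The effective velocity V = v + ρ_x/ρ² therefore satisfies ρDV = −A²ρ_x − ρu w_x,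
without viscosity. In the functional ½∫ρv² + ½∫ρV² + 2A²∫ρ log ρ, which is twice the energy at time
zero, the terms A²∫ρ_x u cancel. What is left is the dissipation, with a good sign, and terms
controlled by N and by the functional (`InPhaseSpace.rate_le`). Gronwall's lemma concludes
(`exists_energy_bound`).

Density bound. A density of mass one equals one somewhere, so |log ρ| ≤ ∫|ρ_x|/ρ ≤ (∫ρ)^{1/2}
(∫ρ(ρ_x/ρ²)²)^{1/2}, and ρ_x/ρ² = V − v is under control (`InPhaseSpace.abs_log_le`).

Bound for u_x. The identity ∂_t v = (u_xx − A²ρ_x)/ρ − u u_x is tested with −(u_xx − w_xx). The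
cubic term is absorbed by interpolation, at the price of a multiple of the dissipation, whose time
integral is already bounded (`InPhaseSpace.neg_integral_accel_le`, `exists_velocity_x_bound`).

The solution is too weak for these computations to be taken literally, and two devices justify them.
For the energy, particle trajectories are defined by the mass to their left (`flow`). Integrals of
ρv and ρV up to a trajectory are absolutely continuous in time, and ∫ρf² is the limit of ∑ n(∫ρf)²
over n material cells of mass 1/n, to which the chain rule applies (`isPrim_integral_sq`). For u_x,
backward difference quotients in time, convexity and lower semicontinuity of the Dirichlet energy
give the needed inequality (`half_normL2_sq_le`).

The constants see the noise only through a bound N, which the values of w determine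
(`IsNoisePath.of_eqOn`); one such N is chosen for each path. Monotonicity in the data is obtained by
adding up the bounds for integer levels of the data. -/

namespace StochCNS

/-! ### Primitives of integrable functions -/

/-- `f` is a primitive of the integrable function `f'` on `[a,b]`. -/
def IsPrim (f f' : ℝ → ℝ) (a b : ℝ) : Prop :=
  IntervalIntegrable f' volume a b ∧ ∀ x ∈ Icc a b, f x = f a + ∫ y in a..x, f' y

theorem _root_.LipschitzOnWith.comp_absolutelyContinuousOnInterval {φ f : ℝ → ℝ} {K : ℝ≥0}
    {s : Set ℝ} {a b : ℝ} (hφ : LipschitzOnWith K φ s) (hf : AbsolutelyContinuousOnInterval f a b)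
    (hs : MapsTo f (uIcc a b) s) : AbsolutelyContinuousOnInterval (fun x => φ (f x)) a b := by
  unfold AbsolutelyContinuousOnInterval at hf ⊢
  have h0 := hf.const_mul (K : ℝ)
  rw [mul_zero] at h0
  refine squeeze_zero' (Eventually.of_forall fun _ => Finset.sum_nonneg fun i _ => dist_nonneg)
    ?_ h0
  rw [eventually_inf_principal]
  filter_upwards with ⟨n, I⟩ hnI
  rw [Finset.mul_sum]
  refine Finset.sum_le_sum fun i hi => ?_
  exact hφ.dist_le_mul _ (hs (hnI.1 i hi).1) _ (hs (hnI.1 i hi).2)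

theorem ae_Ioo_of_ae {p : ℝ → Prop} {a b : ℝ} (h : ∀ᵐ x, x ∈ Ioo a b → p x) :
    ∀ᵐ x ∂(volume.restrict (Ioc a b)), p x := by
  rw [ae_restrict_iff' measurableSet_Ioc]
  have hb : ∀ᵐ x : ℝ, x ≠ b := by simp [ae_iff, measure_singleton]
  filter_upwards [h, hb] with x hx hxb hxm
  exact hx ⟨hxm.1, lt_of_le_of_ne hxm.2 hxb⟩

namespace IsPrim

variable {f f' g g' h : ℝ → ℝ} {a b : ℝ}

theorem intervalIntegrable_sub (hf : IsPrim f f' a b) {x y : ℝ} (hx : x ∈ Icc a b)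
    (hy : y ∈ Icc a b) : IntervalIntegrable f' volume x y :=
  hf.1.mono_set (by
    rw [uIcc_of_le (hx.1.trans hx.2)]
    exact uIcc_subset_Icc hx hy)

theorem integral_eq (hf : IsPrim f f' a b) {x y : ℝ} (hx : x ∈ Icc a b) (hy : y ∈ Icc a b) :
    ∫ z in x..y, f' z = f y - f x := by
  have ha : a ∈ Icc a b := ⟨le_rfl, hx.1.trans hx.2⟩
  rw [hf.2 x hx, hf.2 y hy, ← intervalIntegral.integral_interval_sub_left
    (hf.intervalIntegrable_sub ha hy) (hf.intervalIntegrable_sub ha hx)]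
  ring

theorem absolutelyContinuous (hf : IsPrim f f' a b) (hab : a ≤ b) :
    AbsolutelyContinuousOnInterval f a b := by
  have h1 := hf.1.absolutelyContinuousOnInterval_intervalIntegral (c := a) (by simp)
  have h2 : AbsolutelyContinuousOnInterval (fun _ : ℝ => f a) a b :=
    (LipschitzWith.const (f a)).lipschitzOnWith.absolutelyContinuousOnInterval
  have h3 := h2.fun_add h1
  unfold AbsolutelyContinuousOnInterval at h3 ⊢
  refine h3.congr' ?_
  rw [EventuallyEq, eventually_inf_principal]
  filter_upwards with ⟨n, I⟩ hnI
  refine Finset.sum_congr rfl fun i hi => ?_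
  have := hnI.1 i hi
  rw [uIcc_of_le hab] at this
  rw [hf.2 _ this.1, hf.2 _ this.2]

theorem continuousOn (hf : IsPrim f f' a b) (hab : a ≤ b) : ContinuousOn f (Icc a b) := by
  have := (hf.absolutelyContinuous hab).continuousOn
  rwa [uIcc_of_le hab] at this

theorem ae_hasDerivAt (hf : IsPrim f f' a b) (hab : a ≤ b) :
    ∀ᵐ x, x ∈ Ioo a b → HasDerivAt f (f' x) x := by
  filter_upwards [hf.1.ae_hasDerivAt_integral] with x hx hxm
  have h1 := (hx (by rw [uIcc_of_le hab]; exact Ioo_subset_Icc_self hxm) a (by simp)).const_add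
    (f a)
  refine h1.congr_of_eventuallyEq ?_
  filter_upwards [Icc_mem_nhds hxm.1 hxm.2] with y hy using hf.2 y hy

/-- The calculus rules for `IsPrim` rest on this criterion: the operation preserves absolute
continuity, and the pointwise rule holds at almost every interior point. -/
theorem of_ae_hasDerivAt (hab : a ≤ b) (hf : AbsolutelyContinuousOnInterval f a b)
    (h : ∀ᵐ x, x ∈ Ioo a b → HasDerivAt f (f' x) x) : IsPrim f f' a b := by
  have hd : deriv f =ᵐ[volume.restrict (Ioc a b)] f' := by
    refine ae_Ioo_of_ae ?_
    filter_upwards [h] with x hx hxm using (hx hxm).deriv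
  refine ⟨hf.intervalIntegrable_deriv.congr_ae (by rwa [uIoc_of_le hab]), fun x hx => ?_⟩
  have h1 : ∫ y in a..x, f' y = ∫ y in a..x, deriv f y := by
    rw [intervalIntegral.integral_of_le hx.1, intervalIntegral.integral_of_le hx.1]
    refine integral_congr_ae ?_
    exact EventuallyEq.symm (ae_restrict_of_ae_restrict_of_subset (Ioc_subset_Ioc_right hx.2) hd)
  rw [h1, (hf.mono (by
    rw [uIcc_of_le hab, uIcc_of_le hx.1]; exact Icc_subset_Icc_right hx.2)).integral_deriv_eq_sub]
  ring

theorem ae_eq (hf : IsPrim f f' a b) (hg : IsPrim f g' a b) (hab : a ≤ b) :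
    f' =ᵐ[volume.restrict (Ioc a b)] g' := by
  refine ae_Ioo_of_ae ?_
  filter_upwards [hf.ae_hasDerivAt hab, hg.ae_hasDerivAt hab] with x h1 h2 hx
  exact (h1 hx).unique (h2 hx)

theorem congr (hf : IsPrim f f' a b) (hab : a ≤ b) (hfg : EqOn f g (Icc a b))
    (hfg' : f' =ᵐ[volume.restrict (Ioc a b)] g') : IsPrim g g' a b := by
  refine ⟨hf.1.congr_ae (by rwa [uIoc_of_le hab]), fun x hx => ?_⟩
  rw [← hfg hx, ← hfg (left_mem_Icc.2 hab), hf.2 x hx]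
  congr 1
  rw [intervalIntegral.integral_of_le hx.1, intervalIntegral.integral_of_le hx.1]
  exact integral_congr_ae (ae_restrict_of_ae_restrict_of_subset (Ioc_subset_Ioc_right hx.2) hfg')

theorem mono (hf : IsPrim f f' a b) {c d : ℝ} (hc : a ≤ c) (hcd : c ≤ d) (hd : d ≤ b) :
    IsPrim f f' c d := by
  have hcm : c ∈ Icc a b := ⟨hc, hcd.trans hd⟩
  have hdm : d ∈ Icc a b := ⟨hc.trans hcd, hd⟩
  refine ⟨hf.intervalIntegrable_sub hcm hdm, fun x hx => ?_⟩
  rw [hf.integral_eq hcm ⟨hc.trans hx.1, hx.2.trans hd⟩]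
  ring

theorem mul (hf : IsPrim f f' a b) (hg : IsPrim g g' a b) (hab : a ≤ b) :
    IsPrim (fun x => f x * g x) (fun x => f' x * g x + f x * g' x) a b := by
  refine of_ae_hasDerivAt hab
    ((hf.absolutelyContinuous hab).fun_mul (hg.absolutelyContinuous hab)) ?_
  filter_upwards [hf.ae_hasDerivAt hab, hg.ae_hasDerivAt hab] with x h1 h2 hx
  exact (h1 hx).mul (h2 hx)

theorem add (hf : IsPrim f f' a b) (hg : IsPrim g g' a b) (hab : a ≤ b) :
    IsPrim (fun x => f x + g x) (fun x => f' x + g' x) a b := by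
  refine of_ae_hasDerivAt hab
    ((hf.absolutelyContinuous hab).fun_add (hg.absolutelyContinuous hab)) ?_
  filter_upwards [hf.ae_hasDerivAt hab, hg.ae_hasDerivAt hab] with x h1 h2 hx
  exact (h1 hx).add (h2 hx)

theorem sub (hf : IsPrim f f' a b) (hg : IsPrim g g' a b) (hab : a ≤ b) :
    IsPrim (fun x => f x - g x) (fun x => f' x - g' x) a b := by
  refine of_ae_hasDerivAt hab
    ((hf.absolutelyContinuous hab).fun_sub (hg.absolutelyContinuous hab)) ?_
  filter_upwards [hf.ae_hasDerivAt hab, hg.ae_hasDerivAt hab] with x h1 h2 hx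
  exact (h1 hx).sub (h2 hx)

theorem const_mul (hf : IsPrim f f' a b) (c : ℝ) (hab : a ≤ b) :
    IsPrim (fun x => c * f x) (fun x => c * f' x) a b := by
  refine of_ae_hasDerivAt hab ((hf.absolutelyContinuous hab).const_mul c) ?_
  filter_upwards [hf.ae_hasDerivAt hab] with x h1 hx
  exact (h1 hx).const_mul c

theorem sum {ι : Type*} (s : Finset ι) {F F' : ι → ℝ → ℝ} (hab : a ≤ b)
    (hF : ∀ i ∈ s, IsPrim (F i) (F' i) a b) :
    IsPrim (fun x => ∑ i ∈ s, F i x) (fun x => ∑ i ∈ s, F' i x) a b := by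
  classical
  induction s using Finset.induction_on with
  | empty => exact ⟨by simp, by simp⟩
  | insert i s hi ih =>
    simp only [Finset.sum_insert hi]
    exact (hF i (by simp)).add (ih fun j hj => hF j (by simp [hj])) hab

theorem comp {φ φ' : ℝ → ℝ} {s : Set ℝ} (hf : IsPrim f f' a b) (hab : a ≤ b)
    (hφ : ∀ z ∈ s, HasDerivAt φ (φ' z) z) (hφ' : ContinuousOn φ' s) (hs : MapsTo f (Icc a b) s) :
    IsPrim (fun x => φ (f x)) (fun x => φ' (f x) * f' x) a b := by
  -- The image of `f` is a compact interval inside `s`, where `φ'` is bounded; so `φ` is Lipschitz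
  -- there, and a Lipschitz function of an absolutely continuous one is absolutely continuous.
  have himg := (hf.continuousOn hab).image_Icc hab
  set c := sInf (f '' Icc a b)
  set d := sSup (f '' Icc a b)
  have hsub : Icc c d ⊆ s := by rw [← himg]; exact hs.image_subset
  obtain ⟨K, hK⟩ := isCompact_Icc.exists_bound_of_continuousOn (hφ'.mono hsub)
  have hLip : LipschitzOnWith (Real.toNNReal (max K 0)) φ (Icc c d) := by
    refine (convex_Icc c d).lipschitzOnWith_of_nnnorm_hasDerivWithin_le
      (fun x hx => (hφ x (hsub hx)).hasDerivWithinAt) fun x hx => ?_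
    rw [← NNReal.coe_le_coe, coe_nnnorm, Real.coe_toNNReal _ (le_max_right _ _)]
    exact (hK x hx).trans (le_max_left _ _)
  refine of_ae_hasDerivAt hab (hLip.comp_absolutelyContinuousOnInterval
    (hf.absolutelyContinuous hab) ?_) ?_
  · rw [uIcc_of_le hab, ← himg]; exact mapsTo_image f _
  · filter_upwards [hf.ae_hasDerivAt hab] with x h1 hx
    exact (hφ (f x) (hs (Ioo_subset_Icc_self hx))).comp x (h1 hx)

theorem log (hf : IsPrim f f' a b) (hab : a ≤ b) (hpos : ∀ x ∈ Icc a b, 0 < f x) :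
    IsPrim (fun x => Real.log (f x)) (fun x => f' x / f x) a b := by
  have := hf.comp (φ := Real.log) (φ' := fun z => z⁻¹) (s := Ioi 0) hab
    (fun z hz => Real.hasDerivAt_log (ne_of_gt hz))
    (continuousOn_inv₀.mono fun z hz => ne_of_gt hz) hpos
  refine this.congr hab (fun _ _ => rfl) (Eventually.of_forall fun x => ?_)
  simp only
  ring

theorem inv (hf : IsPrim f f' a b) (hab : a ≤ b) (hpos : ∀ x ∈ Icc a b, 0 < f x) :
    IsPrim (fun x => (f x)⁻¹) (fun x => -(f' x / f x ^ 2)) a b := by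
  have := hf.comp (φ := fun z => z⁻¹) (φ' := fun z => -(z ^ 2)⁻¹) (s := Ioi 0) hab
    (fun z hz => hasDerivAt_inv (ne_of_gt hz))
    (ContinuousOn.neg (ContinuousOn.inv₀ (by fun_prop)
      fun z hz => ne_of_gt (pow_pos (mem_Ioi.1 hz) 2))) hpos
  refine this.congr hab (fun _ _ => rfl) (Eventually.of_forall fun x => ?_)
  simp only
  ring

theorem sq (hf : IsPrim f f' a b) (hab : a ≤ b) :
    IsPrim (fun x => f x ^ 2) (fun x => 2 * f x * f' x) a b := by
  refine (hf.mul hf hab).congr hab (fun x _ => ?_) (Eventually.of_forall fun x => ?_) <;>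
  simp only <;> ring

theorem const (c : ℝ) : IsPrim (fun _ => c) (fun _ => 0) a b := ⟨by simp, by simp⟩

theorem integral_by_parts (hf : IsPrim f f' a b) (hg : IsPrim g g' a b) (hab : a ≤ b) :
    ∫ x in a..b, f' x * g x = f b * g b - f a * g a - ∫ x in a..b, f x * g' x := by
  have h := (hf.mul hg hab).integral_eq (left_mem_Icc.2 hab) (right_mem_Icc.2 hab)
  rw [intervalIntegral.integral_add] at h
  · linarith
  · exact hf.1.mul_continuousOn (by rw [uIcc_of_le hab]; exact hg.continuousOn hab)
  · exact hg.1.continuousOn_mul (by rw [uIcc_of_le hab]; exact hf.continuousOn hab)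

end IsPrim

theorem dx_ae_eq_of_isPrim {f f' : ℝ → ℝ} (hf : IsPrim f f' 0 1) : dx f =ᵐ[unitMeasure] f' := by
  refine ae_Ioo_of_ae ?_
  filter_upwards [hf.ae_hasDerivAt zero_le_one] with x h1 hx
  exact (h1 hx).hasDerivWithinAt.derivWithin
    ((uniqueDiffOn_Icc zero_lt_one) x (Ioo_subset_Icc_self hx))

theorem isPrim_dx_of_ac {f : ℝ → ℝ} (hf : AbsolutelyContinuousOnInterval f 0 1) :
    IsPrim f (dx f) 0 1 := by
  have h0 : IsPrim f (deriv f) 0 1 := by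
    refine IsPrim.of_ae_hasDerivAt zero_le_one hf ?_
    filter_upwards [hf.ae_differentiableAt] with x hx hxm
    exact (hx (by rw [uIcc_of_le zero_le_one]; exact Ioo_subset_Icc_self hxm)).hasDerivAt
  exact h0.congr zero_le_one (fun _ _ => rfl) (dx_ae_eq_of_isPrim h0).symm

theorem IsH1.isPrim {f : ℝ → ℝ} (hf : IsH1 f) : IsPrim f (dx f) 0 1 := isPrim_dx_of_ac hf.1

theorem dx_congr {f g : ℝ → ℝ} (h : EqOn f g (Icc 0 1)) : EqOn (dx f) (dx g) (Icc 0 1) :=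
  fun _ hx => derivWithin_congr h (h hx)

/-! ### Cauchy-Schwarz and Sobolev inequalities -/

theorem sq_integral_mul_le {α : Type*} {mα : MeasurableSpace α} {μ : Measure α} {f g : α → ℝ}
    (hf : MemLp f 2 μ) (hg : MemLp g 2 μ) :
    (∫ x, f x * g x ∂μ) ^ 2 ≤ (∫ x, f x ^ 2 ∂μ) * ∫ x, g x ^ 2 ∂μ := by
  -- The quadratic polynomial c ↦ ∫(f − cg)² is nonnegative, so its discriminant is not positive.
  have key : ∀ c : ℝ, 0 ≤ (∫ x, g x ^ 2 ∂μ) * (c * c) + (-2 * ∫ x, f x * g x ∂μ) * c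
      + ∫ x, f x ^ 2 ∂μ := by
    intro c
    have h1 : ∫ x, (f x - c * g x) ^ 2 ∂μ = (∫ x, g x ^ 2 ∂μ) * (c * c)
        + (-2 * ∫ x, f x * g x ∂μ) * c + ∫ x, f x ^ 2 ∂μ := by
      have : ∀ x, (f x - c * g x) ^ 2 = (c * c) * g x ^ 2 + (-2 * c) * (f x * g x) + f x ^ 2 :=
        fun x => by ring
      simp only [this]
      have i1 : Integrable (fun x => c * c * g x ^ 2) μ := hg.integrable_sq.const_mul _
      have i2 : Integrable (fun x => -2 * c * (f x * g x)) μ := (hf.integrable_mul hg).const_mul _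
      have i3 : Integrable (fun x => c * c * g x ^ 2 + -2 * c * (f x * g x)) μ := i1.add i2
      rw [integral_add i3 hf.integrable_sq, integral_add i1 i2,
        integral_const_mul, integral_const_mul]
      ring
    rw [← h1]
    exact integral_nonneg fun x => sq_nonneg _
  have := discrim_le_zero key
  unfold discrim at this
  nlinarith

theorem integral_unit (f : ℝ → ℝ) : ∫ x in (0 : ℝ)..1, f x = ∫ x, f x ∂unitMeasure := by
  rw [intervalIntegral.integral_of_le zero_le_one, unitMeasure]

instance : IsProbabilityMeasure unitMeasure := ⟨by simp [unitMeasure]⟩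

instance (T : ℝ) : IsFiniteMeasure (spaceTime T) := by unfold spaceTime; infer_instance

theorem normL2_nonneg (f : ℝ → ℝ) : 0 ≤ normL2 f := Real.sqrt_nonneg _

theorem normL2_sq (f : ℝ → ℝ) : normL2 f ^ 2 = ∫ x, f x ^ 2 ∂unitMeasure := by
  rw [normL2, Real.sq_sqrt, integral_unit]
  exact intervalIntegral.integral_nonneg zero_le_one fun x _ => sq_nonneg _

theorem abs_integral_mul_le_normL2 {f g : ℝ → ℝ} (hf : MemLp f 2 unitMeasure)
    (hg : MemLp g 2 unitMeasure) : |∫ x, f x * g x ∂unitMeasure| ≤ normL2 f * normL2 g := by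
  have := sq_integral_mul_le hf hg
  rw [← normL2_sq, ← normL2_sq, ← mul_pow] at this
  exact abs_le_of_sq_le_sq this (mul_nonneg (normL2_nonneg _) (normL2_nonneg _))

theorem Ioc_uIoc_sub {x y : ℝ} (hx : x ∈ Icc (0 : ℝ) 1) (hy : y ∈ Icc (0 : ℝ) 1) :
    Ioc x y ⊆ Ioc 0 1 := Ioc_subset_Ioc hx.1 hy.2

theorem IsPrim.abs_sub_le {f f' : ℝ → ℝ} (hf : IsPrim f f' 0 1) (hf' : MemLp f' 2 unitMeasure)
    {x y : ℝ} (hx : x ∈ Icc (0 : ℝ) 1) (hy : y ∈ Icc (0 : ℝ) 1) :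
    |f x - f y| ≤ normL2 f' * √|x - y| := by
  wlog hxy : x ≤ y generalizing x y
  · rw [abs_sub_comm, abs_sub_comm x y]; exact this hy hx (le_of_not_ge hxy)
  rw [abs_sub_comm (f x), abs_sub_comm x, ← hf.integral_eq hx hy,
    intervalIntegral.integral_of_le hxy]
  have hm : MemLp f' 2 (volume.restrict (Ioc x y)) :=
    hf'.mono_measure (Measure.restrict_mono (Ioc_uIoc_sub hx hy) le_rfl)
  have h1 := sq_integral_mul_le hm (memLp_const (1 : ℝ))
  simp only [mul_one, one_pow, integral_const, smul_eq_mul, measureReal_restrict_apply_univ,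
    Real.volume_real_Ioc_of_le hxy] at h1
  have h2 : ∫ z in Ioc x y, f' z ^ 2 ≤ normL2 f' ^ 2 := by
    rw [normL2_sq]
    exact setIntegral_mono_set hf'.integrable_sq (Eventually.of_forall fun _ => sq_nonneg _)
      (LE.le.eventuallyLE (Ioc_uIoc_sub hx hy))
  have h3 : √|y - x| ^ 2 = y - x := by
    rw [Real.sq_sqrt (abs_nonneg _), abs_of_nonneg (sub_nonneg.2 hxy)]
  refine abs_le_of_sq_le_sq ?_ (mul_nonneg (normL2_nonneg _) (Real.sqrt_nonneg _))
  rw [mul_pow, h3]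
  exact h1.trans (mul_le_mul_of_nonneg_right h2 (sub_nonneg.2 hxy))

theorem IsPrim.abs_sub_le' {f f' : ℝ → ℝ} (hf : IsPrim f f' 0 1) (hf' : MemLp f' 2 unitMeasure)
    {x y : ℝ} (hx : x ∈ Icc (0 : ℝ) 1) (hy : y ∈ Icc (0 : ℝ) 1) :
    |f x - f y| ≤ normL2 f' := by
  refine (hf.abs_sub_le hf' hx hy).trans ?_
  have : √|x - y| ≤ 1 := by
    rw [Real.sqrt_le_one, abs_le]
    constructor <;> linarith [hx.1, hx.2, hy.1, hy.2]
  nlinarith [normL2_nonneg f']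

theorem memLp_of_continuousOn {f : ℝ → ℝ} (hf : ContinuousOn f (Icc 0 1)) (p : ℝ≥0∞) :
    MemLp f p unitMeasure := by
  obtain ⟨C, hC⟩ := isCompact_Icc.exists_bound_of_continuousOn hf
  refine MemLp.of_bound ?_ C ?_
  · exact (hf.mono Ioc_subset_Icc_self).aestronglyMeasurable measurableSet_Ioc
  · exact (ae_restrict_iff' measurableSet_Ioc).2
      (Eventually.of_forall fun x hx => hC x (Ioc_subset_Icc_self hx))

theorem memLp_continuousOn_mul {f g : ℝ → ℝ} (hf : ContinuousOn f (Icc 0 1))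
    (hg : MemLp g 2 unitMeasure) : MemLp (fun x => f x * g x) 2 unitMeasure :=
  hg.mul (memLp_of_continuousOn hf ⊤)

/-- Mean value: a continuous density with unit mass takes the value one. -/
theorem exists_eq_one_of_mass {f : ℝ → ℝ} (hf : ContinuousOn f (Icc 0 1))
    (hm : ∫ x in (0 : ℝ)..1, f x = 1) : ∃ x ∈ Icc (0 : ℝ) 1, f x = 1 := by
  have hI : IntervalIntegrable f volume 0 1 := by
    apply ContinuousOn.intervalIntegrable; rwa [uIcc_of_le zero_le_one]
  by_contra! hne
  have hsub : ∫ x in (0 : ℝ)..1, (f x - 1) = 0 := by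
    rw [intervalIntegral.integral_sub hI (by simp), hm]; simp
  have hc : ContinuousOn (fun x => f x - 1) (Icc 0 1) := hf.sub continuousOn_const
  have hsgn : (∀ x ∈ Icc (0 : ℝ) 1, 0 < f x - 1) ∨ (∀ x ∈ Icc (0 : ℝ) 1, f x - 1 < 0) := by
    by_contra! hcon
    obtain ⟨⟨x, hx, hx'⟩, y, hy, hy'⟩ := hcon
    have : (0 : ℝ) ∈ (fun x => f x - 1) '' Icc 0 1 :=
      isPreconnected_Icc.intermediate_value hx hy hc ⟨hx', hy'⟩
    obtain ⟨z, hz, hz'⟩ := this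
    exact hne z hz (by simp only at hz'; linarith)
  rcases hsgn with h | h
  · have := intervalIntegral.intervalIntegral_pos_of_pos_on (f := fun x => f x - 1)
      (hI.sub (by simp)) (fun x hx => h x (Ioo_subset_Icc_self hx)) zero_lt_one
    linarith
  · have := intervalIntegral.intervalIntegral_pos_of_pos_on (f := fun x => -(f x - 1))
      (hI.sub (by simp)).neg (fun x hx => by linarith [h x (Ioo_subset_Icc_self hx)]) zero_lt_one
    rw [intervalIntegral.integral_neg] at this
    linarith

/-! ### Joint continuity -/

theorem abs_mul_sub_integral_le {f : ℝ → ℝ} {M c d x : ℝ} (hM : 0 ≤ M)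
    (hH : ∀ x ∈ Icc (0 : ℝ) 1, ∀ y ∈ Icc (0 : ℝ) 1, |f x - f y| ≤ M * √|x - y|)
    (hf : ContinuousOn f (Icc 0 1)) (hc : 0 ≤ c) (hd : d ≤ 1) (hcx : c ≤ x) (hxd : x ≤ d) :
    |(d - c) * f x - ∫ z in c..d, f z| ≤ (d - c) * (M * √(d - c)) := by
  have hcd : c ≤ d := hcx.trans hxd
  have hI : IntervalIntegrable f volume c d := by
    apply ContinuousOn.intervalIntegrable
    rw [uIcc_of_le hcd]
    exact hf.mono (Icc_subset_Icc hc hd)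
  have h1 : (d - c) * f x - ∫ z in c..d, f z = ∫ z in c..d, (f x - f z) := by
    rw [intervalIntegral.integral_sub (by simp) hI]; simp
  rw [h1]
  have h2 : ∀ z ∈ uIoc c d, ‖f x - f z‖ ≤ M * √(d - c) := by
    intro z hz
    rw [uIoc_of_le hcd] at hz
    refine (hH x ⟨hc.trans hcx, hxd.trans hd⟩ z ⟨hc.trans hz.1.le, hz.2.trans hd⟩).trans ?_
    gcongr
    rw [abs_le]
    constructor <;> linarith [hz.1, hz.2]
  have h3 := intervalIntegral.norm_integral_le_of_norm_le_const h2
  rw [abs_of_nonneg (sub_nonneg.2 hcd), Real.norm_eq_abs] at h3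
  linarith

/-- The mean of `f t` over an interval of length δ around x is continuous in t and differs from `f t
x` by at most M√δ, uniformly in t. This yields continuity in time at each x, and equicontinuity in x
makes it joint. -/
theorem continuousOn_of_equiHolder {f : ℝ → ℝ → ℝ} {T M : ℝ} (hM : 0 ≤ M)
    (hH : ∀ t ∈ Icc 0 T, ∀ x ∈ Icc (0 : ℝ) 1, ∀ y ∈ Icc (0 : ℝ) 1,
      |f t x - f t y| ≤ M * √|x - y|)
    (hc : ∀ t ∈ Icc 0 T, ContinuousOn (f t) (Icc 0 1))
    (hI : ∀ b ∈ Icc (0 : ℝ) 1, ContinuousOn (fun t => ∫ x in (0 : ℝ)..b, f t x) (Icc 0 T)) :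
    ContinuousOn (fun p : ℝ × ℝ => f p.1 p.2) (Icc 0 T ×ˢ Icc 0 1) := by
  have hsmall : ∀ ε > 0, ∃ δ, 0 < δ ∧ δ ≤ 1 / 2 ∧ M * √δ < ε := by
    intro ε hε
    have h1 : Tendsto (fun δ : ℝ => M * √δ) (𝓝[>] 0) (𝓝 (M * √0)) :=
      (Continuous.tendsto (by fun_prop) 0).mono_left nhdsWithin_le_nhds
    rw [Real.sqrt_zero, mul_zero] at h1
    have h3 : ∀ᶠ δ : ℝ in 𝓝[>] 0, δ ∈ Ioc (0 : ℝ) (1 / 2) := Ioc_mem_nhdsGT (by norm_num)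
    obtain ⟨δ, h4, h5⟩ := ((h1.eventually (gt_mem_nhds hε)).and h3).exists
    exact ⟨δ, h5.1, h5.2, h4⟩
  have hpt : ∀ x ∈ Icc (0 : ℝ) 1, ContinuousOn (fun t => f t x) (Icc 0 T) := by
    intro x hx s hs
    rw [ContinuousWithinAt, Metric.tendsto_nhds]
    intro ε hε
    obtain ⟨δ, hδ, hδ', hδε⟩ := hsmall (ε / 4) (by positivity)
    -- The averaging interval lies on the side of x where there is room for it, which is why δ ≤ 1/2
    -- was arranged.
    obtain ⟨c, d, hc0, hd1, hcd, hcx, hxd⟩ : ∃ c d : ℝ, 0 ≤ c ∧ d ≤ 1 ∧ d - c = δ ∧ c ≤ x ∧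
        x ≤ d := by
      rcases le_total x (1 / 2) with h | h
      · exact ⟨x, x + δ, hx.1, by linarith, by ring, le_rfl, by linarith⟩
      · exact ⟨x - δ, x, by linarith, hx.2, by ring, by linarith, le_rfl⟩
    have hci : ContinuousOn (fun t => ∫ x in c..d, f t x) (Icc 0 T) := by
      have h0 := (hI d ⟨by linarith [hx.1], hd1⟩).sub (hI c ⟨hc0, by linarith [hx.2]⟩)
      refine h0.congr fun t ht => ?_
      have hint : ∀ b ∈ Icc (0 : ℝ) 1, IntervalIntegrable (f t) volume 0 b := fun b hb => by
        apply ContinuousOn.intervalIntegrable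
        rw [uIcc_of_le hb.1]
        exact (hc t ht).mono (Icc_subset_Icc_right hb.2)
      exact (intervalIntegral.integral_interval_sub_left (hint d ⟨by linarith [hx.1], hd1⟩)
        (hint c ⟨hc0, by linarith [hx.2]⟩)).symm
    have h6 := (hci s hs).tendsto
    rw [Metric.tendsto_nhds] at h6
    filter_upwards [h6 (δ * (ε / 4)) (by positivity), self_mem_nhdsWithin] with t ht htm
    rw [Real.dist_eq] at ht ⊢
    have e1 := abs_mul_sub_integral_le hM (hH t htm) (hc t htm) hc0 hd1 hcx hxd
    have e2 := abs_mul_sub_integral_le hM (hH s hs) (hc s hs) hc0 hd1 hcx hxd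
    rw [hcd] at e1 e2
    have e3 : δ * |f t x - f s x| = |(δ * f t x - ∫ z in c..d, f t z) -
        (δ * f s x - ∫ z in c..d, f s z) + ((∫ z in c..d, f t z) - ∫ z in c..d, f s z)| := by
      rw [← abs_of_pos hδ, ← abs_mul, abs_of_pos hδ]; congr 1; ring
    have e4 : δ * |f t x - f s x| < δ * ε := by
      rw [e3]
      calc _ ≤ |δ * f t x - ∫ z in c..d, f t z| + |δ * f s x - ∫ z in c..d, f s z| +
            |(∫ z in c..d, f t z) - ∫ z in c..d, f s z| :=
            (abs_add_le _ _).trans (add_le_add_left (abs_sub _ _) _)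
        _ < δ * ε := by nlinarith
    exact lt_of_mul_lt_mul_left e4 hδ.le
  rintro ⟨s, x⟩ ⟨hs, hx⟩
  simp only at hs hx
  rw [ContinuousWithinAt, Metric.tendsto_nhds]
  intro ε hε
  have h1 : Tendsto (fun p : ℝ × ℝ => f p.1 x) (𝓝[Icc 0 T ×ˢ Icc 0 1] (s, x)) (𝓝 (f s x)) := by
    refine ((hpt x hx s hs).tendsto).comp ?_
    rw [nhdsWithin_prod_eq]
    exact tendsto_fst
  have h2 : Tendsto (fun p : ℝ × ℝ => M * √|p.2 - x|) (𝓝[Icc 0 T ×ˢ Icc 0 1] (s, x)) (𝓝 0) := by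
    have : Tendsto (fun p : ℝ × ℝ => M * √|p.2 - x|) (𝓝 (s, x)) (𝓝 (M * √|x - x|)) :=
      Continuous.tendsto (f := fun p : ℝ × ℝ => M * √|p.2 - x|) (by fun_prop) (s, x)
    rw [sub_self, abs_zero, Real.sqrt_zero, mul_zero] at this
    exact this.mono_left nhdsWithin_le_nhds
  rw [Metric.tendsto_nhds] at h1
  filter_upwards [h1 (ε / 2) (half_pos hε), h2.eventually (gt_mem_nhds (half_pos hε)),
    self_mem_nhdsWithin] with p hp1 hp2 hp
  calc dist (f p.1 p.2) (f s x) ≤ dist (f p.1 p.2) (f p.1 x) + dist (f p.1 x) (f s x) :=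
        dist_triangle _ _ _
    _ < ε := by
      have := hH p.1 hp.1 p.2 hp.2 x hx
      rw [← Real.dist_eq] at this
      linarith

/-! ### Space-time evolution laws -/

theorem spaceTime_eq (T : ℝ) : spaceTime T = volume.restrict (Ioc 0 T ×ˢ Ioc (0 : ℝ) 1) := by
  rw [spaceTime, unitMeasure, Measure.prod_restrict, Measure.volume_eq_prod]

theorem spaceTime_mono {s t : ℝ} (h : s ≤ t) : spaceTime s ≤ spaceTime t := by
  rw [spaceTime_eq, spaceTime_eq]
  exact Measure.restrict_mono (prod_mono_left (Ioc_subset_Ioc_right h)) le_rfl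

theorem memLp_spaceTime_of_continuousOn {f : ℝ → ℝ → ℝ} {T : ℝ}
    (hf : ContinuousOn (fun p : ℝ × ℝ => f p.1 p.2) (Icc 0 T ×ˢ Icc 0 1)) (p : ℝ≥0∞) :
    MemLp (fun p : ℝ × ℝ => f p.1 p.2) p (spaceTime T) := by
  obtain ⟨C, hC⟩ := (isCompact_Icc.prod isCompact_Icc).exists_bound_of_continuousOn hf
  have hsub : Ioc 0 T ×ˢ Ioc (0 : ℝ) 1 ⊆ Icc 0 T ×ˢ Icc 0 1 :=
    prod_mono Ioc_subset_Icc_self Ioc_subset_Icc_self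
  refine MemLp.of_bound ?_ C ?_
  · rw [spaceTime_eq]
    exact (hf.mono hsub).aestronglyMeasurable (measurableSet_Ioc.prod measurableSet_Ioc)
  · rw [spaceTime_eq, ae_restrict_iff' (measurableSet_Ioc.prod measurableSet_Ioc)]
    exact Eventually.of_forall fun x hx => hC x (hsub hx)

theorem memLp_top_spaceTime_of_bound {f : ℝ → ℝ → ℝ} {T M : ℝ}
    (hf : AEStronglyMeasurable (fun p : ℝ × ℝ => f p.1 p.2) (spaceTime T))
    (hM : ∀ t ∈ Icc 0 T, ∀ x ∈ Icc (0 : ℝ) 1, |f t x| ≤ M) :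
    MemLp (fun p : ℝ × ℝ => f p.1 p.2) ⊤ (spaceTime T) := by
  refine MemLp.of_bound hf M ?_
  rw [spaceTime_eq, ae_restrict_iff' (measurableSet_Ioc.prod measurableSet_Ioc)]
  exact Eventually.of_forall fun x hx =>
    hM _ (Ioc_subset_Icc_self hx.1) _ (Ioc_subset_Icc_self hx.2)

theorem continuousOn_slice {f : ℝ → ℝ → ℝ} {T : ℝ}
    (hf : ContinuousOn (fun p : ℝ × ℝ => f p.1 p.2) (Icc 0 T ×ˢ Icc 0 1)) {t : ℝ}
    (ht : t ∈ Icc 0 T) : ContinuousOn (f t) (Icc 0 1) :=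
  hf.comp (f := fun x => (t, x)) (by fun_prop) fun _ hx => ⟨ht, hx⟩

theorem continuousOn_slice_left {f : ℝ → ℝ → ℝ} {T : ℝ}
    (hf : ContinuousOn (fun p : ℝ × ℝ => f p.1 p.2) (Icc 0 T ×ˢ Icc 0 1)) {x : ℝ}
    (hx : x ∈ Icc (0 : ℝ) 1) : ContinuousOn (fun t => f t x) (Icc 0 T) :=
  hf.comp (f := fun t => (t, x)) (by fun_prop) fun _ ht => ⟨ht, hx⟩

/-- Identities that hold almost everywhere for each fixed time can be intersected only over
countably many times. Projecting the rationals onto the interval gives a countable dense family,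
also when the interval is a point. -/
theorem eqOn_Icc_of_rat {f g : ℝ → ℝ} {a b : ℝ} (hab : a ≤ b) (hf : ContinuousOn f (Icc a b))
    (hg : ContinuousOn g (Icc a b))
    (h : ∀ q : ℚ, f (projIcc a b hab q) = g (projIcc a b hab q)) : EqOn f g (Icc a b) := by
  have hc : Continuous fun r : ℝ => (projIcc a b hab r : ℝ) :=
    continuous_subtype_val.comp continuous_projIcc
  have h1 := hf.comp_continuous hc fun r => (projIcc a b hab r).2
  have h2 := hg.comp_continuous hc fun r => (projIcc a b hab r).2
  have h3 := h1.ext_on Rat.denseRange_cast h2 (by rintro _ ⟨q, rfl⟩; exact h q)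
  intro x hx
  have := congrFun h3 x
  simpa [projIcc_of_mem hab hx] using this

theorem integrable_mul_snd {κ : ℝ → ℝ → ℝ} {ψ : ℝ → ℝ} {T : ℝ}
    (hκ : Integrable (fun p : ℝ × ℝ => κ p.1 p.2) (spaceTime T))
    (hψ : MemLp ψ ⊤ unitMeasure) :
    Integrable (fun p : ℝ × ℝ => κ p.1 p.2 * ψ p.2) (spaceTime T) := by
  have h1 : MemLp (fun p : ℝ × ℝ => ψ p.2) ⊤ (spaceTime T) :=
    hψ.comp_snd (volume.restrict (Ioc 0 T))
  exact (memLp_one_iff_integrable.1 (h1.mul (memLp_one_iff_integrable.2 hκ)))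

/-- `f` evolves on `[0,T]` with the integrable rate `κ`. -/
structure Evolves (f κ : ℝ → ℝ → ℝ) (T : ℝ) : Prop where
  integrable : Integrable (fun p : ℝ × ℝ => κ p.1 p.2) (spaceTime T)
  eq : ∀ t ∈ Icc 0 T, ∀ b ∈ Icc (0 : ℝ) 1,
    ∫ x in (0 : ℝ)..b, f t x = (∫ x in (0 : ℝ)..b, f 0 x) +
      ∫ s in (0 : ℝ)..t, ∫ x in (0 : ℝ)..b, κ s x

theorem integrable_prod_sub {κ : ℝ → ℝ → ℝ} {T t a b : ℝ}
    (hκ : Integrable (fun p : ℝ × ℝ => κ p.1 p.2) (spaceTime T)) (ht : t ≤ T) (ha : 0 ≤ a)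
    (hb : b ≤ 1) : Integrable (fun p : ℝ × ℝ => κ p.1 p.2)
      ((volume.restrict (Ioc 0 t)).prod (volume.restrict (Ioc a b))) := by
  refine hκ.mono_measure ?_
  rw [spaceTime_eq, Measure.prod_restrict, Measure.volume_eq_prod]
  exact Measure.restrict_mono (prod_mono (Ioc_subset_Ioc_right ht) (Ioc_subset_Ioc ha hb)) le_rfl

theorem intervalIntegrable_integral {κ : ℝ → ℝ → ℝ} {T a b : ℝ}
    (hκ : Integrable (fun p : ℝ × ℝ => κ p.1 p.2) (spaceTime T)) (hT : 0 ≤ T) (ha : 0 ≤ a)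
    (hab : a ≤ b) (hb : b ≤ 1) :
    IntervalIntegrable (fun s => ∫ x in a..b, κ s x) volume 0 T := by
  rw [intervalIntegrable_iff_integrableOn_Ioc_of_le hT]
  simp only [intervalIntegral.integral_of_le hab]
  exact (integrable_prod_sub hκ le_rfl ha hb).integral_prod_left

theorem integral_swap {κ : ℝ → ℝ → ℝ} {T t a b : ℝ}
    (hκ : Integrable (fun p : ℝ × ℝ => κ p.1 p.2) (spaceTime T)) (ht0 : 0 ≤ t) (ht : t ≤ T)
    (ha : 0 ≤ a) (hab : a ≤ b) (hb : b ≤ 1) :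
    ∫ s in (0 : ℝ)..t, ∫ x in a..b, κ s x = ∫ x in a..b, ∫ s in (0 : ℝ)..t, κ s x := by
  simp only [intervalIntegral.integral_of_le hab, intervalIntegral.integral_of_le ht0]
  exact integral_integral_swap (integrable_prod_sub hκ ht ha hb)

theorem intervalIntegrable_integral_left {κ : ℝ → ℝ → ℝ} {T t : ℝ}
    (hκ : Integrable (fun p : ℝ × ℝ => κ p.1 p.2) (spaceTime T)) (ht0 : 0 ≤ t) (ht : t ≤ T) :
    IntervalIntegrable (fun x => ∫ s in (0 : ℝ)..t, κ s x) volume 0 1 := by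
  rw [intervalIntegrable_iff_integrableOn_Ioc_of_le zero_le_one]
  simp only [intervalIntegral.integral_of_le ht0]
  exact (integrable_prod_sub hκ ht le_rfl le_rfl).integral_prod_right

theorem continuousOn_intervalIntegral {g : ℝ → ℝ} {T : ℝ} (hT : 0 ≤ T)
    (hg : IntervalIntegrable g volume 0 T) :
    ContinuousOn (fun t => ∫ s in (0 : ℝ)..t, g s) (Icc 0 T) := by
  have := intervalIntegral.continuousOn_primitive_interval' hg (a := 0) (by simp)
  rwa [uIcc_of_le hT] at this

namespace Evolves

variable {f κ : ℝ → ℝ → ℝ} {T : ℝ}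

theorem continuousOn_integral (h : Evolves f κ T) (hT : 0 ≤ T) {b : ℝ} (hb : b ∈ Icc (0 : ℝ) 1) :
    ContinuousOn (fun t => ∫ x in (0 : ℝ)..b, f t x) (Icc 0 T) := by
  have h1 := continuousOn_intervalIntegral hT
    (intervalIntegrable_integral h.integrable hT le_rfl hb.1 hb.2)
  exact (continuousOn_const.add h1).congr fun t ht => h.eq t ht b hb

/-- By Fubini, both sides have the same integral over every [0,b]; their difference has zero as a
primitive. -/
theorem ae_eq (h : Evolves f κ T) (hf : ∀ t ∈ Icc 0 T, ContinuousOn (f t) (Icc 0 1)) {t : ℝ}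
    (ht : t ∈ Icc 0 T) :
    ∀ᵐ x ∂unitMeasure, f t x = f 0 x + ∫ s in (0 : ℝ)..t, κ s x := by
  have h0 : (0 : ℝ) ∈ Icc 0 T := ⟨le_rfl, ht.1.trans ht.2⟩
  have hint : ∀ r ∈ Icc 0 T, ∀ b ∈ Icc (0 : ℝ) 1, IntervalIntegrable (f r) volume 0 b :=
    fun r hr b hb => by
      apply ContinuousOn.intervalIntegrable
      rw [uIcc_of_le hb.1]
      exact (hf r hr).mono (Icc_subset_Icc_right hb.2)
  have h1 : (1 : ℝ) ∈ Icc (0 : ℝ) 1 := by simp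
  have hκ := intervalIntegrable_integral_left h.integrable ht.1 ht.2
  have hκb : ∀ b ∈ Icc (0 : ℝ) 1,
      IntervalIntegrable (fun x => ∫ s in (0 : ℝ)..t, κ s x) volume 0 b := fun b hb =>
    hκ.mono_set (by
      rw [uIcc_of_le hb.1, uIcc_of_le zero_le_one]; exact Icc_subset_Icc_right hb.2)
  have hp : IsPrim (fun _ => (0 : ℝ)) (fun x => f t x - f 0 x - ∫ s in (0 : ℝ)..t, κ s x) 0 1 := by
    refine ⟨((hint t ht 1 h1).sub (hint 0 h0 1 h1)).sub hκ, fun b hb => ?_⟩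
    rw [intervalIntegral.integral_sub ((hint t ht b hb).sub (hint 0 h0 b hb)) (hκb b hb),
      intervalIntegral.integral_sub (hint t ht b hb) (hint 0 h0 b hb), h.eq t ht b hb,
      integral_swap h.integrable ht.1 ht.2 le_rfl hb.1 hb.2]
    ring
  filter_upwards [hp.ae_eq (IsPrim.const 0) zero_le_one] with x hx
  linarith

/-- The exceptional set in `Evolves.ae_eq` depends on the time; rational times and continuity in
time give one exceptional set of points x for all times. -/
theorem ae_isPrim (h : Evolves f κ T) (hT : 0 ≤ T)
    (hf : ContinuousOn (fun p : ℝ × ℝ => f p.1 p.2) (Icc 0 T ×ˢ Icc 0 1)) :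
    ∀ᵐ x ∂unitMeasure, IsPrim (fun t => f t x) (fun t => κ t x) 0 T := by
  have h1 : ∀ᵐ x ∂unitMeasure, ∀ q : ℚ, f (projIcc 0 T hT q) x =
      f 0 x + ∫ s in (0 : ℝ)..(projIcc 0 T hT q), κ s x :=
    ae_all_iff.2 fun q => h.ae_eq (fun t ht => continuousOn_slice hf ht) (projIcc 0 T hT q).2
  have h2 : ∀ᵐ x ∂unitMeasure, IntegrableOn (fun t => κ t x) (Ioc 0 T) :=
    Integrable.prod_left_ae h.integrable
  have h3 : ∀ᵐ x ∂unitMeasure, x ∈ Ioc (0 : ℝ) 1 := ae_restrict_mem measurableSet_Ioc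
  filter_upwards [h1, h2, h3] with x hx1 hx2 hx3
  have hi : IntervalIntegrable (fun t => κ t x) volume 0 T :=
    (intervalIntegrable_iff_integrableOn_Ioc_of_le hT).2 hx2
  exact ⟨hi, eqOn_Icc_of_rat hT (continuousOn_slice_left hf (Ioc_subset_Icc_self hx3))
    (continuousOn_const.add (continuousOn_intervalIntegral hT hi)) hx1⟩

theorem isPrim_integral_mul (h : Evolves f κ T) (hT : 0 ≤ T)
    (hf : ∀ t ∈ Icc 0 T, ContinuousOn (f t) (Icc 0 1)) {ψ : ℝ → ℝ}
    (hψ : ContinuousOn ψ (Icc 0 1)) :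
    IsPrim (fun t => ∫ x in (0 : ℝ)..1, f t x * ψ x) (fun t => ∫ x in (0 : ℝ)..1, κ t x * ψ x)
      0 T := by
  have hκ := integrable_mul_snd h.integrable (memLp_of_continuousOn hψ ⊤)
  refine ⟨intervalIntegrable_integral (κ := fun s x => κ s x * ψ x) hκ hT le_rfl zero_le_one le_rfl,
    fun t ht => ?_⟩
  rw [integral_swap (κ := fun s x => κ s x * ψ x) hκ ht.1 ht.2 le_rfl zero_le_one le_rfl]
  have hi : ∀ r ∈ Icc 0 T, IntervalIntegrable (fun x => f r x * ψ x) volume 0 1 := fun r hr => by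
    apply ContinuousOn.intervalIntegrable
    rw [uIcc_of_le zero_le_one]
    exact (hf r hr).mul hψ
  rw [← intervalIntegral.integral_add (hi 0 ⟨le_rfl, hT⟩)
    (intervalIntegrable_integral_left (κ := fun s x => κ s x * ψ x) hκ ht.1 ht.2)]
  simp only [integral_unit]
  refine integral_congr_ae ?_
  filter_upwards [h.ae_eq hf ht] with x hx
  rw [hx, intervalIntegral.integral_mul_const]
  ring

end Evolves

/-! ### Smooth cutoff functions -/

/-- Smooth approximations of the indicator function of `(0,b)`. -/
noncomputable def cutoff (n : ℕ) (b x : ℝ) : ℝ :=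
  Real.smoothTransition ((n + 1) * x - 1) * Real.smoothTransition ((n + 1) * (b - x) - 1)

theorem cutoff_nonneg (n : ℕ) (b x : ℝ) : 0 ≤ cutoff n b x :=
  mul_nonneg (Real.smoothTransition.nonneg _) (Real.smoothTransition.nonneg _)

theorem cutoff_le_one (n : ℕ) (b x : ℝ) : cutoff n b x ≤ 1 :=
  mul_le_one₀ (Real.smoothTransition.le_one _) (Real.smoothTransition.nonneg _)
    (Real.smoothTransition.le_one _)

theorem contDiff_cutoff (n : ℕ) (b : ℝ) : ContDiff ℝ (⊤ : ℕ∞) (cutoff n b) := by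
  unfold cutoff
  refine ContDiff.mul ?_ ?_
  · exact Real.smoothTransition.contDiff.comp (by fun_prop)
  · exact Real.smoothTransition.contDiff.comp (by fun_prop)

theorem cutoff_eq_zero {n : ℕ} {b x : ℝ} (hx : b ≤ x) : cutoff n b x = 0 := by
  rw [cutoff, Real.smoothTransition.zero_of_nonpos (x := (n + 1) * (b - x) - 1), mul_zero]
  have : ((n : ℝ) + 1) * (b - x) ≤ 0 :=
    mul_nonpos_of_nonneg_of_nonpos (by positivity) (by linarith)
  linarith

theorem isTestFunction_cutoff (n : ℕ) {b : ℝ} (hb : b ≤ 1) : IsTestFunction (cutoff n b) := by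
  have hpos : (0 : ℝ) < n + 1 := by positivity
  have hsub : tsupport (cutoff n b) ⊆ Icc (1 / ((n : ℝ) + 1)) (b - 1 / (n + 1)) := by
    refine closure_minimal (fun x hx => ?_) isClosed_Icc
    by_contra hcon
    refine hx ?_
    rw [mem_Icc, not_and_or, not_le, not_le] at hcon
    rcases hcon with h | h
    · rw [cutoff, Real.smoothTransition.zero_of_nonpos, zero_mul]
      rw [lt_div_iff₀ hpos] at h
      linarith
    · rw [cutoff, Real.smoothTransition.zero_of_nonpos (x := (n + 1) * (b - x) - 1), mul_zero]
      have : b - x < 1 / (n + 1) := by linarith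
      rw [lt_div_iff₀ hpos] at this
      linarith
  refine ⟨contDiff_cutoff n b, HasCompactSupport.of_support_subset_isCompact isCompact_Icc
    ((subset_tsupport _).trans hsub), hsub.trans fun x hx => ⟨?_, ?_⟩⟩
  · exact lt_of_lt_of_le (by positivity) hx.1
  · have : (0 : ℝ) < 1 / (n + 1) := by positivity
    linarith [hx.2]

theorem tendsto_cutoff {b x : ℝ} (hx : x ∈ Ioo 0 b) :
    Tendsto (fun n => cutoff n b x) atTop (𝓝 1) := by
  have h1 : ∀ c : ℝ, 0 < c → ∀ᶠ n : ℕ in atTop, 1 ≤ ((n : ℝ) + 1) * c - 1 := by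
    intro c hc
    have : Tendsto (fun n : ℕ => ((n : ℝ) + 1) * c) atTop atTop :=
      (tendsto_atTop_add_const_right _ _ tendsto_natCast_atTop_atTop).atTop_mul_const hc
    filter_upwards [this.eventually_ge_atTop 2] with n hn
    linarith
  refine tendsto_const_nhds.congr' ?_
  filter_upwards [h1 x hx.1, h1 (b - x) (sub_pos.2 hx.2)] with n h2 h3
  rw [cutoff, Real.smoothTransition.one_of_one_le h2, Real.smoothTransition.one_of_one_le h3,
    mul_one]

theorem tendsto_integral_mul_cutoff {g : ℝ → ℝ} (hg : IntervalIntegrable g volume 0 1) {b : ℝ}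
    (hb : b ∈ Icc (0 : ℝ) 1) :
    Tendsto (fun n => ∫ x in (0 : ℝ)..1, g x * cutoff n b x) atTop (𝓝 (∫ x in (0 : ℝ)..b, g x)) := by
  have hcc : ∀ n, Continuous (cutoff n b) := fun n => (contDiff_cutoff n b).continuous
  have hg0 : IntervalIntegrable g volume 0 b := hg.mono_set (by
    rw [uIcc_of_le hb.1, uIcc_of_le zero_le_one]; exact Icc_subset_Icc_right hb.2)
  have hg1 : IntervalIntegrable g volume b 1 := hg.mono_set (by
    rw [uIcc_of_le hb.2, uIcc_of_le zero_le_one]; exact Icc_subset_Icc_left hb.1)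
  have h1 : ∀ n, ∫ x in (0 : ℝ)..1, g x * cutoff n b x = ∫ x in (0 : ℝ)..b, g x * cutoff n b x := by
    intro n
    rw [← intervalIntegral.integral_add_adjacent_intervals
      (hg0.mul_continuousOn (hcc n).continuousOn) (hg1.mul_continuousOn (hcc n).continuousOn)]
    have : ∫ x in b..1, g x * cutoff n b x = ∫ x in b..1, (0 : ℝ) := by
      refine intervalIntegral.integral_congr fun x hx => ?_
      rw [uIcc_of_le hb.2] at hx
      rw [cutoff_eq_zero hx.1, mul_zero]
    rw [this]; simp
  simp only [h1]
  refine intervalIntegral.tendsto_integral_filter_of_dominated_convergence (fun x => |g x|)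
    (Eventually.of_forall fun n => ?_) (Eventually.of_forall fun n => ?_) hg0.abs ?_
  · exact (intervalIntegrable_iff.1 (hg0.mul_continuousOn (hcc n).continuousOn)).aestronglyMeasurable
  · refine Eventually.of_forall fun x _ => ?_
    rw [Real.norm_eq_abs, abs_mul, abs_of_nonneg (cutoff_nonneg n b x)]
    exact mul_le_of_le_one_right (abs_nonneg _) (cutoff_le_one n b x)
  · have hbne : ∀ᵐ x : ℝ, x ≠ b := by simp [ae_iff, measure_singleton]
    filter_upwards [hbne] with x hxb hx
    rw [uIoc_of_le hb.1] at hx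
    simpa using (tendsto_cutoff ⟨hx.1, lt_of_le_of_ne hx.2 hxb⟩).const_mul (g x)

/-- Only cutoffs with rational end point are tested, so that an almost sure statement has to be used
countably often. Letting n → ∞ gives the law on (0,b) for rational b, and continuity in b the rest.
-/
theorem evolves_of_cutoff {f κ : ℝ → ℝ → ℝ} {T : ℝ}
    (hκ : Integrable (fun p : ℝ × ℝ => κ p.1 p.2) (spaceTime T))
    (hf : ∀ t ∈ Icc 0 T, ContinuousOn (f t) (Icc 0 1))
    (h : ∀ (n : ℕ) (q : ℚ), (q : ℝ) ≤ 1 → ∀ t ∈ Icc 0 T,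
      ∫ x in (0 : ℝ)..1, f t x * cutoff n q x = (∫ x in (0 : ℝ)..1, f 0 x * cutoff n q x) +
        ∫ s in (0 : ℝ)..t, ∫ x in (0 : ℝ)..1, κ s x * cutoff n q x) :
    Evolves f κ T := by
  refine ⟨hκ, fun t ht b hb => ?_⟩
  have h0 : (0 : ℝ) ∈ Icc 0 T := ⟨le_rfl, ht.1.trans ht.2⟩
  have hfi : ∀ r ∈ Icc 0 T, IntervalIntegrable (f r) volume 0 1 := fun r hr => by
    apply ContinuousOn.intervalIntegrable
    rw [uIcc_of_le zero_le_one]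
    exact hf r hr
  have hG := intervalIntegrable_integral_left hκ ht.1 ht.2
  have hmain : ∀ b ∈ Icc (0 : ℝ) 1, (∃ q : ℚ, b = q) → ∫ x in (0 : ℝ)..b, f t x =
      (∫ x in (0 : ℝ)..b, f 0 x) + ∫ x in (0 : ℝ)..b, ∫ s in (0 : ℝ)..t, κ s x := by
    rintro b hb ⟨q, rfl⟩
    refine tendsto_nhds_unique (tendsto_integral_mul_cutoff (hfi t ht) hb) ?_
    refine ((tendsto_integral_mul_cutoff (hfi 0 h0) hb).add
      (tendsto_integral_mul_cutoff hG hb)).congr fun n => ?_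
    rw [h n q hb.2 t ht]
    have hi := integrable_mul_snd hκ
      (memLp_of_continuousOn ((contDiff_cutoff n (q : ℝ)).continuous.continuousOn) ⊤)
    rw [integral_swap (κ := fun s x => κ s x * cutoff n q x) hi ht.1 ht.2 le_rfl zero_le_one le_rfl]
    simp only [intervalIntegral.integral_mul_const]
  rw [integral_swap hκ ht.1 ht.2 le_rfl hb.1 hb.2]
  refine eqOn_Icc_of_rat (f := fun b => ∫ x in (0 : ℝ)..b, f t x)
    (g := fun b => (∫ x in (0 : ℝ)..b, f 0 x) + ∫ x in (0 : ℝ)..b, ∫ s in (0 : ℝ)..t, κ s x)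
    zero_le_one (continuousOn_intervalIntegral zero_le_one (hfi t ht))
    ((continuousOn_intervalIntegral zero_le_one (hfi 0 h0)).add
      (continuousOn_intervalIntegral zero_le_one hG)) (fun q => ?_) hb
  refine hmain _ (projIcc 0 1 zero_le_one (q : ℝ)).2 ⟨max 0 (min 1 q), ?_⟩
  simp [projIcc]

/-! ### Pathwise solutions -/

/-- The rate of change of the density. -/
noncomputable def massRate (ρ u : ℝ → ℝ) (x : ℝ) : ℝ := -(dx ρ x * u x + ρ x * dx u x)

/-- The rate of change of `ρ (u - w)`. -/
noncomputable def momentumRate (A : ℝ) (ρ u w : ℝ → ℝ) (x : ℝ) : ℝ :=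
  dx (dx u) x - A ^ 2 * dx ρ x - ρ x * u x * dx u x - (u x - w x) * (dx ρ x * u x + ρ x * dx u x)

/-- Regularity of the path of the noise: `w`, `w_x` are continuous and `w_xx` is square
integrable with `‖w_xx‖ ≤ N`. -/
structure IsNoisePath (T N : ℝ) (w w₁ w₂ : ℝ → ℝ → ℝ) : Prop where
  cont : ContinuousOn (fun p : ℝ × ℝ => w p.1 p.2) (Icc 0 T ×ˢ Icc 0 1)
  cont₁ : ContinuousOn (fun p : ℝ × ℝ => w₁ p.1 p.2) (Icc 0 T ×ˢ Icc 0 1)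
  prim : ∀ t ∈ Icc 0 T, IsPrim (w t) (w₁ t) 0 1
  prim₁ : ∀ t ∈ Icc 0 T, IsPrim (w₁ t) (w₂ t) 0 1
  left : ∀ t ∈ Icc 0 T, w t 0 = 0
  right : ∀ t ∈ Icc 0 T, w t 1 = 0
  zero : ∀ x ∈ Icc (0 : ℝ) 1, w 0 x = 0
  meas₂ : AEStronglyMeasurable (fun p : ℝ × ℝ => w₂ p.1 p.2) (spaceTime T)
  memLp₂ : ∀ t ∈ Icc 0 T, MemLp (w₂ t) 2 unitMeasure
  bound₂ : ∀ t ∈ Icc 0 T, normL2 (w₂ t) ≤ N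

/-- Pathwise solutions of the system solved by `ρ` and `ρ (u - w)`. -/
structure IsPathSolution (A T N : ℝ) (ρ u w w₁ w₂ : ℝ → ℝ → ℝ) : Prop where
  regular : HasStrongRegularity ρ u
  noise : IsNoisePath T N w w₁ w₂
  mass : Evolves ρ (fun t => massRate (ρ t) (u t)) T
  momentum : Evolves (fun t x => ρ t x * (u t x - w t x))
    (fun t => momentumRate A (ρ t) (u t) (w t)) T

namespace HasStrongRegularity

variable {ρ u : ℝ → ℝ → ℝ}

theorem continuousOn_density (h : HasStrongRegularity ρ u) {t : ℝ} (ht : 0 ≤ t) :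
    ContinuousOn (ρ t) (Icc 0 1) := (h.phase t ht).density.isPrim.continuousOn zero_le_one

theorem continuousOn_velocity (h : HasStrongRegularity ρ u) {t : ℝ} (ht : 0 ≤ t) :
    ContinuousOn (u t) (Icc 0 1) := (h.phase t ht).velocity.1.isPrim.continuousOn zero_le_one

theorem exists_bound (h : HasStrongRegularity ρ u) (T : ℝ) : ∃ M, 0 ≤ M ∧ ∀ t ∈ Icc 0 T,
    normL2 (dx (ρ t)) ≤ M ∧ normL2 (dx (u t)) ≤ M ∧
    (∀ x ∈ Icc (0 : ℝ) 1, |ρ t x| ≤ M) ∧ (∀ x ∈ Icc (0 : ℝ) 1, |u t x| ≤ M) := by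
  obtain ⟨M, hM⟩ := h.bound T
  -- The summand 1 is the value that the density takes somewhere; from there it varies by at most
  -- ‖ρ_x‖.
  refine ⟨|M| + 1, by positivity, fun t ht => ?_⟩
  obtain ⟨-, h1, -, h2⟩ := hM t ht
  have hp := h.phase t ht.1
  have h3 := le_abs_self M
  refine ⟨by linarith, by linarith, fun x hx => ?_, fun x hx => ?_⟩
  · obtain ⟨y, hy, hy1⟩ := exists_eq_one_of_mass (h.continuousOn_density ht.1) hp.mass
    have := hp.density.isPrim.abs_sub_le' hp.density.2 hx hy
    rw [hy1] at this
    have h4 := abs_sub_abs_le_abs_sub (ρ t x) 1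
    rw [abs_one] at h4
    linarith
  · have := hp.velocity.1.isPrim.abs_sub_le' hp.velocity.1.2 hx (left_mem_Icc.2 zero_le_one)
    rw [hp.velocity.2.1, sub_zero] at this
    linarith

theorem integrable_massRate (h : HasStrongRegularity ρ u) (T : ℝ) :
    Integrable (fun p : ℝ × ℝ => massRate (ρ p.1) (u p.1) p.2) (spaceTime T) :=
  (((h.density_x T).integrable_mul (h.velocity T)).add
    ((h.density T).integrable_mul (h.velocity_x T))).neg

theorem continuousOn_jointDensity (h : HasStrongRegularity ρ u) {T : ℝ} (hT : 0 ≤ T)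
    (hm : Evolves ρ (fun t => massRate (ρ t) (u t)) T) :
    ContinuousOn (fun p : ℝ × ℝ => ρ p.1 p.2) (Icc 0 T ×ˢ Icc 0 1) := by
  obtain ⟨M, hM0, hM⟩ := h.exists_bound T
  refine continuousOn_of_equiHolder hM0 (fun t ht x hx y hy => ?_)
    (fun t ht => h.continuousOn_density ht.1) fun b hb => hm.continuousOn_integral hT hb
  have hp := (h.phase t ht.1).density
  exact (hp.isPrim.abs_sub_le hp.2 hx hy).trans
    (mul_le_mul_of_nonneg_right (hM t ht).1 (Real.sqrt_nonneg _))

theorem memLp_massRate (h : HasStrongRegularity ρ u) (T : ℝ) :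
    MemLp (fun p : ℝ × ℝ => massRate (ρ p.1) (u p.1) p.2) 2 (spaceTime T) := by
  obtain ⟨M, hM0, hM⟩ := h.exists_bound T
  have h1 := memLp_top_spaceTime_of_bound (h.velocity T).1 fun t ht => (hM t ht).2.2.2
  have h2 := memLp_top_spaceTime_of_bound (h.density T).1 fun t ht => (hM t ht).2.2.1
  exact (MemLp.add (h1.mul (h.density_x T)) ((h.velocity_x T).mul h2)).neg

end HasStrongRegularity

namespace IsNoisePath

variable {T N : ℝ} {w w₁ w₂ : ℝ → ℝ → ℝ}

theorem bound_nonneg (h : IsNoisePath T N w w₁ w₂) (hT : 0 ≤ T) : 0 ≤ N :=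
  (normL2_nonneg _).trans (h.bound₂ 0 ⟨le_rfl, hT⟩)

theorem abs_w₁_le (h : IsNoisePath T N w w₁ w₂) {t x : ℝ} (ht : t ∈ Icc 0 T)
    (hx : x ∈ Icc (0 : ℝ) 1) : |w₁ t x| ≤ N := by
  have hc : ContinuousOn (w₁ t) (Icc 0 1) := continuousOn_slice h.cont₁ ht
  -- Since w vanishes at both ends, w_x has mean zero; adding one makes it a function of unit mass,
  -- hence w_x has a zero.
  obtain ⟨y, hy, hy0⟩ : ∃ y ∈ Icc (0 : ℝ) 1, w₁ t y + 1 = 1 := by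
    refine exists_eq_one_of_mass (f := fun y => w₁ t y + 1) (hc.add continuousOn_const) ?_
    rw [intervalIntegral.integral_add (h.prim t ht).1 (by simp),
      (h.prim t ht).integral_eq (by simp) (by simp), h.left t ht, h.right t ht]
    simp
  have h1 := (h.prim₁ t ht).abs_sub_le' (h.memLp₂ t ht) hx hy
  rw [show w₁ t y = 0 by linarith, sub_zero] at h1
  exact h1.trans (h.bound₂ t ht)

theorem abs_w_le (h : IsNoisePath T N w w₁ w₂) {t x : ℝ} (ht : t ∈ Icc 0 T)
    (hx : x ∈ Icc (0 : ℝ) 1) : |w t x| ≤ N := by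
  have h1 := (h.prim t ht).2 x hx
  rw [h.left t ht, zero_add] at h1
  rw [h1]
  have h2 := intervalIntegral.norm_integral_le_of_norm_le_const (a := 0) (b := x) (f := w₁ t)
    (C := N) fun z hz => by
      rw [uIoc_of_le hx.1] at hz
      exact h.abs_w₁_le ht ⟨hz.1.le, hz.2.trans hx.2⟩
  rw [sub_zero, abs_of_nonneg hx.1] at h2
  exact h2.trans (mul_le_of_le_one_right ((abs_nonneg _).trans (h.abs_w₁_le ht hx)) hx.2)

theorem memLp_w₂ (h : IsNoisePath T N w w₁ w₂) :
    MemLp (fun p : ℝ × ℝ => w₂ p.1 p.2) 2 (spaceTime T) := by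
  refine ⟨h.meas₂, ?_⟩
  rw [eLpNorm_lt_top_iff_lintegral_rpow_enorm_lt_top (by norm_num) (by norm_num)]
  rw [spaceTime, lintegral_prod _ (by rw [← spaceTime]; exact h.meas₂.enorm.pow_const _)]
  have hb : ∀ t ∈ Ioc 0 T, ∫⁻ x, ‖w₂ t x‖ₑ ^ (2 : ℝ≥0∞).toReal ∂unitMeasure ≤
      ENNReal.ofReal (N ^ 2) := by
    intro t ht
    have ht' := Ioc_subset_Icc_self ht
    have h1 := h.memLp₂ t ht'
    have h2 : ∫⁻ x, ‖w₂ t x‖ₑ ^ (2 : ℝ≥0∞).toReal ∂unitMeasure =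
        ENNReal.ofReal (∫ x, w₂ t x ^ 2 ∂unitMeasure) := by
      rw [ofReal_integral_eq_lintegral_ofReal h1.integrable_sq
        (Eventually.of_forall fun _ => sq_nonneg _)]
      refine lintegral_congr fun x => ?_
      rw [← ofReal_norm, ENNReal.ofReal_rpow_of_nonneg (norm_nonneg _) (by norm_num)]
      simp
    rw [h2, ← normL2_sq]
    exact ENNReal.ofReal_le_ofReal (pow_le_pow_left₀ (normL2_nonneg _) (h.bound₂ t ht') 2)
  calc _ ≤ ∫⁻ _ in Ioc 0 T, ENNReal.ofReal (N ^ 2) :=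
        setLIntegral_mono measurable_const hb
    _ < ⊤ := by simp [ENNReal.mul_lt_top]

end IsNoisePath

/-! ### Limits of sums over uniform partitions -/

/-- The first two arguments of K are the ends of the cell that contains the third. As the mesh
shrinks both tend to r, and the step functions built from K converge to g under the majorant κ. The
lemma replaces the product rule when one factor is not differentiable in time pointwise, and it also
evaluates the Riemann sums of the Itô integrals. -/
theorem tendsto_sum_partition {T : ℝ} (hT : 0 ≤ T) {K : ℝ → ℝ → ℝ → ℝ} {g κ : ℝ → ℝ}
    (hκ : IntervalIntegrable κ volume 0 T)
    (hmeas : ∀ s t, 0 ≤ s → s ≤ t → t ≤ T →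
      AEStronglyMeasurable (K s t) (volume.restrict (Ioc s t)))
    (hb : ∀ᵐ r ∂(volume.restrict (Ioc 0 T)), ∀ s t, 0 ≤ s → s ≤ r → r ≤ t → t ≤ T →
      |K s t r| ≤ κ r)
    (hlim : ∀ᵐ r ∂(volume.restrict (Ioc 0 T)), ∀ s t : ℕ → ℝ,
      (∀ n, 0 ≤ s n ∧ s n ≤ r ∧ r ≤ t n ∧ t n ≤ T) → Tendsto s atTop (𝓝 r) →
      Tendsto t atTop (𝓝 r) → Tendsto (fun n => K (s n) (t n) r) atTop (𝓝 (g r))) :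
    IntervalIntegrable g volume 0 T ∧ Tendsto (fun n : ℕ => ∑ i ∈ Finset.range n,
      ∫ r in (T * i / n)..(T * (i + 1) / n), K (T * i / n) (T * (i + 1) / n) r) atTop
      (𝓝 (∫ r in (0 : ℝ)..T, g r)) := by
  rcases hT.eq_or_lt with rfl | hT'
  · simp
  -- With n + 1 cells in place of n there is no division by zero.
  rw [← tendsto_add_atTop_iff_nat 1]
  set p : ℕ → ℕ → ℝ := fun n i => T * i / (n + 1 : ℕ) with hp
  have hp' : ∀ n i : ℕ, T * ((i : ℝ) + 1) / (n + 1 : ℕ) = p n (i + 1) := by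
    intro n i; simp [hp]
  have hpmono : ∀ n, Monotone (p n) := fun n i j hij => by
    simp only [hp]; gcongr
  have hp0 : ∀ n i, 0 ≤ p n i := fun n i => by simp only [hp]; positivity
  have hpT : ∀ n i, i ≤ n + 1 → p n i ≤ T := fun n i hi => by
    have h1 : p n (n + 1) = T := by
      simp only [hp]; field_simp
    rw [← h1]; exact hpmono n hi
  simp only [hp']
  set F : ℕ → ℝ → ℝ := fun n r => ∑ i ∈ Finset.range (n + 1),
    (Ioc (p n i) (p n (i + 1))).indicator (K (p n i) (p n (i + 1))) r with hF
  have hidx : ∀ n, ∀ r ∈ Ioc 0 T, ∃ i < n + 1, r ∈ Ioc (p n i) (p n (i + 1)) := by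
    intro n r hr
    have hN : (0 : ℝ) < (n + 1 : ℕ) := by positivity
    have hx : 0 < r * (n + 1 : ℕ) / T := by have := hr.1; positivity
    -- Cells are open on the left and closed on the right, so the cell of r is found by rounding up;
    -- its index is the ceiling minus one.
    have hc : 0 < ⌈r * (n + 1 : ℕ) / T⌉₊ := Nat.ceil_pos.2 hx
    obtain ⟨i, hi⟩ := Nat.exists_eq_succ_of_ne_zero hc.ne'
    have h1 := Nat.ceil_lt_add_one hx.le
    have h2 := Nat.le_ceil (r * (n + 1 : ℕ) / T)
    rw [hi] at h1 h2
    refine ⟨i, ?_, ?_, ?_⟩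
    · have : ⌈r * (n + 1 : ℕ) / T⌉₊ ≤ n + 1 := by
        rw [Nat.ceil_le, div_le_iff₀ hT', mul_comm]
        exact mul_le_mul_of_nonneg_left hr.2 hN.le
      omega
    · simp only [hp]
      rw [div_lt_iff₀ hN]
      have : (i : ℝ) < r * (n + 1 : ℕ) / T := by push_cast at h1 ⊢; linarith
      rwa [lt_div_iff₀ hT', mul_comm] at this
    · simp only [hp]
      rw [le_div_iff₀ hN]
      rwa [div_le_iff₀ hT', mul_comm _ T] at h2
  have hFeq : ∀ n, ∀ r i, i < n + 1 → r ∈ Ioc (p n i) (p n (i + 1)) →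
      F n r = K (p n i) (p n (i + 1)) r := by
    intro n r i hi hr
    simp only [hF]
    rw [Finset.sum_eq_single i]
    · exact indicator_of_mem hr _
    · intro j _ hji
      refine indicator_of_notMem (fun hrj => ?_) _
      rcases lt_or_gt_of_ne hji with h | h
      · exact absurd (hrj.2.trans (hpmono n h)) (not_le.2 hr.1)
      · exact absurd (hr.2.trans (hpmono n h)) (not_le.2 hrj.1)
    · intro h; exact absurd (Finset.mem_range.2 hi) h
  have hm : ∀ n, ∀ i < n + 1, AEStronglyMeasurable
      ((Ioc (p n i) (p n (i + 1))).indicator (K (p n i) (p n (i + 1))))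
      (volume.restrict (Ioc 0 T)) := by
    intro n i hi
    rw [aestronglyMeasurable_indicator_iff measurableSet_Ioc,
      Measure.restrict_restrict measurableSet_Ioc, inter_eq_self_of_subset_left
        (Ioc_subset_Ioc (hp0 n i) (hpT n (i + 1) (by omega)))]
    exact hmeas _ _ (hp0 n i) (hpmono n (Nat.le_succ i)) (hpT n (i + 1) (by omega))
  have hκ' : Integrable κ (volume.restrict (Ioc 0 T)) :=
    (intervalIntegrable_iff_integrableOn_Ioc_of_le hT).1 hκ
  have hbd : ∀ n, ∀ i < n + 1, ∀ᵐ r ∂(volume.restrict (Ioc 0 T)),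
      ‖(Ioc (p n i) (p n (i + 1))).indicator (K (p n i) (p n (i + 1))) r‖ ≤ κ r := by
    intro n i hi
    filter_upwards [hb, ae_restrict_mem measurableSet_Ioc] with r hr hrm
    by_cases hri : r ∈ Ioc (p n i) (p n (i + 1))
    · rw [indicator_of_mem hri]
      exact hr _ _ (hp0 n i) hri.1.le hri.2 (hpT n (i + 1) (by omega))
    · rw [indicator_of_notMem hri, norm_zero]
      exact (abs_nonneg _).trans (hr 0 T le_rfl hrm.1.le hrm.2 le_rfl)
  have hsum : ∀ n, ∑ i ∈ Finset.range (n + 1), ∫ r in (p n i)..(p n (i + 1)),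
      K (p n i) (p n (i + 1)) r = ∫ r in Ioc 0 T, F n r := by
    intro n
    rw [integral_finsetSum _ fun i hi => hκ'.mono' (hm n i (Finset.mem_range.1 hi))
      (hbd n i (Finset.mem_range.1 hi))]
    refine Finset.sum_congr rfl fun i hi => ?_
    have hi' := Finset.mem_range.1 hi
    rw [integral_indicator measurableSet_Ioc, Measure.restrict_restrict measurableSet_Ioc,
      inter_eq_self_of_subset_left (Ioc_subset_Ioc (hp0 n i) (hpT n (i + 1) (by omega))),
      intervalIntegral.integral_of_le (hpmono n (Nat.le_succ i))]
  have hFm : ∀ n, AEStronglyMeasurable (F n) (volume.restrict (Ioc 0 T)) := fun n =>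
    Finset.aestronglyMeasurable_fun_sum _ fun i hi => hm n i (Finset.mem_range.1 hi)
  have hFb : ∀ n, ∀ᵐ r ∂(volume.restrict (Ioc 0 T)), ‖F n r‖ ≤ κ r := by
    intro n
    filter_upwards [hb, ae_restrict_mem measurableSet_Ioc] with r hr hrm
    obtain ⟨i, hi, hri⟩ := hidx n r hrm
    rw [hFeq n r i hi hri]
    exact hr _ _ (hp0 n i) hri.1.le hri.2 (hpT n (i + 1) (by omega))
  have hFl : ∀ᵐ r ∂(volume.restrict (Ioc 0 T)), Tendsto (fun n => F n r) atTop (𝓝 (g r)) := by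
    filter_upwards [hlim, ae_restrict_mem measurableSet_Ioc] with r hr hrm
    choose! j hj1 hj2 using fun n => hidx n r hrm
    have hgap : ∀ n, p n (j n + 1) - p n (j n) = T / (n + 1) := by
      intro n; simp only [hp]; push_cast; field_simp; ring
    have hlim0 : Tendsto (fun n : ℕ => T / ((n : ℝ) + 1)) atTop (𝓝 0) := by
      refine ((tendsto_const_div_atTop_nhds_zero_nat T).comp (tendsto_add_atTop_nat 1)).congr ?_
      intro n; simp
    refine (hr (fun n => p n (j n)) (fun n => p n (j n + 1)) (fun n => ⟨hp0 _ _, (hj2 n).1.le,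
      (hj2 n).2, hpT n _ (hj1 n)⟩) ?_ ?_).congr fun n => (hFeq n r _ (hj1 n) (hj2 n)).symm
    · refine tendsto_of_tendsto_of_tendsto_of_le_of_le (g := fun n : ℕ => r - T / ((n : ℝ) + 1))
        (h := fun _ => r) ?_ tendsto_const_nhds (fun n => ?_) fun n => (hj2 n).1.le
      · simpa using tendsto_const_nhds.sub hlim0
      · simp only; linarith [hgap n, (hj2 n).2]
    · refine tendsto_of_tendsto_of_tendsto_of_le_of_le (g := fun _ => r)
        (h := fun n : ℕ => r + T / ((n : ℝ) + 1)) tendsto_const_nhds ?_ (fun n => (hj2 n).2)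
          fun n => ?_
      · simpa using tendsto_const_nhds.add hlim0
      · simp only; linarith [hgap n, (hj2 n).1]
  refine ⟨(intervalIntegrable_iff_integrableOn_Ioc_of_le hT).2
    (hκ'.mono' (aestronglyMeasurable_of_tendsto_ae _ hFm hFl) ?_), ?_⟩
  · filter_upwards [hFl, ae_all_iff.2 hFb] with r h1 h2
    exact le_of_tendsto h1.norm (Eventually.of_forall h2)
  · refine Tendsto.congr (fun n => (hsum n).symm) ?_
    rw [intervalIntegral.integral_of_le hT]
    exact tendsto_integral_of_dominated_convergence κ hFm hκ' hFb hFl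

/-- The increment formula `hf` is exact on every cell, so the sums telescope to f(T) − f(0) for each
n and only the integrands have to converge. -/
theorem eq_integral_of_partition {T : ℝ} (hT : 0 ≤ T) {f : ℝ → ℝ} {K : ℝ → ℝ → ℝ → ℝ} {g κ : ℝ → ℝ}
    (hκ : IntervalIntegrable κ volume 0 T)
    (hf : ∀ s t, 0 ≤ s → s ≤ t → t ≤ T → f t - f s = ∫ r in s..t, K s t r)
    (hmeas : ∀ s t, 0 ≤ s → s ≤ t → t ≤ T →
      AEStronglyMeasurable (K s t) (volume.restrict (Ioc s t)))
    (hb : ∀ᵐ r ∂(volume.restrict (Ioc 0 T)), ∀ s t, 0 ≤ s → s ≤ r → r ≤ t → t ≤ T →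
      |K s t r| ≤ κ r)
    (hlim : ∀ᵐ r ∂(volume.restrict (Ioc 0 T)), ∀ s t : ℕ → ℝ,
      (∀ n, 0 ≤ s n ∧ s n ≤ r ∧ r ≤ t n ∧ t n ≤ T) → Tendsto s atTop (𝓝 r) →
      Tendsto t atTop (𝓝 r) → Tendsto (fun n => K (s n) (t n) r) atTop (𝓝 (g r))) :
    IntervalIntegrable g volume 0 T ∧ f T - f 0 = ∫ r in (0 : ℝ)..T, g r := by
  refine ⟨(tendsto_sum_partition hT hκ hmeas hb hlim).1,
    tendsto_nhds_unique ?_ (tendsto_sum_partition hT hκ hmeas hb hlim).2⟩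
  refine tendsto_const_nhds.congr' ?_
  filter_upwards [eventually_gt_atTop 0] with n hn
  have hn' : (0 : ℝ) < n := by exact_mod_cast hn
  have h1 : ∀ i ∈ Finset.range n, ∫ r in (T * i / n)..(T * (i + 1) / n),
      K (T * i / n) (T * (i + 1) / n) r = f (T * ((i + 1 : ℕ) : ℝ) / n) - f (T * (i : ℝ) / n) := by
    intro i hi
    have hi' : (i : ℝ) + 1 ≤ n := by exact_mod_cast Finset.mem_range.1 hi
    push_cast
    refine (hf _ _ (by positivity) (by gcongr; linarith) ?_).symm
    rw [div_le_iff₀ hn']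
    exact mul_le_mul_of_nonneg_left hi' hT
  rw [Finset.sum_congr rfl h1, Finset.sum_range_sub (fun i : ℕ => f (T * (i : ℝ) / n))]
  simp [hn'.ne']

theorem isPrim_of_partition {T : ℝ} (hT : 0 ≤ T) {f : ℝ → ℝ} {K : ℝ → ℝ → ℝ → ℝ} {g κ : ℝ → ℝ}
    (hκ : IntervalIntegrable κ volume 0 T)
    (hf : ∀ s t, 0 ≤ s → s ≤ t → t ≤ T → f t - f s = ∫ r in s..t, K s t r)
    (hmeas : ∀ s t, 0 ≤ s → s ≤ t → t ≤ T →
      AEStronglyMeasurable (K s t) (volume.restrict (Ioc s t)))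
    (hb : ∀ᵐ r ∂(volume.restrict (Ioc 0 T)), ∀ s t, 0 ≤ s → s ≤ r → r ≤ t → t ≤ T →
      |K s t r| ≤ κ r)
    (hlim : ∀ᵐ r ∂(volume.restrict (Ioc 0 T)), ∀ s t : ℕ → ℝ,
      (∀ n, 0 ≤ s n ∧ s n ≤ r ∧ r ≤ t n ∧ t n ≤ T) → Tendsto s atTop (𝓝 r) →
      Tendsto t atTop (𝓝 r) → Tendsto (fun n => K (s n) (t n) r) atTop (𝓝 (g r))) :
    IsPrim f g 0 T := by
  refine ⟨(eq_integral_of_partition hT hκ hf hmeas hb hlim).1, fun t ht => ?_⟩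
  have hsub : Ioc 0 t ⊆ Ioc 0 T := Ioc_subset_Ioc_right ht.2
  have := (eq_integral_of_partition ht.1 (hκ.mono_set (by
      rw [uIcc_of_le hT, uIcc_of_le ht.1]; exact Icc_subset_Icc_right ht.2))
    (fun a b h1 h2 h3 => hf a b h1 h2 (h3.trans ht.2))
    (fun a b h1 h2 h3 => hmeas a b h1 h2 (h3.trans ht.2))
    ((ae_restrict_of_ae_restrict_of_subset hsub hb).mono fun r hr a b h1 h2 h3 h4 =>
      hr a b h1 h2 h3 (h4.trans ht.2))
    ((ae_restrict_of_ae_restrict_of_subset hsub hlim).mono fun r hr a b h1 h2 h3 =>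
      hr a b (fun n => ⟨(h1 n).1, (h1 n).2.1, (h1 n).2.2.1, (h1 n).2.2.2.trans ht.2⟩) h2 h3)).2
  linarith

/-! ### Qualitative properties of pathwise solutions -/

namespace IsPathSolution

variable {A T N : ℝ} {ρ u w w₁ w₂ : ℝ → ℝ → ℝ}

theorem cont_density (h : IsPathSolution A T N ρ u w w₁ w₂) (hT : 0 ≤ T) :
    ContinuousOn (fun p : ℝ × ℝ => ρ p.1 p.2) (Icc 0 T ×ˢ Icc 0 1) :=
  h.regular.continuousOn_jointDensity hT h.mass

theorem density_pos (h : IsPathSolution A T N ρ u w w₁ w₂) {t x : ℝ} (ht : t ∈ Icc 0 T)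
    (hx : x ∈ Icc (0 : ℝ) 1) : 0 < ρ t x := (h.regular.phase t ht.1).pos x hx

theorem prim_density (h : IsPathSolution A T N ρ u w w₁ w₂) {t : ℝ} (ht : t ∈ Icc 0 T) :
    IsPrim (ρ t) (dx (ρ t)) 0 1 := (h.regular.phase t ht.1).density.isPrim

theorem prim_velocity (h : IsPathSolution A T N ρ u w w₁ w₂) {t : ℝ} (ht : t ∈ Icc 0 T) :
    IsPrim (u t) (dx (u t)) 0 1 := (h.regular.phase t ht.1).velocity.1.isPrim

/-- Only ρ(u − w) comes with an evolution law, so joint continuity is proved for this product; u is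
recovered by dividing by the positive density and adding w. -/
theorem cont_velocity (h : IsPathSolution A T N ρ u w w₁ w₂) (hT : 0 ≤ T) :
    ContinuousOn (fun p : ℝ × ℝ => u p.1 p.2) (Icc 0 T ×ˢ Icc 0 1) := by
  obtain ⟨M, hM0, hM⟩ := h.regular.exists_bound T
  have hN := h.noise.bound_nonneg hT
  have hw : ∀ t ∈ Icc 0 T, normL2 (w₁ t) ≤ N := fun t ht => by
    refine abs_le_of_sq_le_sq' ?_ hN |>.2
    rw [normL2_sq]
    have hi : MemLp (w₁ t) 2 unitMeasure := memLp_of_continuousOn (continuousOn_slice h.noise.cont₁ ht) 2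
    calc ∫ x, w₁ t x ^ 2 ∂unitMeasure ≤ ∫ _, N ^ 2 ∂unitMeasure := by
          refine integral_mono_ae hi.integrable_sq (integrable_const _) ?_
          refine (ae_restrict_iff' measurableSet_Ioc).2 (Eventually.of_forall fun x hx => ?_)
          exact sq_le_sq' (abs_le.1 (h.noise.abs_w₁_le ht (Ioc_subset_Icc_self hx))).1
            (abs_le.1 (h.noise.abs_w₁_le ht (Ioc_subset_Icc_self hx))).2
      _ = N ^ 2 := by simp
  have hv : ∀ t ∈ Icc 0 T, ContinuousOn (fun x => ρ t x * (u t x - w t x)) (Icc 0 1) :=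
    fun t ht => (h.regular.continuousOn_density ht.1).mul
      ((h.regular.continuousOn_velocity ht.1).sub (continuousOn_slice h.noise.cont ht))
  have hm : ContinuousOn (fun p : ℝ × ℝ => ρ p.1 p.2 * (u p.1 p.2 - w p.1 p.2))
      (Icc 0 T ×ˢ Icc 0 1) := by
    refine continuousOn_of_equiHolder (f := fun t x => ρ t x * (u t x - w t x))
      (M := 2 * M * (M + N)) (by positivity) (fun t ht x hx y hy => ?_) hv
      fun b hb => h.momentum.continuousOn_integral hT hb
    have hp := h.regular.phase t ht.1
    have e1 := (hp.density.isPrim.abs_sub_le hp.density.2 hx hy).trans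
      (mul_le_mul_of_nonneg_right (hM t ht).1 (Real.sqrt_nonneg _))
    have e2 := (hp.velocity.1.isPrim.abs_sub_le hp.velocity.1.2 hx hy).trans
      (mul_le_mul_of_nonneg_right (hM t ht).2.1 (Real.sqrt_nonneg _))
    have e3 := ((h.noise.prim t ht).abs_sub_le
      (memLp_of_continuousOn (continuousOn_slice h.noise.cont₁ ht) 2) hx hy).trans
      (mul_le_mul_of_nonneg_right (hw t ht) (Real.sqrt_nonneg _))
    have e4 := (hM t ht).2.2.1 x hx
    have e5 := (hM t ht).2.2.2 y hy
    have e6 := h.noise.abs_w_le ht hy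
    set r := √|x - y|
    have hr : 0 ≤ r := Real.sqrt_nonneg _
    have e7 : |u t y - w t y| ≤ M + N := (abs_sub _ _).trans (add_le_add e5 e6)
    have e8 : |(u t x - u t y) - (w t x - w t y)| ≤ (M + N) * r :=
      (abs_sub _ _).trans (by linarith)
    have e9 : ρ t x * (u t x - w t x) - ρ t y * (u t y - w t y) =
      ρ t x * ((u t x - u t y) - (w t x - w t y)) + (ρ t x - ρ t y) * (u t y - w t y) := by ring
    rw [e9]
    refine (abs_add_le _ _).trans ?_
    rw [abs_mul, abs_mul]
    calc _ ≤ M * ((M + N) * r) + (M * r) * (M + N) := by gcongr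
      _ = 2 * M * (M + N) * r := by ring
  have h1 := (hm.div (h.cont_density hT) fun p hp => (h.density_pos hp.1 hp.2).ne').add h.noise.cont
  refine h1.congr fun p hp => ?_
  have := (h.density_pos hp.1 hp.2).ne'
  simp only [Pi.div_apply, Pi.add_apply]
  field_simp
  ring

/-- These constants depend on the solution. They only justify limits and never enter the final
bounds. -/
theorem exists_bounds (h : IsPathSolution A T N ρ u w w₁ w₂) (hT : 0 ≤ T) :
    ∃ m M, 0 < m ∧ 0 ≤ M ∧ ∀ t ∈ Icc 0 T, normL2 (dx (ρ t)) ≤ M ∧ normL2 (dx (u t)) ≤ M ∧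
      ∀ x ∈ Icc (0 : ℝ) 1, m ≤ ρ t x ∧ ρ t x ≤ M ∧ |u t x| ≤ M := by
  obtain ⟨M, hM0, hM⟩ := h.regular.exists_bound T
  obtain ⟨q, hq, hqm⟩ := (isCompact_Icc.prod isCompact_Icc).exists_isMinOn
    (s := Icc 0 T ×ˢ Icc (0 : ℝ) 1) ⟨(0, 0), ⟨le_rfl, hT⟩, by simp⟩ (h.cont_density hT)
  refine ⟨ρ q.1 q.2, M, h.density_pos hq.1 hq.2, hM0, fun t ht => ⟨(hM t ht).1, (hM t ht).2.1,
    fun x hx => ⟨?_, (le_abs_self _).trans ((hM t ht).2.2.1 x hx), (hM t ht).2.2.2 x hx⟩⟩⟩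
  exact hqm (show (t, x) ∈ _ from ⟨ht, hx⟩)

theorem intervalIntegrable_density (h : IsPathSolution A T N ρ u w w₁ w₂) {t a b : ℝ}
    (ht : t ∈ Icc 0 T) (ha : a ∈ Icc (0 : ℝ) 1) (hb : b ∈ Icc (0 : ℝ) 1) :
    IntervalIntegrable (ρ t) volume a b := by
  apply ContinuousOn.intervalIntegrable
  exact (h.regular.continuousOn_density ht.1).mono (uIcc_subset_Icc ha hb)

theorem integral_massRate (h : IsPathSolution A T N ρ u w w₁ w₂) {t b : ℝ}
    (ht : t ∈ Icc 0 T) (hb : b ∈ Icc (0 : ℝ) 1) :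
    ∫ x in (0 : ℝ)..b, massRate (ρ t) (u t) x = -(ρ t b * u t b) := by
  have hp := (h.prim_density ht).mul (h.prim_velocity ht) zero_le_one
  have := hp.integral_eq (left_mem_Icc.2 zero_le_one) hb
  rw [(h.regular.phase t ht.1).velocity.2.1, mul_zero, sub_zero] at this
  simp only [massRate]
  rw [intervalIntegral.integral_neg, this]

end IsPathSolution

/-! ### Lagrangian trajectories -/

/-- The position at time `t` of the particle with mass coordinate `y`. -/
noncomputable def flow (ρ : ℝ → ℝ → ℝ) (y t : ℝ) : ℝ :=
  Function.invFunOn (fun x => ∫ z in (0 : ℝ)..x, ρ t z) (Icc 0 1) y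

namespace IsPathSolution

variable {A T N : ℝ} {ρ u w w₁ w₂ : ℝ → ℝ → ℝ}

theorem mem_image_mass (h : IsPathSolution A T N ρ u w w₁ w₂) {t y : ℝ} (ht : t ∈ Icc 0 T)
    (hy : y ∈ Icc (0 : ℝ) 1) : y ∈ (fun x => ∫ z in (0 : ℝ)..x, ρ t z) '' Icc 0 1 := by
  have hc := continuousOn_intervalIntegral zero_le_one
    (h.intervalIntegrable_density ht (a := 0) (b := 1) (by simp) (by simp))
  refine intermediate_value_Icc zero_le_one hc ?_
  simpa [(h.regular.phase t ht.1).mass] using hy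

theorem flow_mem (h : IsPathSolution A T N ρ u w w₁ w₂) {t y : ℝ} (ht : t ∈ Icc 0 T)
    (hy : y ∈ Icc (0 : ℝ) 1) : flow ρ y t ∈ Icc (0 : ℝ) 1 :=
  Function.invFunOn_mem (h.mem_image_mass ht hy)

theorem integral_flow (h : IsPathSolution A T N ρ u w w₁ w₂) {t y : ℝ} (ht : t ∈ Icc 0 T)
    (hy : y ∈ Icc (0 : ℝ) 1) : ∫ z in (0 : ℝ)..flow ρ y t, ρ t z = y :=
  Function.invFunOn_eq (h.mem_image_mass ht hy)

theorem integral_flow_sub (h : IsPathSolution A T N ρ u w w₁ w₂) {t y z : ℝ} (ht : t ∈ Icc 0 T)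
    (hy : y ∈ Icc (0 : ℝ) 1) (hz : z ∈ Icc (0 : ℝ) 1) :
    ∫ x in flow ρ y t..flow ρ z t, ρ t x = z - y := by
  rw [← intervalIntegral.integral_interval_sub_left
    (h.intervalIntegrable_density ht (left_mem_Icc.2 zero_le_one) (h.flow_mem ht hz))
    (h.intervalIntegrable_density ht (left_mem_Icc.2 zero_le_one) (h.flow_mem ht hy)),
    h.integral_flow ht hy, h.integral_flow ht hz]

theorem le_integral_density (h : IsPathSolution A T N ρ u w w₁ w₂) {t m a b : ℝ}
    (ht : t ∈ Icc 0 T) (hm : ∀ x ∈ Icc (0 : ℝ) 1, m ≤ ρ t x)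
    (ha : a ∈ Icc (0 : ℝ) 1) (hb : b ∈ Icc (0 : ℝ) 1) (hab : a ≤ b) :
    m * (b - a) ≤ ∫ x in a..b, ρ t x := by
  have := intervalIntegral.integral_mono_on hab (by simp)
    (h.intervalIntegrable_density ht ha hb) fun x hx => hm x ⟨ha.1.trans hx.1, hx.2.trans hb.2⟩
  simp only [intervalIntegral.integral_const, smul_eq_mul] at this
  linarith

theorem abs_le_integral_density (h : IsPathSolution A T N ρ u w w₁ w₂) {t m a b : ℝ}
    (ht : t ∈ Icc 0 T) (hm : ∀ x ∈ Icc (0 : ℝ) 1, m ≤ ρ t x)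
    (ha : a ∈ Icc (0 : ℝ) 1) (hb : b ∈ Icc (0 : ℝ) 1) :
    m * |b - a| ≤ |∫ x in a..b, ρ t x| := by
  rcases le_total a b with hab | hab
  · rw [abs_of_nonneg (sub_nonneg.2 hab)]
    exact (h.le_integral_density ht hm ha hb hab).trans (le_abs_self _)
  · rw [abs_sub_comm, abs_of_nonneg (sub_nonneg.2 hab), intervalIntegral.integral_symm, abs_neg]
    exact (h.le_integral_density ht hm hb ha hab).trans (le_abs_self _)

theorem flow_unique (h : IsPathSolution A T N ρ u w w₁ w₂) (hT : 0 ≤ T) {t a b : ℝ}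
    (ht : t ∈ Icc 0 T) (ha : a ∈ Icc (0 : ℝ) 1) (hb : b ∈ Icc (0 : ℝ) 1)
    (hab : ∫ x in a..b, ρ t x = 0) : a = b := by
  obtain ⟨m, M, hm, -, hM⟩ := h.exists_bounds hT
  have := h.abs_le_integral_density ht (fun x hx => ((hM t ht).2.2 x hx).1) ha hb
  rw [hab, abs_zero] at this
  have h1 : |b - a| ≤ 0 := by
    by_contra hcon
    have := mul_pos hm (not_le.1 hcon)
    linarith
  have := abs_eq_zero.1 (le_antisymm h1 (abs_nonneg _))
  linarith

theorem flow_zero (h : IsPathSolution A T N ρ u w w₁ w₂) (hT : 0 ≤ T) {t : ℝ}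
    (ht : t ∈ Icc 0 T) : flow ρ 0 t = 0 :=
  (h.flow_unique hT ht (by simp) (h.flow_mem ht (by simp)) (h.integral_flow ht (by simp))).symm

theorem flow_one (h : IsPathSolution A T N ρ u w w₁ w₂) (hT : 0 ≤ T) {t : ℝ}
    (ht : t ∈ Icc 0 T) : flow ρ 1 t = 1 := by
  have h1 : flow ρ 1 t ∈ Icc (0 : ℝ) 1 := h.flow_mem ht (by simp)
  refine h.flow_unique hT ht h1 (by simp) ?_
  rw [← intervalIntegral.integral_interval_sub_left
    (h.intervalIntegrable_density ht (left_mem_Icc.2 zero_le_one) (right_mem_Icc.2 zero_le_one))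
    (h.intervalIntegrable_density ht (left_mem_Icc.2 zero_le_one) h1),
    h.integral_flow ht (by simp), (h.regular.phase t ht.1).mass, sub_self]

theorem flow_mono (h : IsPathSolution A T N ρ u w w₁ w₂) (hT : 0 ≤ T) {t y z : ℝ}
    (ht : t ∈ Icc 0 T) (hy : y ∈ Icc (0 : ℝ) 1) (hz : z ∈ Icc (0 : ℝ) 1) (hyz : y ≤ z) :
    flow ρ y t ≤ flow ρ z t := by
  obtain ⟨m, M, hm, -, hM⟩ := h.exists_bounds hT
  by_contra! hcon
  have h1 := h.le_integral_density ht (fun x hx => ((hM t ht).2.2 x hx).1) (h.flow_mem ht hz)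
    (h.flow_mem ht hy) hcon.le
  rw [h.integral_flow_sub ht hz hy] at h1
  have := mul_pos hm (sub_pos.2 hcon)
  linarith

/-- The mass to the left of the particle is y at both times. The mass between its old and its new
position is therefore the mass that has crossed the old position. -/
theorem integral_density_flow_time (h : IsPathSolution A T N ρ u w w₁ w₂) {s t y : ℝ}
    (hs : s ∈ Icc 0 T) (ht : t ∈ Icc 0 T) (hy : y ∈ Icc (0 : ℝ) 1) :
    ∫ x in flow ρ y s..flow ρ y t, ρ t x =
      ∫ r in s..t, ρ r (flow ρ y s) * u r (flow ρ y s) := by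
  have hx := h.flow_mem hs hy
  have hT : 0 ≤ T := hs.1.trans hs.2
  have hi := intervalIntegrable_integral (κ := fun s => massRate (ρ s) (u s)) h.mass.integrable hT
    le_rfl hx.1 hx.2
  have hsub : ∀ r ∈ Icc 0 T, IntervalIntegrable
      (fun s' => ∫ x in (0 : ℝ)..flow ρ y s, massRate (ρ s') (u s') x) volume 0 r := fun r hr =>
    hi.mono_set (by
      rw [uIcc_of_le hT, uIcc_of_le hr.1]; exact Icc_subset_Icc_right hr.2)
  rw [← intervalIntegral.integral_interval_sub_left
    (h.intervalIntegrable_density ht (left_mem_Icc.2 zero_le_one) (h.flow_mem ht hy))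
    (h.intervalIntegrable_density ht (left_mem_Icc.2 zero_le_one) hx), h.integral_flow ht hy, h.mass.eq t ht _ hx]
  have h1 := h.mass.eq s hs _ hx
  rw [h.integral_flow hs hy] at h1
  have h2 := intervalIntegral.integral_interval_sub_left (hsub t ht) (hsub s hs)
  have h3 : ∫ r in s..t, ρ r (flow ρ y s) * u r (flow ρ y s) =
      -∫ r in s..t, ∫ x in (0 : ℝ)..flow ρ y s, massRate (ρ r) (u r) x := by
    rw [← intervalIntegral.integral_neg]
    refine intervalIntegral.integral_congr fun r hr => ?_
    have hr' : r ∈ Icc 0 T := uIcc_subset_Icc hs ht hr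
    rw [h.integral_massRate hr' hx, neg_neg]
  rw [h3, ← h2]
  linarith

theorem exists_flow_lipschitz (h : IsPathSolution A T N ρ u w w₁ w₂) (hT : 0 ≤ T) :
    ∃ L, 0 ≤ L ∧ ∀ y ∈ Icc (0 : ℝ) 1, ∀ s ∈ Icc 0 T, ∀ t ∈ Icc 0 T,
      |flow ρ y t - flow ρ y s| ≤ L * |t - s| := by
  obtain ⟨m, M, hm, hM0, hM⟩ := h.exists_bounds hT
  refine ⟨M * M / m, by positivity, fun y hy s hs t ht => ?_⟩
  have h1 := h.abs_le_integral_density ht (fun x hx => ((hM t ht).2.2 x hx).1) (h.flow_mem hs hy)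
    (h.flow_mem ht hy)
  rw [h.integral_density_flow_time hs ht hy] at h1
  have h2 : |∫ r in s..t, ρ r (flow ρ y s) * u r (flow ρ y s)| ≤ M * M * |t - s| := by
    rw [← Real.norm_eq_abs]
    refine intervalIntegral.norm_integral_le_of_norm_le_const fun r hr => ?_
    have hr' : r ∈ Icc 0 T := uIcc_subset_Icc hs ht (uIoc_subset_uIcc hr)
    have h3 := (hM r hr').2.2 _ (h.flow_mem hs hy)
    rw [Real.norm_eq_abs, abs_mul]
    refine mul_le_mul ?_ h3.2.2 (abs_nonneg _) hM0
    rw [abs_of_nonneg (hm.le.trans h3.1)]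
    exact h3.2.1
  rw [div_mul_eq_mul_div, le_div_iff₀ hm]
  linarith

theorem continuousOn_flow (h : IsPathSolution A T N ρ u w w₁ w₂) (hT : 0 ≤ T) {y : ℝ}
    (hy : y ∈ Icc (0 : ℝ) 1) : ContinuousOn (flow ρ y) (Icc 0 T) := by
  obtain ⟨L, hL, hLip⟩ := h.exists_flow_lipschitz hT
  exact (LipschitzOnWith.of_dist_le_mul (K := ⟨L, hL⟩) fun t ht s hs =>
    hLip y hy s hs t ht).continuousOn

/-- In `integral_density_flow_time`, joint continuity makes the left side close to ρ(X(s))(X(t) −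
X(s)) and the right side close to ρu(X(s))(t − s); division by ρ gives the derivative. The
trajectory comes from the mass function, so no uniqueness theory for X' = u(X) is involved. -/
theorem isPrim_flow (h : IsPathSolution A T N ρ u w w₁ w₂) (hT : 0 ≤ T) {y : ℝ}
    (hy : y ∈ Icc (0 : ℝ) 1) : IsPrim (flow ρ y) (fun t => u t (flow ρ y t)) 0 T := by
  obtain ⟨L, hL, hLip⟩ := h.exists_flow_lipschitz hT
  refine IsPrim.of_ae_hasDerivAt hT (LipschitzOnWith.absolutelyContinuousOnInterval (K := ⟨L, hL⟩)
    (by rw [uIcc_of_le hT]; exact LipschitzOnWith.of_dist_le_mul fun t ht s hs =>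
          hLip y hy s hs t ht)) (Eventually.of_forall fun s hs => ?_)
  have hs' := Ioo_subset_Icc_self hs
  set X := flow ρ y with hX
  have hXs : X s ∈ Icc (0 : ℝ) 1 := h.flow_mem hs' hy
  have hpos : 0 < ρ s (X s) := h.density_pos hs' hXs
  rw [hasDerivAt_iff_isLittleO, Asymptotics.isLittleO_iff]
  intro ε hε
  -- The density integral contributes an error ηL|t − s| and the flux integral an error η|t − s|.
  obtain ⟨η, hη, hηε⟩ : ∃ η > 0, η * (L + 1) ≤ ρ s (X s) * ε :=
    ⟨ρ s (X s) * ε / (L + 1), by positivity, by field_simp; rfl⟩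
  have hc1 := (Metric.continuousOn_iff.1 (h.cont_density hT)) (s, X s) ⟨hs', hXs⟩ η hη
  have hc2 := (Metric.continuousOn_iff.1 ((h.cont_density hT).mul (h.cont_velocity hT)))
    (s, X s) ⟨hs', hXs⟩ η hη
  obtain ⟨δ1, hδ1, hd1⟩ := hc1
  obtain ⟨δ2, hδ2, hd2⟩ := hc2
  have hnear : ∀ᶠ t in 𝓝 s, t ∈ Icc 0 T ∧ (1 + L) * |t - s| < min δ1 δ2 := by
    refine Eventually.and (Icc_mem_nhds hs.1 hs.2) ?_
    have : Tendsto (fun t : ℝ => (1 + L) * |t - s|) (𝓝 s) (𝓝 ((1 + L) * |s - s|)) :=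
      Continuous.tendsto (by fun_prop) s
    rw [sub_self, abs_zero, mul_zero] at this
    exact this.eventually (gt_mem_nhds (lt_min hδ1 hδ2))
  filter_upwards [hnear] with t ht
  obtain ⟨ht, htd⟩ := ht
  have hXt : X t ∈ Icc (0 : ℝ) 1 := h.flow_mem ht hy
  have hd0 : |t - s| < min δ1 δ2 := lt_of_le_of_lt (by nlinarith [abs_nonneg (t - s)]) htd
  have hdL : L * |t - s| < min δ1 δ2 := lt_of_le_of_lt (by nlinarith [abs_nonneg (t - s)]) htd
  have e1 : |(∫ x in X s..X t, ρ t x) - ρ s (X s) * (X t - X s)| ≤ η * (L * |t - s|) := by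
    have e : (∫ x in X s..X t, ρ t x) - ρ s (X s) * (X t - X s) =
        ∫ x in X s..X t, (ρ t x - ρ s (X s)) := by
      rw [intervalIntegral.integral_sub (h.intervalIntegrable_density ht hXs hXt) (by simp)]
      simp [mul_comm]
    rw [e, ← Real.norm_eq_abs]
    refine (intervalIntegral.norm_integral_le_of_norm_le_const (C := η) fun x hx => ?_).trans
      (mul_le_mul_of_nonneg_left (hLip y hy s hs' t ht) hη.le)
    have hx' := uIoc_subset_uIcc hx
    have hxm := uIcc_subset_Icc hXs hXt hx'
    have hxd : |x - X s| ≤ |X t - X s| := abs_sub_left_of_mem_uIcc hx'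
    refine (hd1 (t, x) ⟨ht, hxm⟩ ?_).le
    rw [Prod.dist_eq, max_lt_iff, Real.dist_eq, Real.dist_eq]
    exact ⟨hd0.trans_le (min_le_left _ _),
      (hxd.trans (hLip y hy s hs' t ht)).trans_lt (hdL.trans_le (min_le_left _ _))⟩
  have hρu : ContinuousOn (fun r => ρ r (X s) * u r (X s)) (Icc 0 T) :=
    (continuousOn_slice_left (h.cont_density hT) hXs).mul
      (continuousOn_slice_left (h.cont_velocity hT) hXs)
  have e2 : |(∫ r in s..t, ρ r (X s) * u r (X s)) - ρ s (X s) * u s (X s) * (t - s)| ≤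
      η * |t - s| := by
    have e : (∫ r in s..t, ρ r (X s) * u r (X s)) - ρ s (X s) * u s (X s) * (t - s) =
        ∫ r in s..t, (ρ r (X s) * u r (X s) - ρ s (X s) * u s (X s)) := by
      rw [intervalIntegral.integral_sub
        ((hρu.mono (uIcc_subset_Icc hs' ht)).intervalIntegrable) (by simp)]
      simp only [intervalIntegral.integral_const, smul_eq_mul]
      ring
    rw [e, ← Real.norm_eq_abs]
    refine intervalIntegral.norm_integral_le_of_norm_le_const (C := η) fun r hr => ?_
    have hr' := uIoc_subset_uIcc hr
    have hrm := uIcc_subset_Icc hs' ht hr'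
    have hrd : |r - s| ≤ |t - s| := abs_sub_left_of_mem_uIcc hr'
    refine (hd2 (r, X s) ⟨hrm, hXs⟩ ?_).le
    rw [Prod.dist_eq, max_lt_iff, Real.dist_eq, Real.dist_eq, sub_self, abs_zero]
    exact ⟨hrd.trans_lt (hd0.trans_le (min_le_right _ _)), hδ2⟩
  have e5 : ∫ x in X s..X t, ρ t x = ∫ r in s..t, ρ r (X s) * u r (X s) :=
    h.integral_density_flow_time hs' ht hy
  rw [e5] at e1
  have e3 : ρ s (X s) * |X t - X s - (t - s) * u s (X s)| ≤ η * (L + 1) * |t - s| := by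
    have e0 : ρ s (X s) * |X t - X s - (t - s) * u s (X s)| =
        |ρ s (X s) * (X t - X s - (t - s) * u s (X s))| := by
      rw [abs_mul, abs_of_pos hpos]
    rw [e0]
    have e : ρ s (X s) * (X t - X s - (t - s) * u s (X s)) =
      ((∫ r in s..t, ρ r (X s) * u r (X s)) - ρ s (X s) * u s (X s) * (t - s)) -
      ((∫ r in s..t, ρ r (X s) * u r (X s)) - ρ s (X s) * (X t - X s)) := by ring
    rw [e]
    refine (abs_sub _ _).trans ?_
    linarith
  rw [smul_eq_mul, Real.norm_eq_abs, Real.norm_eq_abs]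
  have e4 : ρ s (X s) * |X t - X s - (t - s) * u s (X s)| ≤ ρ s (X s) * (ε * |t - s|) := by
    refine e3.trans ?_
    rw [← mul_assoc]
    exact mul_le_mul_of_nonneg_right hηε (abs_nonneg _)
  exact le_of_mul_le_mul_left e4 hpos

end IsPathSolution

/-! ### Integrals over moving intervals. -/

theorem ae_intervalIntegrable {κ : ℝ → ℝ → ℝ} {T : ℝ}
    (hκ : Integrable (fun p : ℝ × ℝ => κ p.1 p.2) (spaceTime T)) :
    ∀ᵐ s ∂(volume.restrict (Ioc 0 T)), IntervalIntegrable (κ s) volume 0 1 := by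
  filter_upwards [Integrable.prod_right_ae hκ] with s hs
  exact (intervalIntegrable_iff_integrableOn_Ioc_of_le zero_le_one).2 hs

theorem intervalIntegrable_integral_abs {κ : ℝ → ℝ → ℝ} {T : ℝ} (hT : 0 ≤ T)
    (hκ : Integrable (fun p : ℝ × ℝ => κ p.1 p.2) (spaceTime T)) :
    IntervalIntegrable (fun s => ∫ x in (0 : ℝ)..1, |κ s x|) volume 0 T :=
  intervalIntegrable_integral (κ := fun s x => |κ s x|) hκ.abs hT le_rfl zero_le_one le_rfl

theorem abs_integral_le_integral_abs {g : ℝ → ℝ} (hg : IntervalIntegrable g volume 0 1) {b : ℝ}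
    (hb : b ∈ Icc (0 : ℝ) 1) : |∫ x in (0 : ℝ)..b, g x| ≤ ∫ x in (0 : ℝ)..1, |g x| := by
  refine (intervalIntegral.abs_integral_le_integral_abs hb.1).trans ?_
  exact intervalIntegral.integral_mono_interval le_rfl hb.1 hb.2
    (Eventually.of_forall fun x => abs_nonneg _) hg.abs

theorem Evolves.sub_eq {f κ : ℝ → ℝ → ℝ} {T : ℝ} (h : Evolves f κ T) {s t b : ℝ}
    (hs : s ∈ Icc 0 T) (ht : t ∈ Icc 0 T) (hb : b ∈ Icc (0 : ℝ) 1) :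
    (∫ x in (0 : ℝ)..b, f t x) - ∫ x in (0 : ℝ)..b, f s x =
      ∫ r in s..t, ∫ x in (0 : ℝ)..b, κ r x := by
  have hT : 0 ≤ T := hs.1.trans hs.2
  have hi := intervalIntegrable_integral h.integrable hT le_rfl hb.1 hb.2
  have hsub : ∀ r ∈ Icc 0 T, IntervalIntegrable (fun s' => ∫ x in (0 : ℝ)..b, κ s' x) volume 0 r :=
    fun r hr => hi.mono_set (by
      rw [uIcc_of_le hT, uIcc_of_le hr.1]; exact Icc_subset_Icc_right hr.2)
  rw [← intervalIntegral.integral_interval_sub_left (hsub t ht) (hsub s hs), h.eq t ht b hb,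
    h.eq s hs b hb]
  ring

theorem isPrim_integral_comp {g X X' : ℝ → ℝ} {T : ℝ} (hT : 0 ≤ T)
    (hg : ContinuousOn g (Icc 0 1)) (hX : IsPrim X X' 0 T)
    (hXm : ∀ t ∈ Icc 0 T, X t ∈ Icc (0 : ℝ) 1) :
    IsPrim (fun t => ∫ x in (0 : ℝ)..X t, g x) (fun t => g (X t) * X' t) 0 T := by
  -- Extended by its end values, g is continuous on the line, so the primitive is differentiable
  -- also where X touches 0 or 1.
  have hc : Continuous fun x : ℝ => g (projIcc 0 1 zero_le_one x) :=
    hg.comp_continuous (continuous_subtype_val.comp continuous_projIcc) fun x =>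
      (projIcc 0 1 zero_le_one x).2
  have hd : ∀ z, HasDerivAt (fun z => ∫ x in (0 : ℝ)..z, g (projIcc 0 1 zero_le_one x))
      (g (projIcc 0 1 zero_le_one z)) z := fun z =>
    intervalIntegral.integral_hasDerivAt_right (hc.intervalIntegrable _ _)
      hc.stronglyMeasurable.stronglyMeasurableAtFilter hc.continuousAt
  have h1 := hX.comp (s := univ) hT (fun z _ => hd z) hc.continuousOn (fun _ _ => mem_univ _)
  refine h1.congr hT (fun t ht => ?_) ?_
  · refine intervalIntegral.integral_congr fun x hx => ?_
    have hx' : x ∈ Icc (0 : ℝ) 1 := uIcc_subset_Icc (by simp) (hXm t ht) hx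
    rw [projIcc_of_mem zero_le_one hx']
  · refine (ae_restrict_iff' measurableSet_Ioc).2 (Eventually.of_forall fun t ht => ?_)
    simp only
    rw [projIcc_of_mem zero_le_one (hXm t (Ioc_subset_Icc_self ht))]

theorem tendsto_continuousOn {α : Type*} [TopologicalSpace α] {f : α → ℝ} {s : Set α}
    (hf : ContinuousOn f s) {x : α}
    (hx : x ∈ s) {X : ℕ → α} (hX : Tendsto X atTop (𝓝 x)) (hXs : ∀ n, X n ∈ s) :
    Tendsto (fun n => f (X n)) atTop (𝓝 (f x)) :=
  (hf x hx).tendsto.comp (tendsto_nhdsWithin_iff.2 ⟨hX, Eventually.of_forall hXs⟩)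

theorem isPrim_of_tendsto {T : ℝ} (hT : 0 ≤ T) {F F' : ℕ → ℝ → ℝ} {f f' κ : ℝ → ℝ}
    (hF : ∀ n, IsPrim (F n) (F' n) 0 T)
    (hf : ∀ t ∈ Icc 0 T, Tendsto (fun n => F n t) atTop (𝓝 (f t)))
    (hf' : ∀ᵐ s ∂(volume.restrict (Ioc 0 T)), Tendsto (fun n => F' n s) atTop (𝓝 (f' s)))
    (hb : ∀ᵐ s ∂(volume.restrict (Ioc 0 T)), ∀ n, |F' n s| ≤ κ s)
    (hκ : IntervalIntegrable κ volume 0 T) : IsPrim f f' 0 T := by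
  have hκ' : Integrable κ (volume.restrict (Ioc 0 T)) :=
    (intervalIntegrable_iff_integrableOn_Ioc_of_le hT).1 hκ
  have hmeas : ∀ n, AEStronglyMeasurable (F' n) (volume.restrict (Ioc 0 T)) := fun n =>
    ((intervalIntegrable_iff_integrableOn_Ioc_of_le hT).1 (hF n).1).aestronglyMeasurable
  refine ⟨(intervalIntegrable_iff_integrableOn_Ioc_of_le hT).2
    (hκ'.mono' (aestronglyMeasurable_of_tendsto_ae _ hmeas hf') ?_), fun t ht => ?_⟩
  · filter_upwards [hb, hf'] with s h1 h2
    exact le_of_tendsto h2.norm (Eventually.of_forall h1)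
  · have hsub : Ioc 0 t ⊆ Ioc 0 T := Ioc_subset_Ioc_right ht.2
    refine tendsto_nhds_unique (hf t ht) ?_
    have h1 : Tendsto (fun n => ∫ s in Ioc 0 t, F' n s) atTop (𝓝 (∫ s in Ioc 0 t, f' s)) :=
      tendsto_integral_of_dominated_convergence _
        (fun n => (hmeas n).mono_measure (Measure.restrict_mono hsub le_rfl))
        (hκ'.mono_measure (Measure.restrict_mono hsub le_rfl))
        (fun n => (ae_restrict_of_ae_restrict_of_subset hsub hb).mono fun s hs => hs n)
        (ae_restrict_of_ae_restrict_of_subset hsub hf')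
    rw [intervalIntegral.integral_of_le ht.1]
    refine ((hf 0 ⟨le_rfl, hT⟩).add h1).congr fun n => ?_
    rw [(hF n).2 t ht, intervalIntegral.integral_of_le ht.1]

/-- The Lagrangian rate of change of `u - w`, times `ρ`. -/
noncomputable def velocityRate (A : ℝ) (ρ u w₁ : ℝ → ℝ) (x : ℝ) : ℝ :=
  dx (dx u) x - A ^ 2 * dx ρ x - ρ x * u x * w₁ x

/-- The Lagrangian rate of change of `u - w + ρ_x / ρ ^ 2`, times `ρ`. -/
noncomputable def effectiveRate (A : ℝ) (ρ u w₁ : ℝ → ℝ) (x : ℝ) : ℝ :=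
  -(A ^ 2 * dx ρ x) - ρ x * u x * w₁ x

namespace IsPathSolution

variable {A T N : ℝ} {ρ u w w₁ w₂ : ℝ → ℝ → ℝ}

theorem cont_rel (h : IsPathSolution A T N ρ u w w₁ w₂) (hT : 0 ≤ T) :
    ContinuousOn (fun p : ℝ × ℝ => ρ p.1 p.2 * (u p.1 p.2 - w p.1 p.2)) (Icc 0 T ×ˢ Icc 0 1) :=
  (h.cont_density hT).mul ((h.cont_velocity hT).sub h.noise.cont)

theorem cont_along_flow (h : IsPathSolution A T N ρ u w w₁ w₂) (hT : 0 ≤ T) {y : ℝ}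
    (hy : y ∈ Icc (0 : ℝ) 1) {f : ℝ → ℝ → ℝ}
    (hf : ContinuousOn (fun p : ℝ × ℝ => f p.1 p.2) (Icc 0 T ×ˢ Icc 0 1)) :
    ContinuousOn (fun t => f t (flow ρ y t)) (Icc 0 T) :=
  hf.comp (f := fun t => (t, flow ρ y t)) (continuousOn_id.prodMk (h.continuousOn_flow hT hy))
    fun _ ht => ⟨ht, h.flow_mem ht hy⟩

/-- Reynolds' transport theorem. An increment from s to t splits into the change of the integrand
over the new interval [0,X(t)] and the motion of the end point with the integrand frozen at time s,
and `isPrim_of_partition` passes to the limit. The boundary flux ρ(u − w)u at X is then written as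
the integral of its derivative, which turns `momentumRate` into `velocityRate`. -/
theorem isPrim_integral_momentum (h : IsPathSolution A T N ρ u w w₁ w₂) (hT : 0 ≤ T) {y : ℝ}
    (hy : y ∈ Icc (0 : ℝ) 1) :
    IsPrim (fun t => ∫ x in (0 : ℝ)..flow ρ y t, ρ t x * (u t x - w t x))
      (fun s => ∫ x in (0 : ℝ)..flow ρ y s, velocityRate A (ρ s) (u s) (w₁ s) x) 0 T := by
  set X := flow ρ y
  have hXm : ∀ t ∈ Icc 0 T, X t ∈ Icc (0 : ℝ) 1 := fun t ht => h.flow_mem ht hy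
  have hXp : IsPrim X (fun t => u t (X t)) 0 T := h.isPrim_flow hT hy
  have hXc : ContinuousOn X (Icc 0 T) := h.continuousOn_flow hT hy
  have hmc := h.cont_rel hT
  obtain ⟨C, hC⟩ := (isCompact_Icc.prod isCompact_Icc).exists_bound_of_continuousOn hmc
  obtain ⟨m₀, M, -, hM0, hM⟩ := h.exists_bounds hT
  have hrate := h.momentum.integrable
  have hrI := ae_intervalIntegrable (κ := fun r => momentumRate A (ρ r) (u r) (w r)) hrate
  have hsl := fun t ht => continuousOn_slice (f := fun t x => ρ t x * (u t x - w t x)) hmc (t := t) ht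
  have hsl' := fun x hx =>
    continuousOn_slice_left (f := fun t x => ρ t x * (u t x - w t x)) hmc (x := x) hx
  have hu : ContinuousOn (fun r => u r (X r)) (Icc 0 T) := h.cont_along_flow hT hy (h.cont_velocity hT)
  have hP := isPrim_of_partition hT
    (f := fun t => ∫ x in (0 : ℝ)..X t, ρ t x * (u t x - w t x))
    (K := fun s t r => (∫ x in (0 : ℝ)..X t, momentumRate A (ρ r) (u r) (w r) x) +
      ρ s (X r) * (u s (X r) - w s (X r)) * u r (X r))
    (g := fun r => (∫ x in (0 : ℝ)..X r, momentumRate A (ρ r) (u r) (w r) x) +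
      ρ r (X r) * (u r (X r) - w r (X r)) * u r (X r))
    (κ := fun r => (∫ x in (0 : ℝ)..1, |momentumRate A (ρ r) (u r) (w r) x|) + C * M)
    ((intervalIntegrable_integral_abs hT hrate).add (by simp)) ?_ ?_ ?_ ?_
  · refine hP.congr hT (fun _ _ => rfl) ?_
    filter_upwards [hrI, ae_restrict_mem measurableSet_Ioc] with r hr hrm
    have hrm' := Ioc_subset_Icc_self hrm
    have hb := hXm r hrm'
    have hp := ((h.prim_density hrm').mul (h.prim_velocity hrm') zero_le_one).mul
      ((h.prim_velocity hrm').sub (h.noise.prim r hrm') zero_le_one) zero_le_one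
    have h0 : (0 : ℝ) ∈ Icc (0 : ℝ) 1 := by simp
    have e1 := hp.integral_eq h0 hb
    have hr' : IntervalIntegrable (momentumRate A (ρ r) (u r) (w r)) volume 0 (X r) :=
      hr.mono_set (by
        rw [uIcc_of_le hb.1, uIcc_of_le zero_le_one]; exact Icc_subset_Icc_right hb.2)
    rw [(h.regular.phase r hrm'.1).velocity.2.1] at e1
    -- The flux at x = 0 is zero because u vanishes there; it is kept in the form required by the
    -- fundamental theorem of calculus.
    have e2 : ρ r (X r) * (u r (X r) - w r (X r)) * u r (X r) =
        ρ r (X r) * u r (X r) * (u r (X r) - w r (X r)) - ρ r 0 * 0 * (0 - w r 0) := by ring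
    rw [e2, ← e1, ← intervalIntegral.integral_add hr' (hp.intervalIntegrable_sub h0 hb)]
    refine intervalIntegral.integral_congr fun x _ => ?_
    simp only [momentumRate, velocityRate]
    ring
  · intro s t hs hst ht
    have hsm : s ∈ Icc 0 T := ⟨hs, hst.trans ht⟩
    have htm : t ∈ Icc 0 T := ⟨hs.trans hst, ht⟩
    have hq := isPrim_integral_comp hT (hsl s hsm) hXp hXm
    have e1 := h.momentum.sub_eq hsm htm (hXm t htm)
    have e2 := hq.integral_eq hsm htm
    have hi := intervalIntegrable_integral (κ := fun r => momentumRate A (ρ r) (u r) (w r)) hrate hT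
      le_rfl (hXm t htm).1 (hXm t htm).2
    rw [intervalIntegral.integral_add (hi.mono_set (by
      rw [uIcc_of_le hT]; exact uIcc_subset_Icc hsm htm)) (hq.intervalIntegrable_sub hsm htm), e2,
      ← e1]
    ring
  · intro s t hs hst ht
    have hsm : s ∈ Icc 0 T := ⟨hs, hst.trans ht⟩
    have htm : t ∈ Icc 0 T := ⟨hs.trans hst, ht⟩
    have hsub : Ioc s t ⊆ Ioc 0 T := Ioc_subset_Ioc hs ht
    refine AEStronglyMeasurable.add ?_ ?_
    · have hi := intervalIntegrable_integral (κ := fun r => momentumRate A (ρ r) (u r) (w r)) hrate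
        hT le_rfl (hXm t htm).1 (hXm t htm).2
      exact ((intervalIntegrable_iff_integrableOn_Ioc_of_le hT).1 hi).aestronglyMeasurable.mono_measure
        (Measure.restrict_mono hsub le_rfl)
    · have hc : ContinuousOn (fun r => ρ s (X r) * (u s (X r) - w s (X r)) * u r (X r)) (Icc 0 T) :=
        ((hsl s hsm).comp hXc hXm).mul hu
      exact (hc.mono (hsub.trans Ioc_subset_Icc_self)).aestronglyMeasurable measurableSet_Ioc
  · filter_upwards [hrI, ae_restrict_mem measurableSet_Ioc] with r hr hrm
    intro s t hs hsr hrt ht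
    have hrm' := Ioc_subset_Icc_self hrm
    refine (abs_add_le _ _).trans (add_le_add (abs_integral_le_integral_abs hr
      (hXm t ⟨hs.trans (hsr.trans hrt), ht⟩)) ?_)
    rw [abs_mul]
    have hsm : s ∈ Icc 0 T := ⟨hs, hsr.trans (hrt.trans ht)⟩
    have hc := hC (s, X r) ⟨hsm, hXm r hrm'⟩
    exact mul_le_mul hc ((hM r hrm').2.2 _ (hXm r hrm')).2.2 (abs_nonneg _)
      ((norm_nonneg _).trans hc)
  · filter_upwards [hrI, ae_restrict_mem measurableSet_Ioc] with r hr hrm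
    intro s t hst hs ht
    have hrm' := Ioc_subset_Icc_self hrm
    have htm : ∀ n, t n ∈ Icc 0 T := fun n =>
      ⟨(hst n).1.trans ((hst n).2.1.trans (hst n).2.2.1), (hst n).2.2.2⟩
    have hsm : ∀ n, s n ∈ Icc 0 T := fun n =>
      ⟨(hst n).1, (hst n).2.1.trans ((hst n).2.2.1.trans (hst n).2.2.2)⟩
    refine Tendsto.add ?_ (Tendsto.mul ?_ tendsto_const_nhds)
    · exact tendsto_continuousOn (continuousOn_intervalIntegral zero_le_one hr) (hXm r hrm')
        (tendsto_continuousOn hXc hrm' ht htm) fun n => hXm _ (htm n)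
    · exact tendsto_continuousOn (hsl' _ (hXm r hrm')) hrm' hs hsm

end IsPathSolution

/-! ### The density along trajectories and the effective velocity. -/

theorem IsPrim.abs_sub_le_mul {f f' : ℝ → ℝ} (hf : IsPrim f f' 0 1) {C x y : ℝ}
    (hC : ∀ z ∈ Icc (0 : ℝ) 1, |f' z| ≤ C) (hx : x ∈ Icc (0 : ℝ) 1) (hy : y ∈ Icc (0 : ℝ) 1) :
    |f y - f x| ≤ C * |y - x| := by
  rw [← hf.integral_eq hx hy, ← Real.norm_eq_abs]
  exact intervalIntegral.norm_integral_le_of_norm_le_const fun z hz =>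
    hC z (uIcc_subset_Icc hx hy (uIoc_subset_uIcc hz))

/-- Difference quotients of `C¹` functions along a convergent sequence. -/
theorem tendsto_div_of_isPrim {f f' : ℝ → ℝ} (hf : IsPrim f f' 0 1) (hc : ContinuousOn f' (Icc 0 1))
    {x : ℝ} (hx : x ∈ Icc (0 : ℝ) 1) {X : ℕ → ℝ} (hX : Tendsto X atTop (𝓝 x))
    (hXm : ∀ n, X n ∈ Icc (0 : ℝ) 1) (hne : ∀ n, X n ≠ x) :
    Tendsto (fun n => (f (X n) - f x) / (X n - x)) atTop (𝓝 (f' x)) := by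
  rw [Metric.tendsto_nhds]
  intro ε hε
  obtain ⟨δ, hδ, hd⟩ := (Metric.continuousOn_iff.1 hc) x hx (ε / 2) (half_pos hε)
  have h1 : ∀ᶠ n in atTop, dist (X n) x < δ := (Metric.tendsto_nhds.1 hX) δ hδ
  filter_upwards [h1] with n hn
  have hpos : 0 < |X n - x| := abs_pos.2 (sub_ne_zero.2 (hne n))
  have h2 : |f (X n) - f x - f' x * (X n - x)| ≤ ε / 2 * |X n - x| := by
    rw [← hf.integral_eq hx (hXm n)]
    have e : (∫ z in x..X n, f' z) - f' x * (X n - x) = ∫ z in x..X n, (f' z - f' x) := by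
      rw [intervalIntegral.integral_sub (hf.intervalIntegrable_sub hx (hXm n)) (by simp)]
      simp only [intervalIntegral.integral_const, smul_eq_mul]
      ring
    rw [e, ← Real.norm_eq_abs]
    refine intervalIntegral.norm_integral_le_of_norm_le_const fun z hz => ?_
    have hz' := uIoc_subset_uIcc hz
    refine (hd z (uIcc_subset_Icc hx (hXm n) hz') ?_).le
    rw [Real.dist_eq] at hn ⊢
    exact (abs_sub_left_of_mem_uIcc hz').trans_lt hn
  rw [Real.dist_eq]
  have e : (f (X n) - f x) / (X n - x) - f' x = (f (X n) - f x - f' x * (X n - x)) / (X n - x) := by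
    have := sub_ne_zero.2 (hne n)
    field_simp
  rw [e, abs_div, div_lt_iff₀ hpos]
  nlinarith

theorem exists_seq_ne {y : ℝ} (hy : y ∈ Icc (0 : ℝ) 1) : ∃ Y : ℕ → ℝ, (∀ n, Y n ∈ Icc (0 : ℝ) 1) ∧
    (∀ n, Y n ≠ y) ∧ Tendsto Y atTop (𝓝 y) := by
  obtain ⟨c, hc, hcy⟩ : ∃ c ∈ Icc (0 : ℝ) 1, c ≠ y := by
    rcases eq_or_ne y 0 with rfl | h
    · exact ⟨1, by simp, by simp⟩
    · exact ⟨0, by simp, h.symm⟩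
  refine ⟨fun n => y + (c - y) * (1 / ((n : ℝ) + 1)), fun n => ?_, fun n => ?_, ?_⟩
  · have h1 : (0 : ℝ) ≤ 1 / ((n : ℝ) + 1) := by positivity
    have h2 : 1 / ((n : ℝ) + 1) ≤ 1 := by
      rw [div_le_one (by positivity)]; linarith [(Nat.cast_nonneg n : (0 : ℝ) ≤ n)]
    have := (convex_Icc (0 : ℝ) 1) hy hc (a := 1 - 1 / ((n : ℝ) + 1)) (b := 1 / ((n : ℝ) + 1))
      (by linarith) h1 (by ring)
    simp only [smul_eq_mul] at this
    convert this using 1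
    ring
  · have h1 : (0 : ℝ) < 1 / ((n : ℝ) + 1) := by positivity
    simp only [ne_eq, add_eq_left, mul_eq_zero, not_or]
    exact ⟨sub_ne_zero.2 hcy, h1.ne'⟩
  · simpa using (tendsto_const_nhds (x := y)).add
      ((tendsto_one_div_add_atTop_nhds_zero_nat (𝕜 := ℝ)).const_mul (c - y))

namespace IsPathSolution

variable {A T N : ℝ} {ρ u w w₁ w₂ : ℝ → ℝ → ℝ}

theorem ae_isH2 (h : IsPathSolution A T N ρ u w w₁ w₂) :
    ∀ᵐ s ∂(volume.restrict (Ioc 0 T)), IsH2 (u s) :=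
  ae_restrict_of_ae_restrict_of_subset (Ioc_subset_Ioi_self) h.regular.memH2

theorem _root_.StochCNS.abs_velocity_x_le {v : ℝ → ℝ} (hv : IsH2 v) (h0 : IsH10 v) {x : ℝ}
    (hx : x ∈ Icc (0 : ℝ) 1) : |dx v x| ≤ normL2 (dx (dx v)) := by
  have hc : ContinuousOn (dx v) (Icc 0 1) := hv.2.isPrim.continuousOn zero_le_one
  -- v_x has mean zero because v vanishes at both ends, so it has a zero.
  obtain ⟨y, hy, hy0⟩ : ∃ y ∈ Icc (0 : ℝ) 1, dx v y + 1 = 1 := by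
    refine exists_eq_one_of_mass (f := fun y => dx v y + 1) (hc.add continuousOn_const) ?_
    rw [intervalIntegral.integral_add hv.1.isPrim.1 (by simp),
      hv.1.isPrim.integral_eq (by simp) (by simp), h0.2.1, h0.2.2]
    simp
  have h1 := hv.2.isPrim.abs_sub_le' hv.2.2 hx hy
  rwa [show dx v y = 0 by linarith, sub_zero] at h1

theorem _root_.StochCNS.intervalIntegrable_normL2_sq {f : ℝ → ℝ → ℝ} {T : ℝ} (hT : 0 ≤ T)
    (hf : MemLp (fun p : ℝ × ℝ => f p.1 p.2) 2 (spaceTime T)) :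
    IntervalIntegrable (fun s => normL2 (f s) ^ 2) volume 0 T := by
  have := intervalIntegrable_integral (κ := fun s x => f s x ^ 2) hf.integrable_sq hT le_rfl
    zero_le_one le_rfl
  simpa only [normL2_sq, integral_unit] using this

/-- In mass coordinates the specific volume 1/ρ is ∂X/∂y. The difference quotients of X in y have
difference quotients of u as time derivatives; these converge to u_x/ρ at almost every time and are
dominated through |u_x| ≤ ‖u_xx‖, which is integrable in time. Hence 1/ρ has derivative u_x/ρ along
the trajectory, and minus its logarithm is log ρ. The argument works for every y, in particular for
the boundary particle y = 0. -/
theorem isPrim_log_density (h : IsPathSolution A T N ρ u w w₁ w₂) (hT : 0 ≤ T) {y : ℝ}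
    (hy : y ∈ Icc (0 : ℝ) 1) :
    IsPrim (fun t => Real.log (ρ t (flow ρ y t))) (fun s => -(dx (u s) (flow ρ y s))) 0 T := by
  obtain ⟨Y, hYm, hYne, hY⟩ := exists_seq_ne hy
  obtain ⟨m, M, hm, hM0, hM⟩ := h.exists_bounds hT
  set X := flow ρ y with hX
  have hXm : ∀ t ∈ Icc 0 T, X t ∈ Icc (0 : ℝ) 1 := fun t ht => h.flow_mem ht hy
  have hgap : ∀ n, ∀ t ∈ Icc 0 T, m * |flow ρ (Y n) t - X t| ≤ |Y n - y| := fun n t ht => by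
    have := h.abs_le_integral_density ht (fun x hx => ((hM t ht).2.2 x hx).1) (hXm t ht)
      (h.flow_mem ht (hYm n))
    rwa [hX, h.integral_flow_sub ht hy (hYm n)] at this
  have hXne : ∀ n, ∀ t ∈ Icc 0 T, flow ρ (Y n) t ≠ X t := fun n t ht heq => by
    have := h.integral_flow_sub ht hy (hYm n)
    rw [← hX, heq, intervalIntegral.integral_same] at this
    exact hYne n (by linarith)
  have hYX : ∀ t ∈ Icc 0 T, Tendsto (fun n => flow ρ (Y n) t) atTop (𝓝 (X t)) := fun t ht => by
    rw [tendsto_iff_dist_tendsto_zero]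
    have h0 : Tendsto (fun n => |Y n - y| / m) atTop (𝓝 0) := by
      have := ((hY.sub_const y).abs).div_const m
      simpa using this
    refine squeeze_zero (fun n => dist_nonneg) (fun n => ?_) h0
    rw [le_div_iff₀ hm, mul_comm, Real.dist_eq]
    exact hgap n t ht
  set q : ℕ → ℝ → ℝ := fun n t => (flow ρ (Y n) t - X t) / (Y n - y) with hq
  have hqb : ∀ n, ∀ t ∈ Icc 0 T, |q n t| ≤ 1 / m := fun n t ht => by
    have hpos : 0 < |Y n - y| := abs_pos.2 (sub_ne_zero.2 (hYne n))
    rw [hq, abs_div, div_le_div_iff₀ hpos hm, one_mul, mul_comm]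
    exact hgap n t ht
  have hql : ∀ t ∈ Icc 0 T, Tendsto (fun n => q n t) atTop (𝓝 (ρ t (X t))⁻¹) := fun t ht => by
    have hpr : IsPrim (fun x => ∫ z in (0 : ℝ)..x, ρ t z) (ρ t) 0 1 :=
      ⟨h.intervalIntegrable_density ht (by simp) (by simp), fun x _ => by simp⟩
    have h1 := tendsto_div_of_isPrim hpr (h.regular.continuousOn_density ht.1) (hXm t ht) (hYX t ht)
      (fun n => h.flow_mem ht (hYm n)) fun n => hXne n t ht
    refine (h1.inv₀ (h.density_pos ht (hXm t ht)).ne').congr fun n => ?_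
    rw [hX, h.integral_flow ht hy, h.integral_flow ht (hYm n), inv_div]
  have hdp : ∀ n, IsPrim (q n) (fun s => (u s (flow ρ (Y n) s) - u s (X s)) / (Y n - y)) 0 T := by
    intro n
    refine (((h.isPrim_flow hT (hYm n)).sub (h.isPrim_flow hT hy) hT).const_mul (Y n - y)⁻¹
      hT).congr hT (fun t _ => ?_) (Eventually.of_forall fun t => ?_)
    · simp only [hq, hX]; ring
    · simp only [hX]; ring
  have hbound : ∀ᵐ s ∂(volume.restrict (Ioc 0 T)), ∀ n,
      |(u s (flow ρ (Y n) s) - u s (X s)) / (Y n - y)| ≤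
        (1 + normL2 (dx (dx (u s))) ^ 2) * (1 / m) := by
    filter_upwards [h.ae_isH2, ae_restrict_mem measurableSet_Ioc] with s hs hsm n
    have hsm' := Ioc_subset_Icc_self hsm
    have hpos : 0 < |Y n - y| := abs_pos.2 (sub_ne_zero.2 (hYne n))
    have h1 := (h.prim_velocity hsm').abs_sub_le_mul (C := normL2 (dx (dx (u s))))
      (fun z hz => abs_velocity_x_le hs (h.regular.phase s hsm'.1).velocity hz) (hXm s hsm')
      (h.flow_mem hsm' (hYm n))
    have h2 := hqb n s hsm'
    rw [hq, abs_div] at h2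
    rw [abs_div]
    calc _ ≤ normL2 (dx (dx (u s))) * |flow ρ (Y n) s - X s| / |Y n - y| := by gcongr
      _ = normL2 (dx (dx (u s))) * (|flow ρ (Y n) s - X s| / |Y n - y|) := by ring
      _ ≤ (1 + normL2 (dx (dx (u s))) ^ 2) * (1 / m) := by
        refine mul_le_mul ?_ h2 (by positivity) (by positivity)
        nlinarith [sq_nonneg (normL2 (dx (dx (u s))) - 1)]
  have hlim : ∀ᵐ s ∂(volume.restrict (Ioc 0 T)), Tendsto
      (fun n => (u s (flow ρ (Y n) s) - u s (X s)) / (Y n - y)) atTop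
      (𝓝 (dx (u s) (X s) * (ρ s (X s))⁻¹)) := by
    filter_upwards [h.ae_isH2, ae_restrict_mem measurableSet_Ioc] with s hs hsm
    have hsm' := Ioc_subset_Icc_self hsm
    have h1 := tendsto_div_of_isPrim (h.prim_velocity hsm') (hs.2.isPrim.continuousOn zero_le_one)
      (hXm s hsm') (hYX s hsm') (fun n => h.flow_mem hsm' (hYm n)) fun n => hXne n s hsm'
    refine (h1.mul (hql s hsm')).congr fun n => ?_
    have := sub_ne_zero.2 (hXne n s hsm')
    simp only [hq]
    field_simp
  have hκ : IntervalIntegrable (fun s => (1 + normL2 (dx (dx (u s))) ^ 2) * (1 / m)) volume 0 T :=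
    ((intervalIntegrable_const (c := (1 : ℝ))).add (intervalIntegrable_normL2_sq
      (f := fun s => dx (dx (u s))) hT (h.regular.velocity_xx T))).mul_const _
  have hη : IsPrim (fun t => (ρ t (X t))⁻¹) (fun s => dx (u s) (X s) * (ρ s (X s))⁻¹) 0 T :=
    isPrim_of_tendsto hT hdp hql hlim hbound hκ
  have hηpos : ∀ t ∈ Icc 0 T, 0 < (ρ t (X t))⁻¹ := fun t ht =>
    inv_pos.2 (h.density_pos ht (hXm t ht))
  refine ((hη.log hT hηpos).const_mul (-1) hT).congr hT (fun t ht => ?_)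
    ((ae_restrict_iff' measurableSet_Ioc).2 (Eventually.of_forall fun t ht => ?_))
  · simp only [Real.log_inv]; ring
  · have := (h.density_pos (Ioc_subset_Icc_self ht) (hXm t (Ioc_subset_Icc_self ht))).ne'
    simp only
    field_simp

theorem ae_intervalIntegrable_velocityRate (h : IsPathSolution A T N ρ u w w₁ w₂) :
    ∀ᵐ s ∂(volume.restrict (Ioc 0 T)), IsH2 (u s) ∧
      IntervalIntegrable (velocityRate A (ρ s) (u s) (w₁ s)) volume 0 1 ∧
      IntervalIntegrable (effectiveRate A (ρ s) (u s) (w₁ s)) volume 0 1 := by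
  filter_upwards [h.ae_isH2, ae_restrict_mem measurableSet_Ioc] with s hs hsm
  have hsm' := Ioc_subset_Icc_self hsm
  have h1 : IntervalIntegrable (fun x => ρ s x * u s x * w₁ s x) volume 0 1 := by
    apply ContinuousOn.intervalIntegrable
    rw [uIcc_of_le zero_le_one]
    exact ((h.regular.continuousOn_density hsm'.1).mul (h.regular.continuousOn_velocity hsm'.1)).mul
      (continuousOn_slice h.noise.cont₁ hsm')
  have h2 := ((h.prim_density hsm').1.const_mul (A ^ 2))
  exact ⟨hs, (hs.2.isPrim.1.sub h2).sub h1, h2.neg.sub h1⟩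

/-- The contribution of ρ · ρ_x/ρ² = (log ρ)_x is log ρ at X minus log ρ at 0, and x = 0 is itself a
trajectory. The two logarithmic laws contribute −∫u_xx over [0,X], which cancels the viscous part of
`velocityRate`. -/
theorem isPrim_integral_effective (h : IsPathSolution A T N ρ u w w₁ w₂) (hT : 0 ≤ T) {y : ℝ}
    (hy : y ∈ Icc (0 : ℝ) 1) :
    IsPrim (fun t => ∫ x in (0 : ℝ)..flow ρ y t,
        ρ t x * (u t x - w t x + dx (ρ t) x / ρ t x ^ 2))
      (fun s => ∫ x in (0 : ℝ)..flow ρ y s, effectiveRate A (ρ s) (u s) (w₁ s) x) 0 T := by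
  have h0 : (0 : ℝ) ∈ Icc (0 : ℝ) 1 := by simp
  have hp := ((h.isPrim_integral_momentum hT hy).add (h.isPrim_log_density hT hy) hT).sub
    (h.isPrim_log_density hT h0) hT
  refine hp.congr hT (fun t ht => ?_) ?_
  · have hb := h.flow_mem ht hy
    have hl := (h.prim_density ht).log zero_le_one fun x hx => h.density_pos ht hx
    have e := hl.integral_eq h0 hb
    have hi : IntervalIntegrable (fun x => ρ t x * (u t x - w t x)) volume 0 (flow ρ y t) := by
      apply ContinuousOn.intervalIntegrable
      rw [uIcc_of_le hb.1]
      exact ((h.regular.continuousOn_density ht.1).mul ((h.regular.continuousOn_velocity ht.1).sub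
        (continuousOn_slice h.noise.cont ht))).mono (Icc_subset_Icc_right hb.2)
    simp only
    rw [h.flow_zero hT ht, add_sub_assoc, ← e,
      ← intervalIntegral.integral_add hi (hl.intervalIntegrable_sub h0 hb)]
    refine intervalIntegral.integral_congr fun x hx => ?_
    have := (h.density_pos ht (uIcc_subset_Icc h0 hb hx)).ne'
    field_simp
  · filter_upwards [h.ae_intervalIntegrable_velocityRate, ae_restrict_mem measurableSet_Ioc]
      with s ⟨hs, hs1, hs2⟩ hsm
    have hsm' := Ioc_subset_Icc_self hsm
    have hb := h.flow_mem hsm' hy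
    have hsub : uIcc 0 (flow ρ y s) ⊆ uIcc 0 1 := by
      rw [uIcc_of_le hb.1, uIcc_of_le zero_le_one]; exact Icc_subset_Icc_right hb.2
    have e := hs.2.isPrim.integral_eq h0 hb
    have e2 : ∀ a b c : ℝ, a + -b - -c = a - (b - c) := fun a b c => by ring
    rw [h.flow_zero hT hsm', e2, ← e, ← intervalIntegral.integral_sub (hs1.mono_set hsub)
      (hs.2.isPrim.intervalIntegrable_sub h0 hb)]
    refine intervalIntegral.integral_congr fun x _ => ?_
    simp only [velocityRate, effectiveRate]
    ring

end IsPathSolution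

/-! ### Averages over cells of equal mass -/

theorem intervalIntegrable_of_memLp {f : ℝ → ℝ} (hf : MemLp f 2 unitMeasure) {a b : ℝ}
    (ha : a ∈ Icc (0 : ℝ) 1) (hb : b ∈ Icc (0 : ℝ) 1) : IntervalIntegrable f volume a b := by
  have h1 : IntervalIntegrable f volume 0 1 :=
    (intervalIntegrable_iff_integrableOn_Ioc_of_le zero_le_one).2 (hf.integrable (by norm_num))
  exact h1.mono_set (by rw [uIcc_of_le zero_le_one]; exact uIcc_subset_Icc ha hb)

theorem intervalIntegrable_sq_of_memLp {f : ℝ → ℝ} (hf : MemLp f 2 unitMeasure) {a b : ℝ}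
    (ha : a ∈ Icc (0 : ℝ) 1) (hb : b ∈ Icc (0 : ℝ) 1) :
    IntervalIntegrable (fun x => f x ^ 2) volume a b := by
  have h1 : IntervalIntegrable (fun x => f x ^ 2) volume 0 1 :=
    (intervalIntegrable_iff_integrableOn_Ioc_of_le zero_le_one).2 hf.integrable_sq
  exact h1.mono_set (by rw [uIcc_of_le zero_le_one]; exact uIcc_subset_Icc ha hb)

theorem intervalIntegrable_weight_mul {ρ f : ℝ → ℝ} (hρ : ContinuousOn ρ (Icc 0 1)) {a b : ℝ}
    (hf : IntervalIntegrable f volume a b)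
    (ha : a ∈ Icc (0 : ℝ) 1) (hb : b ∈ Icc (0 : ℝ) 1) :
    IntervalIntegrable (fun x => ρ x * f x) volume a b :=
  hf.continuousOn_mul (hρ.mono (uIcc_subset_Icc ha hb))

/-- The left side is 1/k times the variance of f under the probability density kρ on the cell, and a
variance does not change when the constant c is subtracted. The choice of c as the mean gives
Jensen's inequality; as a nearby value of a continuous function it gives smallness. -/
theorem cell_variance {ρ f : ℝ → ℝ} (hρ : ContinuousOn ρ (Icc 0 1)) (hf : MemLp f 2 unitMeasure)
    {a b c k : ℝ} (ha : a ∈ Icc (0 : ℝ) 1) (hb : b ∈ Icc (0 : ℝ) 1) (hk : 0 < k)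
    (hmass : ∫ x in a..b, ρ x = 1 / k) :
    (∫ x in a..b, ρ x * f x ^ 2) - k * (∫ x in a..b, ρ x * f x) ^ 2 =
      (∫ x in a..b, ρ x * (f x - c) ^ 2) - k * ((∫ x in a..b, ρ x * f x) - c / k) ^ 2 := by
  have i1 := intervalIntegrable_weight_mul hρ (intervalIntegrable_sq_of_memLp hf ha hb) ha hb
  have i2 := intervalIntegrable_weight_mul hρ (intervalIntegrable_of_memLp hf ha hb) ha hb
  have i3 : IntervalIntegrable ρ volume a b :=
    (hρ.mono (uIcc_subset_Icc ha hb)).intervalIntegrable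
  have e : ∫ x in a..b, ρ x * (f x - c) ^ 2 = (∫ x in a..b, ρ x * f x ^ 2) -
      2 * c * (∫ x in a..b, ρ x * f x) + c ^ 2 * ∫ x in a..b, ρ x := by
    rw [← intervalIntegral.integral_const_mul, ← intervalIntegral.integral_const_mul,
      ← intervalIntegral.integral_sub i1 (i2.const_mul _),
      ← intervalIntegral.integral_add (i1.sub (i2.const_mul _)) (i3.const_mul _)]
    refine intervalIntegral.integral_congr fun x _ => ?_
    ring
  rw [e, hmass]
  field_simp
  ring

/-- `x` is a partition of `[0,1]` into `n` cells of equal mass. -/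
structure IsMassPartition (ρ : ℝ → ℝ) (n : ℕ) (x : ℕ → ℝ) : Prop where
  mem : ∀ i ≤ n, x i ∈ Icc (0 : ℝ) 1
  zero : x 0 = 0
  last : x n = 1
  mono : ∀ i < n, x i ≤ x (i + 1)
  mass : ∀ i < n, ∫ z in x i..x (i + 1), ρ z = 1 / n

namespace IsMassPartition

variable {ρ f g : ℝ → ℝ} {n : ℕ} {x : ℕ → ℝ}

theorem sum_integral (hx : IsMassPartition ρ n x) (hf : IntervalIntegrable f volume 0 1) :
    ∑ i ∈ Finset.range n, ∫ z in x i..x (i + 1), f z = ∫ z in (0 : ℝ)..1, f z := by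
  rw [intervalIntegral.sum_integral_adjacent_intervals fun i hi => ?_, hx.zero, hx.last]
  exact hf.mono_set (by
    rw [uIcc_of_le zero_le_one]; exact uIcc_subset_Icc (hx.mem i hi.le) (hx.mem (i + 1) hi))

theorem sum_sq_le (hx : IsMassPartition ρ n x) (hn : 0 < n) (hρ : ContinuousOn ρ (Icc 0 1))
    (hpos : ∀ z ∈ Icc (0 : ℝ) 1, 0 ≤ ρ z) (hf : MemLp f 2 unitMeasure) :
    ∑ i ∈ Finset.range n, n * (∫ z in x i..x (i + 1), ρ z * f z) ^ 2 ≤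
      ∫ z in (0 : ℝ)..1, ρ z * f z ^ 2 := by
  have hn' : (0 : ℝ) < n := by exact_mod_cast hn
  have h0 : (0 : ℝ) ∈ Icc (0 : ℝ) 1 := by simp
  have h1 : (1 : ℝ) ∈ Icc (0 : ℝ) 1 := by simp
  rw [← hx.sum_integral (intervalIntegrable_weight_mul hρ (intervalIntegrable_sq_of_memLp hf h0 h1)
    h0 h1)]
  refine Finset.sum_le_sum fun i hi => ?_
  have hi := Finset.mem_range.1 hi
  -- With c the mean of f over the cell, the subtracted square on the right vanishes.
  have := cell_variance hρ hf (c := n * ∫ z in x i..x (i + 1), ρ z * f z) (hx.mem i hi.le)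
    (hx.mem _ hi) hn' (hx.mass i hi)
  have h2 : 0 ≤ ∫ z in x i..x (i + 1),
      ρ z * (f z - n * ∫ z in x i..x (i + 1), ρ z * f z) ^ 2 :=
    intervalIntegral.integral_nonneg (hx.mono i hi) fun z hz => mul_nonneg
      (hpos z ⟨(hx.mem i hi.le).1.trans hz.1, hz.2.trans (hx.mem _ hi).2⟩) (sq_nonneg _)
  rw [mul_div_cancel_left₀ _ hn'.ne', sub_self] at this
  nlinarith

theorem sub_sum_sq_le (hx : IsMassPartition ρ n x) (hn : 0 < n) (hρ : ContinuousOn ρ (Icc 0 1))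
    (hpos : ∀ z ∈ Icc (0 : ℝ) 1, 0 ≤ ρ z) (hf : MemLp f 2 unitMeasure)
    {φ : ℝ → ℝ} (hφ : ContinuousOn φ (Icc 0 1)) {ω : ℝ}
    (hω : ∀ i < n, ∀ z ∈ Icc (x i) (x (i + 1)), |φ z - φ (x i)| ≤ ω) :
    (∫ z in (0 : ℝ)..1, ρ z * f z ^ 2) -
      ∑ i ∈ Finset.range n, n * (∫ z in x i..x (i + 1), ρ z * f z) ^ 2 ≤
      2 * (∫ z in (0 : ℝ)..1, ρ z * (f z - φ z) ^ 2) + 2 * ω ^ 2 := by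
  have hn' : (0 : ℝ) < n := by exact_mod_cast hn
  have h0 : (0 : ℝ) ∈ Icc (0 : ℝ) 1 := by simp
  have h1 : (1 : ℝ) ∈ Icc (0 : ℝ) 1 := by simp
  have hfφ : MemLp (fun z => f z - φ z) 2 unitMeasure := hf.sub (memLp_of_continuousOn hφ 2)
  have hi1 := intervalIntegrable_weight_mul hρ (intervalIntegrable_sq_of_memLp hfφ h0 h1) h0 h1
  rw [← hx.sum_integral (intervalIntegrable_weight_mul hρ (intervalIntegrable_sq_of_memLp hf h0 h1)
    h0 h1), ← hx.sum_integral hi1, ← Finset.sum_sub_distrib, Finset.mul_sum]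
  -- The error from the oscillation of φ is distributed over the cells according to their mass 1/n.
  have hc : 2 * ω ^ 2 = ∑ i ∈ Finset.range n, 2 * ω ^ 2 * (1 / n) := by
    rw [Finset.sum_const, Finset.card_range, nsmul_eq_mul]; field_simp
  rw [hc, ← Finset.sum_add_distrib]
  refine Finset.sum_le_sum fun i hi => ?_
  have hi := Finset.mem_range.1 hi
  have ha := hx.mem i hi.le
  have hb := hx.mem _ hi
  rw [cell_variance hρ hf (c := φ (x i)) ha hb hn' (hx.mass i hi)]
  have h2 : ∫ z in x i..x (i + 1), ρ z * (f z - φ (x i)) ^ 2 ≤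
      ∫ z in x i..x (i + 1), (2 * (ρ z * (f z - φ z) ^ 2) + 2 * ω ^ 2 * ρ z) := by
    refine intervalIntegral.integral_mono_on (hx.mono i hi) ?_ ?_ fun z hz => ?_
    · exact intervalIntegrable_weight_mul hρ (intervalIntegrable_sq_of_memLp
        (hf.sub (memLp_const _)) ha hb) ha hb
    · exact ((intervalIntegrable_weight_mul hρ (intervalIntegrable_sq_of_memLp hfφ ha hb)
        ha hb).const_mul 2).add
        ((hρ.mono (uIcc_subset_Icc ha hb)).intervalIntegrable.const_mul _)
    · have hz1 := hpos z ⟨ha.1.trans hz.1, hz.2.trans hb.2⟩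
      have hz2 := abs_le.1 (hω i hi z hz)
      have hz3 : (φ z - φ (x i)) ^ 2 ≤ ω ^ 2 := sq_le_sq' hz2.1 hz2.2
      have hz4 : (f z - φ (x i)) ^ 2 ≤ 2 * (f z - φ z) ^ 2 + 2 * ω ^ 2 := by
        nlinarith [sq_nonneg ((f z - φ z) - (φ z - φ (x i)))]
      calc _ ≤ ρ z * (2 * (f z - φ z) ^ 2 + 2 * ω ^ 2) := mul_le_mul_of_nonneg_left hz4 hz1
        _ = _ := by ring
  rw [intervalIntegral.integral_add ((intervalIntegrable_weight_mul hρ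
      (intervalIntegrable_sq_of_memLp hfφ ha hb) ha hb).const_mul 2)
      ((hρ.mono (uIcc_subset_Icc ha hb)).intervalIntegrable.const_mul _),
    intervalIntegral.integral_const_mul, intervalIntegral.integral_const_mul, hx.mass i hi] at h2
  have h3 : 0 ≤ (n : ℝ) * ((∫ z in x i..x (i + 1), ρ z * f z) - φ (x i) / n) ^ 2 := by positivity
  linarith

end IsMassPartition

theorem exists_continuous_integral_sq_le {f : ℝ → ℝ} (hf : MemLp f 2 unitMeasure) {ε : ℝ}
    (hε : 0 < ε) : ∃ φ : ℝ → ℝ, Continuous φ ∧ ∫ x in (0 : ℝ)..1, (f x - φ x) ^ 2 ≤ ε := by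
  have : unitMeasure.Regular := by unfold unitMeasure; infer_instance
  obtain ⟨φ, -, h1, h2, -⟩ := MemLp.exists_hasCompactSupport_integral_rpow_sub_le
    (p := 2) (by norm_num) (f := f) (μ := unitMeasure) (by simpa using hf) hε
  refine ⟨φ, h2, ?_⟩
  rw [integral_unit]
  simpa using h1

/-- The sums stay below the integral by Jensen, and the deficit is the total variance of f inside
the cells. It is small because f is close in L² to a continuous function, and because ρ ≥ m makes
cells of mass 1/n short. -/
theorem tendsto_sum_mass_sq {ρ f : ℝ → ℝ} {m : ℝ} (hm : 0 < m) (hρ : ContinuousOn ρ (Icc 0 1))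
    (hmρ : ∀ z ∈ Icc (0 : ℝ) 1, m ≤ ρ z) (hf : MemLp f 2 unitMeasure) {x : ℕ → ℕ → ℝ}
    (hx : ∀ n, 0 < n → IsMassPartition ρ n (x n)) :
    Tendsto (fun n : ℕ => ∑ i ∈ Finset.range n, n * (∫ z in x n i..x n (i + 1), ρ z * f z) ^ 2)
      atTop (𝓝 (∫ z in (0 : ℝ)..1, ρ z * f z ^ 2)) := by
  have hpos : ∀ z ∈ Icc (0 : ℝ) 1, 0 ≤ ρ z := fun z hz => hm.le.trans (hmρ z hz)
  have h0 : (0 : ℝ) ∈ Icc (0 : ℝ) 1 := by simp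
  have h1 : (1 : ℝ) ∈ Icc (0 : ℝ) 1 := by simp
  obtain ⟨M, hM⟩ := isCompact_Icc.exists_bound_of_continuousOn hρ
  have hM0 : 0 ≤ M := (norm_nonneg _).trans (hM 0 h0)
  rw [Metric.tendsto_atTop]
  intro ε hε
  obtain ⟨φ, hφ, hφε⟩ := exists_continuous_integral_sq_le hf
    -- With ρ ≤ M the approximation costs at most 2 · ε/8, and the oscillation of φ costs 2ω² < ε/2.
    (ε := ε / (8 * (M + 1))) (by positivity)
  obtain ⟨ω, hω, hωε⟩ : ∃ ω > 0, 2 * ω ^ 2 < ε / 2 := by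
    refine ⟨√(ε / 8), by positivity, ?_⟩
    rw [Real.sq_sqrt (by positivity)]; linarith
  have huc := isCompact_Icc.uniformContinuousOn_of_continuous (hφ.continuousOn (s := Icc (0 : ℝ) 1))
  rw [Metric.uniformContinuousOn_iff] at huc
  obtain ⟨δ, hδ, hδω⟩ := huc ω hω
  obtain ⟨n₀, hn₀⟩ := exists_nat_gt (1 / (m * δ))
  refine ⟨n₀ + 1, fun n hn => ?_⟩
  have hnpos : 0 < n := by omega
  have hn' : (0 : ℝ) < n := by exact_mod_cast hnpos
  have hP := hx n hnpos
  have hle := hP.sum_sq_le hnpos hρ hpos hf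
  have hmesh : ∀ i < n, x n (i + 1) - x n i < δ := by
    intro i hi
    have ha := hP.mem i hi.le
    have hb := hP.mem _ hi
    have := intervalIntegral.integral_mono_on (μ := volume) (hP.mono i hi) (f := fun _ => m)
      intervalIntegrable_const (hρ.mono (uIcc_subset_Icc ha hb)).intervalIntegrable
      fun z hz => hmρ z ⟨ha.1.trans hz.1, hz.2.trans hb.2⟩
    rw [hP.mass i hi, intervalIntegral.integral_const, smul_eq_mul] at this
    have h2 : 1 / (m * δ) < n := hn₀.trans (by exact_mod_cast hn)
    rw [div_lt_iff₀ (by positivity)] at h2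
    have h3 : (1 : ℝ) / n < m * δ := by rw [div_lt_iff₀ hn']; linarith
    have h4 : m * (x n (i + 1) - x n i) < m * δ := by linarith
    exact lt_of_mul_lt_mul_left h4 hm.le
  have hgap := hP.sub_sum_sq_le hnpos hρ hpos hf hφ.continuousOn (ω := ω) fun i hi z hz => by
    have ha := hP.mem i hi.le
    have hb := hP.mem _ hi
    refine (hδω z ⟨ha.1.trans hz.1, hz.2.trans hb.2⟩ (x n i) ha ?_).le
    rw [Real.dist_eq, abs_of_nonneg (by linarith [hz.1])]
    linarith [hmesh i hi, hz.2]
  have hfφ : MemLp (fun z => f z - φ z) 2 unitMeasure :=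
    hf.sub (memLp_of_continuousOn hφ.continuousOn 2)
  have h5 : ∫ z in (0 : ℝ)..1, ρ z * (f z - φ z) ^ 2 ≤ M * (ε / (8 * (M + 1))) := by
    calc _ ≤ ∫ z in (0 : ℝ)..1, M * (f z - φ z) ^ 2 := by
          refine intervalIntegral.integral_mono_on zero_le_one
            (intervalIntegrable_weight_mul hρ (intervalIntegrable_sq_of_memLp hfφ h0 h1) h0 h1)
            ((intervalIntegrable_sq_of_memLp hfφ h0 h1).const_mul _) fun z hz => ?_
          exact mul_le_mul_of_nonneg_right ((le_abs_self _).trans (hM z hz)) (sq_nonneg _)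
      _ ≤ _ := by
        rw [intervalIntegral.integral_const_mul]
        exact mul_le_mul_of_nonneg_left hφε hM0
  have h6 : M * (ε / (8 * (M + 1))) ≤ ε / 8 := by
    rw [← mul_div_assoc, div_le_div_iff₀ (by positivity) (by norm_num)]
    nlinarith
  rw [Real.dist_eq, abs_sub_comm, abs_of_nonneg (sub_nonneg.2 hle)]
  linarith

theorem tendsto_sum_mass_mul {ρ f g : ℝ → ℝ} {m : ℝ} (hm : 0 < m) (hρ : ContinuousOn ρ (Icc 0 1))
    (hmρ : ∀ z ∈ Icc (0 : ℝ) 1, m ≤ ρ z) (hf : MemLp f 2 unitMeasure) (hg : MemLp g 2 unitMeasure)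
    {x : ℕ → ℕ → ℝ} (hx : ∀ n, 0 < n → IsMassPartition ρ n (x n)) :
    Tendsto (fun n : ℕ => ∑ i ∈ Finset.range n, n * ((∫ z in x n i..x n (i + 1), ρ z * f z) *
      ∫ z in x n i..x n (i + 1), ρ z * g z))
      atTop (𝓝 (∫ z in (0 : ℝ)..1, ρ z * (f z * g z))) := by
  have h0 : (0 : ℝ) ∈ Icc (0 : ℝ) 1 := by simp
  have h1 : (1 : ℝ) ∈ Icc (0 : ℝ) 1 := by simp
  -- Polarization: the product is a quarter of the difference of the squares of f + g and f − g.
  have hp := tendsto_sum_mass_sq hm hρ hmρ (hf.add hg) hx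
  have hs := tendsto_sum_mass_sq hm hρ hmρ (hf.sub hg) hx
  have e : ∫ z in (0 : ℝ)..1, ρ z * (f z * g z) = 1 / 4 * ((∫ z in (0 : ℝ)..1, ρ z * (f + g) z ^ 2) -
      ∫ z in (0 : ℝ)..1, ρ z * (f - g) z ^ 2) := by
    rw [← intervalIntegral.integral_sub
      (intervalIntegrable_weight_mul hρ (intervalIntegrable_sq_of_memLp (hf.add hg) h0 h1) h0 h1)
      (intervalIntegrable_weight_mul hρ (intervalIntegrable_sq_of_memLp (hf.sub hg) h0 h1) h0 h1),
      ← intervalIntegral.integral_const_mul]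
    refine intervalIntegral.integral_congr fun z _ => ?_
    simp only [Pi.add_apply, Pi.sub_apply]
    ring
  rw [e]
  refine ((hp.sub hs).const_mul (1 / 4)).congr' ?_
  filter_upwards [eventually_gt_atTop 0] with n hn
  rw [← Finset.sum_sub_distrib, Finset.mul_sum]
  refine Finset.sum_congr rfl fun i hi => ?_
  have hi := Finset.mem_range.1 hi
  have ha := (hx n hn).mem i hi.le
  have hb := (hx n hn).mem _ hi
  have i1 := intervalIntegrable_weight_mul hρ (intervalIntegrable_of_memLp hf ha hb) ha hb
  have i2 := intervalIntegrable_weight_mul hρ (intervalIntegrable_of_memLp hg ha hb) ha hb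
  have e1 : ∫ z in x n i..x n (i + 1), ρ z * (f + g) z =
      (∫ z in x n i..x n (i + 1), ρ z * f z) + ∫ z in x n i..x n (i + 1), ρ z * g z := by
    rw [← intervalIntegral.integral_add i1 i2]
    simp only [Pi.add_apply, mul_add]
  have e2 : ∫ z in x n i..x n (i + 1), ρ z * (f - g) z =
      (∫ z in x n i..x n (i + 1), ρ z * f z) - ∫ z in x n i..x n (i + 1), ρ z * g z := by
    rw [← intervalIntegral.integral_sub i1 i2]
    simp only [Pi.sub_apply, mul_sub]
  rw [e1, e2]
  ring

/-! ### Time derivatives of ∫ρf² and of ∫ρ log ρ. -/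

theorem ae_memLp_slice {G : ℝ → ℝ → ℝ} {T : ℝ}
    (hG : MemLp (fun p : ℝ × ℝ => G p.1 p.2) 2 (spaceTime T)) :
    ∀ᵐ s ∂(volume.restrict (Ioc 0 T)), MemLp (G s) 2 unitMeasure := by
  filter_upwards [hG.integrable_sq.prod_right_ae, hG.aestronglyMeasurable.prodMk_left] with s h1 h2
  exact (memLp_two_iff_integrable_sq h2).2 h1

theorem Evolves.isPrim_integral_comp {f κ : ℝ → ℝ → ℝ} {T : ℝ} (h : Evolves f κ T) (hT : 0 ≤ T)
    (hf : ContinuousOn (fun p : ℝ × ℝ => f p.1 p.2) (Icc 0 T ×ˢ Icc 0 1)) {φ φ' : ℝ → ℝ} {s : Set ℝ}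
    (hφ : ∀ z ∈ s, HasDerivAt φ (φ' z) z) (hφ' : ContinuousOn φ' s)
    (hs : ∀ t ∈ Icc 0 T, ∀ x ∈ Icc (0 : ℝ) 1, f t x ∈ s) :
    IsPrim (fun t => ∫ x in (0 : ℝ)..1, φ (f t x)) (fun t => ∫ x in (0 : ℝ)..1, φ' (f t x) * κ t x)
      0 T := by
  have hc : ContinuousOn (fun p : ℝ × ℝ => φ' (f p.1 p.2)) (Icc 0 T ×ˢ Icc 0 1) :=
    hφ'.comp hf fun p hp => hs p.1 hp.1 p.2 hp.2
  have hint : Integrable (fun p : ℝ × ℝ => φ' (f p.1 p.2) * κ p.1 p.2) (spaceTime T) := by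
    obtain ⟨C, hC⟩ := (isCompact_Icc.prod isCompact_Icc).exists_bound_of_continuousOn hc
    have := memLp_spaceTime_of_continuousOn (f := fun t x => φ' (f t x)) hc ⊤
    exact h.integrable.mul_of_top_right this
  refine ⟨intervalIntegrable_integral (κ := fun t x => φ' (f t x) * κ t x) hint hT le_rfl
    zero_le_one le_rfl, fun t ht => ?_⟩
  rw [integral_swap (κ := fun t x => φ' (f t x) * κ t x) hint ht.1 ht.2 le_rfl zero_le_one le_rfl]
  have hi := intervalIntegrable_integral_left (κ := fun t x => φ' (f t x) * κ t x) hint ht.1 ht.2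
  have h0 : IntervalIntegrable (fun x => φ (f 0 x)) volume 0 1 := by
    apply ContinuousOn.intervalIntegrable
    rw [uIcc_of_le zero_le_one]
    have hφc : ContinuousOn φ s := fun z hz => (hφ z hz).continuousAt.continuousWithinAt
    exact hφc.comp (continuousOn_slice hf ⟨le_rfl, hT⟩) fun x hx => hs 0 ⟨le_rfl, hT⟩ x hx
  beta_reduce
  rw [← intervalIntegral.integral_add h0 hi, integral_unit, integral_unit]
  refine integral_congr_ae ?_
  filter_upwards [h.ae_isPrim hT hf, show ∀ᵐ x ∂unitMeasure, x ∈ Ioc (0 : ℝ) 1 from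
    ae_restrict_mem measurableSet_Ioc] with x hx hxm
  exact (hx.comp (s := s) hT hφ hφ' fun t ht => hs t ht x (Ioc_subset_Icc_self hxm)).2 t ht

namespace IsPathSolution

variable {A T N : ℝ} {ρ u w w₁ w₂ : ℝ → ℝ → ℝ}

theorem isMassPartition_flow (h : IsPathSolution A T N ρ u w w₁ w₂) (hT : 0 ≤ T) {t : ℝ}
    (ht : t ∈ Icc 0 T) {n : ℕ} (hn : 0 < n) :
    IsMassPartition (ρ t) n (fun i => flow ρ (i / n) t) := by
  have hn' : (0 : ℝ) < n := by exact_mod_cast hn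
  have hm : ∀ i ≤ n, (i / n : ℝ) ∈ Icc (0 : ℝ) 1 := fun i hi =>
    ⟨by positivity, (div_le_one hn').2 (by exact_mod_cast hi)⟩
  refine ⟨fun i hi => h.flow_mem ht (hm i hi), ?_, ?_, fun i hi => ?_, fun i hi => ?_⟩
  · simpa using h.flow_zero hT ht
  · simpa [hn'.ne'] using h.flow_one hT ht
  · exact h.flow_mono hT ht (hm i hi.le) (hm _ hi) (by gcongr; simp)
  · rw [h.integral_flow_sub ht (hm i hi.le) (hm _ hi)]
    push_cast
    ring

/-- The law ρDf = G is known only after integration over material intervals, and f need not be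
differentiable along trajectories. The cells between the trajectories i/n keep the mass 1/n for all
times, so ∑ n(∫ρf)² is a finite sum to which the chain rule applies, with derivative ∑ 2n(∫ρf)(∫G).
Both sums converge as n → ∞. The majorant B + ‖G‖²/m comes from 2ab ≤ a² + b² and Jensen's
inequality for f and for G/ρ. -/
theorem isPrim_integral_sq (h : IsPathSolution A T N ρ u w w₁ w₂) (hT : 0 ≤ T)
    {f G : ℝ → ℝ → ℝ} {B : ℝ} (hf : ∀ t ∈ Icc 0 T, MemLp (f t) 2 unitMeasure)
    (hB : ∀ t ∈ Icc 0 T, ∫ x in (0 : ℝ)..1, ρ t x * f t x ^ 2 ≤ B)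
    (hG : MemLp (fun p : ℝ × ℝ => G p.1 p.2) 2 (spaceTime T))
    (hfG : ∀ y ∈ Icc (0 : ℝ) 1, IsPrim (fun t => ∫ x in (0 : ℝ)..flow ρ y t, ρ t x * f t x)
      (fun s => ∫ x in (0 : ℝ)..flow ρ y s, G s x) 0 T) :
    IsPrim (fun t => ∫ x in (0 : ℝ)..1, ρ t x * f t x ^ 2)
      (fun s => 2 * ∫ x in (0 : ℝ)..1, f s x * G s x) 0 T := by
  obtain ⟨m, M, hm, hM0, hM⟩ := h.exists_bounds hT
  have h0 : (0 : ℝ) ∈ Icc (0 : ℝ) 1 := by simp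
  have h1 : (1 : ℝ) ∈ Icc (0 : ℝ) 1 := by simp
  have hmem : ∀ {n i : ℕ}, i ≤ n → (i / n : ℝ) ∈ Icc (0 : ℝ) 1 := fun {n i} hi =>
    ⟨by positivity, div_le_one_of_le₀ (by exact_mod_cast hi) (by positivity)⟩
  set X : ℕ → ℕ → ℝ → ℝ := fun n i t => flow ρ (i / n) t with hX
  have hXm : ∀ {n i : ℕ}, i ≤ n → ∀ {t}, t ∈ Icc 0 T → X n i t ∈ Icc (0 : ℝ) 1 :=
    fun hi t ht => h.flow_mem ht (hmem hi)
  have hρ : ∀ {t}, t ∈ Icc 0 T → ContinuousOn (ρ t) (Icc 0 1) := fun ht =>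
    h.regular.continuousOn_density ht.1
  have hcell : ∀ n : ℕ, ∀ i < n, IsPrim (fun t => ∫ x in X n i t..X n (i + 1) t, ρ t x * f t x)
      (fun s => ∫ x in X n i s..X n (i + 1) s, G s x) 0 T := by
    intro n i hi
    refine ((hfG _ (hmem (Nat.succ_le_of_lt hi))).sub (hfG _ (hmem hi.le)) hT).congr hT
      (fun t ht => ?_) ?_
    · have hi' := fun {b} (hb : b ∈ Icc (0 : ℝ) 1) => intervalIntegrable_weight_mul (hρ ht)
        (intervalIntegrable_of_memLp (hf t ht) h0 hb) h0 hb
      exact intervalIntegral.integral_interval_sub_left (hi' (hXm hi ht)) (hi' (hXm hi.le ht))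
    · filter_upwards [ae_memLp_slice hG, ae_restrict_mem measurableSet_Ioc] with s hs hsm
      have hsm' := Ioc_subset_Icc_self hsm
      exact intervalIntegral.integral_interval_sub_left
        (intervalIntegrable_of_memLp hs h0 (hXm hi hsm'))
        (intervalIntegrable_of_memLp hs h0 (hXm hi.le hsm'))
  have hdiv : ∀ {s}, s ∈ Icc 0 T → MemLp (G s) 2 unitMeasure →
      MemLp (fun x => (ρ s x)⁻¹ * G s x) 2 unitMeasure := fun hs hGs =>
    memLp_continuousOn_mul ((hρ hs).inv₀ fun x hx => (h.density_pos hs hx).ne') hGs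
  have hcancel : ∀ {s}, s ∈ Icc 0 T → ∀ {a b}, a ∈ Icc (0 : ℝ) 1 → b ∈ Icc (0 : ℝ) 1 →
      ∫ x in a..b, G s x = ∫ x in a..b, ρ s x * ((ρ s x)⁻¹ * G s x) := by
    intro s hs a b ha hb
    refine intervalIntegral.integral_congr fun x hx => ?_
    have := (h.density_pos hs (uIcc_subset_Icc ha hb hx)).ne'
    field_simp
  refine isPrim_of_tendsto hT
    (F := fun n t => ∑ i ∈ Finset.range n, n * (∫ x in X n i t..X n (i + 1) t, ρ t x * f t x) ^ 2)
    (F' := fun n s => ∑ i ∈ Finset.range n, n * (2 * (∫ x in X n i s..X n (i + 1) s, ρ s x * f s x) *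
      ∫ x in X n i s..X n (i + 1) s, G s x))
    (κ := fun s => B + normL2 (G s) ^ 2 * m⁻¹)
    (fun n => IsPrim.sum _ hT fun i hi => ((hcell n i (Finset.mem_range.1 hi)).sq hT).const_mul _ hT)
    (fun t ht => ?_) ?_ ?_
    (intervalIntegrable_const.add ((intervalIntegrable_normL2_sq hT hG).mul_const _))
  · exact tendsto_sum_mass_sq hm (hρ ht) (fun z hz => ((hM t ht).2.2 z hz).1) (hf t ht)
      (x := fun n i => X n i t) fun n hn => h.isMassPartition_flow hT ht hn
  · filter_upwards [ae_memLp_slice hG, ae_restrict_mem measurableSet_Ioc] with s hs hsm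
    have hsm' := Ioc_subset_Icc_self hsm
    have hlim := (tendsto_sum_mass_mul hm (hρ hsm') (fun z hz => ((hM s hsm').2.2 z hz).1)
      (hf s hsm') (hdiv hsm' hs) (x := fun n i => X n i s)
      fun n hn => h.isMassPartition_flow hT hsm' hn).const_mul 2
    have e : ∫ z in (0 : ℝ)..1, ρ s z * (f s z * ((ρ s z)⁻¹ * G s z)) =
        ∫ x in (0 : ℝ)..1, f s x * G s x := by
      refine intervalIntegral.integral_congr fun x hx => ?_
      have := (h.density_pos hsm' (uIcc_subset_Icc h0 h1 hx)).ne'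
      field_simp
    rw [e] at hlim
    refine hlim.congr fun n => ?_
    rw [Finset.mul_sum]
    refine Finset.sum_congr rfl fun i hi => ?_
    have hi := Finset.mem_range.1 hi
    rw [← hcancel hsm' (hXm hi.le hsm') (hXm hi hsm')]
    ring
  · filter_upwards [ae_memLp_slice hG, ae_restrict_mem measurableSet_Ioc] with s hs hsm n
    have hsm' := Ioc_subset_Icc_self hsm
    have hB0 : 0 ≤ ∫ x in (0 : ℝ)..1, ρ s x * f s x ^ 2 :=
      intervalIntegral.integral_nonneg zero_le_one fun x hx =>
        mul_nonneg (h.density_pos hsm' hx).le (sq_nonneg _)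
    rcases Nat.eq_zero_or_pos n with rfl | hn
    · simp only [Finset.range_zero, Finset.sum_empty, abs_zero]
      exact add_nonneg (hB0.trans (hB s hsm')) (by positivity)
    have hn' : (0 : ℝ) < n := by exact_mod_cast hn
    have hP := h.isMassPartition_flow hT hsm' hn
    have hpos := fun z hz => (h.density_pos hsm' (x := z) hz).le
    have b1 := (hP.sum_sq_le hn (hρ hsm') hpos (hf s hsm')).trans (hB s hsm')
    have b2 := hP.sum_sq_le hn (hρ hsm') hpos (hdiv hsm' hs)
    have b3 : ∫ x in (0 : ℝ)..1, ρ s x * ((ρ s x)⁻¹ * G s x) ^ 2 ≤ normL2 (G s) ^ 2 * m⁻¹ := by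
      rw [normL2_sq, ← integral_unit, ← intervalIntegral.integral_mul_const]
      refine intervalIntegral.integral_mono_on zero_le_one (intervalIntegrable_weight_mul (hρ hsm')
        (intervalIntegrable_sq_of_memLp (hdiv hsm' hs) h0 h1) h0 h1)
        ((intervalIntegrable_sq_of_memLp hs h0 h1).mul_const _) fun x hx => ?_
      have hp := h.density_pos hsm' hx
      have : ρ s x * ((ρ s x)⁻¹ * G s x) ^ 2 = G s x ^ 2 * (ρ s x)⁻¹ := by field_simp
      rw [this]
      exact mul_le_mul_of_nonneg_left (inv_anti₀ hm ((hM s hsm').2.2 x hx).1) (sq_nonneg _)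
    refine le_trans ?_ (add_le_add b1 (b2.trans b3))
    rw [← Finset.sum_add_distrib]
    refine (Finset.abs_sum_le_sum_abs _ _).trans (Finset.sum_le_sum fun i hi => ?_)
    have hi := Finset.mem_range.1 hi
    rw [hcancel hsm' (hXm hi.le hsm') (hXm hi hsm')]
    set a := ∫ x in X n i s..X n (i + 1) s, ρ s x * f s x
    set b := ∫ x in X n i s..X n (i + 1) s, ρ s x * ((ρ s x)⁻¹ * G s x)
    change |(n : ℝ) * (2 * a * b)| ≤ n * a ^ 2 + n * b ^ 2
    rw [abs_mul, abs_of_pos hn', ← mul_add]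
    refine mul_le_mul_of_nonneg_left ?_ hn'.le
    rw [abs_le]
    constructor <;> nlinarith [sq_nonneg (a + b), sq_nonneg (a - b)]

/-- The chain rule gives −∫(log ρ + 1)(ρu)_x. The flux ρu vanishes at both ends, so one integration
by parts leaves ∫(ρ_x/ρ)ρu. -/
theorem isPrim_integral_mul_log (h : IsPathSolution A T N ρ u w w₁ w₂) (hT : 0 ≤ T) :
    IsPrim (fun t => ∫ x in (0 : ℝ)..1, ρ t x * Real.log (ρ t x))
      (fun s => ∫ x in (0 : ℝ)..1, dx (ρ s) x * u s x) 0 T := by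
  have h0 : (0 : ℝ) ∈ Icc (0 : ℝ) 1 := by simp
  have h1 : (1 : ℝ) ∈ Icc (0 : ℝ) 1 := by simp
  refine (h.mass.isPrim_integral_comp hT (h.cont_density hT) (φ := fun z => z * Real.log z)
    (φ' := fun z => Real.log z + 1) (s := Ioi 0) (fun z hz => Real.hasDerivAt_mul_log hz.ne')
    ((Real.continuousOn_log.mono fun z hz => (ne_of_gt hz)).add continuousOn_const)
    fun t ht x hx => h.density_pos ht hx).congr hT (fun _ _ => rfl)
    ((ae_restrict_iff' measurableSet_Ioc).2 (Eventually.of_forall fun t ht => ?_))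
  have ht := Ioc_subset_Icc_self ht
  have hl := ((h.prim_density ht).log zero_le_one fun x hx => h.density_pos ht hx).add
    (IsPrim.const 1) zero_le_one
  have hp := (h.prim_density ht).mul (h.prim_velocity ht) zero_le_one
  have e := hl.integral_by_parts hp zero_le_one
  rw [(h.regular.phase t ht.1).velocity.2.1, (h.regular.phase t ht.1).velocity.2.2] at e
  have e1 : ∫ x in (0 : ℝ)..1, (dx (ρ t) x / ρ t x + 0) * (ρ t x * u t x) =
      ∫ x in (0 : ℝ)..1, dx (ρ t) x * u t x := by
    refine intervalIntegral.integral_congr fun x hx => ?_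
    have := (h.density_pos ht (uIcc_subset_Icc h0 h1 hx)).ne'
    field_simp
    ring
  beta_reduce
  rw [← e1, e]
  simp only [massRate, mul_neg, intervalIntegral.integral_neg]
  ring

end IsPathSolution

/-! ### The energy estimate -/

/-- `f` is integrable on `[0,1]` with integral `c`. -/
def HasIntegral (f : ℝ → ℝ) (c : ℝ) : Prop :=
  IntervalIntegrable f volume 0 1 ∧ ∫ x in (0 : ℝ)..1, f x = c

namespace HasIntegral

variable {f g : ℝ → ℝ} {a b : ℝ}

theorem of_intervalIntegrable (hf : IntervalIntegrable f volume 0 1) :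
    HasIntegral f (∫ x in (0 : ℝ)..1, f x) := ⟨hf, rfl⟩

theorem of_memLp_mul (hf : MemLp f 2 unitMeasure) (hg : MemLp g 2 unitMeasure) :
    HasIntegral (fun x => f x * g x) (∫ x in (0 : ℝ)..1, f x * g x) :=
  ⟨(intervalIntegrable_iff_integrableOn_Ioc_of_le zero_le_one).2 (hf.integrable_mul hg), rfl⟩

theorem of_isPrim (hf : IsPrim f g 0 1) : HasIntegral g (f 1 - f 0) :=
  ⟨hf.1, hf.integral_eq (by simp) (by simp)⟩

theorem add (hf : HasIntegral f a) (hg : HasIntegral g b) :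
    HasIntegral (fun x => f x + g x) (a + b) :=
  ⟨hf.1.add hg.1, by rw [intervalIntegral.integral_add hf.1 hg.1, hf.2, hg.2]⟩

theorem sub (hf : HasIntegral f a) (hg : HasIntegral g b) :
    HasIntegral (fun x => f x - g x) (a - b) :=
  ⟨hf.1.sub hg.1, by rw [intervalIntegral.integral_sub hf.1 hg.1, hf.2, hg.2]⟩

theorem const_mul (hf : HasIntegral f a) (c : ℝ) : HasIntegral (fun x => c * f x) (c * a) :=
  ⟨hf.1.const_mul c, by rw [intervalIntegral.integral_const_mul, hf.2]⟩

theorem const (c : ℝ) : HasIntegral (fun _ => c) c := ⟨by simp, by simp⟩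

theorem le (hf : HasIntegral f a) (hg : HasIntegral g b) (h : ∀ x ∈ Icc (0 : ℝ) 1, f x ≤ g x) :
    a ≤ b := by
  rw [← hf.2, ← hg.2]
  exact intervalIntegral.integral_mono_on zero_le_one hf.1 hg.1 h

theorem congr (hf : HasIntegral f a) (h : ∀ x ∈ Icc (0 : ℝ) 1, f x = g x) : HasIntegral g a := by
  have h' : EqOn f g (uIcc 0 1) := fun x hx => h x (by rwa [uIcc_of_le zero_le_one] at hx)
  exact ⟨hf.1.congr fun x hx => h' (uIoc_subset_uIcc hx),
    by rw [← hf.2]; exact (intervalIntegral.integral_congr h').symm⟩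

end HasIntegral

/-- The derivative of the effective velocity correction, `ρ_x / ρ²`. -/
noncomputable def osmotic (ρ : ℝ → ℝ) (x : ℝ) : ℝ := dx ρ x / ρ x ^ 2

/-- The energy of the velocities `u - w` and `u - w + ρ_x / ρ²`. -/
noncomputable def relEnergy (A : ℝ) (ρ u w : ℝ → ℝ) : ℝ :=
  1 / 2 * (∫ x in (0 : ℝ)..1, ρ x * (u x - w x) ^ 2) +
    1 / 2 * (∫ x in (0 : ℝ)..1, ρ x * (u x - w x + osmotic ρ x) ^ 2) +
    2 * A ^ 2 * ∫ x in (0 : ℝ)..1, ρ x * Real.log (ρ x)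

namespace InPhaseSpace

variable {A N : ℝ} {ρ u w w₁ : ℝ → ℝ}

theorem continuousOn_density (h : InPhaseSpace ρ u) : ContinuousOn ρ (Icc 0 1) :=
  h.density.isPrim.continuousOn zero_le_one

theorem continuousOn_velocity (h : InPhaseSpace ρ u) : ContinuousOn u (Icc 0 1) :=
  h.velocity.1.isPrim.continuousOn zero_le_one

theorem memLp_div (h : InPhaseSpace ρ u) : MemLp (fun x => dx ρ x / ρ x) 2 unitMeasure := by
  have := memLp_continuousOn_mul (h.continuousOn_density.inv₀ fun x hx => (h.pos x hx).ne')
    h.density.2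
  refine this.ae_eq (Eventually.of_forall fun x => ?_)
  simp only [div_eq_inv_mul, Pi.inv_apply]

theorem memLp_osmotic (h : InPhaseSpace ρ u) : MemLp (osmotic ρ) 2 unitMeasure := by
  have := memLp_continuousOn_mul ((h.continuousOn_density.pow 2).inv₀
    fun x hx => (pow_pos (h.pos x hx) 2).ne') h.density.2
  refine this.ae_eq (Eventually.of_forall fun x => ?_)
  simp only [div_eq_inv_mul, osmotic, Pi.inv_apply, Pi.pow_apply]

theorem hasIntegral_mul_sq (h : InPhaseSpace ρ u) {f : ℝ → ℝ} (hf : MemLp f 2 unitMeasure) :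
    HasIntegral (fun x => ρ x * f x ^ 2) (∫ x in (0 : ℝ)..1, ρ x * f x ^ 2) :=
  HasIntegral.of_intervalIntegrable (intervalIntegrable_weight_mul h.continuousOn_density
    (intervalIntegrable_sq_of_memLp hf (by simp) (by simp)) (by simp) (by simp))

theorem hasIntegral_density (h : InPhaseSpace ρ u) : HasIntegral ρ 1 :=
  ⟨(h.continuousOn_density.mono (by rw [uIcc_of_le zero_le_one])).intervalIntegrable, h.mass⟩

theorem hasIntegral_mul_log (h : InPhaseSpace ρ u) :
    HasIntegral (fun x => ρ x * Real.log (ρ x)) (∫ x in (0 : ℝ)..1, ρ x * Real.log (ρ x)) := by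
  refine HasIntegral.of_intervalIntegrable (ContinuousOn.intervalIntegrable ?_)
  rw [uIcc_of_le zero_le_one]
  exact h.continuousOn_density.mul (h.continuousOn_density.log fun x hx => (h.pos x hx).ne')

/-- From z log z ≥ z − 1 and the unit mass. Because of it `relEnergy` controls each of its quadratic
terms. -/
theorem integral_mul_log_nonneg (h : InPhaseSpace ρ u) :
    0 ≤ ∫ x in (0 : ℝ)..1, ρ x * Real.log (ρ x) := by
  have := (h.hasIntegral_density.sub (HasIntegral.const 1)).le h.hasIntegral_mul_log fun x hx => by
    have hp := h.pos x hx
    have h1 := Real.one_sub_inv_le_log_of_pos hp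
    calc ρ x - 1 = ρ x * (1 - (ρ x)⁻¹) := by field_simp
      _ ≤ _ := mul_le_mul_of_nonneg_left h1 hp.le
  linarith

/-- Completion of the square: ρ_x u/ρ + ½ρ_x²/ρ³ = ½ρ(u + ρ_x/ρ²)² − ½ρu². -/
theorem energy_eq (h : InPhaseSpace ρ u) : energy A ρ u =
    1 / 4 * (∫ x in (0 : ℝ)..1, ρ x * u x ^ 2) +
      1 / 4 * (∫ x in (0 : ℝ)..1, ρ x * (u x + osmotic ρ x) ^ 2) +
      A ^ 2 * ∫ x in (0 : ℝ)..1, ρ x * Real.log (ρ x) := by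
  have hu : MemLp u 2 unitMeasure := memLp_of_continuousOn h.continuousOn_velocity 2
  have i1 := h.hasIntegral_mul_sq hu
  have i2 := h.hasIntegral_mul_sq (hu.add h.memLp_osmotic)
  have i3 := h.hasIntegral_mul_log
  have e1 : HasIntegral (fun x => 1 / 2 * ρ x * u x ^ 2 + A ^ 2 * ρ x * Real.log (ρ x)) _ :=
    ((i1.const_mul (1 / 2)).add (i3.const_mul (A ^ 2))).congr fun x _ => by ring
  have e2 : HasIntegral (fun x => dx ρ x * u x / ρ x + 1 / 2 * (dx ρ x ^ 2 / ρ x ^ 3)) _ :=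
    ((i2.const_mul (1 / 2)).sub (i1.const_mul (1 / 2))).congr fun x hx => by
      have := (h.pos x hx).ne'
      simp only [Pi.add_apply, osmotic]
      field_simp
      ring
  rw [energy, entropy, e1.2, e2.2]
  simp only [Pi.add_apply]
  ring

theorem two_mul_energy_eq (h : InPhaseSpace ρ u) (hw : ∀ x ∈ Icc (0 : ℝ) 1, w x = 0) :
    relEnergy A ρ u w = 2 * energy A ρ u := by
  have hw' : ∀ x ∈ uIcc (0 : ℝ) 1, w x = 0 := fun x hx => hw x (by
    rwa [uIcc_of_le zero_le_one] at hx)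
  have e1 : ∫ x in (0 : ℝ)..1, ρ x * (u x - w x) ^ 2 = ∫ x in (0 : ℝ)..1, ρ x * u x ^ 2 :=
    intervalIntegral.integral_congr fun x hx => by simp only [hw' x hx, sub_zero]
  have e2 : ∫ x in (0 : ℝ)..1, ρ x * (u x - w x + osmotic ρ x) ^ 2 =
      ∫ x in (0 : ℝ)..1, ρ x * (u x + osmotic ρ x) ^ 2 :=
    intervalIntegral.integral_congr fun x hx => by simp only [hw' x hx, sub_zero]
  rw [h.energy_eq, relEnergy, e1, e2]
  ring

theorem memLp_rel (h : InPhaseSpace ρ u) (hw : ContinuousOn w (Icc 0 1)) :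
    MemLp (fun x => u x - w x) 2 unitMeasure :=
  memLp_of_continuousOn (h.continuousOn_velocity.sub hw) 2

theorem memLp_effective (h : InPhaseSpace ρ u) (hw : ContinuousOn w (Icc 0 1)) :
    MemLp (fun x => u x - w x + osmotic ρ x) 2 unitMeasure :=
  (h.memLp_rel hw).add h.memLp_osmotic

theorem integral_mul_sq_nonneg (h : InPhaseSpace ρ u) (f : ℝ → ℝ) :
    0 ≤ ∫ x in (0 : ℝ)..1, ρ x * f x ^ 2 :=
  intervalIntegral.integral_nonneg zero_le_one fun x hx => mul_nonneg (h.pos x hx).le (sq_nonneg _)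

theorem integral_le_relEnergy (h : InPhaseSpace ρ u) :
    1 / 2 * (∫ x in (0 : ℝ)..1, ρ x * (u x - w x) ^ 2) +
      1 / 2 * (∫ x in (0 : ℝ)..1, ρ x * (u x - w x + osmotic ρ x) ^ 2) ≤ relEnergy A ρ u w := by
  have := mul_nonneg (by positivity : 0 ≤ 2 * A ^ 2) h.integral_mul_log_nonneg
  rw [relEnergy]
  linarith

theorem relEnergy_nonneg (h : InPhaseSpace ρ u) : 0 ≤ relEnergy A ρ u w := by
  have h1 := h.integral_mul_sq_nonneg fun x => u x - w x
  have h2 := h.integral_mul_sq_nonneg fun x => u x - w x + osmotic ρ x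
  have h3 := h.integral_le_relEnergy (A := A) (w := w)
  linarith

theorem energy_le_relEnergy (h : InPhaseSpace ρ u) (hw : ContinuousOn w (Icc 0 1))
    (hN : ∀ x ∈ Icc (0 : ℝ) 1, |w x| ≤ N) : energy A ρ u ≤ relEnergy A ρ u w + N ^ 2 := by
  have hu : MemLp u 2 unitMeasure := memLp_of_continuousOn h.continuousOn_velocity 2
  have i1 := h.hasIntegral_mul_sq hu
  have i2 := h.hasIntegral_mul_sq (hu.add h.memLp_osmotic)
  have j1 := h.hasIntegral_mul_sq (h.memLp_rel hw)
  have j2 := h.hasIntegral_mul_sq (h.memLp_effective hw)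
  have hle := ((i1.add i2).const_mul (1 / 4)).le
    (((j1.add j2).const_mul (1 / 2)).add (h.hasIntegral_density.const_mul (N ^ 2))) fun x hx => by
      have hp := h.pos x hx
      have h1 : w x ^ 2 ≤ N ^ 2 := sq_le_sq' (abs_le.1 (hN x hx)).1 (abs_le.1 (hN x hx)).2
      have h2 : 1 / 4 * (u x ^ 2 + (u x + osmotic ρ x) ^ 2) ≤
          1 / 2 * ((u x - w x) ^ 2 + (u x - w x + osmotic ρ x) ^ 2) + N ^ 2 := by
        nlinarith [sq_nonneg (u x - 2 * w x), sq_nonneg (u x + osmotic ρ x - 2 * w x)]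
      simp only [Pi.add_apply]
      nlinarith
  have h3 := mul_nonneg (sq_nonneg A) h.integral_mul_log_nonneg
  rw [h.energy_eq, relEnergy]
  simp only [Pi.add_apply] at hle
  linarith

theorem normL2_dx_log (h : InPhaseSpace ρ u) :
    normL2 (dx fun x => Real.log (ρ x)) ^ 2 = ∫ x in (0 : ℝ)..1, (dx ρ x / ρ x) ^ 2 := by
  rw [normL2_sq, integral_unit]
  refine integral_congr_ae ?_
  filter_upwards [dx_ae_eq_of_isPrim (h.density.isPrim.log zero_le_one h.pos)] with x hx
  rw [hx]

/-- The dissipation inequality at a fixed time. -/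
theorem rate_le (h : InPhaseSpace ρ u) (h2 : IsH2 u) (hw : IsPrim w w₁ 0 1)
    (hw₁ : ContinuousOn w₁ (Icc 0 1)) (h0 : w 0 = 0) (h1 : w 1 = 0)
    (hN : ∀ x ∈ Icc (0 : ℝ) 1, |w x| ≤ N) (hN₁ : ∀ x ∈ Icc (0 : ℝ) 1, |w₁ x| ≤ N) :
    (∫ x in (0 : ℝ)..1, (u x - w x) * velocityRate A ρ u w₁ x) +
      (∫ x in (0 : ℝ)..1, (u x - w x + osmotic ρ x) * effectiveRate A ρ u w₁ x) +
      2 * A ^ 2 * (∫ x in (0 : ℝ)..1, dx ρ x * u x) ≤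
    -(1 / 2 * dissipation A ρ u) + (1 / 2 * N ^ 2 + 2 * A ^ 2 * N + N ^ 3 +
      4 * N * relEnergy A ρ u w) := by
  have hwc := hw.continuousOn zero_le_one
  have hN0 : 0 ≤ N := (abs_nonneg _).trans (hN 0 (by simp))
  have hu : MemLp u 2 unitMeasure := memLp_of_continuousOn h.continuousOn_velocity 2
  have hv := h.memLp_rel hwc
  have hV := h.memLp_effective hwc
  have hr : MemLp (fun x => ρ x * u x * w₁ x) 2 unitMeasure :=
    memLp_of_continuousOn ((h.continuousOn_density.mul h.continuousOn_velocity).mul hw₁) 2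
  have hG : MemLp (velocityRate A ρ u w₁) 2 unitMeasure :=
    (h2.2.2.sub (h.density.2.const_mul (A ^ 2))).sub hr
  have hG' : MemLp (effectiveRate A ρ u w₁) 2 unitMeasure :=
    (h.density.2.const_mul (A ^ 2)).neg.sub hr
  have l1 := HasIntegral.of_memLp_mul hv hG
  have l2 := HasIntegral.of_memLp_mul hV hG'
  have l3 := (HasIntegral.of_memLp_mul h.density.2 hu).const_mul (2 * A ^ 2)
  -- `r1` and `r2` are integrals of the exact derivatives ((u − w)u_x)_x and (wρ)_x, and both vanish
  -- because u and w are zero at the ends. Adding them to the right side carries out the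
  -- integrations by parts, and a pointwise inequality remains. In it the terms 2A²ρ_x u cancel,
  -- leaving 2A²ρ_x w and the dissipation −A²ρ_x²/ρ².
  have r1 := HasIntegral.of_isPrim ((h.velocity.1.isPrim.sub hw zero_le_one).mul h2.2.isPrim
    zero_le_one)
  have r2 := (HasIntegral.of_isPrim (hw.mul h.density.isPrim zero_le_one)).const_mul (2 * A ^ 2)
  have r3 := (HasIntegral.of_intervalIntegrable (intervalIntegrable_sq_of_memLp h.velocity.1.2
    (a := 0) (b := 1) (by simp) (by simp))).const_mul (1 / 2)
  have r4 := (HasIntegral.of_intervalIntegrable (intervalIntegrable_sq_of_memLp h.memLp_div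
    (a := 0) (b := 1) (by simp) (by simp))).const_mul (A ^ 2)
  have r5 := HasIntegral.const (1 / 2 * N ^ 2)
  have r6 := h.hasIntegral_density.const_mul (2 * A ^ 2 * N + N ^ 3)
  have r7 := (h.hasIntegral_mul_sq hv).const_mul (2 * N)
  have r8 := (h.hasIntegral_mul_sq hV).const_mul (2 * N)
  have hle := ((l1.add l2).add l3).le ((((((r1.add r2).sub r3).sub r4).add r5).add r6).add
    (r7.add r8)) fun x hx => by
      have hp := h.pos x hx
      have e1 : osmotic ρ x * dx ρ x = (dx ρ x / ρ x) ^ 2 := by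
        simp only [osmotic]; field_simp
      simp only [velocityRate, effectiveRate]
      have b1 : w₁ x * dx u x ≤ 1 / 2 * dx u x ^ 2 + 1 / 2 * N ^ 2 := by
        have : w₁ x ^ 2 ≤ N ^ 2 := sq_le_sq' (abs_le.1 (hN₁ x hx)).1 (abs_le.1 (hN₁ x hx)).2
        nlinarith [sq_nonneg (w₁ x - dx u x)]
      have b2 : -(w₁ x * ρ x) ≤ N * ρ x := by
        have := (abs_le.1 (hN₁ x hx)).1
        nlinarith
      -- The forcing −ρu w_x acts on v and on V. Writing u = v + w bounds it by N times squares of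
      -- v, V and N, which is the term that Gronwall's lemma has to handle.
      have b3 : -(u x * w₁ x * ((u x - w x) + (u x - w x + osmotic ρ x))) ≤
          N * (2 * (u x - w x) ^ 2 + 2 * (u x - w x + osmotic ρ x) ^ 2 + N ^ 2) := by
        set v := u x - w x with hvdef
        set V := v + osmotic ρ x
        have hux : |u x| ≤ |v| + N := by
          have e : u x = v + w x := by rw [hvdef]; ring
          rw [e]
          exact (abs_add_le _ _).trans (add_le_add le_rfl (hN x hx))
        have hb : |u x * w₁ x * (v + V)| ≤ (|v| + N) * N * (|v| + |V|) := by
          rw [abs_mul, abs_mul]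
          exact mul_le_mul (mul_le_mul hux (hN₁ x hx) (abs_nonneg _) (by positivity))
            (abs_add_le _ _) (abs_nonneg _) (by positivity)
        refine (neg_le_abs _).trans (hb.trans ?_)
        have : (|v| + N) * (|v| + |V|) ≤ 2 * v ^ 2 + 2 * V ^ 2 + N ^ 2 := by
          rw [← sq_abs v, ← sq_abs V]
          nlinarith [sq_nonneg (|v| - |V|), sq_nonneg (|v| - N), sq_nonneg (|V| - N), sq_nonneg |V|]
        calc _ = N * ((|v| + N) * (|v| + |V|)) := by ring
          _ ≤ _ := mul_le_mul_of_nonneg_left this hN0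
      have b2' := mul_le_mul_of_nonneg_left b2 (by positivity : 0 ≤ 2 * A ^ 2)
      have b3' := mul_le_mul_of_nonneg_left b3 hp.le
      nlinarith [b1, b2', b3', e1]
  rw [h.velocity.2.1, h.velocity.2.2, h0, h1] at hle
  have hE := h.integral_le_relEnergy (A := A) (w := w)
  have hE' := mul_le_mul_of_nonneg_left hE (by positivity : 0 ≤ 4 * N)
  have hD : dissipation A ρ u = (∫ x in (0 : ℝ)..1, dx u x ^ 2) +
      A ^ 2 * ∫ x in (0 : ℝ)..1, (dx ρ x / ρ x) ^ 2 := by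
    rw [dissipation, h.normL2_dx_log, normL2_sq, ← integral_unit]
  have h5 : 0 ≤ A ^ 2 * ∫ x in (0 : ℝ)..1, (dx ρ x / ρ x) ^ 2 := mul_nonneg (sq_nonneg _)
    (intervalIntegral.integral_nonneg zero_le_one fun x _ => sq_nonneg _)
  rw [hD]
  linarith

end InPhaseSpace

/-! ### Gronwall's lemma and the uniform energy bound. -/

theorem IsPrim.gronwall {Y Y' D : ℝ → ℝ} {T C K : ℝ} (hT : 0 ≤ T) (hY : IsPrim Y Y' 0 T)
    (hD : IntervalIntegrable D volume 0 T) (hD0 : ∀ s ∈ Icc 0 T, 0 ≤ D s)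
    (hY0 : ∀ s ∈ Icc 0 T, 0 ≤ Y s) (hC : 0 ≤ C) (hK : 0 ≤ K)
    (h : ∀ᵐ s ∂(volume.restrict (Ioc 0 T)), Y' s ≤ -(1 / 2 * D s) + (C + K * Y s)) :
    (∀ t ∈ Icc 0 T, Y t ≤ Real.exp (K * T) * (Y 0 + C * T)) ∧
      ∫ s in (0 : ℝ)..T, D s ≤ 2 * (Y 0 + (C + K * (Real.exp (K * T) * (Y 0 + C * T))) * T) := by
  have hmain : ∀ t ∈ Icc 0 T, Y t ≤ Real.exp (K * T) * (Y 0 + C * T) := by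
    intro t ht
    -- With the integrating factor e^{−Kt}, the product e^{−Kt}Y grows at most at the rate C.
    have he : IsPrim (fun t => Real.exp (-K * t)) (fun t => Real.exp (-K * t) * -K) 0 T := by
      have h1 : IsPrim (fun t : ℝ => -K * t) (fun _ => -K) 0 T :=
        ⟨by simp, fun x _ => by simp; ring⟩
      exact h1.comp (s := univ) hT (fun z _ => Real.hasDerivAt_exp z) Real.continuous_exp.continuousOn
        fun _ _ => mem_univ _
    have hp := (he.mul hY hT).mono le_rfl ht.1 ht.2
    have e := hp.integral_eq (x := 0) (y := t) ⟨le_rfl, ht.1⟩ ⟨ht.1, le_rfl⟩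
    have hle : ∫ z in (0 : ℝ)..t, Real.exp (-K * z) * -K * Y z + Real.exp (-K * z) * Y' z ≤
        ∫ z in (0 : ℝ)..t, C := by
      refine intervalIntegral.integral_mono_ae_restrict ht.1 hp.1 (by simp) ?_
      rw [Measure.restrict_congr_set Ioc_ae_eq_Icc.symm]
      have hsub : Ioc 0 t ⊆ Ioc 0 T := Ioc_subset_Ioc_right ht.2
      filter_upwards [ae_restrict_of_ae_restrict_of_subset hsub h, ae_restrict_mem measurableSet_Ioc]
        with s hs hsm
      have hs0 := hD0 s ⟨hsm.1.le, hsm.2.trans ht.2⟩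
      have h1 : Real.exp (-K * s) ≤ 1 := Real.exp_le_one_iff.2 (by nlinarith [hsm.1])
      calc _ = Real.exp (-K * s) * (Y' s - K * Y s) := by ring
        _ ≤ Real.exp (-K * s) * C := mul_le_mul_of_nonneg_left (by linarith) (Real.exp_pos _).le
        _ ≤ 1 * C := mul_le_mul_of_nonneg_right h1 hC
        _ = C := one_mul C
    rw [e] at hle
    simp only [mul_zero, Real.exp_zero, one_mul, intervalIntegral.integral_const, smul_eq_mul,
      sub_zero] at hle
    have h2 : Y t = Real.exp (K * t) * (Real.exp (-K * t) * Y t) := by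
      rw [← mul_assoc, ← Real.exp_add]; simp
    have h3 := hY0 0 ⟨le_rfl, hT⟩
    rw [h2]
    have h4 : t * C ≤ C * T := by nlinarith [ht.2]
    refine mul_le_mul (Real.exp_le_exp.2 (mul_le_mul_of_nonneg_left ht.2 hK)) (by linarith)
      (mul_nonneg (Real.exp_pos _).le (hY0 t ht)) (Real.exp_pos _).le
  refine ⟨hmain, ?_⟩
  set B := Real.exp (K * T) * (Y 0 + C * T)
  have h0T : (0 : ℝ) ∈ Icc 0 T := ⟨le_rfl, hT⟩
  have hTT : T ∈ Icc 0 T := ⟨hT, le_rfl⟩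
  -- The differential inequality is used a second time, now with Y ≤ B inserted, to read off the
  -- integral of D.
  have hle : ∫ s in (0 : ℝ)..T, D s ≤ ∫ s in (0 : ℝ)..T, (2 * (C + K * B) - 2 * Y' s) := by
    refine intervalIntegral.integral_mono_ae_restrict hT hD
      (intervalIntegrable_const.sub (hY.1.const_mul 2)) ?_
    rw [Measure.restrict_congr_set Ioc_ae_eq_Icc.symm]
    filter_upwards [h, ae_restrict_mem measurableSet_Ioc] with s hs hsm
    have := mul_le_mul_of_nonneg_left (hmain s (Ioc_subset_Icc_self hsm)) hK
    linarith
  rw [intervalIntegral.integral_sub intervalIntegrable_const (hY.1.const_mul 2),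
    intervalIntegral.integral_const_mul (2 : ℝ) Y', hY.integral_eq h0T hTT] at hle
  simp only [intervalIntegral.integral_const, smul_eq_mul, sub_zero] at hle
  have := hY0 T hTT
  linarith

namespace IsPathSolution

variable {A T N : ℝ} {ρ u w w₁ w₂ : ℝ → ℝ → ℝ}

theorem memLp_effectiveRate (h : IsPathSolution A T N ρ u w w₁ w₂) (hT : 0 ≤ T) :
    MemLp (fun p : ℝ × ℝ => effectiveRate A (ρ p.1) (u p.1) (w₁ p.1) p.2) 2 (spaceTime T) := by
  have hc : MemLp (fun p : ℝ × ℝ => ρ p.1 p.2 * u p.1 p.2 * w₁ p.1 p.2) 2 (spaceTime T) :=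
    memLp_spaceTime_of_continuousOn (f := fun t x => ρ t x * u t x * w₁ t x)
      (((h.cont_density hT).mul (h.cont_velocity hT)).mul h.noise.cont₁) 2
  exact ((h.regular.density_x T).const_mul (A ^ 2)).neg.sub hc

theorem memLp_velocityRate (h : IsPathSolution A T N ρ u w w₁ w₂) (hT : 0 ≤ T) :
    MemLp (fun p : ℝ × ℝ => velocityRate A (ρ p.1) (u p.1) (w₁ p.1) p.2) 2 (spaceTime T) := by
  have hc : MemLp (fun p : ℝ × ℝ => ρ p.1 p.2 * u p.1 p.2 * w₁ p.1 p.2) 2 (spaceTime T) :=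
    memLp_spaceTime_of_continuousOn (f := fun t x => ρ t x * u t x * w₁ t x)
      (((h.cont_density hT).mul (h.cont_velocity hT)).mul h.noise.cont₁) 2
  exact ((h.regular.velocity_xx T).sub ((h.regular.density_x T).const_mul (A ^ 2))).sub hc

theorem exists_integral_mul_sq_le (h : IsPathSolution A T N ρ u w w₁ w₂) (hT : 0 ≤ T) :
    ∃ B, ∀ t ∈ Icc 0 T, (∫ x in (0 : ℝ)..1, ρ t x * (u t x - w t x) ^ 2 ≤ B) ∧
      ∫ x in (0 : ℝ)..1, ρ t x * (u t x - w t x + osmotic (ρ t) x) ^ 2 ≤ B := by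
  obtain ⟨m, M, hm, hM0, hM⟩ := h.exists_bounds hT
  have hN := h.noise.bound_nonneg hT
  have key : ∀ t ∈ Icc 0 T, (∫ x in (0 : ℝ)..1, ρ t x * (u t x - w t x) ^ 2 ≤ M * (M + N) ^ 2) ∧
      ∫ x in (0 : ℝ)..1, ρ t x * osmotic (ρ t) x ^ 2 ≤ (m ^ 3)⁻¹ * M ^ 2 := by
    intro t ht
    have hp := h.regular.phase t ht.1
    have hwc := continuousOn_slice h.noise.cont ht
    constructor
    · refine (hp.hasIntegral_mul_sq (hp.memLp_rel hwc)).le (HasIntegral.const _) fun x hx => ?_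
      obtain ⟨-, b1, b2⟩ := (hM t ht).2.2 x hx
      have b3 : |u t x - w t x| ≤ M + N :=
        (abs_sub _ _).trans (add_le_add b2 (h.noise.abs_w_le ht hx))
      exact mul_le_mul b1 (sq_le_sq' (abs_le.1 b3).1 (abs_le.1 b3).2) (sq_nonneg _) hM0
    · have hd := HasIntegral.of_intervalIntegrable (intervalIntegrable_sq_of_memLp
        hp.density.2 (a := 0) (b := 1) (by simp) (by simp))
      refine ((hp.hasIntegral_mul_sq hp.memLp_osmotic).le (hd.const_mul (m ^ 3)⁻¹) fun x hx => ?_).trans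
        (mul_le_mul_of_nonneg_left ?_ (by positivity))
      · have hpos := hp.pos x hx
        have e : ρ t x * osmotic (ρ t) x ^ 2 = (ρ t x ^ 3)⁻¹ * dx (ρ t) x ^ 2 := by
          simp only [osmotic]; field_simp
        rw [e]
        exact mul_le_mul_of_nonneg_right (inv_anti₀ (by positivity)
          (pow_le_pow_left₀ hm.le ((hM t ht).2.2 x hx).1 3)) (sq_nonneg _)
      · rw [integral_unit, ← normL2_sq]
        exact pow_le_pow_left₀ (normL2_nonneg _) (hM t ht).1 2
  refine ⟨2 * (M * (M + N) ^ 2) + 2 * ((m ^ 3)⁻¹ * M ^ 2), fun t ht => ?_⟩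
  obtain ⟨k1, k2⟩ := key t ht
  have hp := h.regular.phase t ht.1
  have hwc := continuousOn_slice h.noise.cont ht
  have e0 : 0 ≤ M * (M + N) ^ 2 := by positivity
  have e1 : 0 ≤ (m ^ 3)⁻¹ * M ^ 2 := by positivity
  refine ⟨by linarith, ?_⟩
  refine ((hp.hasIntegral_mul_sq (hp.memLp_effective hwc)).le
    (((hp.hasIntegral_mul_sq (hp.memLp_rel hwc)).const_mul 2).add
      ((hp.hasIntegral_mul_sq hp.memLp_osmotic).const_mul 2)) fun x hx => ?_).trans (by linarith)
  have hpos := hp.pos x hx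
  nlinarith [mul_nonneg hpos.le (sq_nonneg (u t x - w t x - osmotic (ρ t) x))]

theorem isPrim_relEnergy (h : IsPathSolution A T N ρ u w w₁ w₂) (hT : 0 ≤ T) :
    IsPrim (fun t => relEnergy A (ρ t) (u t) (w t)) (fun s =>
      (∫ x in (0 : ℝ)..1, (u s x - w s x) * velocityRate A (ρ s) (u s) (w₁ s) x) +
      (∫ x in (0 : ℝ)..1, (u s x - w s x + osmotic (ρ s) x) *
        effectiveRate A (ρ s) (u s) (w₁ s) x) +
      2 * A ^ 2 * (∫ x in (0 : ℝ)..1, dx (ρ s) x * u s x)) 0 T := by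
  obtain ⟨B, hB⟩ := h.exists_integral_mul_sq_le hT
  have h1 := h.isPrim_integral_sq hT (f := fun t x => u t x - w t x)
    (G := fun s => velocityRate A (ρ s) (u s) (w₁ s))
    (fun t ht => (h.regular.phase t ht.1).memLp_rel (continuousOn_slice h.noise.cont ht))
    (fun t ht => (hB t ht).1) (h.memLp_velocityRate hT) fun y hy => h.isPrim_integral_momentum hT hy
  have h2 := h.isPrim_integral_sq hT (f := fun t x => u t x - w t x + osmotic (ρ t) x)
    (G := fun s => effectiveRate A (ρ s) (u s) (w₁ s))
    (fun t ht => (h.regular.phase t ht.1).memLp_effective (continuousOn_slice h.noise.cont ht))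
    (fun t ht => (hB t ht).2) (h.memLp_effectiveRate hT) fun y hy => h.isPrim_integral_effective hT hy
  refine (((h1.const_mul (1 / 2) hT).add (h2.const_mul (1 / 2) hT) hT).add
    ((h.isPrim_integral_mul_log hT).const_mul (2 * A ^ 2) hT) hT).congr hT (fun _ _ => rfl)
    (Eventually.of_forall fun s => ?_)
  beta_reduce
  ring

theorem intervalIntegrable_dissipation (h : IsPathSolution A T N ρ u w w₁ w₂) (hT : 0 ≤ T) :
    IntervalIntegrable (fun s => dissipation A (ρ s) (u s)) volume 0 T := by
  have hinv : ContinuousOn (fun p : ℝ × ℝ => (ρ p.1 p.2)⁻¹) (Icc 0 T ×ˢ Icc 0 1) :=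
    (h.cont_density hT).inv₀ fun p hp => (h.density_pos hp.1 hp.2).ne'
  have h1 : MemLp (fun p : ℝ × ℝ => dx (ρ p.1) p.2 / ρ p.1 p.2) 2 (spaceTime T) := by
    refine ((h.regular.density_x T).mul
      (memLp_spaceTime_of_continuousOn (f := fun t x => (ρ t x)⁻¹) hinv ⊤)).ae_eq
      (Eventually.of_forall fun p => ?_)
    simp only [Pi.mul_apply, div_eq_inv_mul]
  refine ((intervalIntegrable_normL2_sq (f := fun t x => dx (u t) x) hT (h.regular.velocity_x T)).add
    ((intervalIntegrable_normL2_sq (f := fun t x => dx (ρ t) x / ρ t x) hT h1).const_mul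
      (A ^ 2))).congr fun s hs => ?_
  rw [uIoc_of_le hT] at hs
  have hp := h.regular.phase s hs.1.le
  simp only [dissipation]
  rw [hp.normL2_dx_log, normL2_sq (fun x => dx (ρ s) x / ρ s x), ← integral_unit]

theorem ae_rate_le (h : IsPathSolution A T N ρ u w w₁ w₂) :
    ∀ᵐ s ∂(volume.restrict (Ioc 0 T)),
      (∫ x in (0 : ℝ)..1, (u s x - w s x) * velocityRate A (ρ s) (u s) (w₁ s) x) +
      (∫ x in (0 : ℝ)..1, (u s x - w s x + osmotic (ρ s) x) *
        effectiveRate A (ρ s) (u s) (w₁ s) x) +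
      2 * A ^ 2 * (∫ x in (0 : ℝ)..1, dx (ρ s) x * u s x) ≤
      -(1 / 2 * dissipation A (ρ s) (u s)) + ((1 / 2 * N ^ 2 + 2 * A ^ 2 * N + N ^ 3) +
        4 * N * relEnergy A (ρ s) (u s) (w s)) := by
  filter_upwards [h.ae_isH2, ae_restrict_mem measurableSet_Ioc] with s hs hsm
  have hsm := Ioc_subset_Icc_self hsm
  exact (h.regular.phase s hsm.1).rate_le hs (h.noise.prim s hsm)
    (continuousOn_slice h.noise.cont₁ hsm) (h.noise.left s hsm) (h.noise.right s hsm)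
    (fun x hx => h.noise.abs_w_le hsm hx) fun x hx => h.noise.abs_w₁_le hsm hx

end IsPathSolution

theorem dissipation_nonneg (A : ℝ) (ρ u : ℝ → ℝ) : 0 ≤ dissipation A ρ u := by
  unfold dissipation; positivity

/-- The energy bound, uniform over all path solutions with the given data. -/
theorem exists_energy_bound (A T N e : ℝ) (hT : 0 ≤ T) : ∃ B, 0 ≤ B ∧
    ∀ ρ u w w₁ w₂, IsPathSolution A T N ρ u w w₁ w₂ → energy A (ρ 0) (u 0) ≤ e →
      IntervalIntegrable (fun s => dissipation A (ρ s) (u s)) volume 0 T ∧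
      ∫ s in (0 : ℝ)..T, dissipation A (ρ s) (u s) ≤ B ∧
      ∀ t ∈ Icc 0 T, relEnergy A (ρ t) (u t) (w t) ≤ B ∧ energy A (ρ t) (u t) ≤ B := by
  -- The bound has to be nonnegative for every N and e, including values for which no path solution
  -- exists; when one exists, N ≥ 0 and N' = N.
  set N' := max N 0 with hN'
  set C := 1 / 2 * N' ^ 2 + 2 * A ^ 2 * N' + N' ^ 3 with hC
  have hN0 : 0 ≤ N' := le_max_right _ _
  have hC0 : 0 ≤ C := by positivity
  -- The factor 2 appears because w vanishes at time zero, where `relEnergy` is twice the energy.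
  set e' := 2 * max e 0 with he'
  have he0 : 0 ≤ e' := by positivity
  set B₀ := Real.exp (4 * N' * T) * (e' + C * T) with hB₀
  have hB0 : 0 ≤ B₀ := by positivity
  refine ⟨B₀ + N' ^ 2 + 2 * (e' + (C + 4 * N' * B₀) * T), by positivity,
    fun ρ u w w₁ w₂ h hle => ?_⟩
  have hNN : N' = N := max_eq_left (h.noise.bound_nonneg hT)
  have hI := h.intervalIntegrable_dissipation hT
  have h0 : (0 : ℝ) ∈ Icc 0 T := ⟨le_rfl, hT⟩
  have hinit : relEnergy A (ρ 0) (u 0) (w 0) ≤ e' := by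
    rw [(h.regular.phase 0 le_rfl).two_mul_energy_eq fun x hx => h.noise.zero x hx, he']
    have := le_max_left e 0
    linarith
  obtain ⟨g1, g2⟩ := (h.isPrim_relEnergy hT).gronwall hT hI
    (fun s _ => dissipation_nonneg _ _ _)
    (fun s hs => (h.regular.phase s hs.1).relEnergy_nonneg) hC0
    (by positivity : 0 ≤ 4 * N') (by rw [hC, hNN]; exact h.ae_rate_le)
  have hmono : Real.exp (4 * N' * T) * (relEnergy A (ρ 0) (u 0) (w 0) + C * T) ≤ B₀ :=
    mul_le_mul_of_nonneg_left (by linarith) (Real.exp_pos _).le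
  have hx1 : 0 ≤ 2 * (e' + (C + 4 * N' * B₀) * T) := by positivity
  refine ⟨hI, g2.trans ?_, fun t ht => ?_⟩
  · have h1 : (C + 4 * N' * (Real.exp (4 * N' * T) * (relEnergy A (ρ 0) (u 0) (w 0) + C * T))) * T ≤
        (C + 4 * N' * B₀) * T := by gcongr
    nlinarith [sq_nonneg N']
  · have h1 := (g1 t ht).trans hmono
    have h2 := (h.regular.phase t ht.1).energy_le_relEnergy (A := A) (N := N')
      (continuousOn_slice h.noise.cont ht) fun x hx => by
        rw [hNN]; exact h.noise.abs_w_le ht hx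
    constructor <;> nlinarith [sq_nonneg N']

/-- Unit mass gives a point with log ρ = 0. From there log ρ changes by at most ∫|ρ_x|/ρ = ∫√ρ ·
√ρ|ρ_x/ρ²|, and Cauchy–Schwarz applies with ∫ρ = 1. Since ρ_x/ρ² is the difference of the two
velocities in `relEnergy`, its weighted square integral is at most 4B. -/
theorem InPhaseSpace.abs_log_le {A B : ℝ} {ρ u w : ℝ → ℝ} (h : InPhaseSpace ρ u)
    (hw : ContinuousOn w (Icc 0 1)) (hB : relEnergy A ρ u w ≤ B) {x : ℝ} (hx : x ∈ Icc (0 : ℝ) 1) :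
    |Real.log (ρ x)| ≤ 2 * √B := by
  obtain ⟨x₀, hx₀, h1⟩ := exists_eq_one_of_mass h.continuousOn_density h.mass
  have hlog := h.density.isPrim.log zero_le_one h.pos
  have e1 := hlog.integral_eq hx₀ hx
  rw [h1, Real.log_one, sub_zero] at e1
  have hsq : ContinuousOn (fun y => √(ρ y)) (Icc 0 1) :=
    Real.continuous_sqrt.comp_continuousOn h.continuousOn_density
  have hi : IntegrableOn (fun y => |dx ρ y / ρ y|) (Ioc 0 1) :=
    (h.memLp_div.integrable (by norm_num)).abs
  have hae : ∀ᵐ y ∂unitMeasure, y ∈ Ioc (0 : ℝ) 1 := ae_restrict_mem measurableSet_Ioc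
  have e2 : |Real.log (ρ x)| ≤ ∫ y, |dx ρ y / ρ y| ∂unitMeasure := by
    rw [← e1, ← Real.norm_eq_abs]
    refine intervalIntegral.norm_integral_le_integral_norm_uIoc.trans ?_
    refine setIntegral_mono_set hi (Eventually.of_forall fun y => abs_nonneg _)
      (LE.le.eventuallyLE (show uIoc x₀ x ≤ Ioc 0 1 from ?_))
    rcases le_total x₀ x with hle | hle
    · rw [uIoc_of_le hle]; exact Ioc_subset_Ioc hx₀.1 hx.2
    · rw [uIoc_of_ge hle]; exact Ioc_subset_Ioc hx.1 hx₀.2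
  have e3 : ∫ y, |dx ρ y / ρ y| ∂unitMeasure =
      ∫ y, √(ρ y) * |√(ρ y) * osmotic ρ y| ∂unitMeasure := by
    refine integral_congr_ae ?_
    filter_upwards [hae] with y hy
    have hp := h.pos y (Ioc_subset_Icc_self hy)
    have hs := Real.mul_self_sqrt hp.le
    rw [abs_mul, abs_of_nonneg (Real.sqrt_nonneg _), ← mul_assoc, hs, osmotic, abs_div, abs_div,
      abs_of_pos hp, abs_of_pos (pow_pos hp 2)]
    field_simp
  have e4 := sq_integral_mul_le (g := fun y => |√(ρ y) * osmotic ρ y|) (memLp_of_continuousOn hsq 2)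
    (memLp_continuousOn_mul hsq h.memLp_osmotic).abs
  have e5 : ∫ y, √(ρ y) ^ 2 ∂unitMeasure = 1 := by
    rw [← h.mass, integral_unit]
    refine integral_congr_ae ?_
    filter_upwards [hae] with y hy
    exact Real.sq_sqrt (h.pos y (Ioc_subset_Icc_self hy)).le
  have e6 : ∫ y, |√(ρ y) * osmotic ρ y| ^ 2 ∂unitMeasure =
      ∫ y in (0 : ℝ)..1, ρ y * osmotic ρ y ^ 2 := by
    rw [integral_unit]
    refine integral_congr_ae ?_
    filter_upwards [hae] with y hy
    rw [sq_abs, mul_pow, Real.sq_sqrt (h.pos y (Ioc_subset_Icc_self hy)).le]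
  have e7 : ∫ y in (0 : ℝ)..1, ρ y * osmotic ρ y ^ 2 ≤ 4 * B := by
    refine ((h.hasIntegral_mul_sq h.memLp_osmotic).le
      (((h.hasIntegral_mul_sq (h.memLp_rel hw)).const_mul 2).add
        ((h.hasIntegral_mul_sq (h.memLp_effective hw)).const_mul 2)) fun y hy => ?_).trans ?_
    · have hp := h.pos y hy
      nlinarith [mul_nonneg hp.le (sq_nonneg ((u y - w y) + (u y - w y + osmotic ρ y)))]
    · have := h.integral_le_relEnergy (A := A) (w := w)
      linarith
  have e8 : Real.log (ρ x) ^ 2 ≤ 4 * B := by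
    rw [← sq_abs]
    refine le_trans ?_ e7
    rw [e3] at e2
    rw [e5, e6, one_mul] at e4
    exact (pow_le_pow_left₀ (abs_nonneg _) e2 2).trans e4
  refine (Real.abs_le_sqrt e8).trans (le_of_eq ?_)
  rw [Real.sqrt_mul (by norm_num), show (4 : ℝ) = 2 ^ 2 by norm_num, Real.sqrt_sq (by norm_num)]

theorem InPhaseSpace.density_bounds {A B : ℝ} {ρ u w : ℝ → ℝ} (h : InPhaseSpace ρ u)
    (hw : ContinuousOn w (Icc 0 1)) (hB : relEnergy A ρ u w ≤ B) {x : ℝ} (hx : x ∈ Icc (0 : ℝ) 1) :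
    ρ x ≤ Real.exp (2 * √B) ∧ (ρ x)⁻¹ ≤ Real.exp (2 * √B) := by
  have hl := abs_le.1 (h.abs_log_le hw hB hx)
  have hp := h.pos x hx
  refine ⟨?_, ?_⟩
  · rw [← Real.exp_log hp]; exact Real.exp_le_exp.2 hl.2
  · rw [← Real.exp_log (inv_pos.2 hp), Real.log_inv]; exact Real.exp_le_exp.2 (by linarith)

/-! ### Backward averages in time -/

/-- The backward difference quotient with step `h`, truncated at time zero. -/
noncomputable def backwardQuot (F : ℝ → ℝ) (h t : ℝ) : ℝ := (F t - F (max (t - h) 0)) / h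

theorem max_sub_mem {T h t : ℝ} (hh : 0 < h) (ht : t ∈ Icc 0 T) : max (t - h) 0 ∈ Icc 0 T :=
  ⟨le_max_right _ _, max_le (by linarith [ht.2]) (ht.1.trans ht.2)⟩

/-- The shifted and the unshifted integral cancel except for the last interval of length h; the
truncation at time zero contributes E(0) on the first one. -/
theorem integral_sub_shift {E : ℝ → ℝ} {T h : ℝ} (hh : 0 < h) (hhT : h ≤ T)
    (hE : IntervalIntegrable E volume 0 T) :
    IntervalIntegrable (fun t => E (max (t - h) 0)) volume 0 T ∧
      ∫ t in (0 : ℝ)..T, (E t - E (max (t - h) 0)) = (∫ t in (T - h)..T, E t) - h * E 0 := by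
  have hT : 0 ≤ T := hh.le.trans hhT
  have hE1 : IntervalIntegrable E volume 0 (T - h) := hE.mono_set (by
    rw [uIcc_of_le hT, uIcc_of_le (by linarith)]; exact Icc_subset_Icc_right (by linarith))
  have hE2 : IntervalIntegrable E volume (T - h) T := hE.mono_set (by
    rw [uIcc_of_le hT, uIcc_of_le (by linarith)]; exact Icc_subset_Icc_left (by linarith))
  have e1 : EqOn (fun _ => E 0) (fun t => E (max (t - h) 0)) (uIcc 0 h) := fun t ht => by
    rw [uIcc_of_le hh.le] at ht
    simp only [max_eq_right (by linarith [ht.2] : t - h ≤ 0)]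
  have e2 : EqOn (fun t => E (t - h)) (fun t => E (max (t - h) 0)) (uIcc h T) := fun t ht => by
    rw [uIcc_of_le hhT] at ht
    simp only [max_eq_left (by linarith [ht.1] : 0 ≤ t - h)]
  have i1 : IntervalIntegrable (fun t => E (max (t - h) 0)) volume 0 h :=
    (intervalIntegrable_const (μ := volume)).congr fun t ht => e1 (uIoc_subset_uIcc ht)
  have i2' : IntervalIntegrable (fun t => E (t - h)) volume h T := by
    have := hE1.comp_sub_right h
    simpa using this
  have i2 : IntervalIntegrable (fun t => E (max (t - h) 0)) volume h T :=
    i2'.congr fun t ht => e2 (uIoc_subset_uIcc ht)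
  refine ⟨i1.trans i2, ?_⟩
  rw [intervalIntegral.integral_sub hE (i1.trans i2),
    ← intervalIntegral.integral_add_adjacent_intervals i1 i2,
    ← intervalIntegral.integral_congr e1, ← intervalIntegral.integral_congr e2,
    intervalIntegral.integral_comp_sub_right (fun t => E t),
    ← intervalIntegral.integral_add_adjacent_intervals hE1 hE2]
  simp only [intervalIntegral.integral_const, smul_eq_mul, sub_self, sub_zero]
  ring

theorem continuousOn_backwardQuot {F : ℝ → ℝ} {T h : ℝ} (hh : 0 < h)
    (hF : ContinuousOn F (Icc 0 T)) : ContinuousOn (backwardQuot F h) (Icc 0 T) := by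
  refine (hF.sub (hF.comp (f := fun t => max (t - h) 0) (by fun_prop) fun t ht =>
    max_sub_mem hh ht)).div_const h

theorem memLp_time_of_continuousOn {f : ℝ → ℝ} {T : ℝ} (hf : ContinuousOn f (Icc 0 T)) (p : ℝ≥0∞) :
    MemLp f p (volume.restrict (Ioc 0 T)) := by
  obtain ⟨C, hC⟩ := isCompact_Icc.exists_bound_of_continuousOn hf
  refine MemLp.of_bound ((hf.mono Ioc_subset_Icc_self).aestronglyMeasurable measurableSet_Ioc) C ?_
  filter_upwards [ae_restrict_mem measurableSet_Ioc] with t ht using hC t (Ioc_subset_Icc_self ht)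

theorem IsPrim.sq_sub_le {F a : ℝ → ℝ} {T s t : ℝ} (hF : IsPrim F a 0 T)
    (ha : MemLp a 2 (volume.restrict (Ioc 0 T))) (hs : 0 ≤ s) (hst : s ≤ t) (ht : t ≤ T) :
    (F t - F s) ^ 2 ≤ (t - s) * ∫ r in s..t, a r ^ 2 := by
  have hsub : Ioc s t ⊆ Ioc 0 T := Ioc_subset_Ioc hs ht
  have h1 : MemLp a 2 (volume.restrict (Ioc s t)) := ha.mono_measure (Measure.restrict_mono hsub le_rfl)
  have h2 := sq_integral_mul_le (memLp_const (1 : ℝ)) h1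
  rw [← hF.integral_eq ⟨hs, hst.trans ht⟩ ⟨hs.trans hst, ht⟩, intervalIntegral.integral_of_le hst,
    intervalIntegral.integral_of_le hst]
  simpa [hst] using h2

/-- By Cauchy–Schwarz the squared quotient is at most the increment of Γ = ∫a² over the step,
divided by h. These increments telescope by `integral_sub_shift`, so the constant is one for every
h. -/
theorem integral_backwardQuot_sq_le {F a : ℝ → ℝ} {T h : ℝ} (hh : 0 < h) (hhT : h ≤ T)
    (hF : IsPrim F a 0 T) (ha : MemLp a 2 (volume.restrict (Ioc 0 T))) :
    ∫ t in (0 : ℝ)..T, backwardQuot F h t ^ 2 ≤ ∫ t in (0 : ℝ)..T, a t ^ 2 := by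
  have hT : 0 ≤ T := hh.le.trans hhT
  have hi : IntervalIntegrable (fun r => a r ^ 2) volume 0 T :=
    (intervalIntegrable_iff_integrableOn_Ioc_of_le hT).2 ha.integrable_sq
  have hΓp : IsPrim (fun t => ∫ r in (0 : ℝ)..t, a r ^ 2) (fun r => a r ^ 2) 0 T :=
    ⟨hi, fun x _ => by simp⟩
  set Γ := fun t => ∫ r in (0 : ℝ)..t, a r ^ 2 with hΓ
  have hΓc := hΓp.continuousOn hT
  have hΓi : IntervalIntegrable Γ volume 0 T := by
    apply ContinuousOn.intervalIntegrable; rwa [uIcc_of_le hT]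
  obtain ⟨j1, j2⟩ := integral_sub_shift hh hhT hΓi
  have hc := continuousOn_backwardQuot hh (hF.continuousOn hT)
  have hle : ∫ t in (0 : ℝ)..T, backwardQuot F h t ^ 2 ≤
      ∫ t in (0 : ℝ)..T, h⁻¹ * (Γ t - Γ (max (t - h) 0)) := by
    refine intervalIntegral.integral_mono_on hT ?_ ((hΓi.sub j1).const_mul _) fun t ht => ?_
    · apply ContinuousOn.intervalIntegrable; rw [uIcc_of_le hT]; exact hc.pow 2
    · have hm := max_sub_mem hh ht
      have hmt : max (t - h) 0 ≤ t := max_le (by linarith) ht.1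
      have h1 := hF.sq_sub_le ha hm.1 hmt ht.2
      rw [hΓp.integral_eq hm ht] at h1
      have h2 : 0 ≤ Γ t - Γ (max (t - h) 0) := by
        rw [← hΓp.integral_eq hm ht]
        exact intervalIntegral.integral_nonneg hmt fun r _ => sq_nonneg _
      have h3 : t - max (t - h) 0 ≤ h := by linarith [le_max_left (t - h) 0]
      rw [backwardQuot, div_pow, div_le_iff₀ (by positivity)]
      calc _ ≤ h * (Γ t - Γ (max (t - h) 0)) := h1.trans (mul_le_mul_of_nonneg_right h3 h2)
        _ = _ := by field_simp
  refine hle.trans ?_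
  rw [intervalIntegral.integral_const_mul, j2]
  have h0 : Γ 0 = 0 := by simp [hΓ]
  have h4 : ∫ t in (T - h)..T, Γ t ≤ ∫ t in (T - h)..T, Γ T := by
    refine intervalIntegral.integral_mono_on (by linarith) (hΓi.mono_set ?_) (by simp) fun t ht => ?_
    · rw [uIcc_of_le hT, uIcc_of_le (by linarith)]; exact Icc_subset_Icc_left (by linarith)
    · have ht' : t ∈ Icc 0 T := ⟨by linarith [ht.1], ht.2⟩
      have := hΓp.integral_eq ht' ⟨hT, le_rfl⟩
      have h5 : 0 ≤ ∫ r in t..T, a r ^ 2 :=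
        intervalIntegral.integral_nonneg ht.2 fun r _ => sq_nonneg _
      linarith
  simp only [intervalIntegral.integral_const, smul_eq_mul] at h4
  rw [h0, mul_zero, sub_zero]
  calc _ ≤ h⁻¹ * ((T - (T - h)) * Γ T) := mul_le_mul_of_nonneg_left h4 (by positivity)
    _ = Γ T := by field_simp; ring

theorem sq_integral_mul_backwardQuot_le {F a b : ℝ → ℝ} {T h : ℝ} (hh : 0 < h) (hhT : h ≤ T)
    (hF : IsPrim F a 0 T) (ha : MemLp a 2 (volume.restrict (Ioc 0 T)))
    (hb : MemLp b 2 (volume.restrict (Ioc 0 T))) :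
    (∫ t in (0 : ℝ)..T, b t * backwardQuot F h t) ^ 2 ≤
      (∫ t in (0 : ℝ)..T, b t ^ 2) * ∫ t in (0 : ℝ)..T, a t ^ 2 := by
  have hT : 0 ≤ T := hh.le.trans hhT
  have hc := continuousOn_backwardQuot hh (hF.continuousOn hT)
  have h1 := sq_integral_mul_le hb (memLp_time_of_continuousOn hc 2)
  rw [← intervalIntegral.integral_of_le hT, ← intervalIntegral.integral_of_le hT,
    ← intervalIntegral.integral_of_le hT] at h1
  exact h1.trans (mul_le_mul_of_nonneg_left (integral_backwardQuot_sq_le hh hhT hF ha)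
    (intervalIntegral.integral_nonneg hT fun _ _ => sq_nonneg _))

theorem tendsto_backwardQuot_continuous {φ : ℝ → ℝ} (hφ : Continuous φ) {t : ℝ} (ht : 0 < t)
    {h : ℕ → ℝ} (hh : ∀ n, 0 < h n) (hlim : Tendsto h atTop (𝓝 0)) :
    Tendsto (fun n => backwardQuot (fun t => ∫ s in (0 : ℝ)..t, φ s) (h n) t) atTop (𝓝 (φ t)) := by
  have hd : HasDerivAt (fun t => ∫ s in (0 : ℝ)..t, φ s) (φ t) t :=
    intervalIntegral.integral_hasDerivAt_right (hφ.intervalIntegrable _ _)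
      hφ.stronglyMeasurable.stronglyMeasurableAtFilter hφ.continuousAt
  have h1 := hasDerivAt_iff_tendsto_slope_zero.1 hd
  have h2 : Tendsto (fun n => -h n) atTop (𝓝[≠] 0) :=
    tendsto_nhdsWithin_iff.2 ⟨by simpa using hlim.neg, Eventually.of_forall fun n => by
      simpa using (hh n).ne'⟩
  refine (h1.comp h2).congr' ?_
  filter_upwards [hlim.eventually (gt_mem_nhds ht)] with n hn
  have := (hh n).ne'
  simp only [Function.comp_apply, backwardQuot, max_eq_left (by linarith : 0 ≤ t - h n), smul_eq_mul,
    ← sub_eq_add_neg]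
  field_simp
  ring

/-- For continuous a the quotients converge pointwise and boundedly. A general a is approximated in
L², with an error that `sq_integral_mul_backwardQuot_le` controls uniformly in the step. -/
theorem tendsto_integral_mul_backwardQuot {F a b : ℝ → ℝ} {T : ℝ} (hT : 0 < T) (hF : IsPrim F a 0 T)
    (ha : MemLp a 2 (volume.restrict (Ioc 0 T))) (hb : MemLp b 2 (volume.restrict (Ioc 0 T)))
    {h : ℕ → ℝ} (hh : ∀ n, 0 < h n) (hhT : ∀ n, h n ≤ T) (hlim : Tendsto h atTop (𝓝 0)) :
    Tendsto (fun n => ∫ t in (0 : ℝ)..T, b t * backwardQuot F (h n) t) atTop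
      (𝓝 (∫ t in (0 : ℝ)..T, b t * a t)) := by
  have hint : ∀ {f g : ℝ → ℝ}, MemLp f 2 (volume.restrict (Ioc 0 T)) →
      MemLp g 2 (volume.restrict (Ioc 0 T)) →
      IntervalIntegrable (fun t => f t * g t) volume 0 T := fun hf hg =>
    (intervalIntegrable_iff_integrableOn_Ioc_of_le hT.le).2 (hf.integrable_mul hg)
  rw [Metric.tendsto_atTop]
  intro ε hε
  set b2 := ∫ t in (0 : ℝ)..T, b t ^ 2 with hb2
  have hb0 : 0 ≤ b2 := intervalIntegral.integral_nonneg hT.le fun _ _ => sq_nonneg _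
  obtain ⟨φ, -, h1, h2, -⟩ := MemLp.exists_hasCompactSupport_integral_rpow_sub_le
    (p := 2) (by norm_num) (f := a) (μ := volume.restrict (Ioc 0 T)) (by simpa using ha)
    -- Multiplied by b2 = ∫b² this is at most (ε/4)²; three errors of size ε/4 will be added.
    (ε := (ε / 4) ^ 2 / (b2 + 1)) (by positivity)
  have haφ : MemLp (fun t => a t - φ t) 2 (volume.restrict (Ioc 0 T)) :=
    ha.sub (memLp_time_of_continuousOn h2.continuousOn 2)
  have h1' : ∫ t in (0 : ℝ)..T, (a t - φ t) ^ 2 ≤ (ε / 4) ^ 2 / (b2 + 1) := by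
    rw [intervalIntegral.integral_of_le hT.le]; simpa using h1
  have hsmall : b2 * ∫ t in (0 : ℝ)..T, (a t - φ t) ^ 2 ≤ (ε / 4) ^ 2 := by
    refine (mul_le_mul_of_nonneg_left h1' hb0).trans ?_
    rw [← mul_div_assoc, div_le_iff₀ (by positivity)]
    nlinarith [sq_nonneg (ε / 4)]
  set Φ := fun t => ∫ s in (0 : ℝ)..t, φ s
  have hΦ : IsPrim Φ φ 0 T := ⟨h2.intervalIntegrable _ _, fun x _ => by simp [Φ]⟩
  have hφT : MemLp φ 2 (volume.restrict (Ioc 0 T)) := memLp_time_of_continuousOn h2.continuousOn 2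
  have hconv : Tendsto (fun n => ∫ t in (0 : ℝ)..T, b t * backwardQuot Φ (h n) t) atTop
      (𝓝 (∫ t in (0 : ℝ)..T, b t * φ t)) := by
    obtain ⟨C, hC⟩ := isCompact_Icc.exists_bound_of_continuousOn (h2.continuousOn (s := Icc 0 T))
    refine intervalIntegral.tendsto_integral_filter_of_dominated_convergence (fun t => |b t| * C)
      (Eventually.of_forall fun n => ?_) (Eventually.of_forall fun n => Eventually.of_forall
        fun t ht => ?_) ?_ (Eventually.of_forall fun t ht => ?_)
    · rw [uIoc_of_le hT.le]
      exact ((intervalIntegrable_iff_integrableOn_Ioc_of_le hT.le).1 (hint hb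
        (memLp_time_of_continuousOn (continuousOn_backwardQuot (hh n) (hΦ.continuousOn hT.le))
          2))).aestronglyMeasurable
    · rw [uIoc_of_le hT.le] at ht
      have ht' := Ioc_subset_Icc_self ht
      have hm := max_sub_mem (hh n) ht'
      rw [norm_mul, Real.norm_eq_abs]
      refine mul_le_mul_of_nonneg_left ?_ (abs_nonneg _)
      rw [backwardQuot, norm_div, Real.norm_of_nonneg (hh n).le, div_le_iff₀ (hh n),
        ← hΦ.integral_eq hm ht']
      refine (intervalIntegral.norm_integral_le_of_norm_le_const fun r hr =>
        hC r (uIcc_subset_Icc hm ht' (uIoc_subset_uIcc hr))).trans ?_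
      have hC0 : 0 ≤ C := (norm_nonneg _).trans (hC t ht')
      refine mul_le_mul_of_nonneg_left ?_ hC0
      rw [abs_le]
      constructor
      · linarith [max_le (by linarith [hh n] : t - h n ≤ t) ht'.1, hh n]
      · linarith [le_max_left (t - h n) 0]
    · exact ((intervalIntegrable_iff_integrableOn_Ioc_of_le hT.le).2
        (hb.integrable (by norm_num))).abs.mul_const C
    · rw [uIoc_of_le hT.le] at ht
      exact (tendsto_backwardQuot_continuous h2 ht.1 hh hlim).const_mul _
  obtain ⟨n₀, hn₀⟩ := Metric.tendsto_atTop.1 hconv (ε / 4) (by positivity)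
  refine ⟨n₀, fun n hn => ?_⟩
  have k1 := hn₀ n hn
  have hFΦ : IsPrim (fun t => F t - Φ t) (fun t => a t - φ t) 0 T := hF.sub hΦ hT.le
  have k2 := (sq_integral_mul_backwardQuot_le (hh n) (hhT n) hFΦ haφ hb).trans hsmall
  have k3 := sq_integral_mul_le hb haφ
  rw [← intervalIntegral.integral_of_le hT.le, ← intervalIntegral.integral_of_le hT.le,
    ← intervalIntegral.integral_of_le hT.le] at k3
  replace k3 := k3.trans hsmall
  have mF := memLp_time_of_continuousOn (continuousOn_backwardQuot (hh n) (hF.continuousOn hT.le)) 2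
  have mΦ := memLp_time_of_continuousOn (continuousOn_backwardQuot (hh n) (hΦ.continuousOn hT.le)) 2
  have e1 : ∫ t in (0 : ℝ)..T, b t * backwardQuot (fun t => F t - Φ t) (h n) t =
      (∫ t in (0 : ℝ)..T, b t * backwardQuot F (h n) t) -
        ∫ t in (0 : ℝ)..T, b t * backwardQuot Φ (h n) t := by
    rw [← intervalIntegral.integral_sub (hint hb mF) (hint hb mΦ)]
    refine intervalIntegral.integral_congr fun t _ => ?_
    simp only [backwardQuot]
    ring
  have e2 : ∫ t in (0 : ℝ)..T, b t * (a t - φ t) =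
      (∫ t in (0 : ℝ)..T, b t * a t) - ∫ t in (0 : ℝ)..T, b t * φ t := by
    rw [← intervalIntegral.integral_sub (hint hb ha) (hint hb hφT)]
    simp only [mul_sub]
  rw [e1] at k2
  rw [e2] at k3
  rw [Real.dist_eq] at k1 ⊢
  have k2' := abs_le.1 (abs_le_of_sq_le_sq k2 (by positivity))
  have k3' := abs_le.1 (abs_le_of_sq_le_sq k3 (by positivity))
  have k1' := abs_lt.1 k1
  rw [abs_lt]
  constructor <;> linarith [k2'.1, k2'.2, k3'.1, k3'.2, k1'.1, k1'.2]

/-! ### The Dirichlet energy of functions with weak time derivatives. -/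

theorem ae_memLp_slice_left {G : ℝ → ℝ → ℝ} {T : ℝ}
    (hG : MemLp (fun p : ℝ × ℝ => G p.1 p.2) 2 (spaceTime T)) :
    ∀ᵐ x ∂unitMeasure, MemLp (fun t => G t x) 2 (volume.restrict (Ioc 0 T)) := by
  filter_upwards [hG.integrable_sq.prod_left_ae, hG.aestronglyMeasurable.prod_swap.prodMk_left]
    with x h1 h2
  exact (memLp_two_iff_integrable_sq h2).2 h1

theorem isMassPartition_uniform {n : ℕ} (hn : 0 < n) :
    IsMassPartition (fun _ => 1) n (fun i => i / n) := by
  have hn' : (0 : ℝ) < n := by exact_mod_cast hn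
  refine ⟨fun i hi => ⟨by positivity, div_le_one_of_le₀ (by exact_mod_cast hi) (by positivity)⟩,
    by simp, by simp [hn'.ne'], fun i _ => by gcongr; simp, fun i _ => ?_⟩
  simp only [intervalIntegral.integral_const, smul_eq_mul, mul_one]
  push_cast
  ring

/-- Lower semicontinuity of the Dirichlet energy along uniformly convergent paths. -/
theorem exists_normL2_sq_sub_le {v v' : ℝ → ℝ → ℝ} {T : ℝ} (hT : 0 ≤ T)
    (hv : ContinuousOn (fun p : ℝ × ℝ => v p.1 p.2) (Icc 0 T ×ˢ Icc 0 1))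
    (hp : ∀ t ∈ Icc 0 T, IsPrim (v t) (v' t) 0 1)
    (hm : ∀ t ∈ Icc 0 T, MemLp (v' t) 2 unitMeasure) {ε : ℝ} (hε : 0 < ε) :
    ∃ δ > 0, ∀ s ∈ Icc 0 T, T - s < δ → normL2 (v' T) ^ 2 - ε ≤ normL2 (v' s) ^ 2 := by
  have hTT : T ∈ Icc 0 T := ⟨hT, le_rfl⟩
  -- The discrete energies ∑ n(v(x_{i+1}) − v(x_i))² on uniform grids lie below ‖v'‖² by Jensen and
  -- converge to it at time T; for fixed n they are continuous in time.
  have hlim := tendsto_sum_mass_sq (ρ := fun _ => 1) one_pos continuousOn_const (fun _ _ => le_rfl)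
    (hm T hTT) (x := fun n i => i / n) fun n hn => isMassPartition_uniform hn
  have e : ∫ z in (0 : ℝ)..1, 1 * v' T z ^ 2 = normL2 (v' T) ^ 2 := by
    rw [normL2_sq, integral_unit]; simp only [one_mul]
  rw [e] at hlim
  obtain ⟨n, hn0, hn⟩ := ((eventually_gt_atTop 0).and
    (hlim.eventually (lt_mem_nhds (sub_lt_self _ (half_pos hε))))).exists
  have hP := isMassPartition_uniform hn0
  have hsum : ∀ s ∈ Icc 0 T, ∑ i ∈ Finset.range n,
      (n : ℝ) * (∫ z in (i / n : ℝ)..((i + 1 : ℕ) / n : ℝ), 1 * v' s z) ^ 2 =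
      ∑ i ∈ Finset.range n, (n : ℝ) * (v s ((i + 1 : ℕ) / n : ℝ) - v s (i / n : ℝ)) ^ 2 := by
    intro s hs
    refine Finset.sum_congr rfl fun i hi => ?_
    have hi := Finset.mem_range.1 hi
    simp only [one_mul]
    rw [(hp s hs).integral_eq (hP.mem i hi.le) (hP.mem _ hi)]
  have hc : ContinuousOn (fun s => ∑ i ∈ Finset.range n,
      (n : ℝ) * (v s ((i + 1 : ℕ) / n : ℝ) - v s (i / n : ℝ)) ^ 2) (Icc 0 T) := by
    refine continuousOn_finsetSum _ fun i hi => ?_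
    have hi := Finset.mem_range.1 hi
    exact continuousOn_const.mul (((continuousOn_slice_left hv (hP.mem _ hi)).sub
      (continuousOn_slice_left hv (hP.mem i hi.le))).pow 2)
  obtain ⟨δ, hδ, hd⟩ := Metric.continuousOn_iff.1 hc T hTT (ε / 2) (half_pos hε)
  refine ⟨δ, hδ, fun s hs hsδ => ?_⟩
  have h1 := hd s hs (by rw [Real.dist_eq, abs_sub_comm, abs_of_nonneg (by linarith [hs.2])]; exact hsδ)
  rw [Real.dist_eq, ← hsum s hs, ← hsum T hTT] at h1
  have h2 := hP.sum_sq_le hn0 continuousOn_const (fun _ _ => zero_le_one) (hm s hs)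
  have e2 : ∫ z in (0 : ℝ)..1, 1 * v' s z ^ 2 = normL2 (v' s) ^ 2 := by
    rw [normL2_sq, integral_unit]; simp only [one_mul]
  rw [e2] at h2
  have h3 := (abs_lt.1 h1).1
  linarith

/-- Convexity, ½p² − ½q² ≤ p(p − q), followed by an integration by parts. Only v needs a second
derivative; z just has to share its boundary values. -/
theorem normL2_sq_sub_le {v v' v'' z z' : ℝ → ℝ} (hp : IsPrim v v' 0 1) (hp' : IsPrim v' v'' 0 1)
    (hz : IsPrim z z' 0 1) (hm : MemLp v' 2 unitMeasure) (hzm : MemLp z' 2 unitMeasure)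
    (h0 : v 0 = z 0) (h1 : v 1 = z 1) :
    1 / 2 * normL2 v' ^ 2 - 1 / 2 * normL2 z' ^ 2 ≤ -∫ x in (0 : ℝ)..1, v'' x * (v x - z x) := by
  rw [hp'.integral_by_parts (hp.sub hz zero_le_one) zero_le_one, h0, h1, sub_self, sub_self,
    mul_zero, mul_zero, sub_self, zero_sub, neg_neg]
  have i1 := HasIntegral.of_memLp_mul hm (hm.sub hzm)
  have i2 := HasIntegral.of_intervalIntegrable (intervalIntegrable_sq_of_memLp hm (a := 0) (b := 1)
    (by simp) (by simp))
  have i3 := HasIntegral.of_intervalIntegrable (intervalIntegrable_sq_of_memLp hzm (a := 0) (b := 1)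
    (by simp) (by simp))
  have := ((i2.const_mul (1 / 2)).sub (i3.const_mul (1 / 2))).le i1 fun x _ => by
    simp only [Pi.sub_apply]
    nlinarith [sq_nonneg (v' x - z' x)]
  simpa only [normL2_sq, ← integral_unit, Pi.sub_apply] using this

/-- The time derivative g is only square integrable, so v' cannot be differentiated in time.
Convexity bounds the increment of E = ½‖v'‖² over a backward step by −h∫v'' times the backward
quotient of v, which needs two space derivatives at the later time only. After integration in time
the left side reduces to the mean of E over the last step minus E(0), and the right side converges
to the integral of v''g. Lower semicontinuity at T bounds the mean from below. -/
theorem half_normL2_sq_le {v v' v'' g : ℝ → ℝ → ℝ} {T : ℝ} (hT : 0 < T)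
    (hv : ContinuousOn (fun p : ℝ × ℝ => v p.1 p.2) (Icc 0 T ×ˢ Icc 0 1))
    (hp : ∀ t ∈ Icc 0 T, IsPrim (v t) (v' t) 0 1) (h0 : ∀ t ∈ Icc 0 T, v t 0 = 0)
    (h1 : ∀ t ∈ Icc 0 T, v t 1 = 0) (hm : ∀ t ∈ Icc 0 T, MemLp (v' t) 2 unitMeasure)
    (hm' : MemLp (fun p : ℝ × ℝ => v' p.1 p.2) 2 (spaceTime T))
    (hp' : ∀ᵐ t ∂(volume.restrict (Ioc 0 T)), IsPrim (v' t) (v'' t) 0 1)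
    (hm'' : MemLp (fun p : ℝ × ℝ => v'' p.1 p.2) 2 (spaceTime T))
    (hg : MemLp (fun p : ℝ × ℝ => g p.1 p.2) 2 (spaceTime T))
    (hgp : ∀ᵐ x ∂unitMeasure, IsPrim (fun t => v t x) (fun t => g t x) 0 T) :
    1 / 2 * normL2 (v' T) ^ 2 ≤ 1 / 2 * normL2 (v' 0) ^ 2 -
      ∫ s in (0 : ℝ)..T, ∫ x in (0 : ℝ)..1, v'' s x * g s x := by
  have hT0 := hT.le
  set E := fun t => 1 / 2 * normL2 (v' t) ^ 2 with hE
  have hEi : IntervalIntegrable E volume 0 T := (intervalIntegrable_normL2_sq hT0 hm').const_mul _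
  set κ := fun (h t x : ℝ) => v'' t x * backwardQuot (fun t => v t x) h t with hκ
  have hκi : ∀ {h}, 0 < h → Integrable (fun p : ℝ × ℝ => κ h p.1 p.2) (spaceTime T) := by
    intro h hh
    have hc : ContinuousOn (fun p : ℝ × ℝ => backwardQuot (fun t => v t p.2) h p.1)
        (Icc 0 T ×ˢ Icc 0 1) :=
      (hv.sub (hv.comp (f := fun p : ℝ × ℝ => (max (p.1 - h) 0, p.2)) (by fun_prop) fun p hp =>
        ⟨max_sub_mem hh hp.1, hp.2⟩)).div_const h
    exact hm''.integrable_mul (memLp_spaceTime_of_continuousOn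
      (f := fun t x => backwardQuot (fun t => v t x) h t) hc 2)
  have hgi : Integrable (fun p : ℝ × ℝ => v'' p.1 p.2 * g p.1 p.2) (spaceTime T) :=
    hm''.integrable_mul hg
  have step : ∀ {h}, 0 < h → h ≤ T → h⁻¹ * (∫ t in (T - h)..T, E t) ≤
      E 0 - ∫ t in (0 : ℝ)..T, ∫ x in (0 : ℝ)..1, κ h t x := by
    intro h hh hhT
    obtain ⟨j1, j2⟩ := integral_sub_shift hh hhT hEi
    have hii := intervalIntegrable_integral (κ := κ h) (hκi hh) hT0 le_rfl zero_le_one le_rfl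
    have hle : ∫ t in (0 : ℝ)..T, (E t - E (max (t - h) 0)) ≤
        ∫ t in (0 : ℝ)..T, -h * ∫ x in (0 : ℝ)..1, κ h t x := by
      refine intervalIntegral.integral_mono_ae_restrict hT0 (hEi.sub j1) (hii.const_mul _) ?_
      rw [Measure.restrict_congr_set Ioc_ae_eq_Icc.symm]
      filter_upwards [hp', ae_restrict_mem measurableSet_Ioc] with t ht htm
      have htm := Ioc_subset_Icc_self htm
      have hsm := max_sub_mem hh htm
      refine (normL2_sq_sub_le (hp t htm) ht (hp _ hsm) (hm t htm) (hm _ hsm)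
        (by rw [h0 t htm, h0 _ hsm]) (by rw [h1 t htm, h1 _ hsm])).trans (le_of_eq ?_)
      rw [neg_mul, ← intervalIntegral.integral_const_mul]
      congr 1
      refine intervalIntegral.integral_congr fun x _ => ?_
      simp only [hκ, backwardQuot]
      field_simp
    rw [j2, intervalIntegral.integral_const_mul (-h)] at hle
    rw [inv_mul_le_iff₀ hh]
    linarith
  set h : ℕ → ℝ := fun n => T / (n + 1) with hh
  have hpos : ∀ n, 0 < h n := fun n => by positivity
  have hleT : ∀ n, h n ≤ T := fun n => div_le_self hT0 (by
    have : (0 : ℝ) ≤ n := n.cast_nonneg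
    linarith)
  have hlim0 : Tendsto h atTop (𝓝 0) := by
    have := (tendsto_one_div_add_atTop_nhds_zero_nat (𝕜 := ℝ)).const_mul T
    simpa [hh, div_eq_mul_inv] using this
  have hlim : Tendsto (fun n => ∫ t in (0 : ℝ)..T, ∫ x in (0 : ℝ)..1, κ (h n) t x) atTop
      (𝓝 (∫ s in (0 : ℝ)..T, ∫ x in (0 : ℝ)..1, v'' s x * g s x)) := by
    rw [integral_swap (κ := fun s x => v'' s x * g s x) hgi hT0 le_rfl le_rfl zero_le_one le_rfl]
    have e : ∀ n, ∫ t in (0 : ℝ)..T, ∫ x in (0 : ℝ)..1, κ (h n) t x =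
        ∫ x in (0 : ℝ)..1, ∫ t in (0 : ℝ)..T, κ (h n) t x := fun n =>
      integral_swap (κ := κ (h n)) (hκi (hpos n)) hT0 le_rfl le_rfl zero_le_one le_rfl
    simp only [e]
    have hae := (ae_memLp_slice_left hm'').and ((ae_memLp_slice_left hg).and hgp)
    have hae' := (ae_restrict_iff' measurableSet_Ioc).1 hae
    have b1 := intervalIntegrable_integral_left (κ := fun s x => v'' s x ^ 2) hm''.integrable_sq hT0
      le_rfl
    have b2 := intervalIntegrable_integral_left (κ := fun s x => g s x ^ 2) hg.integrable_sq hT0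
      le_rfl
    refine intervalIntegral.tendsto_integral_filter_of_dominated_convergence
      (fun x => (∫ t in (0 : ℝ)..T, v'' t x ^ 2) + ∫ t in (0 : ℝ)..T, g t x ^ 2)
      (Eventually.of_forall fun n => ?_) (Eventually.of_forall fun n => ?_) (b1.add b2) ?_
    · rw [uIoc_of_le zero_le_one]
      exact ((intervalIntegrable_iff_integrableOn_Ioc_of_le zero_le_one).1
        (intervalIntegrable_integral_left (κ := κ (h n)) (hκi (hpos n)) hT0
          le_rfl)).aestronglyMeasurable
    · filter_upwards [hae'] with x hx hxm
      rw [uIoc_of_le zero_le_one] at hxm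
      obtain ⟨x1, x2, x3⟩ := hx hxm
      have k := sq_integral_mul_backwardQuot_le (hpos n) (hleT n) x3 x2 x1
      have n1 : 0 ≤ ∫ t in (0 : ℝ)..T, v'' t x ^ 2 :=
        intervalIntegral.integral_nonneg hT0 fun _ _ => sq_nonneg _
      have n2 : 0 ≤ ∫ t in (0 : ℝ)..T, g t x ^ 2 :=
        intervalIntegral.integral_nonneg hT0 fun _ _ => sq_nonneg _
      rw [Real.norm_eq_abs]
      refine abs_le_of_sq_le_sq (k.trans ?_) (by positivity)
      nlinarith
    · filter_upwards [hae'] with x hx hxm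
      rw [uIoc_of_le zero_le_one] at hxm
      obtain ⟨x1, x2, x3⟩ := hx hxm
      exact tendsto_integral_mul_backwardQuot hT x3 x2 x1 hpos hleT hlim0
  refine le_of_forall_pos_le_add fun ε hε => ?_
  obtain ⟨δ, hδ, hd⟩ := exists_normL2_sq_sub_le hT0 hv hp hm hε
  have hev : ∀ᶠ n in atTop, E T - ε ≤ E 0 - ∫ t in (0 : ℝ)..T, ∫ x in (0 : ℝ)..1, κ (h n) t x := by
    filter_upwards [hlim0.eventually (gt_mem_nhds hδ)] with n hn
    refine le_trans ?_ (step (hpos n) (hleT n))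
    rw [le_inv_mul_iff₀ (hpos n)]
    have hsub : uIcc (T - h n) T ⊆ uIcc 0 T := by
      rw [uIcc_of_le hT0, uIcc_of_le (by linarith [hpos n])]
      exact Icc_subset_Icc_left (by linarith [hleT n])
    have := intervalIntegral.integral_mono_on (μ := volume) (a := T - h n) (b := T)
      (by linarith [hpos n]) (f := fun _ => E T - ε) intervalIntegrable_const (hEi.mono_set hsub)
      fun s hs => by
        have := hd s ⟨by linarith [hs.1, hleT n], hs.2⟩ (by linarith [hs.1])
        simp only [hE]
        linarith
    simp only [intervalIntegral.integral_const, smul_eq_mul] at this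
    linarith
  have := ge_of_tendsto (tendsto_const_nhds.sub hlim) hev
  simp only [hE] at this ⊢
  linarith

/-! ### The higher order estimate -/

/-- The Eulerian rate of change of `u - w`. -/
noncomputable def accel (A : ℝ) (ρ u : ℝ → ℝ) (x : ℝ) : ℝ :=
  (dx (dx u) x - A ^ 2 * dx ρ x) / ρ x - u x * dx u x

theorem IsH10.sq_le {u : ℝ → ℝ} (h : IsH10 u) {x : ℝ} (hx : x ∈ Icc (0 : ℝ) 1) :
    u x ^ 2 ≤ 2 * (normL2 u * normL2 (dx u)) := by
  have hc := h.1.isPrim.continuousOn zero_le_one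
  have hu := memLp_of_continuousOn hc 2
  have h0 : (0 : ℝ) ∈ Icc (0 : ℝ) 1 := by simp
  have hsq := h.1.isPrim.sq zero_le_one
  have e := hsq.integral_eq h0 hx
  rw [h.2.1] at e
  have h1 := abs_integral_le_integral_abs hsq.1 hx
  rw [e] at h1
  have h2 := abs_integral_mul_le_normL2 (f := fun x => |u x|) (g := fun x => |dx u x|) hu.abs h.1.2.abs
  have h3 : ∫ x in (0 : ℝ)..1, |2 * u x * dx u x| = 2 * ∫ x, |u x| * |dx u x| ∂unitMeasure := by
    rw [integral_unit, ← integral_const_mul]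
    refine integral_congr_ae (Eventually.of_forall fun x => ?_)
    simp only [abs_mul, abs_two, mul_assoc]
  have h4 : normL2 (fun x => |u x|) = normL2 u := by simp only [normL2, sq_abs]
  have h5 : normL2 (fun x => |dx u x|) = normL2 (dx u) := by simp only [normL2, sq_abs]
  rw [h3] at h1
  rw [h4, h5] at h2
  have h6 := (le_abs_self _).trans h1
  have h7 := (le_abs_self _).trans h2
  simp only [ne_eq, OfNat.ofNat_ne_zero, not_false_eq_true, zero_pow, sub_zero] at h6
  linarith

theorem IsH10.normL2_dx_sq_le {u : ℝ → ℝ} (h : IsH10 u) (h2 : IsH2 u) :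
    normL2 (dx u) ^ 2 ≤ normL2 u * normL2 (dx (dx u)) := by
  have hu := memLp_of_continuousOn (h.1.isPrim.continuousOn zero_le_one) 2
  have e := h.1.isPrim.integral_by_parts h2.2.isPrim zero_le_one
  rw [h.2.1, h.2.2, zero_mul, zero_mul, sub_self, zero_sub, integral_unit, integral_unit] at e
  have h3 := abs_integral_mul_le_normL2 hu h2.2.2
  rw [normL2_sq]
  simp only [sq]
  rw [e]
  exact (neg_le_abs _).trans h3

/-- Young's inequality at a point, with U = u_xx, R = ρ_x, r = ρ, a = u, b = u_x and z = w_xx. The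
products with U/r leave 3/4 of U²/r, the convective term costs another 1/8. The remaining 5/8 exceed
the final 1/2 by the 1/8 needed for the cubic term. -/
theorem neg_mul_accel_le {A U R r a b z L : ℝ} (hL : 1 ≤ L) (hr : 0 < r) (hrL : r ≤ L)
    (hrL' : r⁻¹ ≤ L) : -((U - z) * ((U - A ^ 2 * R) / r - a * b)) ≤
      -(5 / 8 * (U ^ 2 / r)) + 5 / 2 * A ^ 4 * L ^ 2 * (r * (R / r ^ 2) ^ 2) + 3 * L * z ^ 2 +
        3 * L * (a ^ 2 * b ^ 2) := by
  have e : -((U - z) * ((U - A ^ 2 * R) / r - a * b)) = r⁻¹ * (-(U ^ 2) + A ^ 2 * U * R + z * U -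
      A ^ 2 * z * R) + U * (a * b) - z * (a * b) := by field_simp; ring
  have h1 : -(U ^ 2) + A ^ 2 * U * R + z * U - A ^ 2 * z * R ≤
      -(3 / 4 * U ^ 2) + 5 / 2 * A ^ 4 * R ^ 2 + 5 / 2 * z ^ 2 := by
    nlinarith [sq_nonneg (U - 4 * (A ^ 2 * R)), sq_nonneg (U - 4 * z), sq_nonneg (z + A ^ 2 * R)]
  have h1' := mul_le_mul_of_nonneg_left h1 (inv_pos.2 hr).le
  have h2 : U * (a * b) ≤ r⁻¹ * (1 / 8 * U ^ 2) + 2 * r * (a ^ 2 * b ^ 2) := by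
    rw [inv_mul_eq_div, ← sub_nonneg]
    have : 1 / 8 * U ^ 2 / r + 2 * r * (a ^ 2 * b ^ 2) - U * (a * b) =
        (U - 4 * r * (a * b)) ^ 2 / (8 * r) := by field_simp; ring
    rw [this]; positivity
  have h3 : -(z * (a * b)) ≤ 1 / 2 * z ^ 2 + 1 / 2 * (a ^ 2 * b ^ 2) := by
    nlinarith [sq_nonneg (z + a * b)]
  have h4 : r⁻¹ * R ^ 2 ≤ L ^ 2 * (r * (R / r ^ 2) ^ 2) := by
    have : r⁻¹ * R ^ 2 = r ^ 2 * (r * (R / r ^ 2) ^ 2) := by field_simp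
    rw [this]
    exact mul_le_mul_of_nonneg_right (pow_le_pow_left₀ hr.le hrL 2) (by positivity)
  have h4' := mul_le_mul_of_nonneg_left h4 (by positivity : 0 ≤ 5 / 2 * A ^ 4)
  have h5 : r⁻¹ * z ^ 2 ≤ L * z ^ 2 := mul_le_mul_of_nonneg_right hrL' (sq_nonneg z)
  have h6 : r * (a ^ 2 * b ^ 2) ≤ L * (a ^ 2 * b ^ 2) := mul_le_mul_of_nonneg_right hrL (by positivity)
  have h7 : z ^ 2 ≤ L * z ^ 2 := le_mul_of_one_le_left (sq_nonneg z) hL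
  have h8 : a ^ 2 * b ^ 2 ≤ L * (a ^ 2 * b ^ 2) := le_mul_of_one_le_left (by positivity) hL
  have e9 : U ^ 2 / r = r⁻¹ * U ^ 2 := by rw [div_eq_inv_mul]
  rw [e, e9]
  nlinarith

theorem IsNoisePath.mono {T N τ : ℝ} {w w₁ w₂ : ℝ → ℝ → ℝ} (h : IsNoisePath T N w w₁ w₂)
    (hτ : τ ≤ T) : IsNoisePath τ N w w₁ w₂ := by
  have hs : Icc 0 τ ⊆ Icc 0 T := Icc_subset_Icc_right hτ
  have hs2 : Icc 0 τ ×ˢ Icc (0 : ℝ) 1 ⊆ Icc 0 T ×ˢ Icc 0 1 := prod_mono hs subset_rfl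
  exact ⟨h.cont.mono hs2, h.cont₁.mono hs2, fun t ht => h.prim t (hs ht),
    fun t ht => h.prim₁ t (hs ht), fun t ht => h.left t (hs ht), fun t ht => h.right t (hs ht),
    h.zero, h.meas₂.mono_measure (spaceTime_mono hτ), fun t ht => h.memLp₂ t (hs ht),
    fun t ht => h.bound₂ t (hs ht)⟩

theorem Evolves.mono {f κ : ℝ → ℝ → ℝ} {T τ : ℝ} (h : Evolves f κ T) (hτ : τ ≤ T) :
    Evolves f κ τ :=
  ⟨h.integrable.mono_measure (spaceTime_mono hτ), fun t ht => h.eq t (Icc_subset_Icc_right hτ ht)⟩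

namespace IsPathSolution

variable {A T N : ℝ} {ρ u w w₁ w₂ : ℝ → ℝ → ℝ}

theorem mono (h : IsPathSolution A T N ρ u w w₁ w₂) {τ : ℝ} (hτ : τ ≤ T) :
    IsPathSolution A τ N ρ u w w₁ w₂ :=
  ⟨h.regular, h.noise.mono hτ, h.mass.mono hτ, h.momentum.mono hτ⟩

theorem continuousOn_inv (h : IsPathSolution A T N ρ u w w₁ w₂) (hT : 0 ≤ T) :
    ContinuousOn (fun p : ℝ × ℝ => (ρ p.1 p.2)⁻¹) (Icc 0 T ×ˢ Icc 0 1) :=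
  (h.cont_density hT).inv₀ fun _ hp => (h.density_pos hp.1 hp.2).ne'

theorem memLp_accel (h : IsPathSolution A T N ρ u w w₁ w₂) (hT : 0 ≤ T) :
    MemLp (fun p : ℝ × ℝ => accel A (ρ p.1) (u p.1) p.2) 2 (spaceTime T) := by
  have h1 : MemLp (fun p : ℝ × ℝ => (ρ p.1 p.2)⁻¹) ⊤ (spaceTime T) :=
    memLp_spaceTime_of_continuousOn (f := fun t x => (ρ t x)⁻¹) (h.continuousOn_inv hT) ⊤
  have h2 : MemLp (fun p : ℝ × ℝ => u p.1 p.2) ⊤ (spaceTime T) :=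
    memLp_spaceTime_of_continuousOn (h.cont_velocity hT) ⊤
  have h3 := (((h.regular.velocity_xx T).sub ((h.regular.density_x T).const_mul (A ^ 2))).mul
    h1 (r := 2)).sub ((h.regular.velocity_x T).mul h2 (r := 2))
  refine h3.ae_eq (Eventually.of_forall fun p => ?_)
  simp only [Pi.sub_apply, Pi.mul_apply, accel]
  ring

theorem integrable_sq_div (h : IsPathSolution A T N ρ u w w₁ w₂) (hT : 0 ≤ T) :
    Integrable (fun p : ℝ × ℝ => dx (dx (u p.1)) p.2 ^ 2 / ρ p.1 p.2) (spaceTime T) := by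
  have h1 : MemLp (fun p : ℝ × ℝ => (ρ p.1 p.2)⁻¹) ⊤ (spaceTime T) :=
    memLp_spaceTime_of_continuousOn (f := fun t x => (ρ t x)⁻¹) (h.continuousOn_inv hT) ⊤
  refine ((h.regular.velocity_xx T).integrable_sq.mul_of_top_left h1).congr
    (Eventually.of_forall fun p => ?_)
  simp only [Pi.mul_apply, div_eq_mul_inv]

/-- At almost every x both ρ and ρ(u − w) are absolutely continuous in time, and the quotient rule
applies; the terms containing w cancel. -/
theorem ae_isPrim_rel (h : IsPathSolution A T N ρ u w w₁ w₂) (hT : 0 ≤ T) :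
    ∀ᵐ x ∂unitMeasure, IsPrim (fun t => u t x - w t x) (fun t => accel A (ρ t) (u t) x) 0 T := by
  filter_upwards [h.mass.ae_isPrim hT (h.cont_density hT),
    h.momentum.ae_isPrim hT (h.cont_rel hT), show ∀ᵐ x ∂unitMeasure, x ∈ Ioc (0 : ℝ) 1 from
    ae_restrict_mem measurableSet_Ioc] with x h1 h2 hx
  have hx := Ioc_subset_Icc_self hx
  refine (h2.mul (h1.inv hT fun t ht => h.density_pos ht hx) hT).congr hT (fun t ht => ?_)
    ((ae_restrict_iff' measurableSet_Ioc).2 (Eventually.of_forall fun t ht => ?_))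
  · have := (h.density_pos ht hx).ne'
    field_simp
  · have := (h.density_pos (Ioc_subset_Icc_self ht) hx).ne'
    simp only [momentumRate, massRate, accel]
    field_simp
    ring

theorem half_normL2_rel_le (h : IsPathSolution A T N ρ u w w₁ w₂) (hT : 0 ≤ T) :
    1 / 2 * normL2 (fun x => dx (u T) x - w₁ T x) ^ 2 ≤ 1 / 2 * normL2 (dx (u 0)) ^ 2 -
      ∫ s in (0 : ℝ)..T, ∫ x in (0 : ℝ)..1,
        (dx (dx (u s)) x - w₂ s x) * accel A (ρ s) (u s) x := by
  -- The noise starts at zero, so w_x(0) vanishes almost everywhere and the initial value is that of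
  -- u alone.
  have e0 : normL2 (fun x => dx (u 0) x - w₁ 0 x) = normL2 (dx (u 0)) := by
    have h1 : IsPrim (w 0) (fun _ => 0) 0 1 := (IsPrim.const 0).congr zero_le_one
      (fun x hx => (h.noise.zero x hx).symm) (by rfl)
    have h2 := (h.noise.prim 0 ⟨le_rfl, hT⟩).ae_eq h1 zero_le_one
    rw [normL2, normL2, integral_unit, integral_unit]
    congr 1
    refine integral_congr_ae ?_
    filter_upwards [show w₁ 0 =ᵐ[unitMeasure] fun _ => 0 from h2] with x hx
    rw [hx, sub_zero]
  rcases hT.eq_or_lt with rfl | hT'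
  · simp [e0]
  rw [← e0]
  refine half_normL2_sq_le (v := fun t x => u t x - w t x) (v' := fun t x => dx (u t) x - w₁ t x)
    (v'' := fun t x => dx (dx (u t)) x - w₂ t x) (g := fun t => accel A (ρ t) (u t)) hT'
    ((h.cont_velocity hT).sub h.noise.cont)
    (fun t ht => (h.prim_velocity ht).sub (h.noise.prim t ht) zero_le_one) (fun t ht => ?_)
    (fun t ht => ?_) (fun t ht => (h.regular.phase t ht.1).velocity.1.2.sub
      (memLp_of_continuousOn (continuousOn_slice h.noise.cont₁ ht) 2))
    ((h.regular.velocity_x T).sub (memLp_spaceTime_of_continuousOn h.noise.cont₁ 2)) ?_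
    ((h.regular.velocity_xx T).sub h.noise.memLp_w₂) (h.memLp_accel hT) (h.ae_isPrim_rel hT)
  · rw [(h.regular.phase t ht.1).velocity.2.1, h.noise.left t ht, sub_zero]
  · rw [(h.regular.phase t ht.1).velocity.2.2, h.noise.right t ht, sub_zero]
  · filter_upwards [h.ae_isH2, ae_restrict_mem measurableSet_Ioc] with s hs hsm
    exact hs.2.isPrim.sub (h.noise.prim₁ s (Ioc_subset_Icc_self hsm)) zero_le_one

end IsPathSolution

/-- The higher order dissipation inequality at a fixed time. -/
theorem InPhaseSpace.neg_integral_accel_le {A B L P N : ℝ} {ρ u w z : ℝ → ℝ} (h : InPhaseSpace ρ u)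
    (h2 : IsH2 u) (hw : ContinuousOn w (Icc 0 1)) (hB : relEnergy A ρ u w ≤ B) (hL : 1 ≤ L)
    (hρL : ∀ x ∈ Icc (0 : ℝ) 1, ρ x ≤ L ∧ (ρ x)⁻¹ ≤ L) (hP : 1 ≤ P) (huP : normL2 u ≤ P)
    (hz : MemLp z 2 unitMeasure) (hzN : normL2 z ≤ N) :
    -(∫ x in (0 : ℝ)..1, (dx (dx u) x - z x) * accel A ρ u x) ≤
      -(1 / 2 * ∫ x in (0 : ℝ)..1, dx (dx u) x ^ 2 / ρ x) + (10 * A ^ 4 * L ^ 2 * B + 3 * L * N ^ 2) +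
        72 * L ^ 3 * P ^ 4 * dissipation A ρ u := by
  have hL0 : 0 < L := one_pos.trans_le hL
  have hP0 : 0 < P := one_pos.trans_le hP
  have hinv : ContinuousOn (fun x => (ρ x)⁻¹) (Icc 0 1) :=
    h.continuousOn_density.inv₀ fun x hx => (h.pos x hx).ne'
  have hacc : MemLp (accel A ρ u) 2 unitMeasure := by
    refine ((memLp_continuousOn_mul hinv (h2.2.2.sub (h.density.2.const_mul (A ^ 2)))).sub
      (memLp_continuousOn_mul h.continuousOn_velocity h.velocity.1.2)).ae_eq
      (Eventually.of_forall fun x => ?_)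
    simp only [Pi.sub_apply, accel]
    ring
  have i0 := (HasIntegral.of_memLp_mul (h2.2.2.sub hz) hacc).const_mul (-1)
  have iU : HasIntegral (fun x => dx (dx u) x ^ 2 / ρ x) (∫ x in (0 : ℝ)..1, dx (dx u) x ^ 2 / ρ x) := by
    refine HasIntegral.of_intervalIntegrable ?_
    have := intervalIntegrable_weight_mul hinv (intervalIntegrable_sq_of_memLp h2.2.2
      (a := 0) (b := 1) (by simp) (by simp)) (by simp) (by simp)
    simpa only [div_eq_inv_mul] using this
  have iO := h.hasIntegral_mul_sq h.memLp_osmotic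
  have iz := HasIntegral.of_intervalIntegrable (intervalIntegrable_sq_of_memLp hz
      (a := 0) (b := 1) (by simp) (by simp))
  have ib := HasIntegral.of_intervalIntegrable (intervalIntegrable_sq_of_memLp h.velocity.1.2
      (a := 0) (b := 1) (by simp) (by simp))
  have iUU := HasIntegral.of_intervalIntegrable (intervalIntegrable_sq_of_memLp h2.2.2
      (a := 0) (b := 1) (by simp) (by simp))
  rw [integral_unit, ← normL2_sq] at iz ib iUU
  set p := normL2 u
  set q := normL2 (dx u)
  set a := normL2 (dx (dx u))
  have hp0 : 0 ≤ p := normL2_nonneg _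
  have hq0 : 0 ≤ q := normL2_nonneg _
  have ha0 : 0 ≤ a := normL2_nonneg _
  have hle := i0.le (((((iU.const_mul (5 / 8)).const_mul (-1)).add
    (iO.const_mul (5 / 2 * A ^ 4 * L ^ 2))).add (iz.const_mul (3 * L))).add
    (ib.const_mul (3 * L * (2 * (p * q))))) fun x hx => by
      have k1 := neg_mul_accel_le (A := A) (U := dx (dx u) x) (R := dx ρ x) (a := u x) (b := dx u x)
        (z := z x) hL (h.pos x hx) (hρL x hx).1 (hρL x hx).2
      have k2 := mul_le_mul_of_nonneg_right (h.velocity.sq_le hx) (sq_nonneg (dx u x))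
      have k3 := mul_le_mul_of_nonneg_left k2 (by positivity : 0 ≤ 3 * L)
      simp only [Pi.sub_apply, accel, osmotic]
      linarith
  have hO : ∫ y in (0 : ℝ)..1, ρ y * osmotic ρ y ^ 2 ≤ 4 * B := by
    refine (iO.le (((h.hasIntegral_mul_sq (h.memLp_rel hw)).const_mul 2).add
        ((h.hasIntegral_mul_sq (h.memLp_effective hw)).const_mul 2)) fun y hy => ?_).trans ?_
    · have hp := h.pos y hy
      nlinarith [mul_nonneg hp.le (sq_nonneg ((u y - w y) + (u y - w y + osmotic ρ y)))]
    · have := h.integral_le_relEnergy (A := A) (w := w)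
      linarith
  have hUL : a ^ 2 ≤ L * ∫ x in (0 : ℝ)..1, dx (dx u) x ^ 2 / ρ x := by
    refine iUU.le (iU.const_mul L) fun x hx => ?_
    have hpos := h.pos x hx
    rw [← mul_div_assoc, le_div_iff₀ hpos, mul_comm]
    exact mul_le_mul_of_nonneg_right (hρL x hx).1 (sq_nonneg _)
  have hq2 : q ^ 2 ≤ P * a := (h.velocity.normL2_dx_sq_le h2).trans
    (mul_le_mul_of_nonneg_right huP ha0)
  have hq4 : q ^ 4 ≤ P ^ 2 * a ^ 2 := by
    have := pow_le_pow_left₀ (sq_nonneg q) hq2 2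
    nlinarith
  have hzN2 : normL2 z ^ 2 ≤ N ^ 2 := pow_le_pow_left₀ (normL2_nonneg _) hzN 2
  -- Here p = ‖u‖ ≤ P, q = ‖u_x‖ and a = ‖u_xx‖. The term is at most 6LPq³; multiplied by 8LP² it is
  -- bounded by q⁴ + (24L²P³)²q². Since q⁴ ≤ P²a² and a² ≤ L∫u_xx²/ρ, dividing by 8LP² leaves the
  -- factor 1/8 and the constant 576/8 = 72.
  have hcub : 3 * L * (2 * (p * q)) * q ^ 2 ≤
      1 / 8 * (∫ x in (0 : ℝ)..1, dx (dx u) x ^ 2 / ρ x) + 72 * L ^ 3 * P ^ 4 * q ^ 2 := by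
    have c1 : 3 * L * (2 * (p * q)) * q ^ 2 ≤ 6 * L * P * q ^ 3 := by
      have := mul_le_mul_of_nonneg_left huP (by positivity : 0 ≤ 6 * L * q ^ 3)
      nlinarith
    have c2 : 6 * L * P * q ^ 3 * (8 * L * P ^ 2) ≤ (q ^ 4 + (24 * L ^ 2 * P ^ 3) ^ 2 * q ^ 2) := by
      nlinarith [mul_nonneg (sq_nonneg q) (sq_nonneg (q - 24 * L ^ 2 * P ^ 3))]
    have c3 : q ^ 4 + (24 * L ^ 2 * P ^ 3) ^ 2 * q ^ 2 ≤
        P ^ 2 * (L * ∫ x in (0 : ℝ)..1, dx (dx u) x ^ 2 / ρ x) +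
          (24 * L ^ 2 * P ^ 3) ^ 2 * q ^ 2 :=
      add_le_add (hq4.trans (mul_le_mul_of_nonneg_left hUL (by positivity))) le_rfl
    refine c1.trans (le_of_mul_le_mul_right ((c2.trans c3).trans (le_of_eq ?_))
      (by positivity : 0 < 8 * L * P ^ 2))
    ring
  have hD : q ^ 2 ≤ dissipation A ρ u := by
    have : 0 ≤ A ^ 2 * normL2 (dx fun x => Real.log (ρ x)) ^ 2 := by positivity
    rw [dissipation]
    linarith
  have hD' := mul_le_mul_of_nonneg_left hD (by positivity : 0 ≤ 72 * L ^ 3 * P ^ 4)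
  have hO' := mul_le_mul_of_nonneg_left hO (by positivity : 0 ≤ 5 / 2 * A ^ 4 * L ^ 2)
  have hz' := mul_le_mul_of_nonneg_left hzN2 (by positivity : 0 ≤ 3 * L)
  simp only [Pi.sub_apply] at hle
  linarith

theorem InPhaseSpace.normL2_velocity_sq_le {A B L N : ℝ} {ρ u w : ℝ → ℝ} (h : InPhaseSpace ρ u)
    (hw : ContinuousOn w (Icc 0 1)) (hN : ∀ x ∈ Icc (0 : ℝ) 1, |w x| ≤ N)
    (hB : relEnergy A ρ u w ≤ B) (hL : 0 ≤ L) (hρL : ∀ x ∈ Icc (0 : ℝ) 1, (ρ x)⁻¹ ≤ L) :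
    normL2 u ^ 2 ≤ L * (4 * B + 2 * N ^ 2) := by
  have hu := memLp_of_continuousOn h.continuousOn_velocity 2
  have i1 := HasIntegral.of_intervalIntegrable (intervalIntegrable_sq_of_memLp hu
      (a := 0) (b := 1) (by simp) (by simp))
  have i2 := h.hasIntegral_mul_sq (h.memLp_rel hw)
  have hle := i1.le (((i2.const_mul 2).add (h.hasIntegral_density.const_mul (2 * N ^ 2))).const_mul L)
    fun x hx => by
      have hp := h.pos x hx
      have h1 : w x ^ 2 ≤ N ^ 2 := sq_le_sq' (abs_le.1 (hN x hx)).1 (abs_le.1 (hN x hx)).2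
      have h2 : u x ^ 2 ≤ 2 * (u x - w x) ^ 2 + 2 * N ^ 2 := by
        nlinarith [sq_nonneg (u x - 2 * w x)]
      have h3 : 1 ≤ L * ρ x := by
        have := mul_le_mul_of_nonneg_right (hρL x hx) hp.le
        rwa [inv_mul_cancel₀ hp.ne'] at this
      have h4 : 0 ≤ 2 * (u x - w x) ^ 2 + 2 * N ^ 2 := by positivity
      calc u x ^ 2 ≤ 1 * (2 * (u x - w x) ^ 2 + 2 * N ^ 2) := by linarith
        _ ≤ L * ρ x * (2 * (u x - w x) ^ 2 + 2 * N ^ 2) := mul_le_mul_of_nonneg_right h3 h4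
        _ = _ := by ring
  rw [integral_unit, ← normL2_sq] at hle
  refine hle.trans (mul_le_mul_of_nonneg_left ?_ hL)
  have h5 := h.integral_le_relEnergy (A := A) (w := w)
  have h6 := h.integral_mul_sq_nonneg fun x => u x - w x + osmotic ρ x
  linarith

/-- The higher order bound, uniform over all path solutions with the given data. -/
theorem exists_velocity_x_bound (A T N e R : ℝ) (hT : 0 ≤ T) : ∃ B, 0 ≤ B ∧
    ∀ ρ u w w₁ w₂, IsPathSolution A T N ρ u w w₁ w₂ → energy A (ρ 0) (u 0) ≤ e →
      normL2 (dx (u 0)) ≤ R → ∀ t ∈ Icc 0 T,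
      normL2 (dx (u t)) ^ 2 +
        ∫ s in (0 : ℝ)..T, ∫ x in (0 : ℝ)..1, dx (dx (u s)) x ^ 2 / ρ s x ≤ B := by
  obtain ⟨B, hB0, hB⟩ := exists_energy_bound A T N e hT
  set L := Real.exp (2 * √B)
  have hL : 1 ≤ L := Real.one_le_exp (by positivity)
  have hL0 : 0 < L := one_pos.trans_le hL
  -- The energy yields ‖u‖² ≤ P − 1, hence ‖u‖ ≤ P without a square root.
  set P := 1 + L * (4 * B + 2 * N ^ 2)
  have hP0 : 0 ≤ L * (4 * B + 2 * N ^ 2) := by positivity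
  have hP : 1 ≤ P := le_add_of_nonneg_right hP0
  set C₀ := 10 * A ^ 4 * L ^ 2 * B + 3 * L * N ^ 2
  set C₁ := 72 * L ^ 3 * P ^ 4
  have hC0 : 0 ≤ C₀ := by positivity
  have hC1 : 0 ≤ C₁ := by positivity
  set Q := 1 / 2 * R ^ 2 + C₀ * T + C₁ * B
  have hQ0 : 0 ≤ Q := by positivity
  -- `key` at time t gives ‖u_x‖² ≤ 4Q + 2N² after passing from u_x − w_x to u_x. At time T it gives
  -- at most 2Q for the integral, which runs up to T whatever t is.
  refine ⟨6 * Q + 2 * N ^ 2, by positivity, fun ρ u w w₁ w₂ h he hR t ht => ?_⟩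
  obtain ⟨hD1, hD2, hD3⟩ := hB ρ u w w₁ w₂ h he
  have hUI := intervalIntegrable_integral (κ := fun s x => dx (dx (u s)) x ^ 2 / ρ s x)
    (h.integrable_sq_div hT) hT le_rfl zero_le_one le_rfl
  have hU0 : ∀ s, 0 ≤ s → 0 ≤ ∫ x in (0 : ℝ)..1, dx (dx (u s)) x ^ 2 / ρ s x := fun s hs =>
    intervalIntegral.integral_nonneg zero_le_one fun x hx =>
      div_nonneg (sq_nonneg _) ((h.regular.phase s hs).pos x hx).le
  have key : ∀ τ ∈ Icc 0 T, 1 / 2 * normL2 (fun x => dx (u τ) x - w₁ τ x) ^ 2 +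
      1 / 2 * ∫ s in (0 : ℝ)..τ, ∫ x in (0 : ℝ)..1, dx (dx (u s)) x ^ 2 / ρ s x ≤ Q := by
    intro τ hτ
    have hτs := h.mono hτ.2
    have h1 := hτs.half_normL2_rel_le hτ.1
    have hsub : uIcc 0 τ ⊆ uIcc 0 T := by
      rw [uIcc_of_le hT, uIcc_of_le hτ.1]; exact Icc_subset_Icc_right hτ.2
    have hint : Integrable (fun p : ℝ × ℝ => (dx (dx (u p.1)) p.2 - w₂ p.1 p.2) *
        accel A (ρ p.1) (u p.1) p.2) (spaceTime τ) :=
      ((hτs.regular.velocity_xx τ).sub hτs.noise.memLp_w₂).integrable_mul (hτs.memLp_accel hτ.1)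
    have hI := intervalIntegrable_integral
      (κ := fun s x => (dx (dx (u s)) x - w₂ s x) * accel A (ρ s) (u s) x) hint hτ.1 le_rfl
      zero_le_one le_rfl
    have hle : ∫ s in (0 : ℝ)..τ, -(∫ x in (0 : ℝ)..1,
        (dx (dx (u s)) x - w₂ s x) * accel A (ρ s) (u s) x) ≤
        ∫ s in (0 : ℝ)..τ, (-(1 / 2 * ∫ x in (0 : ℝ)..1, dx (dx (u s)) x ^ 2 / ρ s x) + C₀ +
          C₁ * dissipation A (ρ s) (u s)) := by
      refine intervalIntegral.integral_mono_ae_restrict hτ.1 hI.neg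
        ((((hUI.mono_set hsub).const_mul (1 / 2)).neg.add intervalIntegrable_const).add
          ((hD1.mono_set hsub).const_mul C₁)) ?_
      rw [Measure.restrict_congr_set Ioc_ae_eq_Icc.symm]
      filter_upwards [hτs.ae_isH2, ae_restrict_mem measurableSet_Ioc] with s hs hsm
      have hsm' : s ∈ Icc 0 T := ⟨hsm.1.le, hsm.2.trans hτ.2⟩
      have hp := h.regular.phase s hsm.1.le
      have hwc := continuousOn_slice h.noise.cont hsm'
      have hbd := fun x hx => hp.density_bounds hwc (hD3 s hsm').1 (x := x) hx
      refine hp.neg_integral_accel_le hs hwc (hD3 s hsm').1 hL hbd hP ?_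
        (h.noise.memLp₂ s hsm') (h.noise.bound₂ s hsm')
      have h3 := hp.normL2_velocity_sq_le hwc (fun x hx => h.noise.abs_w_le hsm' hx)
        (hD3 s hsm').1 hL0.le fun x hx => (hbd x hx).2
      nlinarith [sq_nonneg (normL2 (u s) - 1), normL2_nonneg (u s)]
    have j1 : IntervalIntegrable
        (fun s => -(1 / 2 * ∫ x in (0 : ℝ)..1, dx (dx (u s)) x ^ 2 / ρ s x)) volume 0 τ :=
      ((hUI.mono_set hsub).const_mul (1 / 2)).neg
    have j2 : IntervalIntegrable (fun _ : ℝ => C₀) volume 0 τ := intervalIntegrable_const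
    rw [intervalIntegral.integral_neg, intervalIntegral.integral_add (j1.add j2)
      ((hD1.mono_set hsub).const_mul C₁), intervalIntegral.integral_add j1 j2,
      intervalIntegral.integral_neg, intervalIntegral.integral_const_mul,
      intervalIntegral.integral_const_mul, intervalIntegral.integral_const, smul_eq_mul,
      sub_zero] at hle
    have hDle : ∫ s in (0 : ℝ)..τ, dissipation A (ρ s) (u s) ≤ B :=
      (intervalIntegral.integral_mono_interval le_rfl hτ.1 hτ.2
        (Eventually.of_forall fun s => dissipation_nonneg _ _ _) hD1).trans hD2
    have hD' := mul_le_mul_of_nonneg_left hDle hC1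
    have hτC : τ * C₀ ≤ C₀ * T := by nlinarith [hτ.2]
    have hR2 : normL2 (dx (u 0)) ^ 2 ≤ R ^ 2 := pow_le_pow_left₀ (normL2_nonneg _) hR 2
    simp only [Q]
    linarith
  have k1 := key t ht
  have k2 := key T ⟨hT, le_rfl⟩
  have n1 : 0 ≤ ∫ s in (0 : ℝ)..t, ∫ x in (0 : ℝ)..1, dx (dx (u s)) x ^ 2 / ρ s x :=
    intervalIntegral.integral_nonneg ht.1 fun s hs => hU0 s hs.1
  have n2 := sq_nonneg (normL2 (fun x => dx (u T) x - w₁ T x))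
  have hw₁c := continuousOn_slice h.noise.cont₁ ht
  have hv := (h.regular.phase t ht.1).velocity.1.2.sub (memLp_of_continuousOn hw₁c 2)
  have i1 := HasIntegral.of_intervalIntegrable (intervalIntegrable_sq_of_memLp
    (h.regular.phase t ht.1).velocity.1.2 (a := 0) (b := 1) (by simp) (by simp))
  have i2 := HasIntegral.of_intervalIntegrable (intervalIntegrable_sq_of_memLp hv
      (a := 0) (b := 1) (by simp) (by simp))
  have h5 := i1.le ((i2.const_mul 2).add (HasIntegral.const (2 * N ^ 2))) fun x hx => by
    have hb := abs_le.1 (h.noise.abs_w₁_le ht hx)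
    have := sq_le_sq' hb.1 hb.2
    simp only [Pi.sub_apply]
    nlinarith [sq_nonneg (dx (u t) x - 2 * w₁ t x)]
  simp only [integral_unit] at h5
  rw [← normL2_sq, ← normL2_sq] at h5
  have e : normL2 (dx (u t) - w₁ t) = normL2 (fun x => dx (u t) x - w₁ t x) := rfl
  rw [e] at h5
  linarith

/-! ### Constants that are monotone in the data and depend only on the path of the noise. -/

theorem monotone_sum_ceil {K : ℕ → ℝ} (hK : ∀ n, 0 ≤ K n) :
    Monotone fun e : ℝ => ∑ n ∈ Finset.range (⌈e⌉₊ + 1), K n := fun _ _ hab =>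
  Finset.sum_le_sum_of_subset_of_nonneg
    (Finset.range_mono (Nat.add_le_add_right (Nat.ceil_mono hab) 1)) fun n _ _ => hK n

theorem le_sum_ceil {K : ℕ → ℝ} (hK : ∀ n, 0 ≤ K n) (e : ℝ) :
    K ⌈e⌉₊ ≤ ∑ n ∈ Finset.range (⌈e⌉₊ + 1), K n :=
  Finset.single_le_sum (fun n _ => hK n) (Finset.self_mem_range_succ _)

theorem eLpNorm_top_le {f : ℝ → ℝ} {C : ℝ} (hf : ∀ x ∈ Icc (0 : ℝ) 1, |f x| ≤ C) :
    eLpNorm f ⊤ unitMeasure ≤ ENNReal.ofReal C := by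
  rw [eLpNorm_exponent_top]
  refine eLpNormEssSup_le_of_ae_bound ?_
  filter_upwards [show ∀ᵐ x ∂unitMeasure, x ∈ Ioc (0 : ℝ) 1 from
    ae_restrict_mem measurableSet_Ioc] with x hx using hf x (Ioc_subset_Icc_self hx)

/-- The conclusion of the main theorem for a single path. -/
def HasBounds (A T c₁ c₂ c₃ : ℝ) (ρ u : ℝ → ℝ → ℝ) : Prop :=
  (IntervalIntegrable (fun s => dissipation A (ρ s) (u s)) volume 0 T ∧
    ∀ t ∈ Icc 0 T, energy A (ρ t) (u t) +
      ∫ s in (0 : ℝ)..T, dissipation A (ρ s) (u s) ≤ c₁) ∧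
  (∀ t ∈ Icc 0 T, eLpNorm (ρ t) ⊤ unitMeasure + eLpNorm (fun x => (ρ t x)⁻¹) ⊤ unitMeasure ≤
    ENNReal.ofReal c₂) ∧
  (Integrable (fun p : ℝ × ℝ => dx (dx (u p.1)) p.2 ^ 2 / ρ p.1 p.2) (spaceTime T) ∧
    ∀ t ∈ Icc 0 T, normL2 (dx (u t)) ^ 2 +
      ∫ s in (0 : ℝ)..T, ∫ x in (0 : ℝ)..1, dx (dx (u s)) x ^ 2 / ρ s x ≤ c₃)

/-- The data are rounded up to integers and the nonnegative bounds of all lower levels are added.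
This makes the constants monotone without any inspection of how the bounds depend on the data. -/
theorem exists_monotone_bounds (A T N : ℝ) (hT : 0 ≤ T) : ∃ C₁ C₂ : ℝ → ℝ, ∃ C₃ : ℝ → ℝ → ℝ,
    (Monotone C₁ ∧ Monotone C₂ ∧ (∀ e, Monotone (C₃ e)) ∧ ∀ r, Monotone fun e => C₃ e r) ∧
    ∀ ρ u w w₁ w₂, IsPathSolution A T N ρ u w w₁ w₂ →
      HasBounds A T (C₁ (energy A (ρ 0) (u 0))) (C₂ (energy A (ρ 0) (u 0)))
        (C₃ (energy A (ρ 0) (u 0)) (normL2 (dx (u 0)))) ρ u := by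
  choose B hB0 hB using fun n : ℕ => exists_energy_bound A T N n hT
  choose D hD0 hD using fun n m : ℕ => exists_velocity_x_bound A T N n m hT
  have h1 : ∀ n, 0 ≤ 2 * B n := fun n => by linarith [hB0 n]
  have h2 : ∀ n, 0 ≤ 2 * Real.exp (2 * √(B n)) := fun n => by positivity
  have h3 : ∀ (r : ℝ) (n : ℕ), 0 ≤ ∑ m ∈ Finset.range (⌈r⌉₊ + 1), D n m := fun r n =>
    Finset.sum_nonneg fun m _ => hD0 n m
  refine ⟨_, _, fun e r => ∑ n ∈ Finset.range (⌈e⌉₊ + 1), ∑ m ∈ Finset.range (⌈r⌉₊ + 1), D n m,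
    ⟨monotone_sum_ceil h1, monotone_sum_ceil h2, fun e r r' hr =>
      Finset.sum_le_sum fun n _ => monotone_sum_ceil (hD0 n) hr,
      fun r => monotone_sum_ceil (h3 r)⟩, fun ρ u w w₁ w₂ h => ?_⟩
  set e := energy A (ρ 0) (u 0)
  have hle : e ≤ (⌈e⌉₊ : ℝ) := Nat.le_ceil e
  obtain ⟨b1, b2, b3⟩ := hB ⌈e⌉₊ ρ u w w₁ w₂ h hle
  refine ⟨⟨b1, fun t ht => ?_⟩, fun t ht => ?_, h.integrable_sq_div hT, fun t ht => ?_⟩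
  · refine le_trans ?_ (le_sum_ceil h1 e)
    linarith [(b3 t ht).2]
  · refine le_trans ?_ (ENNReal.ofReal_le_ofReal (le_sum_ceil h2 e))
    have hp := h.regular.phase t ht.1
    have hb := fun x hx => hp.density_bounds (continuousOn_slice h.noise.cont ht) (b3 t ht).1
      (x := x) hx
    rw [two_mul, ENNReal.ofReal_add (by positivity) (by positivity)]
    refine add_le_add (eLpNorm_top_le fun x hx => ?_) (eLpNorm_top_le fun x hx => ?_)
    · rw [abs_of_pos (hp.pos x hx)]; exact (hb x hx).1
    · rw [abs_of_pos (inv_pos.2 (hp.pos x hx))]; exact (hb x hx).2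
  · refine le_trans ?_ (le_sum_ceil (h3 _) e)
    refine le_trans ?_ (le_sum_ceil (hD0 _) _)
    exact hD _ _ ρ u w w₁ w₂ h hle (Nat.le_ceil _) t ht

/-- The values of w determine w_x by continuity and then w_xx almost everywhere. A bound N valid for
one choice of derivatives is thus valid for every other. -/
theorem IsNoisePath.of_eqOn {T N N' : ℝ} {w w₁ w₂ z z₁ z₂ : ℝ → ℝ → ℝ}
    (hw : IsNoisePath T N w w₁ w₂) (hz : IsNoisePath T N' z z₁ z₂)
    (h : ∀ t ∈ Icc 0 T, EqOn (w t) (z t) (Icc 0 1)) : IsNoisePath T N z z₁ z₂ := by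
  refine ⟨hz.cont, hz.cont₁, hz.prim, hz.prim₁, hz.left, hz.right, hz.zero, hz.meas₂, hz.memLp₂,
    fun t ht => ?_⟩
  have h1 : w₁ t =ᵐ[volume.restrict (Ioc 0 1)] z₁ t :=
    ((hw.prim t ht).congr zero_le_one (h t ht) (by rfl)).ae_eq (hz.prim t ht) zero_le_one
  have h2 : EqOn (w₁ t) (z₁ t) (Icc 0 1) := by
    refine Measure.eqOn_Icc_of_ae_eq volume zero_ne_one ?_ (continuousOn_slice hw.cont₁ ht)
      (continuousOn_slice hz.cont₁ ht)
    rw [Measure.restrict_congr_set Ioc_ae_eq_Icc.symm]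
    exact h1
  have h3 := ((hw.prim₁ t ht).congr zero_le_one h2 (by rfl)).ae_eq (hz.prim₁ t ht) zero_le_one
  have e : normL2 (z₂ t) = normL2 (w₂ t) := by
    rw [normL2, normL2, integral_unit, integral_unit]
    congr 1
    refine integral_congr_ae ?_
    filter_upwards [show w₂ t =ᵐ[unitMeasure] z₂ t from h3] with x hx
    rw [hx]
  rw [e]
  exact hw.bound₂ t ht

/-- The constants must be fixed before the solution. If W is the trace of some regular path, one
admissible N is chosen, and `IsNoisePath.of_eqOn` transfers it to any solution driven by the same
values. Otherwise no path solution has this noise and the constants are irrelevant. -/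
theorem exists_bounds_of_noisePath (T : ℝ≥0) (W : NoisePath T) (A : ℝ) :
    ∃ C₁ C₂ : ℝ → ℝ, ∃ C₃ : ℝ → ℝ → ℝ,
    (Monotone C₁ ∧ Monotone C₂ ∧ (∀ e, Monotone (C₃ e)) ∧ ∀ r, Monotone fun e => C₃ e r) ∧
    ∀ N ρ u w w₁ w₂, IsPathSolution A T N ρ u w w₁ w₂ →
      (∀ (t : Icc (0 : ℝ≥0) T) (x : Icc (0 : ℝ) 1), W t x = w (t : ℝ≥0) x) →
      HasBounds A T (C₁ (energy A (ρ 0) (u 0))) (C₂ (energy A (ρ 0) (u 0)))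
        (C₃ (energy A (ρ 0) (u 0)) (normL2 (dx (u 0)))) ρ u := by
  by_cases hex : ∃ (N : ℝ) (w w₁ w₂ : ℝ → ℝ → ℝ), IsNoisePath T N w w₁ w₂ ∧
      ∀ (t : Icc (0 : ℝ≥0) T) (x : Icc (0 : ℝ) 1), W t x = w (t : ℝ≥0) x
  · obtain ⟨N, z, z₁, z₂, hz, hzW⟩ := hex
    obtain ⟨C₁, C₂, C₃, hC, hb⟩ := exists_monotone_bounds A T N T.2
    refine ⟨C₁, C₂, C₃, hC, fun N' ρ u w w₁ w₂ h hW => hb ρ u w w₁ w₂ ⟨h.regular,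
      hz.of_eqOn h.noise fun t ht x hx => ?_, h.mass, h.momentum⟩⟩
    have ht' : (⟨t, ht.1⟩ : ℝ≥0) ∈ Icc (0 : ℝ≥0) T := ⟨zero_le, ht.2⟩
    exact (hzW ⟨_, ht'⟩ ⟨x, hx⟩).symm.trans (hW ⟨_, ht'⟩ ⟨x, hx⟩)
  · refine ⟨0, 0, 0, ⟨monotone_const, monotone_const, fun _ => monotone_const,
      fun _ => monotone_const⟩, fun N ρ u w w₁ w₂ h hW => ?_⟩
    exact absurd ⟨N, w, w₁, w₂, h.noise, hW⟩ hex

/-! ### Maximal inequalities -/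

/-- The running maximum of a sequence. -/
noncomputable def runMax (a : ℕ → ℝ) : ℕ → ℝ
  | 0 => a 0
  | n + 1 => max (runMax a n) (a (n + 1))

theorem le_runMax (a : ℕ → ℝ) {i n : ℕ} (h : i ≤ n) : a i ≤ runMax a n := by
  induction n with
  | zero => rw [Nat.le_zero.1 h]; exact le_rfl
  | succ n ih =>
    rcases Nat.le_succ_iff.1 h with h | rfl
    · exact (ih h).trans (le_max_left _ _)
    · exact le_max_right _ _

/-- The pathwise form of Doob's inequality. -/
theorem sum_runMax_mul_sub_le (a : ℕ → ℝ) (n : ℕ) :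
    ∑ i ∈ Finset.range n, runMax a i * (a (i + 1) - a i) ≤
      runMax a n * a n - 1 / 2 * runMax a n ^ 2 := by
  induction n with
  | zero => simp only [Finset.range_zero, Finset.sum_empty, runMax]; nlinarith [sq_nonneg (a 0)]
  | succ n ih =>
    rw [Finset.sum_range_succ]
    simp only [runMax]
    rcases le_total (a (n + 1)) (runMax a n) with h | h
    · rw [max_eq_left h]; linarith
    · rw [max_eq_right h]; nlinarith [sq_nonneg (a (n + 1) - runMax a n)]

/-! ### Submartingale inequalities in L². -/

section

variable {Ω : Type*} {G mΩ : MeasurableSpace Ω} {P : Measure Ω}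

/-- `p ≤ E[q | G]`, tested against nonnegative square integrable functions. -/
structure IsSubPair (P : Measure Ω) (G : MeasurableSpace Ω) (p q : Ω → ℝ) : Prop where
  meas : Measurable[G] p
  memLp_left : MemLp p 2 P
  memLp_right : MemLp q 2 P
  le : ∀ r : Ω → ℝ, Measurable[G] r → (∀ ω, 0 ≤ r ω) → MemLp r 2 P →
    ∫ ω, r ω * p ω ∂P ≤ ∫ ω, r ω * q ω ∂P

/-- The set where p₁ is the larger of the two is G-measurable. The first pair is tested with r
restricted to it, the second with r restricted to the complement. -/
theorem IsSubPair.sup (hG : G ≤ mΩ) {p₁ p₂ q₁ q₂ : Ω → ℝ}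
    (h₁ : IsSubPair P G p₁ q₁) (h₂ : IsSubPair P G p₂ q₂) :
    IsSubPair P G (fun ω => max (p₁ ω) (p₂ ω)) (fun ω => max (q₁ ω) (q₂ ω)) := by
  refine ⟨h₁.meas.max h₂.meas, h₁.memLp_left.sup h₂.memLp_left, h₁.memLp_right.sup h₂.memLp_right,
    fun r hr hr0 hr2 => ?_⟩
  have hS : MeasurableSet[G] {ω | p₂ ω ≤ p₁ ω} := measurableSet_le h₂.meas h₁.meas
  set S := {ω | p₂ ω ≤ p₁ ω} with hSdef
  have hS' : MeasurableSet S := hG _ hS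
  have hr0' : ∀ (s : Set Ω) ω, 0 ≤ s.indicator r ω := fun s ω => indicator_nonneg (fun ω _ => hr0 ω) ω
  have l1 := h₁.le _ (hr.indicator hS) (hr0' S) (hr2.indicator hS')
  have l2 := h₂.le _ (hr.indicator hS.compl) (hr0' Sᶜ) (hr2.indicator hS'.compl)
  have e : ∫ ω, r ω * max (p₁ ω) (p₂ ω) ∂P =
      (∫ ω, S.indicator r ω * p₁ ω ∂P) + ∫ ω, Sᶜ.indicator r ω * p₂ ω ∂P := by
    have i1 : Integrable (fun ω => S.indicator r ω * p₁ ω) P :=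
      (hr2.indicator hS').integrable_mul h₁.memLp_left
    have i2 : Integrable (fun ω => Sᶜ.indicator r ω * p₂ ω) P :=
      (hr2.indicator hS'.compl).integrable_mul h₂.memLp_left
    rw [← integral_add i1 i2]
    refine integral_congr_ae (Eventually.of_forall fun ω => ?_)
    by_cases hω : ω ∈ S
    · have : p₂ ω ≤ p₁ ω := hω
      simp [hω, max_eq_left this]
    · have : p₁ ω ≤ p₂ ω := (not_le.1 hω).le
      simp [hω, max_eq_right this]
  rw [e]
  refine (add_le_add l1 l2).trans ?_
  have j1 : Integrable (fun ω => S.indicator r ω * q₁ ω) P :=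
    (hr2.indicator hS').integrable_mul h₁.memLp_right
  have j2 : Integrable (fun ω => Sᶜ.indicator r ω * q₂ ω) P :=
    (hr2.indicator hS'.compl).integrable_mul h₂.memLp_right
  rw [← integral_add j1 j2]
  refine integral_mono (j1.add j2)
    (hr2.integrable_mul (h₁.memLp_right.sup h₂.memLp_right)) fun ω => ?_
  by_cases hω : ω ∈ S
  · simpa [hω] using mul_le_mul_of_nonneg_left (le_max_left (q₁ ω) (q₂ ω)) (hr0 ω)
  · simpa [hω] using mul_le_mul_of_nonneg_left (le_max_right (q₁ ω) (q₂ ω)) (hr0 ω)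

theorem IsSubPair.runningMax (hG : G ≤ mΩ) {p q : ℕ → Ω → ℝ}
    (h : ∀ j, IsSubPair P G (p j) (q j)) (n : ℕ) :
    IsSubPair P G (fun ω => runMax (fun j => p j ω) n) (fun ω => runMax (fun j => q j ω) n) := by
  induction n with
  | zero => exact h 0
  | succ n ih => exact ih.sup hG (h (n + 1))

theorem measurable_runMax {s : ℕ → Ω → ℝ} {n : ℕ}
    (h : ∀ i ≤ n, Measurable[G] (s i)) : Measurable[G] fun ω => runMax (fun i => s i ω) n := by
  induction n with
  | zero => exact h 0 le_rfl
  | succ n ih => exact (ih fun i hi => h i (hi.trans n.le_succ)).max (h _ le_rfl)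

theorem memLp_runMax {s : ℕ → Ω → ℝ} (h : ∀ i, MemLp (s i) 2 P) (n : ℕ) :
    MemLp (fun ω => runMax (fun i => s i ω) n) 2 P := by
  induction n with
  | zero => exact h 0
  | succ n ih => exact ih.sup (h _)

/-- Doob's `L²` maximal inequality. -/
theorem integral_runMax_sq_le {s : ℕ → Ω → ℝ} {G : ℕ → MeasurableSpace Ω} (hmono : Monotone G)
    (hs : ∀ i, IsSubPair P (G i) (s i) (s (i + 1))) (h0 : ∀ i ω, 0 ≤ s i ω) (n : ℕ) :
    ∫ ω, runMax (fun i => s i ω) n ^ 2 ∂P ≤ 4 * ∫ ω, s n ω ^ 2 ∂P := by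
  have hL : ∀ i, MemLp (s i) 2 P := fun i => (hs i).memLp_left
  have hM := memLp_runMax hL
  have hterm : ∀ i, Integrable (fun ω => runMax (fun i => s i ω) i * (s (i + 1) ω - s i ω)) P :=
    fun i => (hM i).integrable_mul ((hL (i + 1)).sub (hL i))
  have hnn : ∀ i, 0 ≤ ∫ ω, runMax (fun i => s i ω) i * (s (i + 1) ω - s i ω) ∂P := by
    intro i
    have := (hs i).le (fun ω => runMax (fun i => s i ω) i)
      (measurable_runMax fun j hj => ((hs j).meas).mono (hmono hj) le_rfl)
      (fun ω => (h0 i ω).trans (le_runMax (fun i => s i ω) le_rfl)) (hM i)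
    have e : ∫ ω, runMax (fun i => s i ω) i * (s (i + 1) ω - s i ω) ∂P =
        (∫ ω, runMax (fun i => s i ω) i * s (i + 1) ω ∂P) -
          ∫ ω, runMax (fun i => s i ω) i * s i ω ∂P := by
      simp only [mul_sub]
      exact integral_sub ((hM i).integrable_mul (hL (i + 1))) ((hM i).integrable_mul (hL i))
    rw [e]
    linarith
  have hsum : 0 ≤ ∫ ω, ∑ i ∈ Finset.range n,
      runMax (fun i => s i ω) i * (s (i + 1) ω - s i ω) ∂P := by
    rw [integral_finsetSum _ fun i _ => hterm i]
    exact Finset.sum_nonneg fun i _ => hnn i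
  -- With M the running maximum, the pathwise inequality bounds the integrand by M² + 4Ms − 2M² =
  -- 4Ms − M², and this is at most 4s² since (M − 2s)² ≥ 0.
  have hle : ∫ ω, (runMax (fun i => s i ω) n ^ 2 + 4 * ∑ i ∈ Finset.range n,
      runMax (fun i => s i ω) i * (s (i + 1) ω - s i ω)) ∂P ≤ ∫ ω, 4 * s n ω ^ 2 ∂P := by
    refine integral_mono ((hM n).integrable_sq.add
      ((integrable_finsetSum _ fun i _ => hterm i).const_mul 4)) ((hL n).integrable_sq.const_mul 4)
      fun ω => ?_
    have := sum_runMax_mul_sub_le (fun i => s i ω) n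
    simp only
    nlinarith [sq_nonneg (runMax (fun i => s i ω) n - 2 * s n ω)]
  rw [integral_add (hM n).integrable_sq
    ((integrable_finsetSum _ fun i _ => hterm i).const_mul 4), integral_const_mul,
    integral_const_mul] at hle
  linarith

variable {H : Type*} [NormedAddCommGroup H] [InnerProductSpace ℝ H]

theorem integral_mul_eq_zero_of_indep {r ξ : Ω → ℝ} (hr : Measurable[G] r)
    (hrm : AEStronglyMeasurable r P) (hξ : AEStronglyMeasurable ξ P) (hξ0 : ∫ ω, ξ ω ∂P = 0)
    (hind : Indep (MeasurableSpace.comap ξ inferInstance) G P) : ∫ ω, r ω * ξ ω ∂P = 0 := by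
  have h1 : IndepFun r ξ P := by
    rw [IndepFun_iff_Indep]
    exact indep_of_indep_of_le_left hind.symm hr.comap_le
  have := h1.integral_mul_eq_mul_integral hrm hξ
  simp only [Pi.mul_apply] at this
  rw [this, hξ0, mul_zero]

theorem IsSubPair.norm (hG : G ≤ mΩ) {κ : Type*} {a : Ω → H}
    (ha : StronglyMeasurable[G] a) (ha2 : MemLp a 2 P) {s : Finset κ} {ξ : κ → Ω → ℝ} (c : κ → H)
    (hξ2 : ∀ k ∈ s, MemLp (ξ k) 2 P) (hξ0 : ∀ k ∈ s, ∫ ω, ξ k ω ∂P = 0)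
    (hind : ∀ k ∈ s, Indep (MeasurableSpace.comap (ξ k) inferInstance) G P) :
    IsSubPair P G (fun ω => ‖a ω‖) (fun ω => ‖a ω + ∑ k ∈ s, ξ k ω • c k‖) := by
  have hb2 : MemLp (fun ω => ∑ k ∈ s, ξ k ω • c k) 2 P :=
    memLp_finsetSum s fun k hk => (memLp_top_const (c k)).smul (hξ2 k hk)
  refine ⟨ha.norm.measurable, ha2.norm, (ha2.add hb2).norm, fun r hr hr0 hr2 => ?_⟩
  set e : Ω → H := fun ω => ‖a ω‖⁻¹ • a ω
  have he : StronglyMeasurable[G] e := by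
    have : StronglyMeasurable[G] fun ω => ‖a ω‖⁻¹ := ha.norm.measurable.inv.stronglyMeasurable
    exact this.smul ha
  have he1 : ∀ ω, ‖e ω‖ ≤ 1 := fun ω => by
    simp only [e, norm_smul, norm_inv, norm_norm]
    exact inv_mul_le_one
  have hθ : ∀ k, Measurable[G] fun ω => r ω * inner ℝ (e ω) (c k) := fun k =>
    hr.mul (he.inner stronglyMeasurable_const).measurable
  have hθ2 : ∀ k, MemLp (fun ω => r ω * inner ℝ (e ω) (c k)) 2 P := fun k => by
    refine (hr2.mul_const ‖c k‖).mono ((hθ k).mono hG le_rfl).aestronglyMeasurable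
      (Eventually.of_forall fun ω => ?_)
    rw [norm_mul, norm_mul, norm_norm]
    refine mul_le_mul_of_nonneg_left ((norm_inner_le_norm _ _).trans ?_) (norm_nonneg _)
    exact mul_le_of_le_one_left (norm_nonneg _) (he1 ω)
  have hzero : ∀ k ∈ s, ∫ ω, r ω * inner ℝ (e ω) (c k) * ξ k ω ∂P = 0 := fun k hk =>
    integral_mul_eq_zero_of_indep (hθ k) (hθ2 k).aestronglyMeasurable
      (hξ2 k hk).aestronglyMeasurable (hξ0 k hk) (hind k hk)
  have hint : ∀ k ∈ s, Integrable (fun ω => r ω * inner ℝ (e ω) (c k) * ξ k ω) P := fun k hk =>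
    (hθ2 k).integrable_mul (hξ2 k hk)
  have hra : Integrable (fun ω => r ω * ‖a ω‖) P := hr2.integrable_mul ha2.norm
  calc ∫ ω, r ω * ‖a ω‖ ∂P
      = ∫ ω, (r ω * ‖a ω‖ + ∑ k ∈ s, r ω * inner ℝ (e ω) (c k) * ξ k ω) ∂P := by
        rw [integral_add hra (integrable_finsetSum _ hint), integral_finsetSum _ hint,
          Finset.sum_eq_zero hzero, add_zero]
    _ ≤ _ := by
        refine integral_mono (hra.add (integrable_finsetSum _ hint))
          (hr2.integrable_mul (ha2.add hb2).norm) fun ω => ?_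
        have h1 : inner ℝ (e ω) (a ω) = ‖a ω‖ := by
          simp only [e, real_inner_smul_left, real_inner_self_eq_norm_sq]
          rcases eq_or_ne ‖a ω‖ 0 with h | h
          · simp [h]
          · field_simp
        have h2 : inner ℝ (e ω) (a ω + ∑ k ∈ s, ξ k ω • c k) =
            ‖a ω‖ + ∑ k ∈ s, inner ℝ (e ω) (c k) * ξ k ω := by
          rw [inner_add_right, h1, inner_sum]
          congr 1
          refine Finset.sum_congr rfl fun k _ => ?_
          rw [real_inner_smul_right, mul_comm]
        have h3 : inner ℝ (e ω) (a ω + ∑ k ∈ s, ξ k ω • c k) ≤ ‖a ω + ∑ k ∈ s, ξ k ω • c k‖ :=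
          (real_inner_le_norm _ _).trans (mul_le_of_le_one_left (norm_nonneg _) (he1 ω))
        rw [h2] at h3
        have h4 := mul_le_mul_of_nonneg_left h3 (hr0 ω)
        rw [mul_add, Finset.mul_sum] at h4
        simpa only [mul_assoc] using h4

end

/-! ### Uniform convergence of Hilbert space valued Brownian series. -/

section

variable {Ω : Type*} {mΩ : MeasurableSpace Ω} {P : Measure Ω} {ℱ : Filtration ℝ≥0 mΩ}
  {W : ℕ → ℝ≥0 → Ω → ℝ}

namespace IsWienerSequence

theorem measurable (hW : IsWienerSequence P ℱ W) (k : ℕ) (t : ℝ≥0) : Measurable (W k t) :=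
  (hW.adapted k t).mono (ℱ.le t) le_rfl

theorem memLp (hW : IsWienerSequence P ℱ W) (k : ℕ) (t : ℝ≥0) : MemLp (W k t) 2 P :=
  ((hW.brownian k).hasLaw_eval t).hasGaussianLaw.memLp_two

theorem integral_eq_zero (hW : IsWienerSequence P ℱ W) (k : ℕ) (t : ℝ≥0) :
    ∫ ω, W k t ω ∂P = 0 := (hW.brownian k).integral_eval t

theorem integral_sq (hW : IsWienerSequence P ℱ W) (k : ℕ) (t : ℝ≥0) :
    ∫ ω, W k t ω * W k t ω ∂P = t := by
  have : IsProbabilityMeasure P := ((hW.brownian k).hasLaw_eval t).isProbabilityMeasure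
  have h := (hW.brownian k).covariance_eval t t
  rw [covariance_eq_sub (hW.memLp k t) (hW.memLp k t), hW.integral_eq_zero] at h
  simpa using h

theorem integral_mul_of_ne (hW : IsWienerSequence P ℱ W) {k l : ℕ} (hkl : k ≠ l) (t : ℝ≥0) :
    ∫ ω, W k t ω * W l t ω ∂P = 0 := by
  have h : IndepFun (W k t) (W l t) P :=
    (hW.indep.indepFun hkl).comp (measurable_pi_apply t) (measurable_pi_apply t)
  have := h.integral_mul_eq_mul_integral (hW.memLp k t).aestronglyMeasurable
    (hW.memLp l t).aestronglyMeasurable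
  simp only [Pi.mul_apply] at this
  rw [this, hW.integral_eq_zero, zero_mul]

end IsWienerSequence

variable {H : Type*} [NormedAddCommGroup H] [InnerProductSpace ℝ H]

/-- The sum of `W^k c_k` over `m ≤ k < n`. -/
def noiseSum (W : ℕ → ℝ≥0 → Ω → ℝ) (c : ℕ → H) (m n : ℕ) (t : ℝ≥0) (ω : Ω) : H :=
  ∑ k ∈ Finset.Ico m n, W k t ω • c k

theorem stronglyMeasurable_noiseSum {G : MeasurableSpace Ω} {c : ℕ → H} {m n : ℕ} {t : ℝ≥0}
    (h : ∀ k ∈ Finset.Ico m n, Measurable[G] (W k t)) :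
    StronglyMeasurable[G] (noiseSum W c m n t) :=
  Finset.stronglyMeasurable_fun_sum _ fun k hk => (h k hk).stronglyMeasurable.smul_const (c k)

theorem IsWienerSequence.memLp_noiseSum (hW : IsWienerSequence P ℱ W) (c : ℕ → H) (m n : ℕ)
    (t : ℝ≥0) : MemLp (noiseSum W c m n t) 2 P :=
  memLp_finsetSum _ fun k _ => (memLp_top_const (c k)).smul (hW.memLp k t)

theorem IsWienerSequence.isSubPair_time (hW : IsWienerSequence P ℱ W) (c : ℕ → H) (m n : ℕ)
    {s t : ℝ≥0} (hst : s ≤ t) :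
    IsSubPair P (ℱ s) (fun ω => ‖noiseSum W c m n s ω‖) (fun ω => ‖noiseSum W c m n t ω‖) := by
  have := IsSubPair.norm (P := P) (ℱ.le s)
    (stronglyMeasurable_noiseSum (c := c) (m := m) (n := n) fun k _ => hW.adapted k s)
    (hW.memLp_noiseSum c m n s) (s := Finset.Ico m n)
    (ξ := fun k ω => W k t ω - W k s ω) c (fun k _ => (hW.memLp k t).sub (hW.memLp k s))
    (fun k _ => by
      rw [integral_sub ((hW.brownian k).integrable_eval t) ((hW.brownian k).integrable_eval s),
        hW.integral_eq_zero, hW.integral_eq_zero, sub_zero])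
    (fun k _ => hW.indep_past k s t hst)
  convert this using 3 with ω
  simp only [noiseSum, ← Finset.sum_add_distrib, sub_smul, add_sub_cancel]

/-- The `σ`-algebra generated by the paths of `W^k`, `k < n`. -/
abbrev pathSigma (W : ℕ → ℝ≥0 → Ω → ℝ) (n : ℕ) : MeasurableSpace Ω :=
  ⨆ k ∈ Iio n, MeasurableSpace.comap (fun ω t => W k t ω) inferInstance

theorem pathSigma_mono : Monotone (pathSigma W) := fun _ _ h =>
  biSup_mono fun _ hk => lt_of_lt_of_le hk h

theorem measurable_pathSigma {k n : ℕ} (h : k < n) (t : ℝ≥0) :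
    Measurable[pathSigma W n] (W k t) := by
  have h1 : Measurable[MeasurableSpace.comap (fun ω t => W k t ω) inferInstance] (W k t) :=
    (measurable_pi_apply t).comp (comap_measurable fun ω t => W k t ω)
  exact h1.mono (le_biSup (fun k => MeasurableSpace.comap (fun ω t => W k t ω) inferInstance)
    (mem_Iio.2 h)) le_rfl

theorem IsWienerSequence.comap_path_le (hW : IsWienerSequence P ℱ W) (k : ℕ) :
    MeasurableSpace.comap (fun ω t => W k t ω) inferInstance ≤ mΩ :=
  (measurable_pi_lambda _ fun t => hW.measurable k t).comap_le

theorem IsWienerSequence.pathSigma_le (hW : IsWienerSequence P ℱ W) (n : ℕ) :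
    pathSigma W n ≤ mΩ := iSup₂_le fun k _ => hW.comap_path_le k

theorem IsWienerSequence.indep_pathSigma (hW : IsWienerSequence P ℱ W) (n : ℕ) (t : ℝ≥0) :
    Indep (MeasurableSpace.comap (W n t) inferInstance) (pathSigma W n) P := by
  have h := indep_iSup_of_disjoint hW.comap_path_le hW.indep
    (S := {n}) (T := Iio n) (by simp)
  simp only [mem_singleton_iff, iSup_iSup_eq_left] at h
  refine indep_of_indep_of_le_left h ?_
  have h1 : Measurable[MeasurableSpace.comap (fun ω t => W n t ω) inferInstance] (W n t) :=
    (measurable_pi_apply t).comp (comap_measurable fun ω t => W n t ω)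
  exact h1.comap_le

/-- At a fixed time the partial sums form a martingale in their length, because the next Brownian
motion is independent of the earlier ones. Conditioning on whole paths gives the same σ-algebra for
all times, so maxima over a time grid remain submartingales. -/
theorem IsWienerSequence.isSubPair_index (hW : IsWienerSequence P ℱ W) (c : ℕ → H) {m n : ℕ}
    (hmn : m ≤ n) (t : ℝ≥0) :
    IsSubPair P (pathSigma W n) (fun ω => ‖noiseSum W c m n t ω‖)
      (fun ω => ‖noiseSum W c m (n + 1) t ω‖) := by
  have := IsSubPair.norm (P := P) (hW.pathSigma_le n)
    (stronglyMeasurable_noiseSum (c := c) (m := m) (n := n) fun k hk =>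
      measurable_pathSigma (W := W) (Finset.mem_Ico.1 hk).2 t)
    (hW.memLp_noiseSum c m n t) (s := {n}) (ξ := fun k => W k t) c (fun k _ => hW.memLp k t)
    (fun k _ => hW.integral_eq_zero k t)
    (fun k hk => by rw [Finset.mem_singleton.1 hk]; exact hW.indep_pathSigma n t)
  convert this using 3 with ω
  simp only [noiseSum, Finset.sum_Ico_succ_top hmn, Finset.sum_singleton]

theorem IsWienerSequence.integral_norm_noiseSum_sq (hW : IsWienerSequence P ℱ W) (c : ℕ → H)
    (m n : ℕ) (t : ℝ≥0) :
    ∫ ω, ‖noiseSum W c m n t ω‖ ^ 2 ∂P = ∑ k ∈ Finset.Ico m n, t * ‖c k‖ ^ 2 := by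
  have e : ∀ ω, ‖noiseSum W c m n t ω‖ ^ 2 = ∑ k ∈ Finset.Ico m n, ∑ l ∈ Finset.Ico m n,
      W k t ω * W l t ω * inner ℝ (c k) (c l) := fun ω => by
    rw [← real_inner_self_eq_norm_sq, noiseSum, sum_inner]
    refine Finset.sum_congr rfl fun k _ => ?_
    rw [inner_sum]
    refine Finset.sum_congr rfl fun l _ => ?_
    rw [real_inner_smul_left, real_inner_smul_right, mul_assoc]
  have hi : ∀ k l, Integrable (fun ω => W k t ω * W l t ω * inner ℝ (c k) (c l)) P := fun k l =>
    ((hW.memLp k t).integrable_mul (hW.memLp l t)).mul_const _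
  simp only [e]
  rw [integral_finsetSum _ fun k _ => integrable_finsetSum _ fun l _ => hi k l]
  refine Finset.sum_congr rfl fun k hk => ?_
  rw [integral_finsetSum _ fun l _ => hi k l, Finset.sum_eq_single_of_mem k hk fun l _ hl => by
    rw [integral_mul_const, hW.integral_mul_of_ne hl.symm, zero_mul]]
  rw [integral_mul_const, hW.integral_sq, real_inner_self_eq_norm_sq]

/-- The maximal inequality, over a time grid and over the length of the sum. -/
theorem IsWienerSequence.integral_maximal_le (hW : IsWienerSequence P ℱ W) (c : ℕ → H)
    {τ : ℕ → ℝ≥0} (hτ : Monotone τ) (m I J : ℕ) :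
    ∫ ω, runMax (fun i => runMax (fun j => ‖noiseSum W c m (m + i) (τ j) ω‖) J) I ^ 2 ∂P ≤
      16 * ∑ k ∈ Finset.Ico m (m + I), τ J * ‖c k‖ ^ 2 := by
  -- Doob's inequality is applied to the maximum over times as a process in the length, then to the
  -- longest sum as a process in time; hence the factor 4 · 4 = 16.
  have h1 := integral_runMax_sq_le (P := P)
    (s := fun i ω => runMax (fun j => ‖noiseSum W c m (m + i) (τ j) ω‖) J)
    (G := fun i => pathSigma W (m + i)) (fun i j hij => pathSigma_mono (by omega))
    (fun i => IsSubPair.runningMax (hW.pathSigma_le _)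
      (fun j => hW.isSubPair_index c (Nat.le_add_right m i) (τ j)) J)
    (fun i ω => (norm_nonneg _).trans
      (le_runMax (fun j => ‖noiseSum W c m (m + i) (τ j) ω‖) (Nat.zero_le J))) I
  have h2 := integral_runMax_sq_le (P := P) (s := fun j ω => ‖noiseSum W c m (m + I) (τ j) ω‖)
    (G := fun j => ℱ (τ j)) (fun i j hij => ℱ.mono (hτ hij))
    (fun j => hW.isSubPair_time c m (m + I) (hτ j.le_succ)) (fun _ _ => norm_nonneg _) J
  beta_reduce at h1 h2
  rw [hW.integral_norm_noiseSum_sq] at h2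
  linarith

/-- The maximum of the partial sums over a grid of mesh `1 / (N + 1)`. -/
noncomputable def gridMax (W : ℕ → ℝ≥0 → Ω → ℝ) (c : ℕ → H) (T m N : ℕ) (ω : Ω) : ℝ :=
  runMax (fun i => runMax (fun j => ‖noiseSum W c m (m + i) (j / (N + 1 : ℕ)) ω‖) (T * (N + 1))) N

/-- A majorant of `sup ‖∑_{m ≤ k < n} W^k c_k‖²` over `n` and over `[0,T]`. -/
noncomputable def noiseMajorant (W : ℕ → ℝ≥0 → Ω → ℝ) (c : ℕ → H) (T m : ℕ) (ω : Ω) : ℝ≥0∞ :=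
  liminf (fun N => ENNReal.ofReal (gridMax W c T m N ω ^ 2)) atTop

theorem IsWienerSequence.measurable_gridMax (hW : IsWienerSequence P ℱ W) (c : ℕ → H)
    (T m N : ℕ) : Measurable (gridMax W c T m N) :=
  measurable_runMax fun _ _ => measurable_runMax fun _ _ =>
    (stronglyMeasurable_noiseSum fun k _ => hW.measurable k _).norm.measurable

theorem IsWienerSequence.measurable_noiseMajorant (hW : IsWienerSequence P ℱ W) (c : ℕ → H)
    (T m : ℕ) : Measurable (noiseMajorant W c T m) :=
  Measurable.liminf fun N => ((hW.measurable_gridMax c T m N).pow_const 2).ennreal_ofReal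

/-- Fatou's lemma over the grids. The grid of mesh 1/(N+1) with T(N+1) steps ends exactly at T, so
the maximal inequality gives a bound that does not depend on N. -/
theorem IsWienerSequence.lintegral_noiseMajorant_le (hW : IsWienerSequence P ℱ W) {c : ℕ → H}
    (hc : Summable fun k => ‖c k‖ ^ 2) (T m : ℕ) :
    ∫⁻ ω, noiseMajorant W c T m ω ∂P ≤ ENNReal.ofReal (16 * (T * ∑' k, ‖c (k + m)‖ ^ 2)) := by
  refine (lintegral_liminf_le fun N =>
    ((hW.measurable_gridMax c T m N).pow_const 2).ennreal_ofReal).trans ?_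
  refine liminf_le_of_le (by isBoundedDefault) fun b hb => ?_
  obtain ⟨N, hN⟩ := hb.exists
  refine hN.trans ?_
  have hmem : MemLp (gridMax W c T m N) 2 P :=
    memLp_runMax (fun i => memLp_runMax (fun j => (hW.memLp_noiseSum c m (m + i) _).norm) _) _
  rw [← ofReal_integral_eq_lintegral_ofReal hmem.integrable_sq
    (Eventually.of_forall fun ω => sq_nonneg _)]
  refine ENNReal.ofReal_le_ofReal ?_
  have hτ : Monotone fun j : ℕ => (j : ℝ≥0) / (N + 1 : ℕ) := fun i j hij =>
    div_le_div_of_nonneg_right (by exact_mod_cast hij) zero_le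
  have h := hW.integral_maximal_le c hτ m N (T * (N + 1))
  refine h.trans ?_
  have e : (((T * (N + 1) : ℕ) : ℝ≥0) / (N + 1 : ℕ)) = (T : ℝ≥0) := by
    rw [Nat.cast_mul, mul_div_assoc, div_self (by positivity), mul_one]
  rw [e, ← Finset.mul_sum, Finset.sum_Ico_eq_sum_range]
  have h1 := ((summable_nat_add_iff m).2 hc).sum_le_tsum (Finset.range N) fun k _ => sq_nonneg _
  have h2 : ∑ k ∈ Finset.range (m + N - m), ‖c (m + k)‖ ^ 2 =
      ∑ k ∈ Finset.range N, ‖c (k + m)‖ ^ 2 := by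
    rw [Nat.add_sub_cancel_left]
    exact Finset.sum_congr rfl fun k _ => by rw [add_comm]
  rw [h2]
  simp only [NNReal.coe_natCast]
  gcongr

/-- The grid points ⌊t(N+1)⌋/(N+1) tend to t, paths are continuous, and for N ≥ n − m the sum is
among those over which the maximum is taken. -/
theorem le_noiseMajorant (c : ℕ → H) {ω : Ω} (hω : ∀ k, Continuous fun t => W k t ω) {T m n : ℕ}
    (hmn : m ≤ n) {t : ℝ≥0} (ht : t ≤ T) :
    ENNReal.ofReal (‖noiseSum W c m n t ω‖ ^ 2) ≤ noiseMajorant W c T m ω := by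
  have hcont : Continuous fun t => ENNReal.ofReal (‖noiseSum W c m n t ω‖ ^ 2) := by
    refine ENNReal.continuous_ofReal.comp ((Continuous.norm ?_).pow 2)
    exact continuous_finsetSum _ fun k _ => (hω k).smul continuous_const
  have hgrid : Tendsto (fun N : ℕ => ((⌊t * (N + 1 : ℕ)⌋₊ : ℕ) : ℝ≥0) / (N + 1 : ℕ)) atTop
      (𝓝 t) := by
    have := (tendsto_nat_floor_mul_div_atTop (R := ℝ) t.2).comp
      (tendsto_natCast_atTop_atTop.comp (tendsto_add_atTop_nat 1))
    rw [← NNReal.tendsto_coe]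
    refine this.congr fun N => ?_
    have e : (⌊(t : ℝ) * ((N + 1 : ℕ) : ℝ)⌋₊) = ⌊t * ((N + 1 : ℕ) : ℝ≥0)⌋₊ := rfl
    simp only [Function.comp]
    rw [NNReal.coe_div, NNReal.coe_natCast, NNReal.coe_natCast, ← e]
    rfl
  have hlim := (hcont.tendsto t).comp hgrid
  rw [← hlim.liminf_eq]
  refine liminf_le_liminf ?_
  filter_upwards [eventually_ge_atTop (n - m)] with N hN
  refine ENNReal.ofReal_le_ofReal (pow_le_pow_left₀ (norm_nonneg _) ?_ 2)
  have h1 : ⌊t * ((N + 1 : ℕ) : ℝ≥0)⌋₊ ≤ T * (N + 1) := by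
    refine Nat.floor_le_of_le ?_
    rw [Nat.cast_mul]
    gcongr
  have h2 := le_runMax
    (fun j : ℕ => ‖noiseSum W c m (m + (n - m)) (j / (N + 1 : ℕ)) ω‖) h1
  have h3 := le_runMax (fun i => runMax
    (fun j : ℕ => ‖noiseSum W c m (m + i) (j / (N + 1 : ℕ)) ω‖) (T * (N + 1))) hN
  have h4 := h2.trans h3
  rw [Nat.add_sub_cancel' hmn] at h4
  exact h4

/-- Almost surely the series `∑ W^k c_k` is Cauchy, uniformly on bounded time intervals. -/
theorem IsWienerSequence.ae_noiseSum_le (hW : IsWienerSequence P ℱ W) {c : ℕ → H}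
    (hc : Summable fun k => ‖c k‖ ^ 2) :
    ∀ᵐ ω ∂P, ∀ T : ℕ, ∀ ε > 0, ∃ m, ∀ n ≥ m, ∀ t : ℝ≥0, t ≤ T →
      ‖noiseSum W c m n t ω‖ ≤ ε := by
  rw [ae_all_iff]
  intro T
  -- Fatou once more, now in m: the expectations are bounded by tails of a convergent series. A
  -- vanishing lower limit is enough, since one m is needed for each ε.
  have hzero : ∫⁻ ω, liminf (fun m => noiseMajorant W c T m ω) atTop ∂P = 0 := by
    refine le_antisymm ((lintegral_liminf_le fun m => hW.measurable_noiseMajorant c T m).trans ?_)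
      zero_le
    have htail := (tendsto_sum_nat_add fun k => ‖c k‖ ^ 2)
    have h := ENNReal.tendsto_ofReal ((htail.const_mul (T : ℝ)).const_mul 16)
    rw [mul_zero, mul_zero, ENNReal.ofReal_zero] at h
    rw [← h.liminf_eq]
    exact liminf_le_liminf (Eventually.of_forall fun m => hW.lintegral_noiseMajorant_le hc T m)
  rw [lintegral_eq_zero_iff (Measurable.liminf fun m => hW.measurable_noiseMajorant c T m)] at hzero
  filter_upwards [hzero, ae_all_iff.2 fun k => (hW.brownian k).cont] with ω hω hcont ε hε
  have hlt : liminf (fun m => noiseMajorant W c T m ω) atTop < ENNReal.ofReal (ε ^ 2) := by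
    rw [show liminf (fun m => noiseMajorant W c T m ω) atTop = 0 from hω]
    exact ENNReal.ofReal_pos.2 (by positivity)
  obtain ⟨m, hm⟩ := (frequently_lt_of_liminf_lt (by isBoundedDefault) hlt).exists
  refine ⟨m, fun n hn t ht => ?_⟩
  have h := (le_noiseMajorant c hcont hn ht).trans hm.le
  rw [ENNReal.ofReal_le_ofReal_iff (by positivity)] at h
  exact le_of_sq_le_sq h hε.le

end

/-! ### Limits of noise paths -/

theorem eLpNorm_eq_ofReal_normL2 {f : ℝ → ℝ} (hf : MemLp f 2 unitMeasure) :
    eLpNorm f 2 unitMeasure = ENNReal.ofReal (normL2 f) := by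
  rw [hf.eLpNorm_eq_integral_rpow_norm (by simp) (by simp), normL2, integral_unit,
    Real.sqrt_eq_rpow]
  norm_num

theorem normL2_le_iff {f : ℝ → ℝ} (hf : MemLp f 2 unitMeasure) {c : ℝ} (hc : 0 ≤ c) :
    normL2 f ≤ c ↔ eLpNorm f 2 unitMeasure ≤ ENNReal.ofReal c := by
  rw [eLpNorm_eq_ofReal_normL2 hf, ENNReal.ofReal_le_ofReal_iff hc]

theorem normL2_add_le {f g : ℝ → ℝ} (hf : MemLp f 2 unitMeasure) (hg : MemLp g 2 unitMeasure) :
    normL2 (fun x => f x + g x) ≤ normL2 f + normL2 g := by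
  rw [normL2_le_iff (f := fun x => f x + g x) (hf.add hg) (add_nonneg (normL2_nonneg _) (normL2_nonneg _)),
    ENNReal.ofReal_add (normL2_nonneg _) (normL2_nonneg _), ← eLpNorm_eq_ofReal_normL2 hf,
    ← eLpNorm_eq_ofReal_normL2 hg]
  exact eLpNorm_add_le hf.1 hg.1 (by norm_num)

theorem normL2_sub_comm (f g : ℝ → ℝ) :
    normL2 (fun x => f x - g x) = normL2 fun x => g x - f x := by
  unfold normL2
  congr 2 with x
  ring

theorem normL2_const_mul (c : ℝ) (f : ℝ → ℝ) : normL2 (fun x => c * f x) = |c| * normL2 f := by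
  unfold normL2
  simp only [mul_pow]
  rw [intervalIntegral.integral_const_mul, Real.sqrt_mul (sq_nonneg c), Real.sqrt_sq_eq_abs]

namespace IsNoisePath

variable {T N M K : ℝ} {f f₁ f₂ g g₁ g₂ : ℝ → ℝ → ℝ}

theorem add_mul (hf : IsNoisePath T N f f₁ f₂) (hg : IsNoisePath T M g g₁ g₂) (c : ℝ)
    (hK : ∀ t ∈ Icc 0 T, normL2 (fun x => f₂ t x + c * g₂ t x) ≤ K) :
    IsNoisePath T K (fun t x => f t x + c * g t x) (fun t x => f₁ t x + c * g₁ t x)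
      (fun t x => f₂ t x + c * g₂ t x) where
  cont := hf.cont.add (hg.cont.const_smul c)
  cont₁ := hf.cont₁.add (hg.cont₁.const_smul c)
  prim t ht := (hf.prim t ht).add ((hg.prim t ht).const_mul c zero_le_one) zero_le_one
  prim₁ t ht := (hf.prim₁ t ht).add ((hg.prim₁ t ht).const_mul c zero_le_one) zero_le_one
  left t ht := by rw [hf.left t ht, hg.left t ht, mul_zero, add_zero]
  right t ht := by rw [hf.right t ht, hg.right t ht, mul_zero, add_zero]
  zero x hx := by rw [hf.zero x hx, hg.zero x hx, mul_zero, add_zero]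
  meas₂ := hf.meas₂.add (hg.meas₂.const_mul c)
  memLp₂ t ht := (hf.memLp₂ t ht).add ((hg.memLp₂ t ht).const_mul c)
  bound₂ := hK

theorem sub (hf : IsNoisePath T N f f₁ f₂) (hg : IsNoisePath T M g g₁ g₂)
    (hK : ∀ t ∈ Icc 0 T, normL2 (fun x => f₂ t x - g₂ t x) ≤ K) :
    IsNoisePath T K (fun t x => f t x - g t x) (fun t x => f₁ t x - g₁ t x)
      (fun t x => f₂ t x - g₂ t x) := by
  have h := hf.add_mul hg (-1) (K := K)
  simp only [neg_one_mul, ← sub_eq_add_neg] at h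
  exact h hK

end IsNoisePath

theorem tendstoUniformlyOn_limUnder {α : Type*} {F : ℕ → α → ℝ} {s : Set α}
    (h : ∀ ε > 0, ∃ m, ∀ n ≥ m, ∀ n' ≥ m, ∀ p ∈ s, |F n p - F n' p| ≤ ε) :
    TendstoUniformlyOn F (fun p => limUnder atTop fun n => F n p) atTop s := by
  have hF : UniformCauchySeqOn F atTop s := by
    rw [Metric.uniformCauchySeqOn_iff]
    intro ε hε
    obtain ⟨m, hm⟩ := h (ε / 2) (by positivity)
    exact ⟨m, fun n hn n' hn' p hp => (hm n hn n' hn' p hp).trans_lt (by linarith)⟩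
  exact hF.tendstoUniformlyOn_of_tendsto fun p hp => (hF.cauchySeq hp).tendsto_limUnder

/-- Limits in `C([0,T]; H²)` of noise paths are noise paths. -/
theorem exists_isNoisePath_limit {T : ℝ} (hT : 0 ≤ T) {f f₁ f₂ : ℕ → ℝ → ℝ → ℝ} {B : ℕ → ℝ}
    (h : ∀ n, IsNoisePath T (B n) (f n) (f₁ n) (f₂ n))
    (hm : ∀ n, StronglyMeasurable fun p : ℝ × ℝ => f₂ n p.1 p.2)
    (hC : ∀ ε > 0, ∃ m, ∀ n ≥ m, ∀ t ∈ Icc 0 T, normL2 (fun x => f₂ n t x - f₂ m t x) ≤ ε) :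
    ∃ N w₁ w₂, IsNoisePath T N (fun t x => limUnder atTop fun n => f n t x) w₁ w₂ ∧
      TendstoUniformlyOn (fun n (p : ℝ × ℝ) => f n p.1 p.2)
        (fun p => limUnder atTop fun n => f n p.1 p.2) atTop (Icc 0 T ×ˢ Icc 0 1) := by
  have hmem : ∀ n n', ∀ t ∈ Icc 0 T, MemLp (fun x => f₂ n t x - f₂ n' t x) 2 unitMeasure :=
    fun n n' t ht => ((h n).memLp₂ t ht).sub ((h n').memLp₂ t ht)
  have hC' : ∀ ε > 0, ∃ m, ∀ n ≥ m, ∀ n' ≥ m, ∀ t ∈ Icc 0 T,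
      normL2 (fun x => f₂ n t x - f₂ n' t x) ≤ ε := by
    intro ε hε
    obtain ⟨m, hm⟩ := hC (ε / 2) (by positivity)
    refine ⟨m, fun n hn n' hn' t ht => ?_⟩
    have h1 := normL2_add_le (hmem n m t ht) (hmem m n' t ht)
    simp only [sub_add_sub_cancel] at h1
    have h2 := hm n hn t ht
    have h3 := hm n' hn' t ht
    rw [normL2_sub_comm] at h3
    linarith
  have hu : TendstoUniformlyOn (fun n (p : ℝ × ℝ) => f n p.1 p.2)
      (fun p => limUnder atTop fun n => f n p.1 p.2) atTop (Icc 0 T ×ˢ Icc 0 1) :=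
    tendstoUniformlyOn_limUnder fun ε hε => by
      obtain ⟨m, hm⟩ := hC' ε hε
      exact ⟨m, fun n hn n' hn' p hp => ((h n).sub (h n') (hm n hn n' hn')).abs_w_le hp.1 hp.2⟩
  have hu₁ : TendstoUniformlyOn (fun n (p : ℝ × ℝ) => f₁ n p.1 p.2)
      (fun p => limUnder atTop fun n => f₁ n p.1 p.2) atTop (Icc 0 T ×ˢ Icc 0 1) :=
    tendstoUniformlyOn_limUnder fun ε hε => by
      obtain ⟨m, hm⟩ := hC' ε hε
      exact ⟨m, fun n hn n' hn' p hp => ((h n).sub (h n') (hm n hn n' hn')).abs_w₁_le hp.1 hp.2⟩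
  have hlim : ∀ t ∈ Icc 0 T, ∀ x ∈ Icc (0 : ℝ) 1,
      Tendsto (fun n => f n t x) atTop (𝓝 (limUnder atTop fun n => f n t x)) :=
    fun t ht x hx => hu.tendsto_at (x := (t, x)) ⟨ht, hx⟩
  have hlim₁ : ∀ t ∈ Icc 0 T, ∀ x ∈ Icc (0 : ℝ) 1,
      Tendsto (fun n => f₁ n t x) atTop (𝓝 (limUnder atTop fun n => f₁ n t x)) :=
    fun t ht x hx => hu₁.tendsto_at (x := (t, x)) ⟨ht, hx⟩
  have hcont : ContinuousOn (fun p : ℝ × ℝ => limUnder atTop fun n => f n p.1 p.2)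
      (Icc 0 T ×ˢ Icc 0 1) := hu.continuousOn (Frequently.of_forall fun n => (h n).cont)
  have hcont₁ : ContinuousOn (fun p : ℝ × ℝ => limUnder atTop fun n => f₁ n p.1 p.2)
      (Icc 0 T ×ˢ Icc 0 1) := hu₁.continuousOn (Frequently.of_forall fun n => (h n).cont₁)
  -- A single subsequence with geometric rate, uniform in time; along it f₂ converges almost
  -- everywhere in x for each t.
  obtain ⟨φ, hφ, hφC⟩ := extraction_forall_of_eventually'
    (P := fun j m => ∀ n ≥ m, ∀ n' ≥ m, ∀ t ∈ Icc 0 T,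
      normL2 (fun x => f₂ n t x - f₂ n' t x) ≤ (1 / 4) ^ j) fun j => by
      obtain ⟨m, hm⟩ := hC' ((1 / 4) ^ j) (by positivity)
      exact ⟨m, fun k hk n hn n' hn' => hm n (hk.trans hn) n' (hk.trans hn')⟩
  -- As a pointwise limit of jointly measurable functions w₂ is jointly measurable, which a choice
  -- of an L² limit at each time would not ensure.
  set w₂ : ℝ → ℝ → ℝ := fun t x => limUnder atTop fun j => f₂ (φ j) t x with hw₂
  have hae : ∀ t ∈ Icc 0 T, ∀ᵐ x ∂unitMeasure,
      Tendsto (fun j => f₂ (φ j) t x) atTop (𝓝 (w₂ t x)) := by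
    intro t ht
    have hsum : ∑' j : ℕ, 2 * ENNReal.ofReal ((1 / 4) ^ j) ≠ ⊤ := by
      rw [ENNReal.tsum_mul_left, ← ENNReal.ofReal_tsum_of_nonneg (fun j => by positivity)
        (summable_geometric_of_lt_one (by norm_num) (by norm_num))]
      exact ENNReal.mul_ne_top (by simp) ENNReal.ofReal_ne_top
    have := Lp.ae_tendsto_of_cauchy_eLpNorm (f := fun j => f₂ (φ j) t) (p := 2) (μ := unitMeasure)
      (fun j => ((h (φ j)).memLp₂ t ht).1) (by norm_num) hsum fun i n n' hn hn' => by
        have h1 := hφC i (φ n) (hφ.monotone hn) (φ n') (hφ.monotone hn') t ht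
        rw [normL2_le_iff (hmem _ _ t ht) (by positivity)] at h1
        refine lt_of_le_of_lt h1 ?_
        rw [two_mul]
        exact ENNReal.lt_add_right ENNReal.ofReal_ne_top (by simp)
    filter_upwards [this] with x hx using tendsto_nhds_limUnder hx
  have hmeas : ∀ t ∈ Icc 0 T, AEStronglyMeasurable (w₂ t) unitMeasure := fun t ht =>
    aestronglyMeasurable_of_tendsto_ae atTop (fun j => ((h (φ j)).memLp₂ t ht).1) (hae t ht)
  have hle : ∀ t ∈ Icc 0 T, ∀ j, eLpNorm (fun x => w₂ t x - f₂ (φ j) t x) 2 unitMeasure ≤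
      ENNReal.ofReal ((1 / 4) ^ j) := by
    intro t ht j
    refine (Lp.eLpNorm_lim_le_liminf_eLpNorm (f := fun i x => f₂ (φ i) t x - f₂ (φ j) t x)
      (fun i => (hmem _ _ t ht).1) _ ?_).trans ?_
    · filter_upwards [hae t ht] with x hx using hx.sub_const _
    · refine liminf_le_of_le (by isBoundedDefault) fun b hb => ?_
      obtain ⟨i, hi, hij⟩ := (hb.and (eventually_ge_atTop j)).exists
      refine hi.trans ((normL2_le_iff (hmem _ _ t ht) (by positivity)).1 ?_)
      exact hφC j _ (hφ.monotone hij) _ le_rfl t ht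
  have hmem' : ∀ t ∈ Icc 0 T, ∀ j, MemLp (fun x => w₂ t x - f₂ (φ j) t x) 2 unitMeasure :=
    fun t ht j => ⟨(hmeas t ht).sub ((h (φ j)).memLp₂ t ht).1,
      (hle t ht j).trans_lt ENNReal.ofReal_lt_top⟩
  have hmem₂ : ∀ t ∈ Icc 0 T, MemLp (w₂ t) 2 unitMeasure := fun t ht => by
    have := (hmem' t ht 0).add ((h (φ 0)).memLp₂ t ht)
    exact this.congr_norm (hmeas t ht) (Eventually.of_forall fun x => by simp)
  refine ⟨B (φ 0) + 1, fun t x => limUnder atTop fun n => f₁ n t x, w₂,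
    ⟨hcont, hcont₁, fun t ht => ?_, fun t ht => ?_, fun t ht => ?_, fun t ht => ?_,
      fun x hx => ?_, ?_, hmem₂, fun t ht => ?_⟩, hu⟩
  · refine ⟨ContinuousOn.intervalIntegrable (by
      rw [uIcc_of_le zero_le_one]; 
      exact continuousOn_slice (f := fun t x => limUnder atTop fun n => f₁ n t x) hcont₁ ht), fun x hx => ?_⟩
    have h1 : Tendsto (fun n => ∫ y in (0 : ℝ)..x, f₁ n t y) atTop
        (𝓝 (∫ y in (0 : ℝ)..x, limUnder atTop fun n => f₁ n t y)) := by
      obtain ⟨C, hC⟩ := hC' 1 one_pos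
      refine intervalIntegral.tendsto_integral_filter_of_dominated_convergence
        (fun _ => B C + 1) ?_ ?_ (by simp) ?_
      · refine Eventually.of_forall fun n => ?_
        rw [uIoc_of_le hx.1]
        exact ((continuousOn_slice (h n).cont₁ ht).mono fun y hy =>
          ⟨hy.1.le, hy.2.trans hx.2⟩).aestronglyMeasurable measurableSet_Ioc
      · filter_upwards [eventually_ge_atTop C] with n hn
        refine Eventually.of_forall fun y hy => ?_
        rw [uIoc_of_le hx.1] at hy
        have hy' : y ∈ Icc (0 : ℝ) 1 := ⟨hy.1.le, hy.2.trans hx.2⟩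
        have h2 := ((h n).sub (h C) (hC n hn C le_rfl)).abs_w₁_le ht hy'
        have h3 := (h C).abs_w₁_le ht hy'
        have h4 := abs_add_le (f₁ n t y - f₁ C t y) (f₁ C t y)
        rw [sub_add_cancel] at h4
        rw [Real.norm_eq_abs]
        linarith
      · refine Eventually.of_forall fun y hy => ?_
        rw [uIoc_of_le hx.1] at hy
        exact hlim₁ t ht y ⟨hy.1.le, hy.2.trans hx.2⟩
    exact tendsto_nhds_unique (hlim t ht x hx)
      (((hlim t ht 0 (by simp)).add h1).congr fun n => ((h n).prim t ht).2 x hx |>.symm)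
  · have hI : ∀ j, IntervalIntegrable (fun x => w₂ t x - f₂ (φ j) t x) volume 0 1 := fun j =>
      (intervalIntegrable_iff_integrableOn_Ioc_of_le zero_le_one).2
        ((hmem' t ht j).integrable (by norm_num))
    have hI₂ : IntervalIntegrable (w₂ t) volume 0 1 :=
      (intervalIntegrable_iff_integrableOn_Ioc_of_le zero_le_one).2
        ((hmem₂ t ht).integrable (by norm_num))
    refine ⟨hI₂, fun x hx => ?_⟩
    have hprim : ∀ j, IsPrim (fun x => ∫ y in (0 : ℝ)..x, (w₂ t y - f₂ (φ j) t y))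
        (fun x => w₂ t x - f₂ (φ j) t x) 0 1 := fun j => ⟨hI j, fun x _ => by simp⟩
    have h0 : Tendsto (fun j => ∫ y in (0 : ℝ)..x, (w₂ t y - f₂ (φ j) t y)) atTop (𝓝 0) := by
      refine squeeze_zero_norm (fun j => ?_)
        (tendsto_pow_atTop_nhds_zero_of_lt_one (r := (1 / 4 : ℝ)) (by norm_num) (by norm_num))
      have h1 := (hprim j).abs_sub_le' (hmem' t ht j) hx (y := 0) (by simp)
      rw [intervalIntegral.integral_same, sub_zero] at h1
      exact h1.trans ((normL2_le_iff (hmem' t ht j) (by positivity)).2 (hle t ht j))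
    have hx1 : Tendsto (fun j => f₁ (φ j) t x) atTop _ :=
      (hlim₁ t ht x hx).comp hφ.tendsto_atTop
    have hx0 : Tendsto (fun j => f₁ (φ j) t 0) atTop _ :=
      (hlim₁ t ht 0 (by simp)).comp hφ.tendsto_atTop
    have h2 := (hx0.add tendsto_const_nhds (b := ∫ y in (0 : ℝ)..x, w₂ t y)).sub h0
    rw [sub_zero] at h2
    refine tendsto_nhds_unique hx1 (h2.congr fun j => ?_)
    have hx' : uIcc 0 x ⊆ uIcc (0 : ℝ) 1 := by
      rw [uIcc_of_le hx.1, uIcc_of_le zero_le_one]; exact Icc_subset_Icc_right hx.2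
    rw [intervalIntegral.integral_sub (hI₂.mono_set hx') (((h (φ j)).prim₁ t ht).1.mono_set hx'),
      ((h (φ j)).prim₁ t ht).2 x hx]
    ring
  · exact tendsto_nhds_unique (hlim t ht 0 (by simp))
      (tendsto_const_nhds.congr fun n => ((h n).left t ht).symm)
  · exact tendsto_nhds_unique (hlim t ht 1 (by simp))
      (tendsto_const_nhds.congr fun n => ((h n).right t ht).symm)
  · exact tendsto_nhds_unique (hlim 0 ⟨le_rfl, hT⟩ x hx)
      (tendsto_const_nhds.congr fun n => ((h n).zero x hx).symm)
  · exact (StronglyMeasurable.limUnder fun j => hm (φ j)).aestronglyMeasurable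
  · have h1 := normL2_add_le (hmem' t ht 0) ((h (φ 0)).memLp₂ t ht)
    simp only [sub_add_cancel] at h1
    have h2 := (normL2_le_iff (hmem' t ht 0) (by positivity)).2 (hle t ht 0)
    have h3 := (h (φ 0)).bound₂ t ht
    rw [pow_zero] at h2
    have e : normL2 (fun x => w₂ t x) = normL2 (w₂ t) := rfl
    linarith

/-! ### The path of the noise -/

theorem norm_sum_smul_toLp {g : ℕ → ℝ → ℝ} (hg : ∀ k, MemLp (g k) 2 unitMeasure) (s : Finset ℕ)
    (a : ℕ → ℝ) :
    ‖∑ k ∈ s, a k • (hg k).toLp (g k)‖ = normL2 fun x => ∑ k ∈ s, g k x * a k := by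
  have hm : MemLp (fun x => ∑ k ∈ s, g k x * a k) 2 unitMeasure :=
    memLp_finsetSum s fun k _ => (hg k).mul_const (a k)
  have e : ∑ k ∈ s, a k • (hg k).toLp (g k) = hm.toLp _ := by
    refine Lp.ext ((Lp.coeFn_fun_finsetSum _ _).trans ?_)
    refine EventuallyEq.trans ?_ hm.coeFn_toLp.symm
    have h1 : ∀ᵐ x ∂unitMeasure, ∀ k, (a k • (hg k).toLp (g k) : Lp ℝ 2 unitMeasure) x =
        g k x * a k := by
      rw [ae_all_iff]
      intro k
      filter_upwards [Lp.coeFn_smul (a k) ((hg k).toLp (g k)), (hg k).coeFn_toLp] with x h1 h2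
      rw [h1, Pi.smul_apply, h2, smul_eq_mul, mul_comm]
    filter_upwards [h1] with x hx
    exact Finset.sum_congr rfl fun k _ => hx k
  rw [e, Lp.norm_toLp, eLpNorm_eq_ofReal_normL2 hm, ENNReal.toReal_ofReal (normL2_nonneg _)]

theorem isNoisePath_single {s c b : ℝ → ℝ} (h2 : IsH2 s) (h0 : IsH10 s)
    (hc : dx (dx s) =ᵐ[unitMeasure] c) (hcm : StronglyMeasurable c) (hb : Continuous b)
    (hb0 : b 0 = 0) (T : ℝ) :
    ∃ N, IsNoisePath T N (fun t x => s x * b t) (fun t x => dx s x * b t)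
      (fun t x => c x * b t) := by
  obtain ⟨C, hC⟩ := isCompact_Icc.exists_bound_of_continuousOn (hb.continuousOn (s := Icc 0 T))
  have hc2 : MemLp c 2 unitMeasure := h2.2.2.ae_eq hc
  have hsnd : MapsTo Prod.snd (Icc (0 : ℝ) T ×ˢ Icc (0 : ℝ) 1) (Icc 0 1) := fun p hp => hp.2
  refine ⟨C * normL2 c, ⟨?_, ?_, fun t _ => ?_, fun t _ => ?_, fun t _ => ?_, fun t _ => ?_,
    fun x _ => ?_, ?_, fun t _ => hc2.mul_const _, fun t ht => ?_⟩⟩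
  · exact ((h2.1.isPrim.continuousOn zero_le_one).comp continuousOn_snd hsnd).mul
      (hb.comp continuous_fst).continuousOn
  · exact ((h2.2.isPrim.continuousOn zero_le_one).comp continuousOn_snd hsnd).mul
      (hb.comp continuous_fst).continuousOn
  · simpa only [mul_comm] using h2.1.isPrim.const_mul (b t) zero_le_one
  · simpa only [mul_comm] using
      (h2.2.isPrim.congr zero_le_one (fun _ _ => rfl) hc).const_mul (b t) zero_le_one
  · rw [h0.2.1, zero_mul]
  · rw [h0.2.2, zero_mul]
  · rw [hb0, mul_zero]
  · exact ((hcm.comp_measurable measurable_snd).mul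
      (hb.comp continuous_fst).stronglyMeasurable).aestronglyMeasurable
  · have e : normL2 (fun x => c x * b t) = |b t| * normL2 c := by
      rw [← normL2_const_mul]; simp only [mul_comm]
    rw [e]
    exact mul_le_mul_of_nonneg_right (hC t ht) (normL2_nonneg _)

theorem isNoisePath_zero (T : ℝ) :
    IsNoisePath T 0 (fun _ _ => 0) (fun _ _ => 0) (fun _ _ => 0) where
  cont := continuousOn_const
  cont₁ := continuousOn_const
  prim _ _ := IsPrim.const 0
  prim₁ _ _ := IsPrim.const 0
  left _ _ := rfl
  right _ _ := rfl
  zero _ _ := rfl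
  meas₂ := aestronglyMeasurable_const
  memLp₂ _ _ := memLp_const 0
  bound₂ _ _ := by simp [normL2]

theorem isNoisePath_sum {s c b : ℕ → ℝ → ℝ} (h2 : ∀ k, IsH2 (s k)) (h0 : ∀ k, IsH10 (s k))
    (hc : ∀ k, dx (dx (s k)) =ᵐ[unitMeasure] c k) (hcm : ∀ k, StronglyMeasurable (c k))
    (hb : ∀ k, Continuous (b k)) (hb0 : ∀ k, b k 0 = 0) (T : ℝ) (n : ℕ) :
    ∃ N, IsNoisePath T N (fun t x => ∑ k ∈ Finset.range n, s k x * b k t)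
      (fun t x => ∑ k ∈ Finset.range n, dx (s k) x * b k t)
      (fun t x => ∑ k ∈ Finset.range n, c k x * b k t) := by
  induction n with
  | zero => exact ⟨0, by simpa using isNoisePath_zero T⟩
  | succ n ih =>
    obtain ⟨N, hN⟩ := ih
    obtain ⟨M, hM⟩ := isNoisePath_single (h2 n) (h0 n) (hc n) (hcm n) (hb n) (hb0 n) T
    refine ⟨N + M, ?_⟩
    have := hN.add_mul hM 1 (K := N + M) fun t ht => by
      simp only [one_mul]
      exact (normL2_add_le (hN.memLp₂ t ht) (hM.memLp₂ t ht)).trans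
        (add_le_add (hN.bound₂ t ht) (hM.bound₂ t ht))
    simpa only [Finset.sum_range_succ, one_mul] using this

theorem IsNoiseCoefficient.summable {σ : ℕ → ℝ → ℝ} (hσ : IsNoiseCoefficient σ) :
    Summable fun k => normL2 (dx (dx (σ k))) ^ 2 := by
  have h := hσ.finite
  rw [lintegral_tsum fun k => ((hσ.memH2 k).2.2.1.aemeasurable.pow_const 2).ennreal_ofReal] at h
  have e : ∀ k, ∫⁻ x, ENNReal.ofReal (dx (dx (σ k)) x ^ 2) ∂unitMeasure =
      ENNReal.ofReal (normL2 (dx (dx (σ k))) ^ 2) := fun k => by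
    rw [normL2_sq, ofReal_integral_eq_lintegral_ofReal (hσ.memH2 k).2.2.integrable_sq
      (Eventually.of_forall fun x => sq_nonneg _)]
  simp only [e] at h
  have := ENNReal.summable_toReal h.ne
  simpa only [ENNReal.toReal_ofReal (sq_nonneg _)] using this

/-- Almost surely, the path of the noise is regular and the series converges uniformly. -/
theorem ae_isNoisePath {Ω : Type*} {mΩ : MeasurableSpace Ω} {P : Measure Ω}
    {ℱ : Filtration ℝ≥0 mΩ} {W : ℕ → ℝ≥0 → Ω → ℝ} {σ : ℕ → ℝ → ℝ}
    (hW : IsWienerSequence P ℱ W) (hσ : IsNoiseCoefficient σ) :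
    ∀ᵐ ω ∂P, ∀ T : ℕ, ∃ N w₁ w₂,
      IsNoisePath T N (fun t x => noise σ W ω t.toNNReal x) w₁ w₂ ∧
      TendstoUniformlyOn
        (fun n (p : ℝ × ℝ) => ∑ k ∈ Finset.range n, σ k p.2 * W k p.1.toNNReal ω)
        (fun p => noise σ W ω p.1.toNNReal p.2) atTop (Icc 0 (T : ℝ) ×ˢ Icc 0 1) := by
  -- Strongly measurable representatives of (σ_k)_xx provide the joint measurability in (t,x)
  -- required for the limit.
  set c : ℕ → ℝ → ℝ := fun k => (hσ.memH2 k).2.2.1.mk _ with hcdef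
  have hc : ∀ k, dx (dx (σ k)) =ᵐ[unitMeasure] c k := fun k => (hσ.memH2 k).2.2.1.ae_eq_mk
  have hcm : ∀ k, StronglyMeasurable (c k) := fun k => (hσ.memH2 k).2.2.1.stronglyMeasurable_mk
  have hc2 : ∀ k, MemLp (c k) 2 unitMeasure := fun k => (hσ.memH2 k).2.2.ae_eq (hc k)
  have hsum : Summable fun k => ‖(hc2 k).toLp (c k)‖ ^ 2 := by
    refine hσ.summable.congr fun k => ?_
    rw [Lp.norm_toLp, ← eLpNorm_congr_ae (hc k), eLpNorm_eq_ofReal_normL2 (hσ.memH2 k).2.2,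
      ENNReal.toReal_ofReal (normL2_nonneg _)]
  filter_upwards [hW.ae_noiseSum_le hsum, ae_all_iff.2 fun k => (hW.brownian k).cont,
    ae_all_iff.2 fun k => (hW.brownian k).eval_zero_ae_eq_zero] with ω hω hcont hzero T
  set b : ℕ → ℝ → ℝ := fun k t => W k t.toNNReal ω with hb
  have hbc : ∀ k, Continuous (b k) := fun k => (hcont k).comp continuous_real_toNNReal
  have hb0 : ∀ k, b k 0 = 0 := fun k => by simp [hb, hzero k]
  choose B hB using isNoisePath_sum hσ.memH2 hσ.memH10 hc hcm hbc hb0 T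
  refine exists_isNoisePath_limit (Nat.cast_nonneg T) hB (fun n => ?_) fun ε hε => ?_
  · exact Finset.stronglyMeasurable_fun_sum _ fun k _ =>
      ((hcm k).comp_measurable measurable_snd).mul
        ((hbc k).comp continuous_fst).stronglyMeasurable
  · obtain ⟨m, hm⟩ := hω T ε hε
    refine ⟨m, fun n hn t ht => ?_⟩
    have h1 := hm n hn t.toNNReal (Real.toNNReal_le_iff_le_coe.2 (by simpa using ht.2))
    rw [noiseSum, norm_sum_smul_toLp hc2] at h1
    simpa only [Finset.sum_Ico_eq_sub _ hn] using h1

/-! ### Integration by parts in time -/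

/-- Abel summation. The integrator b is merely continuous but X is absolutely continuous, so the
left-endpoint sums equal boundary terms minus ∑ b(t_{i+1})(X(t_{i+1}) − X(t_i)), which converge
along every path. -/
theorem tendsto_riemann_sum {X x b : ℝ → ℝ} {T : ℝ} (hT : 0 ≤ T) (hX : IsPrim X x 0 T)
    (hb : Continuous b) :
    Tendsto (fun n : ℕ => ∑ i ∈ Finset.range n,
      X (T * i / n) * (b (T * (i + 1) / n) - b (T * i / n))) atTop
      (𝓝 (X T * b T - X 0 * b 0 - ∫ r in (0 : ℝ)..T, b r * x r)) := by
  obtain ⟨C, hC⟩ := isCompact_Icc.exists_bound_of_continuousOn (hb.continuousOn (s := Icc 0 T))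
  have hlim := (tendsto_sum_partition hT (K := fun _ t r => b t * x r) (g := fun r => b r * x r)
    (κ := fun r => C * |x r|) (hX.1.abs.const_mul C)
    (fun s t hs hst ht => ((hX.intervalIntegrable_sub ⟨hs, hst.trans ht⟩
      ⟨hs.trans hst, ht⟩).const_mul (b t)).1.aestronglyMeasurable)
    (Eventually.of_forall fun r s t hs hsr hrt ht => by
      rw [abs_mul]
      exact mul_le_mul_of_nonneg_right (hC t ⟨hs.trans (hsr.trans hrt), ht⟩) (abs_nonneg _))
    (Eventually.of_forall fun r s t _ _ ht => (((hb.tendsto r).comp ht).mul_const _))).2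
  refine (tendsto_const_nhds.sub hlim).congr' ?_
  filter_upwards [eventually_ge_atTop 1] with n hn
  have hn' : (0 : ℝ) < n := by exact_mod_cast hn
  have hmem : ∀ i ≤ n, T * (i : ℝ) / n ∈ Icc 0 T := fun i hi => by
    have hi' : (i : ℝ) ≤ n := by exact_mod_cast hi
    refine ⟨by positivity, ?_⟩
    rw [div_le_iff₀ hn']
    exact mul_le_mul_of_nonneg_left hi' hT
  have e1 : ∀ i ∈ Finset.range n, ∫ r in (T * i / n)..(T * (i + 1) / n),
      b (T * (i + 1) / n) * x r =
      b (T * (i + 1) / n) * (X (T * (i + 1) / n) - X (T * i / n)) := fun i hi => by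
    have h2 := hmem (i + 1) (Finset.mem_range.1 hi)
    push_cast at h2
    rw [intervalIntegral.integral_const_mul,
      hX.integral_eq (hmem i (Finset.mem_range.1 hi).le) h2]
  have e2 := Finset.sum_range_sub (fun i : ℕ => X (T * i / n) * b (T * i / n)) n
  push_cast at e2
  rw [mul_div_assoc, div_self hn'.ne', mul_one, mul_zero, zero_div] at e2
  rw [Finset.sum_congr rfl e1, ← e2, ← Finset.sum_sub_distrib]
  exact Finset.sum_congr rfl fun i _ => by ring

theorem iterated_integral_eq {κ : ℝ → ℝ → ℝ} {T t : ℝ}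
    (hκ : Integrable (fun p : ℝ × ℝ => κ p.1 p.2) (spaceTime T)) (ht : t ∈ Icc 0 T) :
    ∫ s in (0 : ℝ)..t, ∫ x in (0 : ℝ)..1, κ s x = ∫ p, κ p.1 p.2 ∂spaceTime t := by
  have h := hκ.mono_measure (spaceTime_mono ht.2)
  rw [spaceTime, integral_prod _ h, intervalIntegral.integral_of_le ht.1]
  simp only [integral_unit]

theorem integrable_mul_continuousOn {q v : ℝ → ℝ → ℝ} {T : ℝ}
    (hq : Integrable (fun p : ℝ × ℝ => q p.1 p.2) (spaceTime T))
    (hv : ContinuousOn (fun p : ℝ × ℝ => v p.1 p.2) (Icc 0 T ×ˢ Icc 0 1)) :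
    Integrable (fun p : ℝ × ℝ => q p.1 p.2 * v p.1 p.2) (spaceTime T) :=
  memLp_one_iff_integrable.1
    ((memLp_spaceTime_of_continuousOn hv ⊤).mul (memLp_one_iff_integrable.2 hq))

/-- The value at time `t` of `∫ ρ v φ dx - ∫₀ᵗ ∫ q v φ dx ds`. -/
noncomputable def pairing (ρ q : ℝ → ℝ → ℝ) (φ : ℝ → ℝ) (t : ℝ) (v : ℝ → ℝ → ℝ) : ℝ :=
  (∫ x in (0 : ℝ)..1, ρ t x * (v t x * φ x)) -
    ∫ s in (0 : ℝ)..t, ∫ x in (0 : ℝ)..1, q s x * (v s x * φ x)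

section pairing

variable {ρ q v : ℝ → ℝ → ℝ} {φ : ℝ → ℝ} {T t : ℝ}

theorem continuousOn_mul_snd (hφ : ContinuousOn φ (Icc 0 1))
    (hv : ContinuousOn (fun p : ℝ × ℝ => v p.1 p.2) (Icc 0 T ×ˢ Icc 0 1)) :
    ContinuousOn (fun p : ℝ × ℝ => v p.1 p.2 * φ p.2) (Icc 0 T ×ˢ Icc 0 1) :=
  hv.mul (hφ.comp continuousOn_snd fun _ hp => hp.2)

theorem pairing_sum (hρ : ContinuousOn (ρ t) (Icc 0 1))
    (hq : Integrable (fun p : ℝ × ℝ => q p.1 p.2) (spaceTime T)) (hφ : ContinuousOn φ (Icc 0 1))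
    (ht : t ∈ Icc 0 T) (s : Finset ℕ) {v : ℕ → ℝ → ℝ → ℝ}
    (hv : ∀ k, ContinuousOn (fun p : ℝ × ℝ => v k p.1 p.2) (Icc 0 T ×ˢ Icc 0 1)) :
    pairing ρ q φ t (fun r x => ∑ k ∈ s, v k r x) = ∑ k ∈ s, pairing ρ q φ t (v k) := by
  have hvφ := fun k => continuousOn_mul_snd hφ (hv k)
  have hi := fun k => integrable_mul_continuousOn (v := fun r x => v k r x * φ x) hq (hvφ k)
  have hit := fun k => (hi k).mono_measure (spaceTime_mono ht.2)
  have hj : ∀ k, Integrable (fun x => ρ t x * (v k t x * φ x)) unitMeasure := fun k =>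
    (memLp_of_continuousOn (hρ.mul (continuousOn_slice (f := fun r x => v k r x * φ x)
      (hvφ k) ht)) 1).integrable le_rfl
  have e : ∀ k, ∫ s in (0 : ℝ)..t, ∫ x in (0 : ℝ)..1, q s x * (v k s x * φ x) =
      ∫ p, q p.1 p.2 * (v k p.1 p.2 * φ p.2) ∂spaceTime t := fun k =>
    iterated_integral_eq (κ := fun r x => q r x * (v k r x * φ x)) (hi k) ht
  have hs := integrable_finsetSum s fun k _ => hi k
  have es := iterated_integral_eq
    (κ := fun r x => ∑ k ∈ s, q r x * (v k r x * φ x)) hs ht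
  simp only [pairing, Finset.sum_mul, Finset.mul_sum, Finset.sum_sub_distrib]
  rw [es, integral_finsetSum s fun k _ => hit k, integral_unit,
    integral_finsetSum s fun k _ => hj k]
  simp only [e]
  simp only [integral_unit]

theorem tendsto_pairing (hρ : ContinuousOn (ρ t) (Icc 0 1))
    (hq : Integrable (fun p : ℝ × ℝ => q p.1 p.2) (spaceTime T)) (hφ : ContinuousOn φ (Icc 0 1))
    (ht : t ∈ Icc 0 T) {v' : ℕ → ℝ → ℝ → ℝ}
    (hv' : ∀ k, ContinuousOn (fun p : ℝ × ℝ => v' k p.1 p.2) (Icc 0 T ×ˢ Icc 0 1))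
    (hv : ContinuousOn (fun p : ℝ × ℝ => v p.1 p.2) (Icc 0 T ×ˢ Icc 0 1))
    (hlim : TendstoUniformlyOn (fun n (p : ℝ × ℝ) => v' n p.1 p.2) (fun p => v p.1 p.2) atTop
      (Icc 0 T ×ˢ Icc 0 1)) :
    Tendsto (fun n => pairing ρ q φ t (v' n)) atTop (𝓝 (pairing ρ q φ t v)) := by
  obtain ⟨V, hV⟩ := (isCompact_Icc.prod isCompact_Icc).exists_bound_of_continuousOn hv
  obtain ⟨F, hF⟩ := isCompact_Icc.exists_bound_of_continuousOn hφ
  have hbd : ∀ᶠ n in atTop, ∀ r ∈ Icc 0 T, ∀ x ∈ Icc (0 : ℝ) 1,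
      ‖v' n r x * φ x‖ ≤ (V + 1) * F := by
    filter_upwards [Metric.tendstoUniformlyOn_iff.1 hlim 1 one_pos] with n hn r hr x hx
    have h1 := hn (r, x) ⟨hr, hx⟩
    have h2 := hV (r, x) ⟨hr, hx⟩
    rw [dist_eq_norm, norm_sub_rev] at h1
    have h3 := norm_sub_norm_le (v' n r x) (v r x)
    simp only at h1 h2
    rw [norm_mul]
    exact mul_le_mul (by linarith) (hF x hx) (norm_nonneg _) (by linarith [norm_nonneg (v r x)])
  have hpt : ∀ r ∈ Icc 0 T, ∀ x ∈ Icc (0 : ℝ) 1,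
      Tendsto (fun n => v' n r x * φ x) atTop (𝓝 (v r x * φ x)) := fun r hr x hx =>
    (hlim.tendsto_at (x := (r, x)) ⟨hr, hx⟩).mul_const _
  have hi := fun k => integrable_mul_continuousOn (v := fun r x => v' k r x * φ x) hq
    (continuousOn_mul_snd hφ (hv' k))
  have hI := integrable_mul_continuousOn (v := fun r x => v r x * φ x) hq
    (continuousOn_mul_snd hφ hv)
  have hqt := hq.mono_measure (spaceTime_mono ht.2)
  have hmemt : ∀ᵐ p ∂spaceTime t, p.1 ∈ Icc 0 T ∧ p.2 ∈ Icc (0 : ℝ) 1 := by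
    rw [spaceTime_eq]
    filter_upwards [ae_restrict_mem (measurableSet_Ioc.prod measurableSet_Ioc)] with p hp
    exact ⟨⟨hp.1.1.le, hp.1.2.trans ht.2⟩, Ioc_subset_Icc_self hp.2⟩
  have hmem : ∀ᵐ x ∂unitMeasure, x ∈ Icc (0 : ℝ) 1 := by
    filter_upwards [show ∀ᵐ x ∂unitMeasure, x ∈ Ioc (0 : ℝ) 1 from
      ae_restrict_mem measurableSet_Ioc] with x hx using Ioc_subset_Icc_self hx
  have hρ1 : Integrable (ρ t) unitMeasure := (memLp_of_continuousOn hρ 1).integrable le_rfl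
  refine Tendsto.sub ?_ ?_
  · simp only [integral_unit]
    refine tendsto_integral_filter_of_dominated_convergence
      (fun x => ‖ρ t x‖ * ((V + 1) * F)) (Eventually.of_forall fun n => ?_) ?_
      (hρ1.norm.mul_const _) ?_
    · exact (memLp_of_continuousOn (hρ.mul (continuousOn_slice (f := fun r x => v' n r x * φ x)
        (continuousOn_mul_snd hφ (hv' n)) ht)) 1).1
    · filter_upwards [hbd] with n hn
      filter_upwards [hmem] with x hx
      rw [norm_mul]
      exact mul_le_mul_of_nonneg_left (hn t ht x hx) (norm_nonneg _)
    · filter_upwards [hmem] with x hx using (hpt t ht x hx).const_mul _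
  · have e := iterated_integral_eq (κ := fun r x => q r x * (v r x * φ x)) hI ht
    rw [e]
    refine Tendsto.congr (fun n => (iterated_integral_eq
      (κ := fun r x => q r x * (v' n r x * φ x)) (hi n) ht).symm) ?_
    refine tendsto_integral_filter_of_dominated_convergence
      (fun p => ‖q p.1 p.2‖ * ((V + 1) * F)) (Eventually.of_forall fun n => ?_) ?_
      (hqt.norm.mul_const _) ?_
    · exact ((hi n).mono_measure (spaceTime_mono ht.2)).1
    · filter_upwards [hbd] with n hn
      filter_upwards [hmemt] with p hp
      rw [norm_mul]
      exact mul_le_mul_of_nonneg_left (hn _ hp.1 _ hp.2) (norm_nonneg _)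
    · filter_upwards [hmemt] with p hp using (hpt _ hp.1 _ hp.2).const_mul _

theorem continuousOn_pairing (hT : 0 ≤ T)
    (hρ : ContinuousOn (fun p : ℝ × ℝ => ρ p.1 p.2) (Icc 0 T ×ˢ Icc 0 1))
    (hq : Integrable (fun p : ℝ × ℝ => q p.1 p.2) (spaceTime T)) (hφ : ContinuousOn φ (Icc 0 1))
    (hv : ContinuousOn (fun p : ℝ × ℝ => v p.1 p.2) (Icc 0 T ×ˢ Icc 0 1)) :
    ContinuousOn (fun t => pairing ρ q φ t v) (Icc 0 T) := by
  have hc := hρ.mul (continuousOn_mul_snd hφ hv)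
  obtain ⟨C, hC⟩ := (isCompact_Icc.prod isCompact_Icc).exists_bound_of_continuousOn hc
  have hmem : ∀ᵐ x ∂unitMeasure, x ∈ Icc (0 : ℝ) 1 := by
    filter_upwards [show ∀ᵐ x ∂unitMeasure, x ∈ Ioc (0 : ℝ) 1 from
      ae_restrict_mem measurableSet_Ioc] with x hx using Ioc_subset_Icc_self hx
  refine ContinuousOn.sub ?_ ?_
  · simp only [integral_unit]
    refine continuousOn_of_dominated (bound := fun _ => C) (fun t ht => ?_) (fun t ht => ?_)
      (integrable_const C) ?_
    · exact (memLp_of_continuousOn (continuousOn_slice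
        (f := fun r x => ρ r x * (v r x * φ x)) hc ht) 1).1
    · filter_upwards [hmem] with x hx using hC (t, x) ⟨ht, hx⟩
    · filter_upwards [hmem] with x hx using
        continuousOn_slice_left (f := fun r x => ρ r x * (v r x * φ x)) hc hx
  · exact continuousOn_intervalIntegral hT (intervalIntegrable_integral
      (κ := fun r x => q r x * (v r x * φ x))
      (integrable_mul_continuousOn (v := fun r x => v r x * φ x) hq (continuousOn_mul_snd hφ hv))
      hT le_rfl zero_le_one le_rfl)

theorem tendsto_riemann_sum_pairing (hT : 0 ≤ T) (h : Evolves ρ q T)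
    (hρ : ∀ t ∈ Icc 0 T, ContinuousOn (ρ t) (Icc 0 1)) (hφ : ContinuousOn φ (Icc 0 1))
    {s b : ℝ → ℝ} (hs : ContinuousOn s (Icc 0 1)) (hb : Continuous b) (hb0 : b 0 = 0)
    (ht : t ∈ Icc 0 T) :
    Tendsto (fun n : ℕ => ∑ i ∈ Finset.range n,
      (∫ x in (0 : ℝ)..1, ρ (t * i / n) x * s x * φ x) *
        (b (t * (i + 1) / n) - b (t * i / n))) atTop
      (𝓝 (pairing ρ q φ t fun r x => s x * b r)) := by
  have hprim := (h.isPrim_integral_mul hT hρ (ψ := fun x => s x * φ x) (hs.mul hφ)).mono le_rfl ht.1 ht.2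
  have key := tendsto_riemann_sum ht.1 hprim hb
  simp only [← mul_assoc] at key
  convert key using 2
  rw [hb0, mul_zero, sub_zero, pairing]
  congr 1
  · rw [← intervalIntegral.integral_mul_const]
    congr 1 with x
    ring
  · congr 1 with r
    rw [← intervalIntegral.integral_const_mul]
    congr 1 with x
    ring

end pairing

/-! ### From strong solutions to solutions along paths -/

theorem ae_eq_of_tendstoInMeasure {Ω : Type*} {mΩ : MeasurableSpace Ω} {P : Measure Ω}
    {F : ℕ → Ω → ℝ} {g Y : Ω → ℝ} (h : TendstoInMeasure P F atTop g)
    (hY : ∀ᵐ ω ∂P, Tendsto (fun n => F n ω) atTop (𝓝 (Y ω))) : g =ᵐ[P] Y := by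
  obtain ⟨ns, hns, hlim⟩ := h.exists_seq_tendsto_ae
  filter_upwards [hlim, hY] with ω h1 h2
  exact tendsto_nhds_unique h1 (h2.comp hns.tendsto_atTop)

namespace HasStrongRegularity

variable {ρ u w : ℝ → ℝ → ℝ} {T : ℝ}

theorem evolves_mass (h : HasStrongRegularity ρ u) {ρ₀ : ℝ → ℝ}
    (h0 : ∀ x ∈ Icc (0 : ℝ) 1, ρ 0 x = ρ₀ x)
    (hc : ∀ φ, IsTestFunction φ → ∀ t : ℝ≥0, ∫ x in (0 : ℝ)..1, ρ t x * φ x =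
      (∫ x in (0 : ℝ)..1, ρ₀ x * φ x) -
        ∫ s in (0 : ℝ)..t, ∫ x in (0 : ℝ)..1, dx (fun y => ρ s y * u s y) x * φ x) (T : ℝ) :
    Evolves ρ (fun t => massRate (ρ t) (u t)) T := by
  refine evolves_of_cutoff (h.integrable_massRate T) (fun t ht => h.continuousOn_density ht.1)
    fun n q hq t ht => ?_
  lift t to ℝ≥0 using ht.1
  rw [hc _ (isTestFunction_cutoff n hq) t, sub_eq_add_neg, ← intervalIntegral.integral_neg]
  congr 1
  · refine intervalIntegral.integral_congr fun x hx => ?_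
    rw [uIcc_of_le zero_le_one] at hx
    simp only [h0 x hx]
  · refine intervalIntegral.integral_congr fun s hs => ?_
    rw [uIcc_of_le ht.1] at hs
    have hp := h.phase s hs.1
    simp only [integral_unit]
    rw [← integral_neg]
    refine integral_congr_ae ?_
    filter_upwards [dx_ae_eq_of_isPrim (hp.density.isPrim.mul hp.velocity.1.isPrim zero_le_one)]
      with x hx
    rw [hx, massRate]
    ring

theorem memLp_top_velocity (h : HasStrongRegularity ρ u) (T : ℝ) :
    MemLp (fun p : ℝ × ℝ => u p.1 p.2) ⊤ (spaceTime T) := by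
  obtain ⟨M, -, hM⟩ := h.exists_bound T
  exact memLp_top_spaceTime_of_bound (h.velocity T).1 fun t ht => (hM t ht).2.2.2

theorem memLp_top_density (h : HasStrongRegularity ρ u) (T : ℝ) :
    MemLp (fun p : ℝ × ℝ => ρ p.1 p.2) ⊤ (spaceTime T) := by
  obtain ⟨M, -, hM⟩ := h.exists_bound T
  exact memLp_top_spaceTime_of_bound (h.density T).1 fun t ht => (hM t ht).2.2.1

/-- The derivative of the flux `ρ u² + A² ρ`. -/
noncomputable def _root_.StochCNS.fluxDeriv (A : ℝ) (ρ u : ℝ → ℝ) (x : ℝ) : ℝ :=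
  ρ x * u x * dx u x - u x * massRate ρ u x + A ^ 2 * dx ρ x

theorem integrable_fluxDeriv (h : HasStrongRegularity ρ u) (A T : ℝ) :
    Integrable (fun p : ℝ × ℝ => fluxDeriv A (ρ p.1) (u p.1) p.2) (spaceTime T) := by
  have h1 : MemLp (fun p : ℝ × ℝ => ρ p.1 p.2 * u p.1 p.2 * dx (u p.1) p.2) 2 (spaceTime T) :=
    (h.velocity_x T).mul (((h.memLp_top_velocity T).mul (h.memLp_top_density T) (r := ⊤)))
  have h2 : MemLp (fun p : ℝ × ℝ => u p.1 p.2 * massRate (ρ p.1) (u p.1) p.2) 2 (spaceTime T) :=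
    (h.memLp_massRate T).mul (h.memLp_top_velocity T)
  exact ((h1.sub h2).add ((h.density_x T).const_mul (A ^ 2))).integrable (by norm_num)

theorem dx_flux_ae_eq (h : HasStrongRegularity ρ u) (A : ℝ) {s : ℝ} (hs : 0 ≤ s) :
    dx (fun y => ρ s y * u s y ^ 2 + A ^ 2 * ρ s y) =ᵐ[unitMeasure] fluxDeriv A (ρ s) (u s) := by
  have hp := h.phase s hs
  have hu := hp.velocity.1.isPrim
  have h1 := (hp.density.isPrim.mul (hu.mul hu zero_le_one) zero_le_one).add
    (hp.density.isPrim.const_mul (A ^ 2) zero_le_one) zero_le_one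
  have h2 := dx_ae_eq_of_isPrim h1
  simp only [← sq] at h2
  filter_upwards [h2] with x hx
  rw [hx, fluxDeriv, massRate]
  ring

/-- The noise enters through `pairing`, that is ∫ρwφ − ∫∫ρ_t wφ. Moving the first term to the left
turns ρu into ρ(u − w); the second is of finite variation and joins the rate. -/
theorem evolves_momentum (h : HasStrongRegularity ρ u) {A : ℝ} {ρ₀ u₀ : ℝ → ℝ}
    (h0 : ∀ x ∈ Icc (0 : ℝ) 1, ρ 0 x = ρ₀ x ∧ u 0 x = u₀ x)
    (hw : ContinuousOn (fun p : ℝ × ℝ => w p.1 p.2) (Icc 0 T ×ˢ Icc 0 1))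
    (hw0 : ∀ x ∈ Icc (0 : ℝ) 1, w 0 x = 0)
    (hc : ∀ (n : ℕ) (q : ℚ), (q : ℝ) ≤ 1 → ∀ t ∈ Icc 0 T,
      ∫ x in (0 : ℝ)..1, ρ t x * u t x * cutoff n q x =
        (∫ x in (0 : ℝ)..1, ρ₀ x * u₀ x * cutoff n q x) -
          (∫ s in (0 : ℝ)..t, ∫ x in (0 : ℝ)..1,
            dx (fun y => ρ s y * u s y ^ 2 + A ^ 2 * ρ s y) x * cutoff n q x) +
          (∫ s in (0 : ℝ)..t, ∫ x in (0 : ℝ)..1, dx (dx (u s)) x * cutoff n q x) +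
          pairing ρ (fun t => massRate (ρ t) (u t)) (cutoff n q) t w) :
    Evolves (fun t x => ρ t x * (u t x - w t x))
      (fun t => momentumRate A (ρ t) (u t) (w t)) T := by
  have hF := h.integrable_fluxDeriv A T
  have hU : Integrable (fun p : ℝ × ℝ => dx (dx (u p.1)) p.2) (spaceTime T) :=
    (h.velocity_xx T).integrable (by norm_num)
  have hQ := integrable_mul_continuousOn (h.integrable_massRate T)
    (q := fun t => massRate (ρ t) (u t)) hw
  have hκ : Integrable (fun p : ℝ × ℝ => momentumRate A (ρ p.1) (u p.1) (w p.1) p.2)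
      (spaceTime T) := by
    refine ((hU.sub hF).sub hQ).congr (Eventually.of_forall fun p => ?_)
    simp only [Pi.sub_apply, momentumRate, fluxDeriv, massRate]
    ring
  have hwt := fun t (ht : t ∈ Icc 0 T) => continuousOn_slice hw ht
  refine evolves_of_cutoff hκ (fun t ht => (h.continuousOn_density ht.1).mul
    ((h.continuousOn_velocity ht.1).sub (hwt t ht))) fun n q hq t ht => ?_
  have hφc : Continuous (cutoff n q) := (contDiff_cutoff n (q : ℝ)).continuous
  have hφ : MemLp (cutoff n q) ⊤ unitMeasure := memLp_of_continuousOn hφc.continuousOn ⊤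
  have h1 := hc n q hq t ht
  have hFφ := integrable_mul_snd (κ := fun t => fluxDeriv A (ρ t) (u t)) hF hφ
  have hUφ := integrable_mul_snd (κ := fun t => dx (dx (u t))) hU hφ
  have hQφ := integrable_mul_snd (κ := fun t x => massRate (ρ t) (u t) x * w t x) hQ hφ
  have hκφ := integrable_mul_snd (κ := fun t => momentumRate A (ρ t) (u t) (w t)) hκ hφ
  have e1 : ∫ s in (0 : ℝ)..t, ∫ x in (0 : ℝ)..1,
      dx (fun y => ρ s y * u s y ^ 2 + A ^ 2 * ρ s y) x * cutoff n q x =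
      ∫ s in (0 : ℝ)..t, ∫ x in (0 : ℝ)..1, fluxDeriv A (ρ s) (u s) x * cutoff n q x := by
    refine intervalIntegral.integral_congr fun s hs => ?_
    rw [uIcc_of_le ht.1] at hs
    simp only [integral_unit]
    refine integral_congr_ae ?_
    filter_upwards [h.dx_flux_ae_eq A hs.1] with x hx
    rw [hx]
  have e2 := iterated_integral_eq
    (κ := fun s x => fluxDeriv A (ρ s) (u s) x * cutoff n q x) hFφ ht
  have e3 := iterated_integral_eq (κ := fun s x => dx (dx (u s)) x * cutoff n q x) hUφ ht
  have e4 := iterated_integral_eq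
    (κ := fun s x => massRate (ρ s) (u s) x * w s x * cutoff n q x) hQφ ht
  have e5 := iterated_integral_eq
    (κ := fun s x => momentumRate A (ρ s) (u s) (w s) x * cutoff n q x) hκφ ht
  rw [e1, e2, e3, pairing] at h1
  simp only [← mul_assoc] at h1
  rw [e4] at h1
  have m := spaceTime_mono ht.2
  have e6 : ∫ p, momentumRate A (ρ p.1) (u p.1) (w p.1) p.2 * cutoff n q p.2 ∂spaceTime t =
      ((∫ p, dx (dx (u p.1)) p.2 * cutoff n q p.2 ∂spaceTime t) -
        ∫ p, fluxDeriv A (ρ p.1) (u p.1) p.2 * cutoff n q p.2 ∂spaceTime t) -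
        ∫ p, massRate (ρ p.1) (u p.1) p.2 * w p.1 p.2 * cutoff n q p.2 ∂spaceTime t := by
    have j : Integrable (fun p : ℝ × ℝ => dx (dx (u p.1)) p.2 * cutoff n q p.2 -
        fluxDeriv A (ρ p.1) (u p.1) p.2 * cutoff n q p.2) (spaceTime t) :=
      (hUφ.mono_measure m).sub (hFφ.mono_measure m)
    rw [← integral_sub (hUφ.mono_measure m) (hFφ.mono_measure m),
      ← integral_sub j (hQφ.mono_measure m)]
    refine integral_congr_ae (Eventually.of_forall fun p => ?_)
    simp only [momentumRate, fluxDeriv, massRate]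
    ring
  have hii : ∀ f : ℝ → ℝ, ContinuousOn f (Icc 0 1) → IntervalIntegrable f volume 0 1 :=
    fun f hf => ContinuousOn.intervalIntegrable (by rwa [uIcc_of_le zero_le_one])
  have hρc := h.continuousOn_density ht.1
  have e7 : ∫ x in (0 : ℝ)..1, ρ t x * (u t x - w t x) * cutoff n q x =
      (∫ x in (0 : ℝ)..1, ρ t x * u t x * cutoff n q x) -
        ∫ x in (0 : ℝ)..1, ρ t x * w t x * cutoff n q x := by
    rw [← intervalIntegral.integral_sub
      (hii (fun x => ρ t x * u t x * cutoff n q x) ((hρc.mul (h.continuousOn_velocity ht.1)).mul hφc.continuousOn))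
      (hii (fun x => ρ t x * w t x * cutoff n q x) ((hρc.mul (hwt t ht)).mul hφc.continuousOn))]
    congr 1 with x
    ring
  have e8 : ∫ x in (0 : ℝ)..1, ρ 0 x * (u 0 x - w 0 x) * cutoff n q x =
      ∫ x in (0 : ℝ)..1, ρ₀ x * u₀ x * cutoff n q x := by
    refine intervalIntegral.integral_congr fun x hx => ?_
    rw [uIcc_of_le zero_le_one] at hx
    simp only [(h0 x hx).1, (h0 x hx).2, hw0 x hx, sub_zero]
  rw [e7, e8, e5, e6, h1]
  ring

end HasStrongRegularity

/-! ### Pathwise identification of the stochastic integral. -/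

section Ito

variable {Ω : Type*} {mΩ : MeasurableSpace Ω} {P : Measure Ω} {ℱ : Filtration ℝ≥0 mΩ}
  {W : ℕ → ℝ≥0 → Ω → ℝ} {σ : ℕ → ℝ → ℝ} {ρ u : ℝ → Ω → ℝ → ℝ}

/-- The stochastic integral is given by integration by parts along the paths. -/
theorem ae_ito_eq_pairing (hW : IsWienerSequence P ℱ W) (hσ : IsNoiseCoefficient σ)
    (hreg : ∀ᵐ ω ∂P, HasStrongRegularity (fun t => ρ t ω) (fun t => u t ω))
    (hmass : ∀ᵐ ω ∂P, ∀ T : ℝ, Evolves (fun t => ρ t ω) (fun t => massRate (ρ t ω) (u t ω)) T)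
    {φ : ℝ → ℝ} (hφ : Continuous φ) {I : ℝ≥0 → Ω → ℝ}
    (hI : IsItoSeries P (fun k t ω => ∫ x in (0 : ℝ)..1, ρ t ω x * σ k x * φ x) W I) :
    ∀ᵐ ω ∂P, ∀ t : ℝ≥0, I t ω = pairing (fun t => ρ t ω) (fun t => massRate (ρ t ω) (u t ω)) φ t
      fun r x => noise σ W ω r.toNNReal x := by
  obtain ⟨hIc, J, hJ, hJI⟩ := hI
  have hnoise := ae_isNoisePath hW hσ
  have hWc := ae_all_iff.2 fun k => (hW.brownian k).cont
  have hW0 := ae_all_iff.2 fun k => (hW.brownian k).eval_zero_ae_eq_zero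
  have hσc : ∀ k, ContinuousOn (σ k) (Icc 0 1) := fun k =>
    (hσ.memH2 k).1.isPrim.continuousOn zero_le_one
  -- For each k the Riemann sums converge in probability to the Itô integral and almost surely to
  -- the integration by parts formula, so the two limits agree.
  have hJeq : ∀ t : ℝ≥0, ∀ k, J k t =ᵐ[P] fun ω => pairing (fun t => ρ t ω)
      (fun t => massRate (ρ t ω) (u t ω)) φ t fun r x => σ k x * W k r.toNNReal ω := by
    intro t k
    refine ae_eq_of_tendstoInMeasure ((hJ k).2 t) ?_
    filter_upwards [hreg, hmass, hWc, hW0] with ω h hm hc h0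
    have key := tendsto_riemann_sum_pairing t.2 (hm t)
      (fun r hr => h.continuousOn_density hr.1) hφ.continuousOn (hσc k)
      (b := fun r => W k r.toNNReal ω) ((hc k).comp continuous_real_toNNReal) (by simp [h0 k])
      (t := t) ⟨t.2, le_rfl⟩
    refine key.congr fun n => Finset.sum_congr rfl fun i _ => ?_
    have e1 : ((t * i / n : ℝ≥0) : ℝ) = t * i / n := by push_cast; rfl
    have e2 : ((t * (i + 1) / n : ℝ≥0) : ℝ) = t * (i + 1) / n := by push_cast; rfl
    rw [← e1, ← e2, Real.toNNReal_coe, Real.toNNReal_coe]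
  -- `pairing` is additive in the noise and continuous under uniform convergence, so the series over
  -- k can be summed inside it.
  have hIeq : ∀ t : ℝ≥0, I t =ᵐ[P] fun ω => pairing (fun t => ρ t ω)
      (fun t => massRate (ρ t ω) (u t ω)) φ t fun r x => noise σ W ω r.toNNReal x := by
    intro t
    refine ae_eq_of_tendstoInMeasure (hJI t) ?_
    filter_upwards [hreg, hWc, hnoise, ae_all_iff.2 (hJeq t)] with ω h hc hn hj
    obtain ⟨m, hm⟩ := exists_nat_ge t
    obtain ⟨N, w₁, w₂, hN, hu⟩ := hn m
    have ht : (t : ℝ) ∈ Icc 0 (m : ℝ) := ⟨t.2, by exact_mod_cast hm⟩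
    have hcont : ∀ k, ContinuousOn (fun p : ℝ × ℝ => σ k p.2 * W k p.1.toNNReal ω)
        (Icc 0 (m : ℝ) ×ˢ Icc 0 1) := fun k =>
      ((hσc k).comp continuousOn_snd fun _ hp => hp.2).mul
        (((hc k).comp continuous_real_toNNReal).comp continuous_fst).continuousOn
    have hρ := h.continuousOn_density t.2
    refine (tendsto_pairing hρ (h.integrable_massRate m)
      (q := fun t => massRate (ρ t ω) (u t ω)) hφ.continuousOn ht
      (v' := fun n r x => ∑ k ∈ Finset.range n, σ k x * W k r.toNNReal ω)
      (fun n => continuousOn_finsetSum _ fun k _ => hcont k) hN.cont hu).congr fun n => ?_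
    rw [pairing_sum (v := fun k r x => σ k x * W k r.toNNReal ω) hρ (h.integrable_massRate m)
      (q := fun t => massRate (ρ t ω) (u t ω)) hφ.continuousOn ht _ hcont]
    exact Finset.sum_congr rfl fun k _ => (hj k).symm
  -- So far the null set depends on the time. Countably many times, dense in each [0,m], are
  -- collected here; continuity of both sides covers the others.
  have hall : ∀ᵐ ω ∂P, ∀ (m : ℕ) (r : ℚ),
      I (projIcc (0 : ℝ) m m.cast_nonneg r : ℝ).toNNReal ω = pairing (fun t => ρ t ω)
        (fun t => massRate (ρ t ω) (u t ω)) φ (projIcc (0 : ℝ) m m.cast_nonneg r)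
        fun r x => noise σ W ω r.toNNReal x := by
    rw [ae_all_iff]
    intro m
    rw [ae_all_iff]
    intro r
    filter_upwards [hIeq (projIcc (0 : ℝ) m m.cast_nonneg r : ℝ).toNNReal] with ω hω
    rw [hω, Real.coe_toNNReal _ (projIcc (0 : ℝ) m m.cast_nonneg r).2.1]
  filter_upwards [hreg, hmass, hnoise, hIc, hall] with ω h hm hn hc hω t
  obtain ⟨m, hmt⟩ := exists_nat_ge t
  obtain ⟨N, w₁, w₂, hN, -⟩ := hn m
  have hm0 : (0 : ℝ) ≤ m := m.cast_nonneg
  have := eqOn_Icc_of_rat hm0 (f := fun t => I t.toNNReal ω)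
    ((hc.comp continuous_real_toNNReal).continuousOn)
    (continuousOn_pairing hm0 (h.continuousOn_jointDensity hm0 (hm m)) (h.integrable_massRate m)
      (q := fun t => massRate (ρ t ω) (u t ω)) hφ.continuousOn hN.cont) (hω m)
    (x := t) ⟨t.2, by exact_mod_cast hmt⟩
  simpa using this

/-- Almost surely, a strong solution is a solution along paths. -/
theorem IsStrongSolution.ae_isPathSolution {A : ℝ} {ρ₀ u₀ : ℝ → ℝ}
    (hW : IsWienerSequence P ℱ W) (hσ : IsNoiseCoefficient σ)
    (h : IsStrongSolution P ℱ W σ A ρ₀ u₀ ρ u) :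
    ∀ᵐ ω ∂P, ∀ T : ℕ, ∃ N w₁ w₂, IsPathSolution A T N (fun t => ρ t ω) (fun t => u t ω)
      (fun t x => noise σ W ω t.toNNReal x) w₁ w₂ := by
  have hmass : ∀ᵐ ω ∂P, ∀ T : ℝ,
      Evolves (fun t => ρ t ω) (fun t => massRate (ρ t ω) (u t ω)) T := by
    filter_upwards [h.regularity, h.initial, h.continuity] with ω h1 h2 h3 T
    exact h1.evolves_mass (fun x hx => (h2 x hx).1) h3 T
  -- The process I and its null set depend on the test function, hence the restriction to countably
  -- many cutoffs.
  have hmom : ∀ᵐ ω ∂P, ∀ (n : ℕ) (q : ℚ), (q : ℝ) ≤ 1 → ∀ t : ℝ≥0,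
      ∫ x in (0 : ℝ)..1, ρ t ω x * u t ω x * cutoff n q x =
        (∫ x in (0 : ℝ)..1, ρ₀ x * u₀ x * cutoff n q x) -
          (∫ s in (0 : ℝ)..t, ∫ x in (0 : ℝ)..1,
            dx (fun y => ρ s ω y * u s ω y ^ 2 + A ^ 2 * ρ s ω y) x * cutoff n q x) +
          (∫ s in (0 : ℝ)..t, ∫ x in (0 : ℝ)..1, dx (dx (u s ω)) x * cutoff n q x) +
          pairing (fun t => ρ t ω) (fun t => massRate (ρ t ω) (u t ω)) (cutoff n q) t
            fun r x => noise σ W ω r.toNNReal x := by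
    rw [ae_all_iff]
    intro n
    rw [ae_all_iff]
    intro q
    rw [eventually_imp_distrib_left]
    intro hq
    obtain ⟨I, hI, heq⟩ := h.momentum _ (isTestFunction_cutoff n hq)
    filter_upwards [heq, ae_ito_eq_pairing hW hσ h.regularity hmass
      (contDiff_cutoff n (q : ℝ)).continuous hI] with ω h1 h2 t
    rw [h1 t, h2 t]
  filter_upwards [h.regularity, h.initial, hmass, hmom, ae_isNoisePath hW hσ] with ω h1 h2 h3 h4 h5 T
  obtain ⟨N, w₁, w₂, hN, -⟩ := h5 T
  exact ⟨N, w₁, w₂, h1, hN, h3 T, h1.evolves_momentum h2 hN.cont hN.zero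
    fun n q hq t ht => h4 n q hq ⟨t, ht.1⟩⟩

end Ito

/-! ### Transfer to the prescribed initial data and conclusion. -/

theorem normL2_congr {f g : ℝ → ℝ} (h : EqOn f g (Icc 0 1)) : normL2 f = normL2 g := by
  unfold normL2
  congr 1
  refine intervalIntegral.integral_congr fun x hx => ?_
  rw [uIcc_of_le zero_le_one] at hx
  simp only [h hx]

theorem energy_congr {A : ℝ} {ρ ρ' u u' : ℝ → ℝ} (hρ : EqOn ρ ρ' (Icc 0 1))
    (hu : EqOn u u' (Icc 0 1)) : energy A ρ u = energy A ρ' u' := by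
  unfold energy entropy
  congr 1
  · refine intervalIntegral.integral_congr fun x hx => ?_
    rw [uIcc_of_le zero_le_one] at hx
    simp only [hρ hx, hu hx]
  · congr 1
    refine intervalIntegral.integral_congr fun x hx => ?_
    rw [uIcc_of_le zero_le_one] at hx
    simp only [hρ hx, hu hx, dx_congr hρ hx]

end StochCNS

theorem mainTheorem3 :
    ∃ C₁ C₂ : (T : ℝ≥0) → StochCNS.NoisePath T → ℝ → ℝ → ℝ,
    ∃ C₃ : (T : ℝ≥0) → StochCNS.NoisePath T → ℝ → ℝ → ℝ → ℝ,
      (∀ (T : ℝ≥0) (w : StochCNS.NoisePath T) (A : ℝ), Monotone (C₁ T w A) ∧ Monotone (C₂ T w A) ∧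
        (∀ e, Monotone (C₃ T w A e)) ∧ (∀ r, Monotone fun e => C₃ T w A e r)) ∧
      ∀ {Ω : Type*} {mΩ : MeasurableSpace Ω} (P : Measure Ω) [IsProbabilityMeasure P]
        (ℱ : Filtration ℝ≥0 mΩ) (W : ℕ → ℝ≥0 → Ω → ℝ) (σ : ℕ → ℝ → ℝ) (A : ℝ)
        (ρ₀ u₀ : ℝ → ℝ) (ρ u : ℝ → Ω → ℝ → ℝ),
        StochCNS.IsWienerSequence P ℱ W → StochCNS.IsNoiseCoefficient σ → 0 < A →
        StochCNS.InPhaseSpace ρ₀ u₀ →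
        StochCNS.IsStrongSolution P ℱ W σ A ρ₀ u₀ ρ u →
        ∀ᵐ ω ∂P, ∀ T : ℝ≥0,
          (IntervalIntegrable (fun s => StochCNS.dissipation A (ρ s ω) (u s ω)) volume 0 T ∧
            ∀ t ∈ Icc (0 : ℝ) T,
              StochCNS.energy A (ρ t ω) (u t ω) +
                  ∫ s in (0 : ℝ)..T, StochCNS.dissipation A (ρ s ω) (u s ω) ≤
                C₁ T (StochCNS.noisePath σ W T ω) A (StochCNS.energy A ρ₀ u₀)) ∧
          (∀ t ∈ Icc (0 : ℝ) T,
            eLpNorm (ρ t ω) ⊤ StochCNS.unitMeasure +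
                eLpNorm (fun x => (ρ t ω x)⁻¹) ⊤ StochCNS.unitMeasure ≤
              ENNReal.ofReal
                (C₂ T (StochCNS.noisePath σ W T ω) A (StochCNS.energy A ρ₀ u₀))) ∧
          (Integrable (fun p : ℝ × ℝ =>
              StochCNS.dx (StochCNS.dx (u p.1 ω)) p.2 ^ 2 / ρ p.1 ω p.2)
              (StochCNS.spaceTime T) ∧
            ∀ t ∈ Icc (0 : ℝ) T,
              StochCNS.normL2 (StochCNS.dx (u t ω)) ^ 2 +
                  ∫ s in (0 : ℝ)..T, ∫ x in (0 : ℝ)..1,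
                    StochCNS.dx (StochCNS.dx (u s ω)) x ^ 2 / ρ s ω x ≤
                C₃ T (StochCNS.noisePath σ W T ω) A (StochCNS.energy A ρ₀ u₀)
                  (StochCNS.normL2 (StochCNS.dx u₀))) := by
  -- The constants are selected before any probability space is introduced.
  choose C₁ C₂ C₃ hmono hbound using fun (T : ℝ≥0) (w : StochCNS.NoisePath T) (A : ℝ) =>
    StochCNS.exists_bounds_of_noisePath T w A
  refine ⟨C₁, C₂, C₃, hmono, ?_⟩
  intro Ω mΩ P _ ℱ W σ A ρ₀ u₀ ρ u hW hσ _ _ h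
  filter_upwards [h.ae_isPathSolution hW hσ, h.initial] with ω hω h0 T
  -- The almost sure statement covers integer horizons, one null set for all of them; a real horizon
  -- T is reached by restriction.
  obtain ⟨m, hm⟩ := exists_nat_ge T
  obtain ⟨N, w₁, w₂, hN⟩ := hω m
  have hm' : (T : ℝ) ≤ m := by exact_mod_cast hm
  have hb := hbound T (StochCNS.noisePath σ W T ω) A N _ _ _ w₁ w₂ (hN.mono hm') fun t x => by
    simp [StochCNS.noisePath]
  have e1 : StochCNS.energy A (ρ 0 ω) (u 0 ω) = StochCNS.energy A ρ₀ u₀ :=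
    StochCNS.energy_congr (fun x hx => (h0 x hx).1) fun x hx => (h0 x hx).2
  have e2 : StochCNS.normL2 (StochCNS.dx (u 0 ω)) = StochCNS.normL2 (StochCNS.dx u₀) :=
    StochCNS.normL2_congr (StochCNS.dx_congr fun x hx => (h0 x hx).2)
  rw [e1, e2] at hb
  exact hb
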